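/- **Setting.** Let $0<L\le\infty$, $A_0,\omega_0>0$, $E=-\frac{\omega_0}{2}+\frac{\mathrm i A_0}{2}$, $\sigma_3=\operatorname{diag}(1,-1)$, and let $[E,\overline E]$ be the vertical segment. Let $n\ge 0$ on $\mathbb R$ with $\int n=1$ satisfy one of: (1) $n$ is Hölder continuous on $\mathbb R$, $|n(p)-n(q)|\le C|p^{-1}-q^{-1}|^{\mu}$ for large $|p|,|q|$ (some $C$ and $0<\mu\le1$), and $n(\pm\infty)=0$; (2.1) for some $\Lambda>0$, $n(s)=0$ for $|s|\ge\Lambda$ and $n$ is Hölder continuous on $[-\Lambda,\Lambda]$; (2.2) for some $\Lambda>0$, $n=\frac1{2\Lambda}$ on $(-\Lambda,\Lambda)$ and $n=0$ elsewhere. Let $S$ be the set of discontinuities of $n$ ($S=\{\pm\Lambda\}$ in case (2.2), $S=\emptyset$ otherwise). **The IBVP.** Let $\mathcal E(t,x)$, $\rho(t,x,\lambda)$ (complex) and $\mathcal N(t,x,\lambda)$ (real) satisfy, for $t>0$, $0<x<L$, $t\ne x$, $\lambda\in\mathbb R$, $$\mathcal E_t+\mathcal E_x=\int n(s)\rho(t,x,s)\,ds,\qquad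 \rho_t+2\mathrm i\lambda\rho=\mathcal N\mathcal E,\qquad \mathcal N_t=-\tfrac12(\overline{\mathcal E}\rho+\mathcal E\overline\rho),$$ with $\mathcal E(0,x)=0$, $\rho(0,x,\lambda)=0$, $\mathcal N(0,x,\lambda)=-1$ for $0<x<L$, and $\mathcal E(t,0)=A_0e^{\mathrm i\omega_0t}$ for $t>0$. Assume: $\mathcal E$ is continuous on $\{t\ge0,\,0\le x<L,\,t\neq x\}$ and of class $C^1$ on $\{t>0,\,0<x<L,\,t\ne x\}$, and $\mathcal E,\mathcal E_t,\mathcal E_x$ are bounded on $\{0<t\le T,\,0<x\le X,\,t\ne x\}$ for all $T$ and $X<L$; $\rho,\mathcal N$ are continuous on $[0,\infty)\times(0,L)\times\mathbb R$, and $\rho_\lambda,\mathcal N_\lambda$ exist and are continuous on $(0,\infty)\times(0,L)\times\mathbb R$; and $\mathcal N(t,\cdot,\lambda)+1\in L^1(0,L)$ for all $t>0$, $\lambda\in\mathbb R$. (A jump of $\mathcal E$ across the characteristic $t=x$ is allowed; it is unavoidable because the data do not match at $(0,0)$.) **Notation.** Put $F=\begin{pmatrix}\mathcal N&\rho\\ \overline\rho&-\mathcal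 N\end{pmatrix}$, $H=\frac12\begin{pmatrix}0&\mathcal E\\-\overline{\mathcal E}&0\end{pmatrix}$, $G(t,x,z)=\frac14\int\frac{F(t,x,s)n(s)}{s-z}ds$, $\eta(z)=z+\frac14\int\frac{n(s)}{s-z}ds$, $\theta(t,x,z)=zt-\eta(z)x$, with boundary values $G_\pm,\eta_\pm,\theta_\pm$ at $\lambda\pm\mathrm i0$. Let $\varkappa(z)=\big(\frac{z-\overline E}{z-E}\big)^{1/4}$ and $w(z)=\sqrt{(z-E)(z-\overline E)}$, with cut $[E,\overline E]$, $\varkappa(\infty)=1$, $w(z)\sim z$ at infinity; $a=\frac{\varkappa+\varkappa^{-1}}2$, $b=\frac{\varkappa-\varkappa^{-1}}2$, $r=b/a$, $\Phi(t,z)=e^{-\mathrm i t\,\Re E\,\sigma_3}\begin{pmatrix}a&b\\b&a\end{pmatrix}e^{-\mathrm iw(z)t\sigma_3}$, and $h(z)=-2\mathrm i\sqrt{(\Im E)^2-(\Im z)^2}/\Im E$ on $(E,\overline E)$. Consider the $t$-equation $W_t=-(\mathrm iz\sigma_3+H)W$ and the $x^\pm$-equations $W_x=(\mathrm iz\sigma_3+H-\mathrm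 iG)W$ for $\pm\Im z\ge 0$, with $G_\pm$ in place of $G$ at real $z\notin S$; solutions are continuous, and the equations are required for $t\ne x$. The *basic solutions* are solutions $Y^\pm,Z^\pm$ of both equations with the following properties. $Y^\pm=W^\pm\Phi$, where $W^\pm$ solves the $x^\pm$-equation and $W^\pm|_{x=0}=I$. $Z^\pm=\Psi w^\pm$, where $\Psi$ solves the $t$-equation, $\Psi|_{t=0}=I$, $w^\pm$ solves the $x^\pm$-equation for $t=0$, and $w^\pm(x,z)e^{-\mathrm i\eta(z)x\sigma_3}\to I$ as $x\to L$ (with $\eta_\pm$ for $\eta$ at real $z$). $Y^\pm$ is analytic in $\{\pm\Im z>0\}\setminus[E,\overline E]$ and continuous up to $\mathbb R\setminus(S\cup\{\Re E\})$; $Z^\pm$ is analytic in $\{\pm\Im z>0\}$ and continuous up to $\mathbb R\setminus S$. With $A[i]$ the $i$-th column of $A$, put $$M=\Big(Z^+[1]e^{\mathrm i\theta}\ \ \tfrac{Y^+[2]}{a}e^{-\mathrm i\theta}\Big)\ (\Im z>0),\qquad M=\Big(\tfrac{Y^-[1]}{a}e^{\mathrm i\theta}\ \ Z^-[2]e^{-\mathrm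 i\theta}\Big)\ (\Im z<0),\qquad z\notin[E,\overline E].$$ **Problem RH$_0$** (for fixed $t,x$). Let $\Sigma=\mathbb R\cup(E,\overline E)$, with $\mathbb R$ oriented to the right and $(E,\overline E)$ downward. Find a $2\times2$ matrix function $M$, analytic in $\mathbb C\setminus(\Sigma\cup\{E,\overline E\})$, which extends continuously from the left ($M_+$) and from the right ($M_-$) to $\Sigma\setminus(S\cup\{\Re E\})$, is bounded near the points of $S\cup\{\Re E\}$, is $O(|z-E|^{-1/4})$ at $E$ and $O(|z-\overline E|^{-1/4})$ at $\overline E$, satisfies $M(z)=I+O(z^{-1})$ as $z\to\infty$, and satisfies $M_-=M_+J$ on $\Sigma\setminus(S\cup\{\Re E\})$, where $$J=\begin{pmatrix}1&he^{-2\mathrm i\theta}\\0&1\end{pmatrix}\text{ on }(E,\Re E),\quad J=\begin{pmatrix}1-r^2e^{2\mathrm i(\theta_--\theta_+)}&-re^{-2\mathrm i\theta_+}\\re^{2\mathrm i\theta_-}&1\end{pmatrix}\text{ on }\mathbb R,\quad J=\begin{pmatrix}1&0\\he^{2\mathrm i\theta}&1\end{pmatrix}\text{ on }(\Re E,\overline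 E).$$ **Theorem.** Under these assumptions basic solutions exist. For any basic solutions and all $t\ge0$, $0<x<L$, the matrix $M(t,x,\cdot)$ built from them solves RH$_0$, and it is the only solution. For $t\neq x$, $$\mathcal E(t,x)=-4\mathrm i\lim_{z\to\infty}\big(zM(t,x,z)\big)_{12},$$ where $z\to\infty$ nontangentially to $\mathbb R$, i.e. in $\{c|\Re z|\le|\Im z|\}$ for an arbitrary $c>0$. The function $F(t,x,\cdot)$ is continuous on $\mathbb R$, and for all $\lambda\in\mathbb R\setminus(S\cup\{\Re E\})$ $$F(t,x,\lambda)=-M(t,x,\lambda+\mathrm i0)e^{-\mathrm i\lambda t\sigma_3}M^{-1}(0,x,\lambda+\mathrm i0)\,\sigma_3\,M(0,x,\lambda+\mathrm i0)e^{\mathrm i\lambda t\sigma_3}M^{-1}(t,x,\lambda+\mathrm i0).$$ -/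

import Mathlib

open Set Filter Topology Asymptotics MeasureTheory

open scoped ComplexConjugate NNReal

noncomputable section

namespace MaxwellBloch

/-- `2 × 2` complex matrices. -/
abbrev Mat2 : Type := Matrix (Fin 2) (Fin 2) ℂ

/-- The Pauli matrix `σ₃`. -/
def sigma3 : Mat2 := !![1, 0; 0, -1]

/-- The matrix exponential `exp (c σ₃)`. -/
def expSigma3 (c : ℂ) : Mat2 := !![Complex.exp c, 0; 0, Complex.exp (-c)]

/-- Entrywise derivative of a matrix function of a real variable. -/
def HasMatDerivAt (f : ℝ → Mat2) (A : Mat2) (s : ℝ) : Prop :=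
  ∀ i j, HasDerivAt (fun τ => f τ i j) (A i j) s

/-! ### The line shape `n` -/

/-- The shape of the spectral line: a nonnegative function with integral `1` which is
either Hölder continuous on `ℝ` and near infinity and vanishes at infinity,
or vanishes for `|s| ≥ Λ` and is Hölder continuous on `[-Λ, Λ]`,
or is the normalized indicator function of `(-Λ, Λ)`. -/
def IsLineShape (n : ℝ → ℝ) : Prop :=
  (∀ s, 0 ≤ n s) ∧ ∫ s, n s = 1 ∧
    ((∃ C μ : ℝ≥0, 0 < μ ∧ μ ≤ 1 ∧ HolderWith C μ n ∧
        (∃ C' μ' R : ℝ, 0 < μ' ∧ μ' ≤ 1 ∧ 0 < R ∧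
          ∀ p q : ℝ, R ≤ |p| → R ≤ |q| → |n p - n q| ≤ C' * |p⁻¹ - q⁻¹| ^ μ') ∧
        Tendsto n (Bornology.cobounded ℝ) (𝓝 0)) ∨
      (∃ Λ : ℝ, 0 < Λ ∧ (∀ s, Λ ≤ |s| → n s = 0) ∧
        ∃ C μ : ℝ≥0, 0 < μ ∧ μ ≤ 1 ∧ HolderOnWith C μ n (Icc (-Λ) Λ)) ∨
      (∃ Λ : ℝ, 0 < Λ ∧ ∀ s, n s = if |s| < Λ then 1 / (2 * Λ) else 0))

/-! ### The initial-boundary value problem -/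

/-- `(𝓔, ρ, 𝓝)` solves the initial-boundary value problem for the Maxwell--Bloch equations on
`t > 0`, `0 < x < L`, with trivial initial data and input signal `A₀ exp (i ω₀ t)`.

The initial and boundary values of `𝓔` do not match at the corner, and the jump is
transported along the characteristic `t = x`. Hence `𝓔` is of class `C¹` off this line,
and `ρ`, `𝓝` are continuous across it. Continuity of `ρ_t`, `𝓝_t` off the line is a consequence
of the equations. -/
structure IsSolution (L : EReal) (n : ℝ → ℝ) (A₀ ω₀ : ℝ)
    (Ef : ℝ → ℝ → ℂ) (ρ : ℝ → ℝ → ℝ → ℂ) (Nf : ℝ → ℝ → ℝ → ℝ) : Prop where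
  /-- The initial and boundary values of `𝓔` are attained continuously. -/
  field_continuous : ContinuousOn (fun p : ℝ × ℝ => Ef p.1 p.2)
    {p | 0 ≤ p.1 ∧ 0 ≤ p.2 ∧ (p.2 : EReal) < L ∧ p.1 ≠ p.2}
  field_contDiff : ContDiffOn ℝ 1 (fun p : ℝ × ℝ => Ef p.1 p.2)
    {p | 0 < p.1 ∧ 0 < p.2 ∧ (p.2 : EReal) < L ∧ p.1 ≠ p.2}
  /-- `𝓔` and its first derivatives are bounded on bounded sets (including near `(0, 0)`). -/
  field_bounded : ∀ T X : ℝ, (X : EReal) < L → ∃ C : ℝ, ∀ t x : ℝ,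
    0 < t → t ≤ T → 0 < x → x ≤ X → t ≠ x →
      ‖Ef t x‖ ≤ C ∧ ‖fderiv ℝ (fun p : ℝ × ℝ => Ef p.1 p.2) (t, x)‖ ≤ C
  rho_continuous : ContinuousOn (fun p : ℝ × ℝ × ℝ => ρ p.1 p.2.1 p.2.2)
    {p | 0 ≤ p.1 ∧ 0 < p.2.1 ∧ (p.2.1 : EReal) < L}
  inv_continuous : ContinuousOn (fun p : ℝ × ℝ × ℝ => Nf p.1 p.2.1 p.2.2)
    {p | 0 ≤ p.1 ∧ 0 < p.2.1 ∧ (p.2.1 : EReal) < L}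
  rho_differentiable : ∀ t x l : ℝ, 0 < t → 0 < x → (x : EReal) < L →
    DifferentiableAt ℝ (ρ t x) l
  inv_differentiable : ∀ t x l : ℝ, 0 < t → 0 < x → (x : EReal) < L →
    DifferentiableAt ℝ (Nf t x) l
  rho_deriv_continuous : ContinuousOn (fun p : ℝ × ℝ × ℝ => deriv (ρ p.1 p.2.1) p.2.2)
    {p | 0 < p.1 ∧ 0 < p.2.1 ∧ (p.2.1 : EReal) < L}
  inv_deriv_continuous : ContinuousOn (fun p : ℝ × ℝ × ℝ => deriv (Nf p.1 p.2.1) p.2.2)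
    {p | 0 < p.1 ∧ 0 < p.2.1 ∧ (p.2.1 : EReal) < L}
  inv_integrable : ∀ t l : ℝ, 0 < t →
    IntegrableOn (fun x => Nf t x l + 1) {x : ℝ | 0 < x ∧ (x : EReal) < L}
  field_eq : ∀ t x : ℝ, 0 < t → 0 < x → (x : EReal) < L → t ≠ x →
    deriv (fun τ => Ef τ x) t + deriv (fun y => Ef t y) x = ∫ s, (n s : ℂ) * ρ t x s
  rho_eq : ∀ t x l : ℝ, 0 < t → 0 < x → (x : EReal) < L → t ≠ x →
    HasDerivAt (fun τ => ρ τ x l)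
      ((Nf t x l : ℂ) * Ef t x - 2 * Complex.I * (l : ℂ) * ρ t x l) t
  inv_eq : ∀ t x l : ℝ, 0 < t → 0 < x → (x : EReal) < L → t ≠ x →
    HasDerivAt (fun τ => (Nf τ x l : ℂ))
      (-(1 / 2) * (conj (Ef t x) * ρ t x l + Ef t x * conj (ρ t x l))) t
  field_init : ∀ x : ℝ, 0 < x → (x : EReal) < L → Ef 0 x = 0
  rho_init : ∀ x l : ℝ, 0 < x → (x : EReal) < L → ρ 0 x l = 0
  inv_init : ∀ x l : ℝ, 0 < x → (x : EReal) < L → Nf 0 x l = -1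
  field_boundary : ∀ t : ℝ, 0 < t →
    Ef t 0 = (A₀ : ℂ) * Complex.exp (Complex.I * (ω₀ : ℂ) * (t : ℂ))

/-! ### The AKNS systems -/

/-- The density matrix `F`. -/
def densityMatrix (ρ : ℝ → ℝ → ℝ → ℂ) (Nf : ℝ → ℝ → ℝ → ℝ) (t x l : ℝ) : Mat2 :=
  !![(Nf t x l : ℂ), ρ t x l; conj (ρ t x l), -(Nf t x l : ℂ)]

def fieldMatrix (Ef : ℝ → ℝ → ℂ) (t x : ℝ) : Mat2 :=
  (1 / 2 : ℂ) • !![0, Ef t x; -conj (Ef t x), 0]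

/-- The Cauchy integral `G(t,x,z) = (1/4) ∫ F(t,x,s) n(s) / (s - z) ds`. -/
def cauchyMatrix (n : ℝ → ℝ) (ρ : ℝ → ℝ → ℝ → ℂ) (Nf : ℝ → ℝ → ℝ → ℝ) (t x : ℝ) (z : ℂ) :
    Mat2 :=
  Matrix.of fun i j => (1 / 4) * ∫ s : ℝ, densityMatrix ρ Nf t x s i j * (n s : ℂ) / ((s : ℂ) - z)

/-- `f` on the closed half-plane `σ Im z ≥ 0` (`σ = 1` or `σ = -1`): the value `f z` off the real
line, and the boundary value `f (z + i σ 0)` on it. -/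
def sideValue {α : Type*} [TopologicalSpace α] [Nonempty α] (σ : ℝ) (f : ℂ → α) (z : ℂ) : α :=
  if z.im = 0 then limUnder (𝓝[>] (0 : ℝ)) (fun ε : ℝ => f (z + ((σ * ε : ℝ) : ℂ) * Complex.I))
  else f z

/-- Coefficient of the `t`-equation. -/
def coeffU (Ef : ℝ → ℝ → ℂ) (t x : ℝ) (z : ℂ) : Mat2 :=
  -(Complex.I * z) • sigma3 - fieldMatrix Ef t x

/-- Coefficient of the `x`-equation with spectral parameter in the closed half-plane
`σ Im z ≥ 0`; on the real line this is the coefficient of the `x^±`-equation. -/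
def coeffV (n : ℝ → ℝ) (Ef : ℝ → ℝ → ℂ) (ρ : ℝ → ℝ → ℝ → ℂ) (Nf : ℝ → ℝ → ℝ → ℝ)
    (σ t x : ℝ) (z : ℂ) : Mat2 :=
  (Complex.I * z) • sigma3 + fieldMatrix Ef t x
    - Complex.I • sideValue σ (cauchyMatrix n ρ Nf t x) z

/-! ### Spectral functions -/

/-- The point `E = -ω₀/2 + i A₀/2`. -/
def specPoint (A₀ ω₀ : ℝ) : ℂ := ⟨-ω₀ / 2, A₀ / 2⟩

/-- `((z - Ē)/(z - E))^(1/4)`. The quotient is a negative real number exactly on the open interval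
`(E, Ē)` and tends to `1` at infinity, so the principal power is the branch with
cut `[E, Ē]` and value `1` at infinity. -/
def kappa (E z : ℂ) : ℂ := ((z - conj E) / (z - E)) ^ (1 / 4 : ℂ)

/-- `√((z - E)(z - Ē))` with cut `[E, Ē]` and `w(z) ~ z` at infinity. -/
def wFun (E z : ℂ) : ℂ := (z - E) * kappa E z ^ 2

def aFun (E z : ℂ) : ℂ := (kappa E z + (kappa E z)⁻¹) / 2

def bFun (E z : ℂ) : ℂ := (kappa E z - (kappa E z)⁻¹) / 2

/-- The reflection coefficient. -/
def rFun (E z : ℂ) : ℂ := bFun E z / aFun E z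

/-- The jump function on `(E, Ē)`. -/
def hFun (E z : ℂ) : ℂ :=
  -2 * Complex.I * (Real.sqrt (E.im ^ 2 - z.im ^ 2) : ℂ) / (E.im : ℂ)

/-- `η(z) = z + (1/4) ∫ n(s) / (s - z) ds`. -/
def eta (n : ℝ → ℝ) (z : ℂ) : ℂ := z + (1 / 4) * ∫ s : ℝ, (n s : ℂ) / ((s : ℂ) - z)

/-- The phase `θ(t,x,z) = z t - η(z) x`. -/
def theta (n : ℝ → ℝ) (t x : ℝ) (z : ℂ) : ℂ := z * t - eta n z * x

/-- The solution of the `t`-equation at `x = 0`. -/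
def backgroundPhi (E : ℂ) (t : ℝ) (z : ℂ) : Mat2 :=
  expSigma3 (-Complex.I * (E.re : ℂ) * t) * !![aFun E z, bFun E z; bFun E z, aFun E z] *
    expSigma3 (-Complex.I * wFun E z * t)

/-! ### Basic solutions -/

/-- The closed half-plane `σ Im z ≥ 0` without the real points where `n` is discontinuous
(there are such points, `±Λ`, only if `n` is piecewise constant). -/
def closedHalf (n : ℝ → ℝ) (σ : ℝ) : Set ℂ :=
  {z | 0 ≤ σ * z.im ∧ (z.im = 0 → ContinuousAt n z.re)}

def openHalf (σ : ℝ) : Set ℂ := {z | 0 < σ * z.im}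

/-- `Y` is the basic solution `Y^σ = W^σ Φ` together with its analytic continuation from the
real line to the half-plane `σ Im z > 0` cut along `[E, Ē]`. -/
structure IsBasicY (L : EReal) (n : ℝ → ℝ) (E : ℂ) (Ef : ℝ → ℝ → ℂ) (ρ : ℝ → ℝ → ℝ → ℂ)
    (Nf : ℝ → ℝ → ℝ → ℝ) (σ : ℝ) (Y : ℝ → ℝ → ℂ → Mat2) : Prop where
  /-- `Y = W Φ`, where `W` solves the `x`-equation for each `t`, and `W = I` at `x = 0`. -/
  factor : ∃ W : ℝ → ℝ → ℂ → Mat2, ∀ t : ℝ, 0 ≤ t →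
    ∀ z ∈ closedHalf n σ \ (segment ℝ E (conj E) \ {(E.re : ℂ)}),
      W t 0 z = 1 ∧
      ContinuousOn (fun x => W t x z) {x : ℝ | 0 ≤ x ∧ (x : EReal) < L} ∧
      (∀ x : ℝ, 0 < x → (x : EReal) < L → x ≠ t →
        HasMatDerivAt (fun y => W t y z) (coeffV n Ef ρ Nf σ t x z * W t x z) x) ∧
      ∀ x : ℝ, 0 ≤ x → (x : EReal) < L → Y t x z = W t x z * backgroundPhi E t z
  /-- `Y` solves the `t`-equation. -/
  t_eq : ∀ x : ℝ, 0 < x → (x : EReal) < L →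
    ∀ z ∈ closedHalf n σ \ (segment ℝ E (conj E) \ {(E.re : ℂ)}),
      ContinuousOn (fun t => Y t x z) (Ici 0) ∧
      ∀ t : ℝ, 0 < t → t ≠ x →
        HasMatDerivAt (fun τ => Y τ x z) (coeffU Ef t x z * Y t x z) t
  analytic : ∀ t x : ℝ, 0 ≤ t → 0 < x → (x : EReal) < L → ∀ i j,
    DifferentiableOn ℂ (fun z => Y t x z i j) (openHalf σ \ segment ℝ E (conj E))
  continuous : ∀ t x : ℝ, 0 ≤ t → 0 < x → (x : EReal) < L →
    ContinuousOn (Y t x) (closedHalf n σ \ segment ℝ E (conj E))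

/-- `Z` is the basic solution `Z^σ = Ψ w^σ` together with its analytic continuation from the
real line to the half-plane `σ Im z > 0`. -/
structure IsBasicZ (L : EReal) (n : ℝ → ℝ) (Ef : ℝ → ℝ → ℂ) (ρ : ℝ → ℝ → ℝ → ℂ)
    (Nf : ℝ → ℝ → ℝ → ℝ) (σ : ℝ) (Z : ℝ → ℝ → ℂ → Mat2) : Prop where
  /-- `Z = Ψ w`, where `Ψ` solves the `t`-equation for each `x` and `Ψ = I` at `t = 0`, and
  `w` solves the `x`-equation for `t = 0` and `w exp (-i η x σ₃) → I` as `x → L`. -/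
  factor : ∃ (Ψ : ℝ → ℝ → ℂ → Mat2) (w : ℝ → ℂ → Mat2), ∀ z ∈ closedHalf n σ,
    (∀ x : ℝ, 0 < x → (x : EReal) < L →
      Ψ 0 x z = 1 ∧ ContinuousOn (fun t => Ψ t x z) (Ici 0) ∧
      (∀ t : ℝ, 0 < t → t ≠ x →
        HasMatDerivAt (fun τ => Ψ τ x z) (coeffU Ef t x z * Ψ t x z) t) ∧
      HasMatDerivAt (fun y => w y z) (coeffV n Ef ρ Nf σ 0 x z * w x z) x ∧
      ∀ t : ℝ, 0 ≤ t → Z t x z = Ψ t x z * w x z) ∧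
    Tendsto (fun x : ℝ => w x z * expSigma3 (-Complex.I * sideValue σ (eta n) z * x))
      (comap (fun x : ℝ => (x : EReal)) (𝓝[<] L)) (𝓝 1)
  /-- `Z` solves the `x`-equation. -/
  x_eq : ∀ t : ℝ, 0 ≤ t → ∀ z ∈ closedHalf n σ,
    ContinuousOn (fun x => Z t x z) {x : ℝ | 0 < x ∧ (x : EReal) < L} ∧
    ∀ x : ℝ, 0 < x → (x : EReal) < L → x ≠ t →
      HasMatDerivAt (fun y => Z t y z) (coeffV n Ef ρ Nf σ t x z * Z t x z) x
  analytic : ∀ t x : ℝ, 0 ≤ t → 0 < x → (x : EReal) < L → ∀ i j,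
    DifferentiableOn ℂ (fun z => Z t x z i j) (openHalf σ)
  continuous : ∀ t x : ℝ, 0 ≤ t → 0 < x → (x : EReal) < L →
    ContinuousOn (Z t x) (closedHalf n σ)

/-- `(Y⁺, Z⁺, Y⁻, Z⁻)` are the basic solutions. -/
def AreBasicSolutions (L : EReal) (n : ℝ → ℝ) (E : ℂ) (Ef : ℝ → ℝ → ℂ) (ρ : ℝ → ℝ → ℝ → ℂ)
    (Nf : ℝ → ℝ → ℝ → ℝ) (Yp Zp Ym Zm : ℝ → ℝ → ℂ → Mat2) : Prop :=
  IsBasicY L n E Ef ρ Nf 1 Yp ∧ IsBasicZ L n Ef ρ Nf 1 Zp ∧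
    IsBasicY L n E Ef ρ Nf (-1) Ym ∧ IsBasicZ L n Ef ρ Nf (-1) Zm

/-- The matrix `M` built from the basic solutions; only its values off the contour matter. -/
def basicM (n : ℝ → ℝ) (E : ℂ) (Yp Zp Ym Zm : ℝ → ℝ → ℂ → Mat2) (t x : ℝ) (z : ℂ) : Mat2 :=
  let e : ℂ := Complex.exp (Complex.I * theta n t x z)
  let e' : ℂ := Complex.exp (-Complex.I * theta n t x z)
  if 0 < z.im then
    Matrix.of fun i => ![Zp t x z i 0 * e, Yp t x z i 1 / aFun E z * e']
  else
    Matrix.of fun i => ![Ym t x z i 0 / aFun E z * e, Zm t x z i 1 * e']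

/-! ### The Riemann--Hilbert problem -/

/-- The closed contour: the real line together with the closed interval `[E, Ē]`. -/
def closedContour (E : ℂ) : Set ℂ := {z | z.im = 0} ∪ segment ℝ E (conj E)

/-- The regular points of the contour: real points other than `Re E` where `n` is continuous, and
the points of `(E, Re E) ∪ (Re E, Ē)`. -/
def regularContour (n : ℝ → ℝ) (E : ℂ) : Set ℂ :=
  {z | z.im = 0 ∧ z.re ≠ E.re ∧ ContinuousAt n z.re} ∪
    {z | z.re = E.re ∧ z.im ≠ 0 ∧ |z.im| < E.im}

/-- Approach to a contour point from the left (`+`) side: the real line is oriented from left to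
right, the interval `(E, Ē)` downward. -/
def plusSide (E ζ : ℂ) : Filter ℂ :=
  if ζ.im = 0 then 𝓝[{z | 0 < z.im}] ζ else 𝓝[{z | E.re < z.re}] ζ

/-- Approach to a contour point from the right (`-`) side. -/
def minusSide (E ζ : ℂ) : Filter ℂ :=
  if ζ.im = 0 then 𝓝[{z | z.im < 0}] ζ else 𝓝[{z | z.re < E.re}] ζ

/-- The boundary value `M₊`; on the real line it is `M(λ + i0)`. -/
def plusValue (E : ℂ) (M : ℂ → Mat2) (ζ : ℂ) : Mat2 := limUnder (plusSide E ζ) M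

/-- The boundary value `M₋`. -/
def minusValue (E : ℂ) (M : ℂ → Mat2) (ζ : ℂ) : Mat2 := limUnder (minusSide E ζ) M

/-- The jump matrix. -/
def jumpMatrix (n : ℝ → ℝ) (E : ℂ) (t x : ℝ) (ζ : ℂ) : Mat2 :=
  let θp := sideValue 1 (theta n t x) ζ
  let θm := sideValue (-1) (theta n t x) ζ
  if ζ.im = 0 then
    !![1 - rFun E ζ ^ 2 * Complex.exp (2 * Complex.I * (θm - θp)),
        -rFun E ζ * Complex.exp (-2 * Complex.I * θp);
      rFun E ζ * Complex.exp (2 * Complex.I * θm), 1]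
  else if 0 < ζ.im then
    !![1, hFun E ζ * Complex.exp (-2 * Complex.I * theta n t x ζ); 0, 1]
  else
    !![1, 0; hFun E ζ * Complex.exp (2 * Complex.I * theta n t x ζ), 1]

/-- `M` solves the basic Riemann--Hilbert problem with parameters `(t, x)`. -/
structure SolvesRH (n : ℝ → ℝ) (E : ℂ) (t x : ℝ) (M : ℂ → Mat2) : Prop where
  analytic : ∀ i j, DifferentiableOn ℂ (fun z => M z i j) (closedContour E)ᶜ
  /-- `M` extends continuously from either side to the regular points of the contour. -/
  boundary_plus : ∀ ζ ∈ regularContour n E, ∃ A : Mat2, Tendsto M (plusSide E ζ) (𝓝 A)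
  boundary_minus : ∀ ζ ∈ regularContour n E, ∃ A : Mat2, Tendsto M (minusSide E ζ) (𝓝 A)
  /-- `M` is bounded near `Re E` and near the discontinuities of `n`. -/
  bounded : ∀ l : ℝ, (l = E.re ∨ ¬ ContinuousAt n l) → ∀ i j,
    (fun z => M z i j) =O[𝓝[(closedContour E)ᶜ] (l : ℂ)] (fun _ => (1 : ℝ))
  endpoint : ∀ i j,
    (fun z => M z i j) =O[𝓝[(closedContour E)ᶜ] E] (fun z => ‖z - E‖ ^ (-(1 / 4) : ℝ))
  endpoint_conj : ∀ i j,
    (fun z => M z i j) =O[𝓝[(closedContour E)ᶜ] (conj E)]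
      (fun z => ‖z - conj E‖ ^ (-(1 / 4) : ℝ))
  jump : ∀ ζ ∈ regularContour n E,
    minusValue E M ζ = plusValue E M ζ * jumpMatrix n E t x ζ
  normalization : ∀ i j,
    (fun z => M z i j - (1 : Mat2) i j) =O[Bornology.cobounded ℂ ⊓ 𝓟 (closedContour E)ᶜ]
      (fun z => z⁻¹)

end MaxwellBloch

end

open MaxwellBloch

/-!
The matrix `M` of the theorem has an explicit form. Let `Ψ(t,x,z)` (`psi`) be the propagator of the
`t`-equation, which is entire in `z`. The field vanishes ahead of the characteristic `t = x`
(`MaxwellBloch.IsSolution.field_eq_zero`), so that `Ψ = exp (-i z t σ₃)` for `t ≤ x`. The matrix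
`Ψ exp (i η x σ₃)` (`jointSol`) also solves the `x`-equation: differentiation along characteristics,
where the field is differentiable, turns the Maxwell--Bloch equations into a zero curvature
condition, and the candidate for the derivative solves the same linear equation in `t` as the
derivative (`psi_hasDerivAt_x_of_lt`). At real `z` the equation follows by passing to boundary
values; the Cauchy integrals converge there, uniformly for `x` near a given point, because their
densities are locally Hölder continuous (`exists_tendsto_cauchy_integral`). Hence
`Z = Ψ exp (i η x σ₃)` and `Y = Ψ exp (i η x σ₃) (a b; b a)` are basic solutions
(`jointSol_isBasicZ`, `jointSol_isBasicY`). Basic solutions need not be unique, but the columns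
which occur in `M` are: off the real line `Y` is given by linear ODE uniqueness, and the
normalization of `Z` at `x = L` fixes the column which cannot be changed by a decaying exponential.
So `M` is the product of `Ψ exp (i z t σ₃)` with a triangular matrix with off-diagonal entry
`r exp (∓ 2 i θ)` (`rhSolution`, `basicM_eq`).

The jumps of this product are those of the triangular factor, and `h` is the jump of `r` across the
cut. It is bounded near every point, since `|r| ≤ 1` and `± Im η ≥ 0` for `± Im z > 0`. The
normalization at infinity is the main analytic point. For `x < t`, a Wentzel--Kramers--Brillouin
estimate for oscillatory systems (`exists_oscillatory_bound`), applied in `t`, shows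
that each column of `Ψ exp (i z t σ₃)` is `O(1/z)`-close to the identity in a half-plane and in
strips; applied in `x`, with the explicit value at `x = 0`, it controls the remaining column of `M` in
a cone in the upper half-plane. `M` is of exponential type, and the Phragmén--Lindelöf principle
extends the bound from a strip and a ray to the upper half-plane (`exists_upper_bound_column_one`).
The symmetry `M(z̄)ᴴ M(z) = 1` covers the lower half-plane (`rhSolution_solvesRH`). The next term of the
estimates in a cone is the field (`tendsto_mul_rhSolution`).

Since `det M = 1`, for another solution `M'` the matrix `M' M⁻¹` has no jumps, so it is holomorphic
across the regular points of the contour by Morera's theorem; the singularities at the finitely many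
other points are at worst of order `1/2`, hence removable, and Liouville's theorem gives `M' = M`
(`SolvesRH.eqOn_of_det_eq_one`). Finally, at real `λ` the equations for `ρ` and `𝓝` say that `F Ψ`
solves the `t`-equation with initial value `-σ₃`, so `F = -Ψ σ₃ Ψ⁻¹` (`densityMatrix_mul_psi`), and
`exp (-i λ t σ₃)` intertwines the triangular factors at the times `t` and `0` (`densityMatrix_eq`).
-/


/-! ### Linear differential equations with bounded coefficients -/

section LinearODE

variable {E : Type*} [NormedAddCommGroup E] [NormedSpace ℝ E]

/-- A mean value inequality in which nothing is asked of the derivative at the left endpoint and at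
one exceptional point. -/
theorem norm_le_add_sub_of_deriv_bound {f f' : ℝ → E} {B B' : ℝ → ℝ} {a b : ℝ} (c : ℝ) (hab : a ≤ b)
    (hf : ContinuousOn f (Icc a b)) (hf' : ∀ s ∈ Ioo a b, s ≠ c → HasDerivAt f (f' s) s)
    (hB : ∀ s, HasDerivAt B (B' s) s) (hb : ∀ s ∈ Ioo a b, s ≠ c → ‖f' s‖ ≤ B' s) :
    ‖f b‖ ≤ ‖f a‖ + (B b - B a) := by
  have key : ∀ a b : ℝ, a ≤ b → ContinuousOn f (Icc a b) →
      (∀ s ∈ Ioo a b, HasDerivAt f (f' s) s) → (∀ s ∈ Ioo a b, ‖f' s‖ ≤ B' s) →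
      ‖f b‖ ≤ ‖f a‖ + (B b - B a) := by
    intro a b hab hf hf' hb
    rcases hab.eq_or_lt with rfl | hlt
    · simp
    have hBc : Continuous B := continuous_iff_continuousAt.2 fun s => (hB s).continuousAt
    have h1 : ∀ᶠ a' in 𝓝[>] a, ‖f b‖ ≤ ‖f a'‖ + (B b - B a') := by
      filter_upwards [Ioo_mem_nhdsGT hlt] with a' ha'
      have := image_norm_le_of_norm_deriv_right_le_deriv_boundary' (f := f) (f' := f') (a := a')
        (b := b) (B := fun s => ‖f a'‖ + (B s - B a')) (B' := B')
        (hf.mono (Icc_subset_Icc_left ha'.1.le))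
        (fun s hs => (hf' s ⟨ha'.1.trans_le hs.1, hs.2⟩).hasDerivWithinAt) (by simp)
        (by fun_prop) (fun s _ => (((hB s).sub_const _).const_add _).hasDerivWithinAt)
        (fun s hs => hb s ⟨ha'.1.trans_le hs.1, hs.2⟩)
      exact this ⟨ha'.2.le, le_rfl⟩
    have h2 : Tendsto (fun a' => ‖f a'‖ + (B b - B a')) (𝓝[>] a) (𝓝 (‖f a‖ + (B b - B a))) := by
      have h3 : Tendsto f (𝓝[>] a) (𝓝 (f a)) :=
        ((hf a ⟨le_rfl, hlt.le⟩).mono_of_mem_nhdsWithin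
          (mem_of_superset (Ioc_mem_nhdsGT hlt) Ioc_subset_Icc_self)).tendsto
      exact h3.norm.add (((hBc.tendsto a).mono_left nhdsWithin_le_nhds).const_sub _)
    exact ge_of_tendsto h2 h1
  by_cases hc : c ∈ Ioo a b
  · have h1 := key a c hc.1.le (hf.mono (Icc_subset_Icc_right hc.2.le))
      (fun s hs => hf' s ⟨hs.1, hs.2.trans hc.2⟩ hs.2.ne)
      (fun s hs => hb s ⟨hs.1, hs.2.trans hc.2⟩ hs.2.ne)
    have h2 := key c b hc.2.le (hf.mono (Icc_subset_Icc_left hc.1.le))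
      (fun s hs => hf' s ⟨hc.1.trans hs.1, hs.2⟩ hs.1.ne')
      (fun s hs => hb s ⟨hc.1.trans hs.1, hs.2⟩ hs.1.ne')
    linarith
  · have hne : ∀ s ∈ Ioo a b, s ≠ c := fun s hs h => hc (h ▸ hs)
    exact key a b hab hf (fun s hs => hf' s hs (hne s hs)) (fun s hs => hb s hs (hne s hs))

/-- Grönwall's inequality with one exceptional point. -/
theorem norm_le_mul_exp_of_deriv_bound {f f' : ℝ → E} {K ε a b : ℝ} (c : ℝ) (hK : 0 ≤ K)
    (hε : 0 ≤ ε) (hf : ContinuousOn f (Icc a b))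
    (hf' : ∀ s ∈ Ioo a b, s ≠ c → HasDerivAt f (f' s) s)
    (hb : ∀ s ∈ Ioo a b, s ≠ c → ‖f' s‖ ≤ K * ‖f s‖ + ε) :
    ∀ t ∈ Icc a b, ‖f t‖ ≤ (‖f a‖ + ε * (t - a)) * Real.exp (K * (t - a)) := by
  have hgr : ∀ δ x : ℝ, 0 ≤ x → gronwallBound δ K ε x ≤ (δ + ε * x) * Real.exp (K * x) := by
    intro δ x hx
    rcases hK.eq_or_lt with rfl | hK
    · simp [gronwallBound_K0]
    · rw [gronwallBound_of_K_ne_0 hK.ne', add_mul]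
      have h1 : Real.exp (K * x) - 1 ≤ K * x * Real.exp (K * x) := by
        have := Real.add_one_le_exp (-(K * x))
        rw [Real.exp_neg] at this
        have h2 := Real.exp_pos (K * x)
        have h3 := mul_le_mul_of_nonneg_right this h2.le
        rw [inv_mul_cancel₀ h2.ne'] at h3
        linarith
      have h2 : ε / K * (Real.exp (K * x) - 1) ≤ ε / K * (K * x * Real.exp (K * x)) := by gcongr
      have h3 : ε / K * (K * x * Real.exp (K * x)) = ε * x * Real.exp (K * x) := by field_simp
      linarith
  have key : ∀ a t : ℝ, a ≤ t → ContinuousOn f (Icc a t) →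
      (∀ s ∈ Ioo a t, HasDerivAt f (f' s) s) → (∀ s ∈ Ioo a t, ‖f' s‖ ≤ K * ‖f s‖ + ε) →
      ‖f t‖ ≤ (‖f a‖ + ε * (t - a)) * Real.exp (K * (t - a)) := by
    intro a t hat hf hf' hb
    rcases hat.eq_or_lt with rfl | hlt
    · simp
    have h1 : ∀ᶠ a' in 𝓝[>] a, ‖f t‖ ≤ (‖f a'‖ + ε * (t - a')) * Real.exp (K * (t - a')) := by
      filter_upwards [Ioo_mem_nhdsGT hlt] with a' ha'
      refine (norm_le_gronwallBound_of_norm_deriv_right_le (f := f) (f' := f') (δ := ‖f a'‖)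
        (K := K) (ε := ε) (a := a') (b := t) (hf.mono (Icc_subset_Icc_left ha'.1.le))
        (fun s hs => (hf' s ⟨ha'.1.trans_le hs.1, hs.2⟩).hasDerivWithinAt) le_rfl
        (fun s hs => hb s ⟨ha'.1.trans_le hs.1, hs.2⟩) t ⟨ha'.2.le, le_rfl⟩).trans
        (hgr _ _ (by linarith [ha'.2]))
    have h3 : Tendsto f (𝓝[>] a) (𝓝 (f a)) :=
      ((hf a ⟨le_rfl, hlt.le⟩).mono_of_mem_nhdsWithin
        (mem_of_superset (Ioc_mem_nhdsGT hlt) Ioc_subset_Icc_self)).tendsto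
    have h4 : Tendsto (fun a' : ℝ => a') (𝓝[>] a) (𝓝 a) := nhdsWithin_le_nhds
    have h2 : Tendsto (fun a' => (‖f a'‖ + ε * (t - a')) * Real.exp (K * (t - a'))) (𝓝[>] a)
        (𝓝 ((‖f a‖ + ε * (t - a)) * Real.exp (K * (t - a)))) :=
      (h3.norm.add ((h4.const_sub t).const_mul ε)).mul
        ((Real.continuous_exp.tendsto _).comp ((h4.const_sub t).const_mul K))
    exact ge_of_tendsto h2 h1
  intro t ht
  by_cases hc : c ∈ Ioo a t
  · have h1 := key a c hc.1.le (hf.mono (Icc_subset_Icc_right (hc.2.le.trans ht.2)))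
      (fun s hs => hf' s ⟨hs.1, hs.2.trans (hc.2.trans_le ht.2)⟩ hs.2.ne)
      (fun s hs => hb s ⟨hs.1, hs.2.trans (hc.2.trans_le ht.2)⟩ hs.2.ne)
    have h2 := key c t hc.2.le (hf.mono (Icc_subset_Icc hc.1.le ht.2))
      (fun s hs => hf' s ⟨hc.1.trans hs.1, hs.2.trans_le ht.2⟩ hs.1.ne')
      (fun s hs => hb s ⟨hc.1.trans hs.1, hs.2.trans_le ht.2⟩ hs.1.ne')
    have hca := hc.1
    have htc := hc.2
    have e1 : (1 : ℝ) ≤ Real.exp (K * (c - a)) :=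
      Real.one_le_exp (mul_nonneg hK (by linarith))
    calc ‖f t‖ ≤ (‖f c‖ + ε * (t - c)) * Real.exp (K * (t - c)) := h2
      _ ≤ ((‖f a‖ + ε * (c - a)) * Real.exp (K * (c - a))
          + ε * (t - c) * Real.exp (K * (c - a))) * Real.exp (K * (t - c)) := by
        refine mul_le_mul_of_nonneg_right (add_le_add h1 ?_) (Real.exp_pos _).le
        exact le_mul_of_one_le_right (mul_nonneg hε (sub_nonneg.2 htc.le)) e1
      _ = (‖f a‖ + ε * (t - a)) * (Real.exp (K * (c - a)) * Real.exp (K * (t - c))) := by ring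
      _ = _ := by rw [← Real.exp_add]; ring_nf
  · have hne : ∀ s ∈ Ioo a t, s ≠ c := fun s hs h => hc (h ▸ hs)
    have hs' : ∀ s ∈ Ioo a t, s ∈ Ioo a b := fun s hs => ⟨hs.1, hs.2.trans_le ht.2⟩
    exact key a t ht.1 (hf.mono (Icc_subset_Icc_right ht.2))
      (fun s hs => hf' s (hs' s hs) (hne s hs)) (fun s hs => hb s (hs' s hs) (hne s hs))

end LinearODE

section Propagator

variable {𝔸 : Type*} [NormedRing 𝔸] [NormedAlgebra ℝ 𝔸] [CompleteSpace 𝔸] [NormOneClass 𝔸]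

/-- The terms of the Dyson series of the equation `Y' = A Y`. -/
noncomputable def dysonTerm (A : ℝ → 𝔸) : ℕ → ℝ → 𝔸
  | 0 => fun _ => 1
  | n + 1 => fun t => ∫ s in (0 : ℝ)..t, A s * dysonTerm A n s

/-- The solution of `Y' = A Y`, `Y 0 = 1`, as a Dyson series. -/
noncomputable def propagator (A : ℝ → 𝔸) (t : ℝ) : 𝔸 := ∑' n, dysonTerm A n t

/-- Measurable coefficients on `(0, ∞)` which are bounded on each `(0, T]`. -/
structure IsBoundedCoeff (A : ℝ → 𝔸) : Prop where
  aestronglyMeasurable : ∀ T : ℝ, AEStronglyMeasurable A (volume.restrict (Ioc 0 T))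
  bounded : ∀ T : ℝ, ∃ C : ℝ, ∀ s ∈ Ioc 0 T, ‖A s‖ ≤ C

omit [NormedAlgebra ℝ 𝔸] [CompleteSpace 𝔸] [NormOneClass 𝔸] in
theorem IsBoundedCoeff.integrableOn_mul {A : ℝ → 𝔸} (hA : IsBoundedCoeff A) {f : ℝ → 𝔸} {T : ℝ}
    (hf : ContinuousOn f (Icc 0 T)) : IntegrableOn (fun s => A s * f s) (Ioc 0 T) := by
  obtain ⟨M, hM⟩ := hA.bounded T
  obtain ⟨D, hD⟩ := isCompact_Icc.exists_bound_of_continuousOn hf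
  have hf' : AEStronglyMeasurable f (volume.restrict (Ioc 0 T)) :=
    (hf.mono Ioc_subset_Icc_self).aestronglyMeasurable measurableSet_Ioc
  refine IntegrableOn.of_bound (by simp) ((hA.aestronglyMeasurable T).mul hf') (M * D) ?_
  refine (ae_restrict_iff' measurableSet_Ioc).2 (ae_of_all _ fun s hs => ?_)
  refine (norm_mul_le _ _).trans ?_
  have := hM s hs
  have h2 := hD s (Ioc_subset_Icc_self hs)
  have h0 : 0 ≤ M := (norm_nonneg _).trans this
  gcongr

omit [CompleteSpace 𝔸] in
theorem IsBoundedCoeff.dysonTerm_bound {A : ℝ → 𝔸} (hA : IsBoundedCoeff A) {T M : ℝ}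
    (hM : ∀ s ∈ Ioc 0 T, ‖A s‖ ≤ M) (hM0 : 0 ≤ M) (n : ℕ) :
    ContinuousOn (dysonTerm A n) (Icc 0 T) ∧
      ∀ t ∈ Icc 0 T, ‖dysonTerm A n t‖ ≤ (M * t) ^ n / n.factorial := by
  induction n with
  | zero => exact ⟨continuousOn_const, fun t _ => by simp [dysonTerm]⟩
  | succ n ih =>
    have hint := hA.integrableOn_mul ih.1
    constructor
    · rcases le_or_gt 0 T with hT | hT
      · have := intervalIntegral.continuousOn_primitive_interval (μ := volume) (a := 0) (b := T)
          (f := fun s => A s * dysonTerm A n s)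
        rw [uIcc_of_le hT, integrableOn_Icc_iff_integrableOn_Ioc] at this
        exact this hint
      · rw [Icc_eq_empty (by linarith)]; exact continuousOn_empty _
    · intro t ht
      have h1 : ‖dysonTerm A (n + 1) t‖ ≤
          ∫ s in (0 : ℝ)..t, M * ((M * s) ^ n / n.factorial) := by
        refine intervalIntegral.norm_integral_le_of_norm_le ht.1
          (ae_of_all _ fun s hs => ?_) (Continuous.intervalIntegrable (by fun_prop) _ _)
        have hs' : s ∈ Ioc 0 T := ⟨hs.1, hs.2.trans ht.2⟩
        refine (norm_mul_le _ _).trans ?_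
        have := hM s hs'
        have h2 := ih.2 s (Ioc_subset_Icc_self hs')
        gcongr
      refine h1.trans (le_of_eq ?_)
      have : (fun s : ℝ => M * ((M * s) ^ n / n.factorial))
          = fun s => (M ^ (n + 1) / n.factorial) * s ^ n := by
        funext s; rw [mul_pow]; ring
      rw [this, intervalIntegral.integral_const_mul, integral_pow, Nat.factorial_succ]
      push_cast
      field_simp
      simp [mul_pow]

/-- The Dyson series converges uniformly on bounded intervals, by the factorial bounds for its
terms, and solves the Volterra equation of the linear equation. The coefficient may jump, so the
differential equation holds only where the coefficient is continuous. -/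
theorem IsBoundedCoeff.propagator_spec {A : ℝ → 𝔸} (hA : IsBoundedCoeff A)
    (T : ℝ) : ContinuousOn (propagator A) (Icc 0 T) ∧
      ∀ t ∈ Icc 0 T, propagator A t = 1 + ∫ s in (0 : ℝ)..t, A s * propagator A s := by
  obtain ⟨M', hM'⟩ := hA.bounded T
  obtain ⟨M, hM0, hM⟩ : ∃ M, 0 ≤ M ∧ ∀ s ∈ Ioc 0 T, ‖A s‖ ≤ M :=
    ⟨max M' 0, le_max_right _ _, fun s hs => (hM' s hs).trans (le_max_left _ _)⟩
  have hd := hA.dysonTerm_bound hM hM0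
  have hd' : ∀ n, ∀ t ∈ Icc 0 T, ‖dysonTerm A n t‖ ≤ (M * T) ^ n / n.factorial := by
    intro n t ht
    refine ((hd n).2 t ht).trans ?_
    have := ht.1
    have := ht.2
    gcongr
  have hsum : Summable fun n : ℕ => (M * T) ^ n / n.factorial := Real.summable_pow_div_factorial _
  refine ⟨continuousOn_tsum (fun n => (hd n).1) hsum hd', fun t ht => ?_⟩
  have hs : Summable fun n => dysonTerm A n t := .of_norm_bounded hsum fun n => hd' n t ht
  have hI : HasSum (fun n => ∫ s in (0 : ℝ)..t, A s * dysonTerm A n s)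
      (∫ s in (0 : ℝ)..t, A s * propagator A s) := by
    refine intervalIntegral.hasSum_integral_of_dominated_convergence
      (fun n _ => M * ((M * T) ^ n / n.factorial)) (fun n => ?_) (fun n => ?_) ?_ ?_ ?_
    · rw [uIoc_of_le ht.1]
      exact ((hA.integrableOn_mul (hd n).1).mono_set (Ioc_subset_Ioc_right ht.2)).1
    · refine ae_of_all _ fun s hs => ?_
      rw [uIoc_of_le ht.1] at hs
      have hs' : s ∈ Ioc 0 T := ⟨hs.1, hs.2.trans ht.2⟩
      refine (norm_mul_le _ _).trans ?_
      have := hM s hs'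
      have h2 := hd' n s (Ioc_subset_Icc_self hs')
      gcongr
    · exact ae_of_all _ fun s _ => hsum.mul_left M
    · simp
    · refine ae_of_all _ fun s hs => ?_
      rw [uIoc_of_le ht.1] at hs
      have hs' : s ∈ Icc 0 T := ⟨hs.1.le, hs.2.trans ht.2⟩
      exact (Summable.of_norm_bounded hsum fun n => hd' n s hs').hasSum.mul_left (A s)
  rw [propagator, hs.tsum_eq_zero_add]
  congr 1
  exact hI.tsum_eq

theorem IsBoundedCoeff.propagator_zero {A : ℝ → 𝔸} (hA : IsBoundedCoeff A) :
    propagator A 0 = 1 := by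
  simpa using (hA.propagator_spec 0).2 0 (by simp)

theorem IsBoundedCoeff.propagator_continuousOn {A : ℝ → 𝔸} (hA : IsBoundedCoeff A) :
    ContinuousOn (propagator A) (Ici 0) := by
  intro t ht
  have := (hA.propagator_spec (t + 1)).1 t ⟨ht, by linarith⟩
  refine this.mono_of_mem_nhdsWithin ?_
  rw [← Ici_inter_Iic]
  exact inter_mem self_mem_nhdsWithin (mem_nhdsWithin_of_mem_nhds (Iic_mem_nhds (by linarith)))

theorem IsBoundedCoeff.propagator_hasDerivAt {A : ℝ → 𝔸} (hA : IsBoundedCoeff A) {t : ℝ}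
    (ht : 0 < t) (hc : ContinuousAt A t) : HasDerivAt (propagator A) (A t * propagator A t) t := by
  obtain ⟨h1, h2⟩ := hA.propagator_spec (t + 1)
  have hI := hA.integrableOn_mul h1
  have hnhds : Ioc 0 (t + 1) ∈ 𝓝 t := Ioc_mem_nhds ht (by linarith)
  have hcont : ContinuousAt (propagator A) t :=
    h1.continuousAt (mem_of_superset hnhds Ioc_subset_Icc_self)
  have h3 : HasDerivAt (fun u => ∫ s in (0 : ℝ)..u, A s * propagator A s) (A t * propagator A t) t :=
    intervalIntegral.integral_hasDerivAt_right
      ((intervalIntegrable_iff_integrableOn_Ioc_of_le ht.le).2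
        (hI.mono_set (Ioc_subset_Ioc_right (by linarith))))
      ⟨_, hnhds, hI.1⟩ (hc.mul hcont)
  refine (h3.const_add 1).congr_of_eventuallyEq ?_
  filter_upwards [hnhds] with u hu using h2 u (Ioc_subset_Icc_self hu)

omit [CompleteSpace 𝔸] [NormOneClass 𝔸] in
/-- Uniqueness for linear equations. -/
theorem eq_of_linear_deriv {A f g : ℝ → 𝔸} {a b M : ℝ} (c : ℝ) (hab : a ≤ b)
    (hf : ContinuousOn f (Icc a b)) (hg : ContinuousOn g (Icc a b))
    (hf' : ∀ s ∈ Ioo a b, s ≠ c → HasDerivAt f (A s * f s) s)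
    (hg' : ∀ s ∈ Ioo a b, s ≠ c → HasDerivAt g (A s * g s) s)
    (hA : ∀ s ∈ Ioo a b, s ≠ c → ‖A s‖ ≤ M) (h0 : f a = g a) : f b = g b := by
  have := norm_le_mul_exp_of_deriv_bound (f := fun s => f s - g s)
    (f' := fun s => A s * f s - A s * g s) (K := max M 0) (ε := 0) c (le_max_right _ _) le_rfl
    (hf.sub hg) (fun s hs hne => (hf' s hs hne).sub (hg' s hs hne))
    (fun s hs hne => by
      rw [← mul_sub, add_zero]
      refine (norm_mul_le _ _).trans ?_
      gcongr
      exact (hA s hs hne).trans (le_max_left _ _)) b ⟨hab, le_rfl⟩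
  simp only [h0, sub_self, norm_zero, zero_mul, add_zero] at this
  exact sub_eq_zero.1 (norm_le_zero_iff.1 this)

end Propagator

section ParameterDerivative

variable {𝔸 : Type*} [NormedRing 𝔸] [NormedAlgebra ℂ 𝔸] [CompleteSpace 𝔸] [NormOneClass 𝔸]

/-- If the coefficient is affine in a complex parameter, then the propagator is an entire function
of this parameter; its derivative is given by Duhamel's formula. -/
theorem propagator_differentiable {A : ℝ → 𝔸} {B : 𝔸} (c : ℝ)
    (hA : ∀ z : ℂ, IsBoundedCoeff fun s => A s + z • B)
    (hc : ∀ t : ℝ, 0 < t → t ≠ c → ContinuousAt A t)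
    (hinv : ∀ z : ℂ, ∃ V : ℝ → 𝔸, ContinuousOn V (Ici 0) ∧
      ∀ t, 0 ≤ t → propagator (fun s => A s + z • B) t * V t = 1) {t : ℝ} (ht : 0 ≤ t) :
    Differentiable ℂ fun z : ℂ => propagator (fun s => A s + z • B) t := by
  intro z
  set Y : ℂ → ℝ → 𝔸 := fun z => propagator fun s => A s + z • B with hY
  have hYc : ∀ z, ContinuousOn (Y z) (Ici 0) := fun z => (hA z).propagator_continuousOn
  have hYd : ∀ z, ∀ s, 0 < s → s ≠ c → HasDerivAt (Y z) ((A s + z • B) * Y z s) s :=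
    fun z s hs hne => (hA z).propagator_hasDerivAt hs ((hc s hs hne).add continuousAt_const)
  have hI : Icc 0 t ⊆ Ici (0 : ℝ) := fun s hs => hs.1
  obtain ⟨M, hM⟩ := (hA z).bounded t
  have hMb : ∀ s ∈ Ioo 0 t, ‖A s + z • B‖ ≤ max M 0 := fun s hs =>
    (hM s ⟨hs.1, hs.2.le⟩).trans (le_max_left _ _)
  obtain ⟨D, hD⟩ := isCompact_Icc.exists_bound_of_continuousOn ((hYc z).mono hI)
  have hD0 : 0 ≤ D := (norm_nonneg _).trans (hD 0 ⟨le_rfl, ht⟩)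
  set K := max M 0 + ‖B‖ with hK
  have hK0 : 0 ≤ K := by positivity
  set C := ‖B‖ * D * t * Real.exp (K * t) with hC
  -- the first variation is Lipschitz in the parameter
  have h1 : ∀ h : ℂ, ‖h‖ ≤ 1 → ∀ s ∈ Icc 0 t, ‖Y (z + h) s - Y z s‖ ≤ C * ‖h‖ := by
    intro h hh s hs
    have := norm_le_mul_exp_of_deriv_bound (f := fun s => Y (z + h) s - Y z s)
      (f' := fun s => (A s + (z + h) • B) * Y (z + h) s - (A s + z • B) * Y z s)
      (K := K) (ε := ‖h‖ * ‖B‖ * D) c hK0 (by positivity)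
      (((hYc (z + h)).mono hI).sub ((hYc z).mono hI))
      (fun s hs hne => (hYd _ s hs.1 hne).sub (hYd _ s hs.1 hne))
      (fun s hs hne => by
        have e : (A s + (z + h) • B) * Y (z + h) s - (A s + z • B) * Y z s
            = (A s + z • B + h • B) * (Y (z + h) s - Y z s) + h • (B * Y z s) := by
          rw [add_smul, ← add_assoc, mul_sub, add_mul (A s + z • B) (h • B) (Y z s),
            smul_mul_assoc h B (Y z s)]
          abel
        rw [e]
        refine (norm_add_le _ _).trans (add_le_add ?_ ?_)
        · refine (norm_mul_le _ _).trans ?_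
          gcongr
          refine (norm_add_le _ _).trans (add_le_add (hMb s hs) ?_)
          rw [norm_smul]
          exact mul_le_of_le_one_left (norm_nonneg _) hh
        · rw [norm_smul, mul_assoc]
          gcongr
          refine (norm_mul_le _ _).trans ?_
          gcongr
          exact hD s ⟨hs.1.le, hs.2.le⟩) s hs
    have e0 : Y (z + h) 0 - Y z 0 = 0 := by
      simp only [hY]; rw [(hA (z + h)).propagator_zero, (hA z).propagator_zero, sub_self]
    refine this.trans ?_
    simp only [e0, norm_zero, zero_add, sub_zero]
    calc ‖h‖ * ‖B‖ * D * s * Real.exp (K * s) ≤ ‖h‖ * ‖B‖ * D * t * Real.exp (K * t) := by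
          have := hs.1
          have := hs.2
          gcongr
      _ = C * ‖h‖ := by rw [hC]; ring
  obtain ⟨V, hVc, hV⟩ := hinv z
  set g : ℝ → 𝔸 := fun s => V s * B * Y z s with hg
  have hgc : ContinuousOn g (Ici 0) := (hVc.mul continuousOn_const).mul (hYc z)
  set k : ℝ → 𝔸 := fun s => Y z s * ∫ u in (0 : ℝ)..s, g u with hk
  have hgi : IntegrableOn g (Icc 0 (t + 1)) :=
    (hgc.mono fun s hs => hs.1).integrableOn_Icc
  have hkc : ContinuousOn k (Icc 0 t) := by
    refine ((hYc z).mono hI).mul ?_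
    have := intervalIntegral.continuousOn_primitive_interval (μ := volume) (a := 0) (b := t) (f := g)
    rw [uIcc_of_le ht] at this
    exact this (hgi.mono_set (Icc_subset_Icc_right (by linarith)))
  have hkd : ∀ s ∈ Ioo 0 t, s ≠ c → HasDerivAt k ((A s + z • B) * k s + B * Y z s) s := by
    intro s hs hne
    have hi : HasDerivAt (fun u => ∫ v in (0 : ℝ)..u, g v) (g s) s := by
      refine intervalIntegral.integral_hasDerivAt_right
        ((intervalIntegrable_iff_integrableOn_Icc_of_le hs.1.le).2
          (hgi.mono_set (Icc_subset_Icc_right (by linarith [hs.2])))) ?_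
        (hgc.continuousAt (Ici_mem_nhds hs.1))
      exact ⟨Icc 0 (t + 1), Icc_mem_nhds hs.1 (by linarith [hs.2]), hgi.1⟩
    have := (hYd z s hs.1 hne).mul hi
    refine this.congr_deriv ?_
    simp only [hk, hg]
    rw [← mul_assoc (Y z s), ← mul_assoc (Y z s), hV s hs.1.le, one_mul, mul_assoc]
  have h2 : ∀ h : ℂ, ‖h‖ ≤ 1 → ‖Y (z + h) t - Y z t - h • k t‖ ≤
      ‖B‖ * C * t * Real.exp (K * t) * ‖h‖ ^ 2 := by
    intro h hh
    have hC0 : 0 ≤ C := by positivity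
    have := norm_le_mul_exp_of_deriv_bound (f := fun s => Y (z + h) s - Y z s - h • k s)
      (f' := fun s => (A s + (z + h) • B) * Y (z + h) s - (A s + z • B) * Y z s
        - h • ((A s + z • B) * k s + B * Y z s))
      (K := K) (ε := ‖h‖ * ‖B‖ * (C * ‖h‖)) c hK0 (by positivity)
      ((((hYc (z + h)).mono hI).sub ((hYc z).mono hI)).sub (hkc.const_smul h))
      (fun s hs hne => ((hYd _ s hs.1 hne).sub (hYd _ s hs.1 hne)).sub
        ((hkd s hs hne).const_smul h))
      (fun s hs hne => by
        have e : (A s + (z + h) • B) * Y (z + h) s - (A s + z • B) * Y z s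
            - h • ((A s + z • B) * k s + B * Y z s)
            = (A s + z • B) * (Y (z + h) s - Y z s - h • k s)
              + h • (B * (Y (z + h) s - Y z s)) := by
          rw [add_smul, ← add_assoc, mul_sub, mul_sub, add_mul (A s + z • B) (h • B) (Y (z + h) s),
            smul_mul_assoc h B (Y (z + h) s), mul_smul_comm h (A s + z • B), mul_sub, smul_sub,
            smul_add]
          abel
        rw [e]
        refine (norm_add_le _ _).trans (add_le_add ?_ ?_)
        · refine (norm_mul_le _ _).trans ?_
          gcongr
          exact (hMb s hs).trans (le_add_of_nonneg_right (norm_nonneg _))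
        · rw [norm_smul, mul_assoc]
          gcongr
          refine (norm_mul_le _ _).trans ?_
          gcongr
          exact h1 h hh s ⟨hs.1.le, hs.2.le⟩) t ⟨ht, le_rfl⟩
    have e0 : Y (z + h) 0 - Y z 0 - h • k 0 = 0 := by
      simp only [hY, hk]
      rw [(hA (z + h)).propagator_zero, (hA z).propagator_zero]; simp
    refine this.trans (le_of_eq ?_)
    simp only [e0, norm_zero, zero_add, sub_zero]
    ring
  refine HasDerivAt.differentiableAt (f' := k t) ?_
  rw [hasDerivAt_iff_isLittleO_nhds_zero]
  have h3 : (fun h : ℂ => Y (z + h) t - Y z t - h • k t) =O[𝓝 0] fun h => ‖h‖ ^ 2 := by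
    refine .of_bound (‖B‖ * C * t * Real.exp (K * t)) ?_
    filter_upwards [Metric.closedBall_mem_nhds (0 : ℂ) one_pos] with h hh
    rw [mem_closedBall_zero_iff] at hh
    simpa using h2 h hh
  exact h3.trans_isLittleO ((isLittleO_norm_pow_id one_lt_two))

end ParameterDerivative

/-! ### The algebra of matrices -/

/-- The operator norm for the sup norm on `ℂ²`, on the uniform space of matrices with entrywise
convergence. -/
@[reducible] noncomputable def mat2NormedRing : NormedRing Mat2 :=
  letI R : NormedRing Mat2 := Matrix.linftyOpNormedRing
  { toNorm := R.toNorm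
    toRing := Matrix.instRing
    dist := R.toMetricSpace.dist
    dist_self := R.dist_self
    dist_comm := R.dist_comm
    dist_triangle := R.dist_triangle
    toUniformSpace := inferInstance
    uniformity_dist := R.toMetricSpace.uniformity_dist
    eq_of_dist_eq_zero := R.eq_of_dist_eq_zero
    dist_eq := R.dist_eq
    norm_mul_le := R.norm_mul_le }

attribute [local instance] mat2NormedRing

@[reducible] noncomputable def mat2NormedAlgebra : NormedAlgebra ℂ Mat2 :=
  letI R : @NormedAlgebra ℂ Mat2 _ Matrix.linftyOpSemiNormedRing := Matrix.linftyOpNormedAlgebra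
  { toAlgebra := inferInstance
    norm_smul_le := R.norm_smul_le }

attribute [local instance] mat2NormedAlgebra

theorem mat2_norm_eq (A : Mat2) : ‖A‖ = max (‖A 0 0‖ + ‖A 0 1‖) (‖A 1 0‖ + ‖A 1 1‖) := by
  have := Matrix.linfty_opNorm_def A
  change ‖A‖ = _ at this
  rw [this]
  simp only [Fin.sum_univ_two]
  rw [show (Finset.univ : Finset (Fin 2)) = {0, 1} from rfl]
  simp only [Finset.sup_insert, Finset.sup_singleton]
  exact NNReal.coe_max _ _

theorem mat2NormOneClass : NormOneClass Mat2 := ⟨by rw [mat2_norm_eq]; simp⟩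

attribute [local instance] mat2NormOneClass

theorem norm_entry_le (A : Mat2) (i j : Fin 2) : ‖A i j‖ ≤ ‖A‖ := by
  rw [mat2_norm_eq]
  fin_cases i <;> fin_cases j <;> simp

theorem norm_le_sum_entries (A : Mat2) : ‖A‖ ≤ ‖A 0 0‖ + ‖A 0 1‖ + (‖A 1 0‖ + ‖A 1 1‖) := by
  rw [mat2_norm_eq]
  exact max_le (le_add_of_nonneg_right (by positivity)) (le_add_of_nonneg_left (by positivity))

theorem hasMatDerivAt_iff {f : ℝ → Mat2} {A : Mat2} {s : ℝ} :
    HasMatDerivAt f A s ↔ HasDerivAt f A s :=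
  ⟨fun h => hasDerivAt_pi.2 fun i => hasDerivAt_pi.2 fun j => h i j,
    fun h i j => hasDerivAt_pi.1 (hasDerivAt_pi.1 h i) j⟩

theorem norm_sigma3 : ‖sigma3‖ = 1 := by simp [mat2_norm_eq, sigma3]

/-! ### The solution of the `t`-equation -/

theorem eq_of_deriv_eq_zero {E : Type*} [NormedAddCommGroup E] [NormedSpace ℝ E] {f : ℝ → E}
    {a b : ℝ} (c : ℝ) (hab : a ≤ b) (hf : ContinuousOn f (Icc a b))
    (hf' : ∀ s ∈ Ioo a b, s ≠ c → HasDerivAt f 0 s) : f b = f a := by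
  have := norm_le_add_sub_of_deriv_bound (f := fun s => f s - f a) (f' := fun _ => 0)
    (B := fun _ => 0) (B' := fun _ => 0) c hab (hf.sub continuousOn_const)
    (fun s hs hne => (hf' s hs hne).sub_const _) (fun s => hasDerivAt_const _ _) (by simp)
  simp only [sub_self, norm_zero, add_zero] at this
  exact sub_eq_zero.1 (norm_le_zero_iff.1 this)

theorem coeffU_eq (Ef : ℝ → ℝ → ℂ) (t x : ℝ) (z : ℂ) :
    coeffU Ef t x z = !![-(Complex.I * z), -(Ef t x / 2); conj (Ef t x) / 2, Complex.I * z] := by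
  ext i j
  fin_cases i <;> fin_cases j <;> simp [coeffU, fieldMatrix, sigma3] <;> ring

theorem norm_fieldMatrix (Ef : ℝ → ℝ → ℂ) (t x : ℝ) : ‖fieldMatrix Ef t x‖ = ‖Ef t x‖ / 2 := by
  rw [mat2_norm_eq]
  simp [fieldMatrix, div_eq_inv_mul]

theorem coeffU_affine (Ef : ℝ → ℝ → ℂ) (t x : ℝ) (z : ℂ) :
    coeffU Ef t x z = -fieldMatrix Ef t x + z • (-Complex.I • sigma3) := by
  rw [coeffU, smul_smul, sub_eq_add_neg, add_comm, show z * -Complex.I = -(Complex.I * z) by ring]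

theorem norm_coeffU_le (Ef : ℝ → ℝ → ℂ) (t x : ℝ) (z : ℂ) :
    ‖coeffU Ef t x z‖ ≤ ‖z‖ + ‖Ef t x‖ / 2 := by
  refine (norm_sub_le _ _).trans ?_
  rw [norm_fieldMatrix, norm_neg_smul_sigma]
where
  norm_neg_smul_sigma : ‖-(Complex.I * z) • sigma3‖ = ‖z‖ := by
    rw [norm_smul, norm_sigma3]; simp

/-- The solution of the `t`-equation which is the identity at `t = 0`. -/
noncomputable def psi (Ef : ℝ → ℝ → ℂ) (t x : ℝ) (z : ℂ) : Mat2 :=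
  propagator (fun s => coeffU Ef s x z) t

namespace MaxwellBloch.IsSolution

variable {L : EReal} {n : ℝ → ℝ} {A₀ ω₀ : ℝ} {Ef : ℝ → ℝ → ℂ} {ρ : ℝ → ℝ → ℝ → ℂ}
  {Nf : ℝ → ℝ → ℝ → ℝ} (hsol : IsSolution L n A₀ ω₀ Ef ρ Nf)

include hsol

theorem field_bound (T : ℝ) {X : ℝ} (hX : (X : EReal) < L) : ∃ C : ℝ, 0 ≤ C ∧
    ∀ t x : ℝ, 0 < t → t ≤ T → 0 ≤ x → x ≤ X → t ≠ x → ‖Ef t x‖ ≤ C := by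
  obtain ⟨C, hC⟩ := hsol.field_bounded T X hX
  refine ⟨max C |A₀|, le_max_of_le_right (abs_nonneg _), fun t x ht htT hx hxX hne => ?_⟩
  rcases hx.eq_or_lt with rfl | hx
  · refine le_max_of_le_right (le_of_eq ?_)
    rw [hsol.field_boundary t ht, norm_mul, Complex.norm_real, mul_comm Complex.I, mul_assoc,
      mul_comm Complex.I, ← mul_assoc, ← Complex.ofReal_mul, Complex.norm_exp_ofReal_mul_I, mul_one,
      Real.norm_eq_abs]
  · exact le_max_of_le_left (hC t x ht htT hx hxX hne).1

theorem field_continuousAt {t x : ℝ} (ht : 0 < t) (hx : 0 ≤ x) (hxL : (x : EReal) < L)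
    (hne : t ≠ x) : ContinuousAt (fun s => Ef s x) t := by
  have h1 : ContinuousOn (fun s => Ef s x) (Ioi 0 \ {x}) :=
    hsol.field_continuous.comp (f := fun s : ℝ => (s, x)) (by fun_prop)
      fun s hs => ⟨le_of_lt hs.1, hx, hxL, hs.2⟩
  exact h1.continuousAt ((isOpen_Ioi.sdiff isClosed_singleton).mem_nhds ⟨ht, hne⟩)

theorem fieldMatrix_continuousAt {t x : ℝ} (ht : 0 < t) (hx : 0 ≤ x) (hxL : (x : EReal) < L)
    (hne : t ≠ x) : ContinuousAt (fun s => fieldMatrix Ef s x) t := by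
  have h := hsol.field_continuousAt ht hx hxL hne
  have h' : ContinuousAt (fun s => conj (Ef s x)) t := Complex.continuous_conj.continuousAt.comp h
  refine continuousAt_pi.2 fun i => continuousAt_pi.2 fun j => ?_
  fin_cases i <;> fin_cases j <;> simp [fieldMatrix] <;> fun_prop

theorem coeffU_continuousAt {t x : ℝ} (ht : 0 < t) (hx : 0 ≤ x) (hxL : (x : EReal) < L)
    (hne : t ≠ x) (z : ℂ) : ContinuousAt (fun s => coeffU Ef s x z) t :=
  continuousAt_const.sub (hsol.fieldMatrix_continuousAt ht hx hxL hne)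

theorem coeffU_isBoundedCoeff {x : ℝ} (hx : 0 ≤ x) (hxL : (x : EReal) < L) (z : ℂ) :
    IsBoundedCoeff fun s => coeffU Ef s x z where
  aestronglyMeasurable T := by
    have h1 : ContinuousOn (fun s => coeffU Ef s x z) (Ioc 0 T \ {x}) := fun s hs =>
      (hsol.coeffU_continuousAt hs.1.1 hx hxL hs.2 z).continuousWithinAt
    have h2 := h1.aestronglyMeasurable (μ := volume)
      (measurableSet_Ioc.diff (measurableSet_singleton x))
    rwa [Measure.restrict_congr_set (sdiff_null_ae_eq_self (by simp))] at h2
  bounded T := by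
    obtain ⟨C, hC0, hC⟩ := hsol.field_bound T hxL
    refine ⟨‖z‖ + max C ‖Ef x x‖ / 2, fun s hs => (norm_coeffU_le _ _ _ _).trans ?_⟩
    gcongr
    by_cases h : s = x
    · rw [h]; exact le_max_right _ _
    · exact (hC s x hs.1 hs.2 hx le_rfl h).trans (le_max_left _ _)

theorem psi_zero {x : ℝ} (hx : 0 ≤ x) (hxL : (x : EReal) < L) (z : ℂ) : psi Ef 0 x z = 1 :=
  (hsol.coeffU_isBoundedCoeff hx hxL z).propagator_zero

theorem psi_continuousOn {x : ℝ} (hx : 0 ≤ x) (hxL : (x : EReal) < L) (z : ℂ) :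
    ContinuousOn (fun t => psi Ef t x z) (Ici 0) :=
  (hsol.coeffU_isBoundedCoeff hx hxL z).propagator_continuousOn

theorem psi_hasDerivAt {t x : ℝ} (ht : 0 < t) (hx : 0 ≤ x) (hxL : (x : EReal) < L) (hne : t ≠ x)
    (z : ℂ) : HasDerivAt (fun t => psi Ef t x z) (coeffU Ef t x z * psi Ef t x z) t :=
  (hsol.coeffU_isBoundedCoeff hx hxL z).propagator_hasDerivAt ht
    (hsol.coeffU_continuousAt ht hx hxL hne z)

theorem psi_entry_continuousOn {x : ℝ} (hx : 0 ≤ x) (hxL : (x : EReal) < L) (z : ℂ) (i j : Fin 2) :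
    ContinuousOn (fun t => psi Ef t x z i j) (Ici 0) :=
  (continuous_apply_apply i j).comp_continuousOn (hsol.psi_continuousOn hx hxL z)

theorem det_psi {t x : ℝ} (ht : 0 ≤ t) (hx : 0 ≤ x) (hxL : (x : EReal) < L) (z : ℂ) :
    (psi Ef t x z).det = 1 := by
  have hc := hsol.psi_entry_continuousOn hx hxL z
  have hI : Icc 0 t ⊆ Ici (0 : ℝ) := fun s hs => hs.1
  have := eq_of_deriv_eq_zero (f := fun t => (psi Ef t x z).det) x ht ?_ ?_
  · rw [this, hsol.psi_zero hx hxL, Matrix.det_one]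
  · simp only [Matrix.det_fin_two]
    exact ((((hc 0 0).mul (hc 1 1)).sub ((hc 0 1).mul (hc 1 0))).mono hI)
  · intro s hs hne
    have hd := hasMatDerivAt_iff.2 (hsol.psi_hasDerivAt hs.1 hx hxL hne z)
    simp only [Matrix.det_fin_two]
    refine (((hd 0 0).mul (hd 1 1)).sub ((hd 0 1).mul (hd 1 0))).congr_deriv ?_
    simp only [coeffU_eq, Matrix.mul_apply, Fin.sum_univ_two, Matrix.of_apply, Matrix.cons_val',
      Matrix.cons_val_zero, Matrix.cons_val_one, Matrix.cons_val_fin_one]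
    ring

theorem psi_mul_adjugate {t x : ℝ} (ht : 0 ≤ t) (hx : 0 ≤ x) (hxL : (x : EReal) < L) (z : ℂ) :
    psi Ef t x z * (psi Ef t x z).adjugate = 1 := by
  rw [Matrix.mul_adjugate, hsol.det_psi ht hx hxL, one_smul]

theorem adjugate_mul_psi {t x : ℝ} (ht : 0 ≤ t) (hx : 0 ≤ x) (hxL : (x : EReal) < L) (z : ℂ) :
    (psi Ef t x z).adjugate * psi Ef t x z = 1 := by
  rw [Matrix.adjugate_mul, hsol.det_psi ht hx hxL, one_smul]

/-- The symmetry `Ψ(z̄)ᴴ = Ψ(z)⁻¹`, a consequence of `U(z̄)ᴴ = -U(z)`. -/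
theorem psi_conjTranspose_mul {t x : ℝ} (ht : 0 ≤ t) (hx : 0 ≤ x) (hxL : (x : EReal) < L) (z : ℂ) :
    (psi Ef t x (conj z)).conjTranspose * psi Ef t x z = 1 := by
  have hI : Icc 0 t ⊆ Ici (0 : ℝ) := fun s hs => hs.1
  ext i j
  have := eq_of_deriv_eq_zero
    (f := fun t => ((psi Ef t x (conj z)).conjTranspose * psi Ef t x z) i j) x ht ?_ ?_
  · rw [this, hsol.psi_zero hx hxL, hsol.psi_zero hx hxL]; simp
  · simp only [Matrix.mul_apply, Fin.sum_univ_two, Matrix.conjTranspose_apply]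
    have hc := hsol.psi_entry_continuousOn hx hxL z
    have hc' := hsol.psi_entry_continuousOn hx hxL (conj z)
    exact ((((hc' 0 i).star.mul (hc 0 j))).add ((hc' 1 i).star.mul (hc 1 j))).mono hI
  · intro s hs hne
    have hd := hasMatDerivAt_iff.2 (hsol.psi_hasDerivAt hs.1 hx hxL hne z)
    have hd' := hasMatDerivAt_iff.2 (hsol.psi_hasDerivAt hs.1 hx hxL hne (conj z))
    simp only [Matrix.mul_apply, Fin.sum_univ_two, Matrix.conjTranspose_apply]
    refine (((hd' 0 i).star.mul (hd 0 j)).add ((hd' 1 i).star.mul (hd 1 j))).congr_deriv ?_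
    simp only [coeffU_eq, Matrix.mul_apply, Fin.sum_univ_two, Matrix.of_apply, Matrix.cons_val',
      Matrix.cons_val_zero, Matrix.cons_val_one, Matrix.cons_val_fin_one, RCLike.star_def, map_add,
      map_mul, map_neg, map_div₀, Complex.conj_I, Complex.conj_conj, map_ofNat]
    ring

/-- `Ψ` is an entire function of the spectral parameter. -/
theorem psi_differentiable {t x : ℝ} (ht : 0 ≤ t) (hx : 0 ≤ x) (hxL : (x : EReal) < L) :
    Differentiable ℂ fun z => psi Ef t x z := by
  have h := fun z => hsol.coeffU_isBoundedCoeff hx hxL z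
  have hp : ∀ (z : ℂ) (t : ℝ), psi Ef t x z
      = propagator (fun s => -fieldMatrix Ef s x + z • (-Complex.I • sigma3)) t := fun z t => by
    simp only [psi, coeffU_affine]
  simp only [coeffU_affine] at h
  simp only [hp]
  refine propagator_differentiable x h
    (fun s hs hne => (hsol.fieldMatrix_continuousAt hs hx hxL hne).neg) (fun z => ?_) ht
  refine ⟨fun s => (psi Ef s x z).adjugate, ?_, fun s hs => ?_⟩
  · have hc := hsol.psi_continuousOn hx hxL z
    exact (Continuous.matrix_adjugate continuous_id).comp_continuousOn hc
  · rw [← hp]; exact hsol.psi_mul_adjugate hs hx hxL z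

end MaxwellBloch.IsSolution

/-! ### Causality and the characteristic derivative -/

theorem MaxwellBloch.IsLineShape.integrable {n : ℝ → ℝ} (hn : IsLineShape n) : Integrable n := by
  by_contra h
  have := hn.2.1
  rw [integral_undef h] at this
  exact zero_ne_one this

/-- The polarization `∫ n ρ`. -/
noncomputable def polarization (n : ℝ → ℝ) (ρ : ℝ → ℝ → ℝ → ℂ) (t x : ℝ) : ℂ :=
  ∫ s, (n s : ℂ) * ρ t x s

theorem norm_polarization_le {n : ℝ → ℝ} (hn : IsLineShape n) {ρ : ℝ → ℝ → ℝ → ℂ} {t x C : ℝ}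
    (hρ : ∀ s, ‖ρ t x s‖ ≤ C) : ‖polarization n ρ t x‖ ≤ C := by
  have h1 : ‖polarization n ρ t x‖ ≤ ∫ s, n s * C := by
    refine norm_integral_le_of_norm_le (hn.integrable.mul_const C) (ae_of_all _ fun s => ?_)
    rw [norm_mul, Complex.norm_real, Real.norm_of_nonneg (hn.1 s)]
    exact mul_le_mul_of_nonneg_left (hρ s) (hn.1 s)
  rwa [integral_mul_const, hn.2.1, one_mul] at h1

theorem isOpen_lt_coe (L : EReal) : IsOpen {x : ℝ | (x : EReal) < L} :=
  isOpen_Iio.preimage continuous_coe_real_ereal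

theorem expSigma3_hasDerivAt (c : ℂ) (s : ℝ) : HasDerivAt (fun s : ℝ => expSigma3 (c * s))
    (c • sigma3 * expSigma3 (c * s)) s := by
  have h1 : HasDerivAt (fun s : ℝ => c * (s : ℂ)) c s := by
    simpa using (hasDerivAt_id s).ofReal_comp.const_mul c
  have h2 := h1.cexp
  have h3 := h1.neg.cexp
  rw [← hasMatDerivAt_iff]
  intro i j
  fin_cases i <;> fin_cases j <;>
    simp only [expSigma3, sigma3, Fin.zero_eta, Fin.mk_one, Matrix.of_apply, Matrix.cons_val',
      Matrix.cons_val_zero, Matrix.cons_val_one, Matrix.cons_val_fin_one, Matrix.mul_apply,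
      Fin.sum_univ_two, Matrix.smul_apply, smul_eq_mul]
  · exact h2.congr_deriv (by ring)
  · exact (hasDerivAt_const s (0 : ℂ)).congr_deriv (by simp)
  · exact (hasDerivAt_const s (0 : ℂ)).congr_deriv (by simp)
  · exact h3.congr_deriv (by simp only [Pi.neg_apply]; ring)

theorem expSigma3_zero : expSigma3 0 = 1 := by
  ext i j; fin_cases i <;> fin_cases j <;> simp [expSigma3]

namespace MaxwellBloch.IsSolution

variable {L : EReal} {n : ℝ → ℝ} {A₀ ω₀ : ℝ} {Ef : ℝ → ℝ → ℂ} {ρ : ℝ → ℝ → ℝ → ℂ}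
  {Nf : ℝ → ℝ → ℝ → ℝ} (hsol : IsSolution L n A₀ ω₀ Ef ρ Nf)

include hsol

theorem field_differentiableAt {t x : ℝ} (ht : 0 < t) (hx : 0 < x) (hxL : (x : EReal) < L)
    (hne : t ≠ x) : DifferentiableAt ℝ (fun p : ℝ × ℝ => Ef p.1 p.2) (t, x) := by
  refine (hsol.field_contDiff.differentiableOn one_ne_zero).differentiableAt ?_
  have : IsOpen {p : ℝ × ℝ | 0 < p.1 ∧ 0 < p.2 ∧ (p.2 : EReal) < L ∧ p.1 ≠ p.2} :=
    (isOpen_Ioi.preimage continuous_fst).inter ((isOpen_Ioi.preimage continuous_snd).inter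
      (((isOpen_lt_coe L).preimage continuous_snd).inter
        (isOpen_ne_fun continuous_fst continuous_snd)))
  exact this.mem_nhds ⟨ht, hx, hxL, hne⟩

theorem field_hasDerivAt_t {t x : ℝ} (ht : 0 < t) (hx : 0 < x) (hxL : (x : EReal) < L)
    (hne : t ≠ x) : HasDerivAt (fun s => Ef s x)
      (fderiv ℝ (fun p : ℝ × ℝ => Ef p.1 p.2) (t, x) (1, 0)) t :=
  (hsol.field_differentiableAt ht hx hxL hne).hasFDerivAt.comp_hasDerivAt t
    (f := fun s => (s, x)) ((hasDerivAt_id t).prodMk (hasDerivAt_const t x))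

theorem field_hasDerivAt_x {t x : ℝ} (ht : 0 < t) (hx : 0 < x) (hxL : (x : EReal) < L)
    (hne : t ≠ x) : HasDerivAt (fun y => Ef t y)
      (fderiv ℝ (fun p : ℝ × ℝ => Ef p.1 p.2) (t, x) (0, 1)) x :=
  (hsol.field_differentiableAt ht hx hxL hne).hasFDerivAt.comp_hasDerivAt x
    (f := fun y => (t, y)) ((hasDerivAt_const x t).prodMk (hasDerivAt_id x))

/-- The derivative of the field along characteristics is the polarization. -/
theorem field_hasDerivAt_characteristic {a b s : ℝ} (ht : 0 < a + s) (hx : 0 < b + s)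
    (hxL : ((b + s : ℝ) : EReal) < L) (hne : a ≠ b) :
    HasDerivAt (fun s => Ef (a + s) (b + s)) (polarization n ρ (a + s) (b + s)) s := by
  have hne' : a + s ≠ b + s := fun h => hne (add_right_cancel h)
  have h := (hsol.field_differentiableAt ht hx hxL hne').hasFDerivAt.comp_hasDerivAt s
    (f := fun s => (a + s, b + s))
    (((hasDerivAt_id s).const_add a).prodMk ((hasDerivAt_id s).const_add b))
  refine h.congr_deriv ?_
  rw [polarization, ← hsol.field_eq _ _ ht hx hxL hne',
    (hsol.field_hasDerivAt_t ht hx hxL hne').deriv, (hsol.field_hasDerivAt_x ht hx hxL hne').deriv,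
    ← map_add]
  simp

theorem rho_continuousOn_t {x : ℝ} (hx : 0 < x) (hxL : (x : EReal) < L) (l : ℝ) :
    ContinuousOn (fun t => ρ t x l) (Ici 0) :=
  hsol.rho_continuous.comp (f := fun t : ℝ => (t, x, l)) (by fun_prop) fun _ hs => ⟨hs, hx, hxL⟩

theorem inv_continuousOn_t {x : ℝ} (hx : 0 < x) (hxL : (x : EReal) < L) (l : ℝ) :
    ContinuousOn (fun t => Nf t x l) (Ici 0) :=
  hsol.inv_continuous.comp (f := fun t : ℝ => (t, x, l)) (by fun_prop) fun _ hs => ⟨hs, hx, hxL⟩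

/-- The Bloch vector has length `1`. -/
theorem inv_sq_add_norm_rho_sq {t x : ℝ} (ht : 0 ≤ t) (hx : 0 < x) (hxL : (x : EReal) < L)
    (l : ℝ) : Nf t x l ^ 2 + ‖ρ t x l‖ ^ 2 = 1 := by
  have hI : Icc 0 t ⊆ Ici (0 : ℝ) := fun s hs => hs.1
  have hN : ContinuousOn (fun t => (Nf t x l : ℂ)) (Ici 0) :=
    Complex.continuous_ofReal.comp_continuousOn (hsol.inv_continuousOn_t hx hxL l)
  have hR := hsol.rho_continuousOn_t hx hxL l
  have h := eq_of_deriv_eq_zero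
    (f := fun t => (Nf t x l : ℂ) * Nf t x l + ρ t x l * star (ρ t x l)) x ht ?_ ?_
  · simp only [hsol.inv_init x l hx hxL, hsol.rho_init x l hx hxL, RCLike.star_def,
      Complex.mul_conj'] at h
    have h2 : ((Nf t x l ^ 2 + ‖ρ t x l‖ ^ 2 : ℝ) : ℂ) = ((1 : ℝ) : ℂ) := by
      push_cast
      rw [sq, h]; simp
    exact_mod_cast h2
  · exact ((hN.mul hN).add (hR.mul hR.star)).mono hI
  · intro s hs hne
    have h1 := hsol.inv_eq s x l hs.1 hx hxL hne
    have h2 := hsol.rho_eq s x l hs.1 hx hxL hne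
    refine ((h1.mul h1).add (h2.mul h2.star)).congr_deriv ?_
    simp only [RCLike.star_def, map_sub, map_mul, Complex.conj_ofReal, Complex.conj_I, map_ofNat]
    ring

theorem norm_rho_le_one {t x : ℝ} (ht : 0 ≤ t) (hx : 0 < x) (hxL : (x : EReal) < L) (l : ℝ) :
    ‖ρ t x l‖ ≤ 1 := by
  have := hsol.inv_sq_add_norm_rho_sq ht hx hxL l
  nlinarith [sq_nonneg (Nf t x l), norm_nonneg (ρ t x l)]

theorem abs_inv_le_one {t x : ℝ} (ht : 0 ≤ t) (hx : 0 < x) (hxL : (x : EReal) < L) (l : ℝ) :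
    |Nf t x l| ≤ 1 := by
  have := hsol.inv_sq_add_norm_rho_sq ht hx hxL l
  exact abs_le_one_iff_mul_self_le_one.2 (by nlinarith [sq_nonneg (‖ρ t x l‖)])

/-- The phase `exp (2 i λ t)` is removed from the equation for `ρ`, and `|𝓝| ≤ 1`. -/
theorem norm_rho_le {B B' : ℝ → ℝ} (hB : ∀ s, HasDerivAt B (B' s) s) {t x : ℝ} (ht : 0 ≤ t)
    (hx : 0 < x) (hxL : (x : EReal) < L) (hE : ∀ s ∈ Ioo 0 t, s ≠ x → ‖Ef s x‖ ≤ B' s) (l : ℝ) :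
    ‖ρ t x l‖ ≤ B t - B 0 := by
  have he : ∀ s : ℝ, HasDerivAt (fun s : ℝ => Complex.exp ((2 * l * s : ℝ) * Complex.I))
      (Complex.exp ((2 * l * s : ℝ) * Complex.I) * (2 * l * Complex.I)) s := by
    intro s
    have : HasDerivAt (fun s : ℝ => ((2 * l * s : ℝ) : ℂ) * Complex.I) (2 * l * Complex.I) s := by
      have h := ((hasDerivAt_id s).const_mul (2 * l)).ofReal_comp.mul_const Complex.I
      refine h.congr_deriv ?_
      push_cast; ring
    exact this.cexp
  have h := norm_le_add_sub_of_deriv_bound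
    (f := fun s => ρ s x l * Complex.exp ((2 * l * s : ℝ) * Complex.I))
    (f' := fun s => (Nf s x l : ℂ) * Ef s x * Complex.exp ((2 * l * s : ℝ) * Complex.I))
    (a := 0) (b := t) x ht ?_ ?_ hB ?_
  · simpa only [norm_mul, Complex.norm_exp_ofReal_mul_I, mul_one, hsol.rho_init x l hx hxL,
      norm_zero, zero_mul, zero_add] using h
  · exact (((hsol.rho_continuousOn_t hx hxL l).mono fun s hs => hs.1)).mul
      fun s _ => (he s).continuousAt.continuousWithinAt
  · intro s hs hne
    refine ((hsol.rho_eq s x l hs.1 hx hxL hne).mul (he s)).congr_deriv ?_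
    ring
  · intro s hs hne
    simp only [norm_mul, Complex.norm_exp_ofReal_mul_I, mul_one, Complex.norm_real]
    exact (mul_le_of_le_one_left (norm_nonneg _) (hsol.abs_inv_le_one hs.1.le hx hxL l)).trans
      (hE s hs hne)

/-- Causality: there is no signal ahead of the characteristic `t = x`. The bound
`‖𝓔‖ ≤ C t ^ (2 k) / (2 k)!` follows by induction, as the polarization is at most the time integral
of `‖𝓔‖`, and the field is the integral of the polarization along a characteristic that starts
at `t = 0`. -/
theorem field_eq_zero (hn : IsLineShape n) {t x : ℝ} (ht : 0 ≤ t) (htx : t < x)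
    (hxL : (x : EReal) < L) : Ef t x = 0 := by
  have hx : 0 < x := ht.trans_lt htx
  rcases ht.eq_or_lt with rfl | ht
  · exact hsol.field_init x hx hxL
  obtain ⟨C, hC0, hC⟩ := hsol.field_bound x hxL
  have hd : ∀ (k : ℕ) (s : ℝ), HasDerivAt (fun s : ℝ => C * s ^ (k + 1) / (k + 1).factorial)
      (C * s ^ k / k.factorial) s := by
    intro k s
    refine (((hasDerivAt_pow (k + 1) s).const_mul C).div_const _).congr_deriv ?_
    rw [Nat.factorial_succ]
    push_cast
    have : (k.factorial : ℝ) ≠ 0 := by positivity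
    have : (k + 1 : ℝ) ≠ 0 := by positivity
    field_simp
  have key : ∀ k : ℕ, ∀ t y : ℝ, 0 < t → t < y → y ≤ x →
      ‖Ef t y‖ ≤ C * t ^ (2 * k) / (2 * k).factorial := by
    intro k
    induction k with
    | zero =>
      intro t y ht hty hyx
      simpa using hC t y ht (hty.le.trans hyx) (ht.trans hty).le hyx hty.ne
    | succ k ih =>
      intro t y ht hty hyx
      have hyL : ∀ y', y' ≤ y → (y' : EReal) < L := fun y' h =>
        (EReal.coe_le_coe_iff.2 (h.trans hyx)).trans_lt hxL
      have h := norm_le_add_sub_of_deriv_bound (f := fun s => Ef (0 + s) (y - t + s))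
        (f' := fun s => polarization n ρ (0 + s) (y - t + s)) (a := 0) (b := t) (-1) ht.le ?_ ?_
        (hd (2 * k + 1)) ?_
      · simp only [add_zero, hsol.field_init (y - t) (by linarith) (hyL _ (by linarith)), norm_zero,
          zero_add, sub_add_cancel] at h
        simpa [mul_add, add_assoc] using h
      · refine hsol.field_continuous.comp (f := fun s : ℝ => (0 + s, y - t + s)) (by fun_prop) ?_
        intro s hs
        have h1 := hs.1
        have h2 := hs.2
        exact ⟨by simpa using h1, by simp; linarith, hyL _ (by simp; linarith),
          by simp only [ne_eq]; linarith⟩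
      · intro s hs _
        have h1 := hs.1
        have h2 := hs.2
        exact hsol.field_hasDerivAt_characteristic (by linarith) (by linarith)
          (hyL _ (by linarith)) (by linarith)
      · intro s hs _
        have h1 := hs.1
        have h2 := hs.2
        refine norm_polarization_le hn fun l => ?_
        have h3 := hsol.norm_rho_le (hd (2 * k)) (t := 0 + s) (x := y - t + s) (by linarith)
          (by linarith) (hyL _ (by linarith)) (fun r hr _ => ih r _ hr.1 (by linarith [hr.2])
            (by linarith)) l
        simpa using h3
  have hlim : Tendsto (fun k : ℕ => C * t ^ (2 * k) / (2 * k).factorial) atTop (𝓝 0) := by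
    have h1 := (FloorSemiring.tendsto_pow_div_factorial_atTop t).comp
      (tendsto_id.const_mul_atTop' (r := 2) two_pos)
    have h2 := h1.const_mul C
    simpa [Function.comp_def, mul_div_assoc] using h2
  exact norm_le_zero_iff.1 (ge_of_tendsto' hlim fun k => key k t x ht htx le_rfl)

theorem rho_eq_zero (hn : IsLineShape n) {t x : ℝ} (ht : 0 ≤ t) (htx : t ≤ x) (hx : 0 < x)
    (hxL : (x : EReal) < L) (l : ℝ) : ρ t x l = 0 := by
  have := hsol.norm_rho_le (B := fun _ => 0) (B' := fun _ => 0) (fun s => hasDerivAt_const _ _) ht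
    hx hxL (fun s hs _ => by
      rw [hsol.field_eq_zero hn hs.1.le (hs.2.trans_le htx) hxL, norm_zero]) l
  simpa using this

theorem inv_eq_neg_one (hn : IsLineShape n) {t x : ℝ} (ht : 0 ≤ t) (htx : t ≤ x) (hx : 0 < x)
    (hxL : (x : EReal) < L) (l : ℝ) : Nf t x l = -1 := by
  have h := eq_of_deriv_eq_zero (f := fun t => (Nf t x l : ℂ)) x ht
    (Complex.continuous_ofReal.comp_continuousOn
      ((hsol.inv_continuousOn_t hx hxL l).mono fun s hs => hs.1))
    (fun s hs hne => (hsol.inv_eq s x l hs.1 hx hxL hne).congr_deriv (by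
      rw [hsol.field_eq_zero hn hs.1.le (hs.2.trans_le htx) hxL]; simp))
  simp only [hsol.inv_init x l hx hxL] at h
  exact_mod_cast h

theorem densityMatrix_eq_neg_sigma3 (hn : IsLineShape n) {t x : ℝ} (ht : 0 ≤ t) (htx : t ≤ x)
    (hx : 0 < x) (hxL : (x : EReal) < L) (l : ℝ) : densityMatrix ρ Nf t x l = -sigma3 := by
  ext i j
  fin_cases i <;> fin_cases j <;>
    simp [densityMatrix, sigma3, hsol.rho_eq_zero hn ht htx hx hxL, hsol.inv_eq_neg_one hn ht htx hx hxL]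

theorem polarization_continuousOn (hn : IsLineShape n) :
    ContinuousOn (fun p : ℝ × ℝ => polarization n ρ p.1 p.2)
      {p | 0 ≤ p.1 ∧ 0 < p.2 ∧ (p.2 : EReal) < L} := by
  refine continuousOn_of_dominated (bound := n) (fun p hp => ?_) (fun p hp => ?_) hn.integrable
    (ae_of_all _ fun s => ?_)
  · have : Continuous (ρ p.1 p.2) := by
      have h := hsol.rho_continuous.comp (f := fun s : ℝ => (p.1, p.2, s)) (s := univ)
        (by fun_prop) fun _ _ => hp
      exact continuousOn_univ.1 h
    exact (Complex.continuous_ofReal.comp_aestronglyMeasurable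
      hn.integrable.aestronglyMeasurable).mul this.aestronglyMeasurable
  · refine ae_of_all _ fun s => ?_
    rw [norm_mul, Complex.norm_real, Real.norm_of_nonneg (hn.1 s)]
    exact mul_le_of_le_one_right (hn.1 s) (hsol.norm_rho_le_one hp.1 hp.2.1 hp.2.2 s)
  · exact continuousOn_const.mul (hsol.rho_continuous.comp
      (f := fun p : ℝ × ℝ => (p.1, p.2, s)) (by fun_prop) fun p hp => hp)

/-- Along characteristics the field is Lipschitz continuous, including the boundary `x = 0`. -/
theorem norm_field_sub_le (hn : IsLineShape n) {τ x y : ℝ} (hτ : 0 < τ) (hx : 0 ≤ x) (hxy : x ≤ y)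
    (hyL : (y : EReal) < L) : ‖Ef (τ + y) y - Ef (τ + x) x‖ ≤ y - x := by
  have hL : ∀ y', y' ≤ y → (y' : EReal) < L := fun y' h => (EReal.coe_le_coe_iff.2 h).trans_lt hyL
  have h := norm_le_add_sub_of_deriv_bound (f := fun s => Ef (τ + s) (0 + s) - Ef (τ + x) x)
    (f' := fun s => polarization n ρ (τ + s) (0 + s)) (B := fun s => s) (B' := fun _ => 1)
    (a := x) (b := y) (-1) hxy ?_ ?_ (fun s => hasDerivAt_id s) ?_
  · simpa using h
  · refine ContinuousOn.sub ?_ continuousOn_const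
    refine hsol.field_continuous.comp (f := fun s : ℝ => (τ + s, 0 + s)) (by fun_prop) ?_
    intro s hs
    have h1 := hs.1
    exact ⟨by simp; linarith, by simp; linarith, by simpa using hL s hs.2, by simpa using hτ.ne'⟩
  · intro s hs _
    have h1 := hs.1
    exact (hsol.field_hasDerivAt_characteristic (by linarith) (by linarith)
      (hL _ (by linarith [hs.2])) hτ.ne').sub_const _
  · intro s hs _
    have h1 := hs.1
    exact norm_polarization_le hn fun l => hsol.norm_rho_le_one (by linarith) (by linarith)
      (hL _ (by linarith [hs.2])) l

/-- Ahead of the front the field vanishes and the propagator is free. -/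
theorem psi_of_le (hn : IsLineShape n) {t x : ℝ} (ht : 0 ≤ t) (htx : t ≤ x)
    (hxL : (x : EReal) < L) (z : ℂ) : psi Ef t x z = expSigma3 (-Complex.I * z * t) := by
  have hd := expSigma3_hasDerivAt (-Complex.I * z)
  refine eq_of_linear_deriv (f := fun t => psi Ef t x z) (A := fun _ => (-Complex.I * z) • sigma3)
    (M := ‖(-Complex.I * z) • sigma3‖) x ht
    ((hsol.psi_continuousOn (ht.trans htx) hxL z).mono fun s hs => hs.1)
    (fun s _ => (hd s).continuousAt.continuousWithinAt) (fun s hs hne => ?_) (fun s _ _ => hd s)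
    (fun _ _ _ => le_rfl) ?_
  · refine (hsol.psi_hasDerivAt hs.1 (ht.trans htx) hxL hne z).congr_deriv ?_
    congr 1
    have : fieldMatrix Ef s x = 0 := by
      rw [fieldMatrix, hsol.field_eq_zero hn hs.1.le (hs.2.trans_le htx) hxL]
      ext i j; fin_cases i <;> fin_cases j <;> simp
    rw [coeffU, this, sub_zero]; congr 1; ring
  · simp only [hsol.psi_zero (ht.trans htx) hxL]
    simp [expSigma3_zero]

end MaxwellBloch.IsSolution

/-! ### Cauchy integrals off the real line -/

theorem abs_im_le_norm_sub (s : ℝ) (z : ℂ) : |z.im| ≤ ‖(s : ℂ) - z‖ := by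
  simpa using Complex.abs_im_le_norm ((s : ℂ) - z)

theorem ofReal_sub_ne_zero {z : ℂ} (hz : z.im ≠ 0) (s : ℝ) : (s : ℂ) - z ≠ 0 := fun h => by
  have := abs_im_le_norm_sub s z
  rw [h, norm_zero] at this
  exact hz (abs_nonpos_iff.1 this)

theorem norm_cauchy_kernel_le {n : ℝ → ℝ} (hn0 : ∀ s, 0 ≤ n s) {z : ℂ} (hz : z.im ≠ 0) {s C : ℝ}
    {f : ℂ} (hf : ‖f‖ ≤ C) : ‖f * (n s : ℂ) / ((s : ℂ) - z)‖ ≤ C / |z.im| * n s := by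
  rw [norm_div, norm_mul, Complex.norm_real, Real.norm_of_nonneg (hn0 s), div_mul_eq_mul_div]
  have := abs_im_le_norm_sub s z
  have h0 := abs_pos.2 hz
  have := hn0 s
  gcongr
  exact mul_nonneg ((norm_nonneg _).trans hf) this

theorem cauchy_kernel_aestronglyMeasurable {n : ℝ → ℝ} (hn : Integrable n) {f : ℝ → ℂ}
    (hf : AEStronglyMeasurable f) (z : ℂ) :
    AEStronglyMeasurable fun s : ℝ => f s * (n s : ℂ) / ((s : ℂ) - z) := by
  have h1 : AEStronglyMeasurable fun s : ℝ => (n s : ℂ) :=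
    Complex.continuous_ofReal.comp_aestronglyMeasurable hn.aestronglyMeasurable
  have h2 : Measurable fun s : ℝ => ((s : ℂ) - z)⁻¹ :=
    (Complex.measurable_ofReal.sub_const z).inv
  simp only [div_eq_mul_inv]
  exact (hf.mul h1).mul h2.aestronglyMeasurable

theorem cauchy_kernel_integrable {n : ℝ → ℝ} (hn : Integrable n) (hn0 : ∀ s, 0 ≤ n s) {f : ℝ → ℂ}
    (hf : AEStronglyMeasurable f) {C : ℝ} (hC : ∀ s, ‖f s‖ ≤ C) {z : ℂ} (hz : z.im ≠ 0) :
    Integrable fun s : ℝ => f s * (n s : ℂ) / ((s : ℂ) - z) :=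
  (hn.const_mul (C / |z.im|)).mono' (cauchy_kernel_aestronglyMeasurable hn hf z)
    (ae_of_all _ fun s => norm_cauchy_kernel_le hn0 hz (hC s))

/-- Differentiation under the Cauchy integral; the derivative of the density may grow linearly. -/
theorem cauchy_integral_hasDerivAt {n : ℝ → ℝ} (hn : Integrable n) (hn0 : ∀ s, 0 ≤ n s)
    {f f' : ℝ → ℝ → ℂ} {t C : ℝ} {u : Set ℝ} (hu : u ∈ 𝓝 t)
    (hf : ∀ τ ∈ u, ∀ s, HasDerivAt (fun τ => f τ s) (f' τ s) τ)
    (hfc : ∀ τ ∈ u, Continuous (f τ)) (hf'c : Continuous (f' t)) (hf1 : ∀ s, ‖f t s‖ ≤ 1)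
    (hf2 : ∀ τ ∈ u, ∀ s, ‖f' τ s‖ ≤ C * (1 + |s|)) {z : ℂ} (hz : z.im ≠ 0) :
    HasDerivAt (fun τ => ∫ s : ℝ, f τ s * (n s : ℂ) / ((s : ℂ) - z))
      (∫ s : ℝ, f' t s * (n s : ℂ) / ((s : ℂ) - z)) t := by
  have hC0 : 0 ≤ C := by
    have := (norm_nonneg _).trans (hf2 t (mem_of_mem_nhds hu) 0)
    simpa using this
  have h0 := abs_pos.2 hz
  refine (hasDerivAt_integral_of_dominated_loc_of_deriv_le
    (F' := fun τ s => f' τ s * (n s : ℂ) / ((s : ℂ) - z))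
    (bound := fun s => C * ((1 + ‖z‖) / |z.im| + 1) * n s) hu ?_ ?_ ?_ ?_ ?_ ?_).2
  · filter_upwards [hu] with τ hτ
    exact cauchy_kernel_aestronglyMeasurable hn (hfc τ hτ).aestronglyMeasurable z
  · exact cauchy_kernel_integrable hn hn0 (hfc t (mem_of_mem_nhds hu)).aestronglyMeasurable hf1 hz
  · exact cauchy_kernel_aestronglyMeasurable hn hf'c.aestronglyMeasurable z
  · refine ae_of_all _ fun s τ hτ => ?_
    rw [norm_div, norm_mul, Complex.norm_real, Real.norm_of_nonneg (hn0 s),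
      div_le_iff₀ (norm_pos_iff.2 (ofReal_sub_ne_zero hz s))]
    have h1 := abs_im_le_norm_sub s z
    have h2 : |s| ≤ ‖(s : ℂ) - z‖ + ‖z‖ := by
      have := norm_add_le ((s : ℂ) - z) z
      simpa using this
    have h3 : 1 + |s| ≤ ((1 + ‖z‖) / |z.im| + 1) * ‖(s : ℂ) - z‖ := by
      have : (1 + ‖z‖) ≤ (1 + ‖z‖) / |z.im| * ‖(s : ℂ) - z‖ := by
        rw [div_mul_eq_mul_div, le_div_iff₀ h0]
        gcongr
      linarith
    calc ‖f' τ s‖ * n s ≤ C * (1 + |s|) * n s :=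
          mul_le_mul_of_nonneg_right (hf2 τ hτ s) (hn0 s)
      _ ≤ C * (((1 + ‖z‖) / |z.im| + 1) * ‖(s : ℂ) - z‖) * n s := by
          have := hn0 s
          gcongr
      _ = _ := by ring
  · exact hn.const_mul _
  · refine ae_of_all _ fun s τ hτ => ?_
    exact ((hf τ hτ s).mul_const _).div_const _

theorem cauchyMatrix_apply (n : ℝ → ℝ) (ρ : ℝ → ℝ → ℝ → ℂ) (Nf : ℝ → ℝ → ℝ → ℝ) (t x : ℝ) (z : ℂ)
    (i j : Fin 2) : cauchyMatrix n ρ Nf t x z i j =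
      (1 / 4) * ∫ s : ℝ, densityMatrix ρ Nf t x s i j * (n s : ℂ) / ((s : ℂ) - z) := rfl

theorem cauchyMatrix_one_one (n : ℝ → ℝ) (ρ : ℝ → ℝ → ℝ → ℂ) (Nf : ℝ → ℝ → ℝ → ℝ) (t x : ℝ) (z : ℂ) :
    cauchyMatrix n ρ Nf t x z 1 1 = -cauchyMatrix n ρ Nf t x z 0 0 := by
  simp [cauchyMatrix_apply, densityMatrix, neg_mul, neg_div, integral_neg]

namespace MaxwellBloch.IsSolution

variable {L : EReal} {n : ℝ → ℝ} {A₀ ω₀ : ℝ} {Ef : ℝ → ℝ → ℂ} {ρ : ℝ → ℝ → ℝ → ℂ}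
  {Nf : ℝ → ℝ → ℝ → ℝ} (hsol : IsSolution L n A₀ ω₀ Ef ρ Nf)

include hsol

theorem rho_continuous_l {t x : ℝ} (ht : 0 ≤ t) (hx : 0 < x) (hxL : (x : EReal) < L) :
    Continuous (ρ t x) :=
  continuousOn_univ.1 (hsol.rho_continuous.comp (f := fun s : ℝ => (t, x, s)) (s := univ)
    (by fun_prop) fun _ _ => ⟨ht, hx, hxL⟩)

theorem inv_continuous_l {t x : ℝ} (ht : 0 ≤ t) (hx : 0 < x) (hxL : (x : EReal) < L) :
    Continuous (Nf t x) :=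
  continuousOn_univ.1 (hsol.inv_continuous.comp (f := fun s : ℝ => (t, x, s)) (s := univ)
    (by fun_prop) fun _ _ => ⟨ht, hx, hxL⟩)

theorem densityMatrix_continuous {t x : ℝ} (ht : 0 ≤ t) (hx : 0 < x) (hxL : (x : EReal) < L) :
    Continuous (densityMatrix ρ Nf t x) := by
  have h1 := hsol.rho_continuous_l ht hx hxL
  have h2 := hsol.inv_continuous_l ht hx hxL
  have h3 : Continuous fun l => conj (ρ t x l) := Complex.continuous_conj.comp h1
  refine continuous_pi fun i => continuous_pi fun j => ?_
  fin_cases i <;> fin_cases j <;> simp [densityMatrix] <;> fun_prop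

theorem norm_densityMatrix_entry_le {t x : ℝ} (ht : 0 ≤ t) (hx : 0 < x) (hxL : (x : EReal) < L)
    (l : ℝ) (i j : Fin 2) : ‖densityMatrix ρ Nf t x l i j‖ ≤ 1 := by
  have h1 := hsol.norm_rho_le_one ht hx hxL l
  have h2 := hsol.abs_inv_le_one ht hx hxL l
  fin_cases i <;> fin_cases j <;> simpa [densityMatrix]

theorem densityMatrix_aestronglyMeasurable {t x : ℝ} (ht : 0 ≤ t) (hx : 0 < x)
    (hxL : (x : EReal) < L) (i j : Fin 2) :
    AEStronglyMeasurable fun l => densityMatrix ρ Nf t x l i j :=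
  ((continuous_apply_apply i j).comp
    (hsol.densityMatrix_continuous ht hx hxL)).aestronglyMeasurable

theorem norm_cauchyMatrix_entry_le (hn : IsLineShape n) {t x : ℝ} (ht : 0 ≤ t) (hx : 0 < x)
    (hxL : (x : EReal) < L) {z : ℂ} (hz : z.im ≠ 0) (i j : Fin 2) :
    ‖cauchyMatrix n ρ Nf t x z i j‖ ≤ 1 / (4 * |z.im|) := by
  rw [cauchyMatrix_apply, norm_mul]
  have h := norm_integral_le_of_norm_le (hn.integrable.const_mul (1 / |z.im|))
    (ae_of_all _ fun s => norm_cauchy_kernel_le hn.1 (s := s) hz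
      (hsol.norm_densityMatrix_entry_le ht hx hxL s i j))
  rw [integral_const_mul, hn.2.1, mul_one] at h
  calc ‖(1 / 4 : ℂ)‖ * _ ≤ 1 / 4 * (1 / |z.im|) := by
        refine mul_le_mul (by norm_num) h (norm_nonneg _) (by norm_num)
    _ = _ := by field_simp

theorem densityMatrix_continuousOn (i j : Fin 2) :
    ContinuousOn (fun p : ℝ × ℝ × ℝ => densityMatrix ρ Nf p.1 p.2.1 p.2.2 i j)
      {p | 0 ≤ p.1 ∧ 0 < p.2.1 ∧ (p.2.1 : EReal) < L} := by
  have h1 := hsol.rho_continuous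
  have h2 := Complex.continuous_ofReal.comp_continuousOn hsol.inv_continuous
  have h3 := Complex.continuous_conj.comp_continuousOn hsol.rho_continuous
  fin_cases i <;> fin_cases j
  · exact h2
  · exact h1
  · exact h3
  · exact h2.neg

theorem cauchyMatrix_continuousOn_t (hn : IsLineShape n) {x : ℝ} (hx : 0 < x)
    (hxL : (x : EReal) < L) {z : ℂ} (hz : z.im ≠ 0) :
    ContinuousOn (fun t => cauchyMatrix n ρ Nf t x z) (Ici 0) := by
  refine continuousOn_pi.2 fun i => continuousOn_pi.2 fun j => ?_
  simp only [cauchyMatrix_apply]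
  refine continuousOn_const.mul ?_
  refine continuousOn_of_dominated (bound := fun s => 1 / |z.im| * n s) (fun t ht => ?_)
    (fun t ht => ?_) (hn.integrable.const_mul _) (ae_of_all _ fun s => ?_)
  · exact cauchy_kernel_aestronglyMeasurable hn.integrable
      (hsol.densityMatrix_aestronglyMeasurable ht hx hxL i j) z
  · exact ae_of_all _ fun s => norm_cauchy_kernel_le hn.1 hz
      (hsol.norm_densityMatrix_entry_le ht hx hxL s i j)
  · refine ContinuousOn.div_const (ContinuousOn.mul ?_ continuousOn_const) _
    exact (hsol.densityMatrix_continuousOn i j).comp (f := fun t : ℝ => (t, x, s)) (by fun_prop)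
      fun t ht => ⟨ht, hx, hxL⟩

/-- The `t`-derivative of the Cauchy integral: the multiplier `s` of the Bloch equations is split
as `s = z + (s - z)`, and the second summand cancels the kernel. -/
theorem cauchyMatrix_hasDerivAt_t (hn : IsLineShape n) {t x : ℝ} (ht : 0 < t) (hx : 0 < x)
    (hxL : (x : EReal) < L) (hne : t ≠ x) {z : ℂ} (hz : z.im ≠ 0) :
    HasDerivAt (fun t => cauchyMatrix n ρ Nf t x z)
      (!![-(1 / 2) * (conj (Ef t x) * cauchyMatrix n ρ Nf t x z 0 1
            + Ef t x * cauchyMatrix n ρ Nf t x z 1 0),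
          Ef t x * cauchyMatrix n ρ Nf t x z 0 0
            - 2 * Complex.I * (z * cauchyMatrix n ρ Nf t x z 0 1 + 1 / 4 * polarization n ρ t x);
          conj (Ef t x) * cauchyMatrix n ρ Nf t x z 0 0
            + 2 * Complex.I * (z * cauchyMatrix n ρ Nf t x z 1 0
              + 1 / 4 * conj (polarization n ρ t x)),
          (1 / 2) * (conj (Ef t x) * cauchyMatrix n ρ Nf t x z 0 1
            + Ef t x * cauchyMatrix n ρ Nf t x z 1 0)]) t := by
  obtain ⟨C, hC0, hC⟩ := hsol.field_bound (t + 1) hxL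
  have hu : Ioo 0 (t + 1) \ {x} ∈ 𝓝 t :=
    (isOpen_Ioo.sdiff isClosed_singleton).mem_nhds ⟨⟨ht, by linarith⟩, hne⟩
  have hE : ∀ τ ∈ Ioo 0 (t + 1) \ {x}, ‖Ef τ x‖ ≤ C := fun τ hτ =>
    hC τ x hτ.1.1 hτ.1.2.le hx.le le_rfl hτ.2
  have hN := fun τ (hτ : τ ∈ Ioo 0 (t + 1) \ {x}) => hsol.inv_continuous_l hτ.1.1.le hx hxL
  have hR := fun τ (hτ : τ ∈ Ioo 0 (t + 1) \ {x}) => hsol.rho_continuous_l hτ.1.1.le hx hxL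
  have hN' : ∀ τ ∈ Ioo 0 (t + 1) \ {x}, ∀ s, ‖(Nf τ x s : ℂ)‖ ≤ 1 := fun τ hτ s => by
    simpa using hsol.abs_inv_le_one hτ.1.1.le hx hxL s
  have hR' : ∀ τ ∈ Ioo 0 (t + 1) \ {x}, ∀ s, ‖ρ τ x s‖ ≤ 1 := fun τ hτ s =>
    hsol.norm_rho_le_one hτ.1.1.le hx hxL s
  have ht' := mem_of_mem_nhds hu
  have hNt := hN t ht'
  have hRt := hR t ht'
  have iN : Integrable fun s : ℝ => (Nf t x s : ℂ) * (n s : ℂ) / ((s : ℂ) - z) :=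
    cauchy_kernel_integrable hn.integrable hn.1
    (Complex.continuous_ofReal.comp hNt).aestronglyMeasurable (hN' t ht') hz
  have iR := cauchy_kernel_integrable hn.integrable hn.1 hRt.aestronglyMeasurable (hR' t ht') hz
  have hRc : Continuous fun s => conj (ρ t x s) := Complex.continuous_conj.comp hRt
  have iRc := cauchy_kernel_integrable hn.integrable hn.1 hRc.aestronglyMeasurable
    (fun s => by rw [RCLike.norm_conj]; exact hR' t ht' s) hz
  have iP : Integrable fun s => (n s : ℂ) * ρ t x s := by
    refine hn.integrable.mono' ((Complex.continuous_ofReal.comp_aestronglyMeasurable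
      hn.integrable.aestronglyMeasurable).mul hRt.aestronglyMeasurable) (ae_of_all _ fun s => ?_)
    rw [norm_mul, Complex.norm_real, Real.norm_of_nonneg (hn.1 s)]
    exact mul_le_of_le_one_right (hn.1 s) (hR' t ht' s)
  have iPc : Integrable fun s => (n s : ℂ) * conj (ρ t x s) := by
    refine iP.mono ((Complex.continuous_ofReal.comp_aestronglyMeasurable
      hn.integrable.aestronglyMeasurable).mul hRc.aestronglyMeasurable) (ae_of_all _ fun s => ?_)
    simp
  have iS : Integrable fun s : ℝ => 2 * Complex.I *
      (z * (ρ t x s * (n s : ℂ) / ((s : ℂ) - z)) + (n s : ℂ) * ρ t x s) :=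
    ((iR.const_mul _).add iP).const_mul _
  have iSc : Integrable fun s : ℝ => 2 * Complex.I *
      (z * (conj (ρ t x s) * (n s : ℂ) / ((s : ℂ) - z)) + (n s : ℂ) * conj (ρ t x s)) :=
    ((iRc.const_mul _).add iPc).const_mul _
  have dN := cauchy_integral_hasDerivAt hn.integrable hn.1 hu (C := C)
    (f := fun τ s => (Nf τ x s : ℂ))
    (f' := fun τ s => -(1 / 2) * (conj (Ef τ x) * ρ τ x s + Ef τ x * conj (ρ τ x s)))
    (fun τ hτ s => hsol.inv_eq τ x s hτ.1.1 hx hxL hτ.2)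
    (fun τ hτ => Complex.continuous_ofReal.comp (hN τ hτ)) (by fun_prop) (hN' t ht')
    (fun τ hτ s => by
      have h1 : ‖conj (Ef τ x) * ρ τ x s + Ef τ x * conj (ρ τ x s)‖ ≤ C + C := by
        refine (norm_add_le _ _).trans (add_le_add ?_ ?_) <;> rw [norm_mul, RCLike.norm_conj] <;>
          exact (mul_le_of_le_one_right (norm_nonneg _) (hR' τ hτ s)).trans (hE τ hτ)
      rw [norm_mul]
      have h2 : ‖(-(1 / 2) : ℂ)‖ = 1 / 2 := by norm_num
      rw [h2]
      nlinarith [abs_nonneg s, mul_nonneg hC0 (abs_nonneg s)]) hz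
  have bR : ∀ τ ∈ Ioo 0 (t + 1) \ {x}, ∀ s : ℝ,
      ‖(Nf τ x s : ℂ) * Ef τ x - 2 * Complex.I * (s : ℂ) * ρ τ x s‖ ≤ (C + 2) * (1 + |s|) := by
    intro τ hτ s
    refine (norm_sub_le _ _).trans ?_
    have h1 : ‖(Nf τ x s : ℂ) * Ef τ x‖ ≤ C := by
      rw [norm_mul]
      exact (mul_le_of_le_one_left (norm_nonneg _) (hN' τ hτ s)).trans (hE τ hτ)
    have h2 : ‖2 * Complex.I * (s : ℂ) * ρ τ x s‖ ≤ 2 * |s| := by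
      rw [norm_mul]
      refine (mul_le_of_le_one_right (norm_nonneg _) (hR' τ hτ s)).trans (le_of_eq ?_)
      simp
    nlinarith [abs_nonneg s, mul_nonneg hC0 (abs_nonneg s)]
  have dR := cauchy_integral_hasDerivAt hn.integrable hn.1 hu (C := C + 2)
    (f := fun τ s => ρ τ x s)
    (f' := fun τ s => (Nf τ x s : ℂ) * Ef τ x - 2 * Complex.I * (s : ℂ) * ρ τ x s)
    (fun τ hτ s => hsol.rho_eq τ x s hτ.1.1 hx hxL hτ.2) hR (by fun_prop) (hR' t ht') bR hz
  have dRc := cauchy_integral_hasDerivAt hn.integrable hn.1 hu (C := C + 2)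
    (f := fun τ s => conj (ρ τ x s))
    (f' := fun τ s => conj ((Nf τ x s : ℂ) * Ef τ x - 2 * Complex.I * (s : ℂ) * ρ τ x s))
    (fun τ hτ s => (hsol.rho_eq τ x s hτ.1.1 hx hxL hτ.2).star)
    (fun τ hτ => Complex.continuous_conj.comp (hR τ hτ))
    (Complex.continuous_conj.comp (by fun_prop))
    (fun s => by rw [RCLike.norm_conj]; exact hR' t ht' s)
    (fun τ hτ s => by rw [RCLike.norm_conj]; exact bR τ hτ s) hz
  have eN : ∫ s : ℝ, -(1 / 2) * (conj (Ef t x) * ρ t x s + Ef t x * conj (ρ t x s)) * (n s : ℂ)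
      / ((s : ℂ) - z) = -(1 / 2) * (conj (Ef t x) * (∫ s : ℝ, ρ t x s * (n s : ℂ) / ((s : ℂ) - z))
        + Ef t x * ∫ s : ℝ, conj (ρ t x s) * (n s : ℂ) / ((s : ℂ) - z)) := by
    rw [← integral_const_mul, ← integral_const_mul, ← integral_add (iR.const_mul _)
      (iRc.const_mul _), ← integral_const_mul]
    congr 1; funext s; ring
  have eR : ∫ s : ℝ, ((Nf t x s : ℂ) * Ef t x - 2 * Complex.I * (s : ℂ) * ρ t x s) * (n s : ℂ)
      / ((s : ℂ) - z) = Ef t x * (∫ s : ℝ, (Nf t x s : ℂ) * (n s : ℂ) / ((s : ℂ) - z))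
        - 2 * Complex.I * (z * (∫ s : ℝ, ρ t x s * (n s : ℂ) / ((s : ℂ) - z))
          + polarization n ρ t x) := by
    rw [polarization, ← integral_const_mul, ← integral_const_mul, ← integral_add (iR.const_mul _)
      iP, ← integral_const_mul, ← integral_sub (iN.const_mul _) iS]
    congr 1; funext s
    have := ofReal_sub_ne_zero hz s
    field_simp
    ring
  have eRc : ∫ s : ℝ, conj ((Nf t x s : ℂ) * Ef t x - 2 * Complex.I * (s : ℂ) * ρ t x s) * (n s : ℂ)
      / ((s : ℂ) - z) = conj (Ef t x) * (∫ s : ℝ, (Nf t x s : ℂ) * (n s : ℂ) / ((s : ℂ) - z))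
        + 2 * Complex.I * (z * (∫ s : ℝ, conj (ρ t x s) * (n s : ℂ) / ((s : ℂ) - z))
          + conj (polarization n ρ t x)) := by
    rw [polarization, ← integral_conj]
    simp only [map_sub, map_mul, Complex.conj_ofReal, Complex.conj_I, map_ofNat]
    rw [← integral_const_mul, ← integral_const_mul, ← integral_add (iRc.const_mul _)
      iPc, ← integral_const_mul, ← integral_add (iN.const_mul _) iSc]
    congr 1; funext s
    have := ofReal_sub_ne_zero hz s
    field_simp
    ring
  rw [← hasMatDerivAt_iff]
  intro i j
  fin_cases i <;> fin_cases j <;>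
    simp only [cauchyMatrix_apply, densityMatrix, Fin.zero_eta, Fin.mk_one, Matrix.of_apply,
      Matrix.cons_val', Matrix.cons_val_zero, Matrix.cons_val_one, Matrix.cons_val_fin_one]
  · refine (dN.const_mul (1 / 4)).congr_deriv ?_
    rw [eN]; ring
  · refine (dR.const_mul (1 / 4)).congr_deriv ?_
    rw [eR]; ring
  · refine (dRc.const_mul (1 / 4)).congr_deriv ?_
    rw [eRc]; ring
  · simp only [neg_mul, neg_div, integral_neg]
    refine (dN.neg.const_mul (1 / 4)).congr_deriv ?_
    rw [eN]; ring

/-- Ahead of the characteristic the medium is at rest. -/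
theorem cauchyMatrix_of_le (hn : IsLineShape n) {t x : ℝ} (ht : 0 ≤ t) (htx : t ≤ x)
    (hx : 0 < x) (hxL : (x : EReal) < L) (z : ℂ) :
    cauchyMatrix n ρ Nf t x z = -(eta n z - z) • sigma3 := by
  ext i j
  simp only [cauchyMatrix_apply, hsol.densityMatrix_eq_neg_sigma3 hn ht htx hx hxL]
  fin_cases i <;> fin_cases j <;> simp [sigma3, eta, neg_div, integral_neg]

end MaxwellBloch.IsSolution

/-! ### The `x`-equation off the real line -/

/-- The matrix `½ (0 e; -ē 0)`. -/
noncomputable def skewOffDiag (e : ℂ) : Mat2 := (1 / 2 : ℂ) • !![0, e; -conj e, 0]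

theorem norm_skewOffDiag (e : ℂ) : ‖skewOffDiag e‖ = ‖e‖ / 2 := by
  rw [mat2_norm_eq]
  simp [skewOffDiag, div_eq_inv_mul]

theorem coeffU_sub_coeffU (Ef : ℝ → ℝ → ℂ) (t x s y : ℝ) (z : ℂ) :
    coeffU Ef t x z - coeffU Ef s y z = -skewOffDiag (Ef t x - Ef s y) := by
  ext i j
  fin_cases i <;> fin_cases j <;> simp [coeffU, fieldMatrix, skewOffDiag] <;> ring

/-- The zero curvature condition along characteristics. -/
theorem zero_curvature_identity {G : Mat2} (h11 : G 1 1 = -G 0 0) {z : ℂ} (P : ℂ)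
    (Ef : ℝ → ℝ → ℂ) (t x : ℝ) :
    -Complex.I • (!![-(1 / 2) * (conj (Ef t x) * G 0 1 + Ef t x * G 1 0),
          Ef t x * G 0 0 - 2 * Complex.I * (z * G 0 1 + 1 / 4 * P);
          conj (Ef t x) * G 0 0 + 2 * Complex.I * (z * G 1 0 + 1 / 4 * conj P),
          (1 / 2) * (conj (Ef t x) * G 0 1 + Ef t x * G 1 0)]
        + G * coeffU Ef t x z - coeffU Ef t x z * G) = -skewOffDiag P := by
  have hI := Complex.I_mul_I
  rw [coeffU_eq]
  ext i j
  fin_cases i <;> fin_cases j <;>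
    simp only [skewOffDiag, Matrix.of_apply, Matrix.cons_val', Matrix.cons_val_zero,
      Matrix.cons_val_one, Matrix.cons_val_fin_one, Fin.zero_eta, Fin.mk_one, Matrix.mul_apply,
      Matrix.smul_apply, Matrix.add_apply, Matrix.sub_apply, Matrix.neg_apply, Fin.sum_univ_two,
      smul_eq_mul, h11]
  · ring
  · linear_combination (P / 2) * hI
  · linear_combination -(conj P / 2) * hI
  · ring

namespace MaxwellBloch.IsSolution

variable {L : EReal} {n : ℝ → ℝ} {A₀ ω₀ : ℝ} {Ef : ℝ → ℝ → ℂ} {ρ : ℝ → ℝ → ℝ → ℂ}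
  {Nf : ℝ → ℝ → ℝ → ℝ} (hsol : IsSolution L n A₀ ω₀ Ef ρ Nf)

include hsol

theorem psi_shift_hasDerivAt {τ x : ℝ} (hτ : 0 < τ) (hx : 0 ≤ x) (hxL : (x : EReal) < L) (z : ℂ) :
    HasDerivAt (fun τ => psi Ef (x + τ) x z) (coeffU Ef (x + τ) x z * psi Ef (x + τ) x z) τ := by
  have h := hsol.psi_hasDerivAt (t := x + τ) (by linarith) hx hxL (by linarith) z
  exact h.comp_const_add x τ

theorem psi_shift_continuousOn {x : ℝ} (hx : 0 ≤ x) (hxL : (x : EReal) < L) (z : ℂ) :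
    ContinuousOn (fun τ => psi Ef (x + τ) x z) (Ici 0) :=
  (hsol.psi_continuousOn hx hxL z).comp (f := fun τ => x + τ) (by fun_prop)
    fun τ hτ => add_nonneg hx hτ

theorem exists_coeffU_shift_bound (T : ℝ) {X : ℝ} (hX : (X : EReal) < L) (z : ℂ) :
    ∃ K : ℝ, 0 ≤ K ∧ ∀ τ y : ℝ, 0 < τ → τ ≤ T → 0 ≤ y → y ≤ X → ‖coeffU Ef (y + τ) y z‖ ≤ K := by
  obtain ⟨C, hC0, hC⟩ := hsol.field_bound (X + T) hX
  refine ⟨‖z‖ + C / 2, by positivity, fun τ y hτ hτT hy hyX => (norm_coeffU_le _ _ _ _).trans ?_⟩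
  gcongr
  exact hC _ _ (by linarith) (by linarith) hy hyX (by linarith)

theorem norm_field_shift_sub_le (hn : IsLineShape n) {τ x y : ℝ} (hτ : 0 < τ) (hx : 0 ≤ x)
    (hxL : (x : EReal) < L) (hy : 0 ≤ y) (hyL : (y : EReal) < L) :
    ‖Ef (y + τ) y - Ef (x + τ) x‖ ≤ |y - x| := by
  rw [add_comm y, add_comm x]
  rcases le_total x y with h | h
  · rw [abs_of_nonneg (sub_nonneg.2 h)]
    exact hsol.norm_field_sub_le hn hτ hx h hyL
  · rw [norm_sub_rev, abs_sub_comm, abs_of_nonneg (sub_nonneg.2 h)]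
    exact hsol.norm_field_sub_le hn hτ hy h hxL

/-- In the coordinates `(τ, x) = (t - x, x)`, the solution is Lipschitz continuous in `x`. -/
theorem exists_psi_shift_lipschitz (hn : IsLineShape n) (T : ℝ) {x X : ℝ} (hx : 0 ≤ x)
    (hxX : x ≤ X) (hXL : (X : EReal) < L) (z : ℂ) : ∃ C : ℝ, ∀ τ y : ℝ, 0 ≤ τ → τ ≤ T → 0 ≤ y →
      y ≤ X → ‖psi Ef (y + τ) y z - psi Ef (x + τ) x z‖
        ≤ C * (|y - x| + ‖expSigma3 (-Complex.I * z * y) - expSigma3 (-Complex.I * z * x)‖) := by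
  have hL : ∀ y', y' ≤ X → (y' : EReal) < L := fun y' h => (EReal.coe_le_coe_iff.2 h).trans_lt hXL
  obtain ⟨K, hK0, hK⟩ := hsol.exists_coeffU_shift_bound T hXL z
  obtain ⟨D, hD⟩ := (isCompact_Icc (a := 0) (b := T)).exists_bound_of_continuousOn
    ((hsol.psi_shift_continuousOn hx (hL x hxX) z).mono fun s hs => hs.1)
  refine ⟨(1 + D * T) * Real.exp (K * T), fun τ y hτ hτT hy hyX => ?_⟩
  have hD0 : 0 ≤ D := (norm_nonneg _).trans (hD 0 ⟨le_rfl, hτ.trans hτT⟩)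
  have h := norm_le_mul_exp_of_deriv_bound (f := fun τ => psi Ef (y + τ) y z - psi Ef (x + τ) x z)
    (f' := fun τ => coeffU Ef (y + τ) y z * psi Ef (y + τ) y z
      - coeffU Ef (x + τ) x z * psi Ef (x + τ) x z) (K := K) (ε := |y - x| * D) (a := 0) (b := T)
    (-1) hK0 (by positivity)
    (((hsol.psi_shift_continuousOn hy (hL y hyX) z).sub
      (hsol.psi_shift_continuousOn hx (hL x hxX) z)).mono fun s hs => hs.1)
    (fun s hs _ => (hsol.psi_shift_hasDerivAt hs.1 hy (hL y hyX) z).sub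
      (hsol.psi_shift_hasDerivAt hs.1 hx (hL x hxX) z))
    (fun s hs _ => by
      have e : coeffU Ef (y + s) y z * psi Ef (y + s) y z
          - coeffU Ef (x + s) x z * psi Ef (x + s) x z
          = coeffU Ef (y + s) y z * (psi Ef (y + s) y z - psi Ef (x + s) x z)
            + (coeffU Ef (y + s) y z - coeffU Ef (x + s) x z) * psi Ef (x + s) x z := by
        rw [mul_sub, sub_mul]; abel
      rw [e]
      refine (norm_add_le _ _).trans (add_le_add ?_ ?_)
      · refine (norm_mul_le _ _).trans ?_
        gcongr
        exact hK s y hs.1 hs.2.le hy hyX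
      · refine (norm_mul_le _ _).trans ?_
        rw [coeffU_sub_coeffU, norm_neg, norm_skewOffDiag]
        gcongr
        · have := hsol.norm_field_shift_sub_le hn hs.1 hx (hL x hxX) hy (hL y hyX)
          linarith [norm_nonneg (Ef (y + s) y - Ef (x + s) x)]
        · exact hD s ⟨hs.1.le, hs.2.le⟩) τ ⟨hτ, hτT⟩
  simp only [add_zero, sub_zero, hsol.psi_of_le hn hy le_rfl (hL y hyX),
    hsol.psi_of_le hn hx le_rfl (hL x hxX)] at h
  refine h.trans ?_
  set e := ‖expSigma3 (-Complex.I * z * y) - expSigma3 (-Complex.I * z * x)‖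
  have he : 0 ≤ e := norm_nonneg _
  have hT : 0 ≤ T := hτ.trans hτT
  calc (e + |y - x| * D * τ) * Real.exp (K * τ) ≤ (e + |y - x| * D * T) * Real.exp (K * T) := by
        gcongr
    _ ≤ ((1 + D * T) * (|y - x| + e)) * Real.exp (K * T) := by
        gcongr
        have h1 : 0 ≤ D * T := by positivity
        nlinarith [mul_nonneg h1 he, abs_nonneg (y - x)]
    _ = _ := by ring

/-- The solution is continuous across the front `x = t`, although the field jumps there. Behind the
front it is compared with the solution along characteristics, where the coefficient is Lipschitz
continuous in `x`. -/
theorem psi_continuousOn_x (hn : IsLineShape n) {t : ℝ} (ht : 0 ≤ t) (z : ℂ) :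
    ContinuousOn (fun x => psi Ef t x z) {x : ℝ | 0 ≤ x ∧ (x : EReal) < L} := by
  rintro x ⟨hx, hxL⟩
  have hsplit : {x : ℝ | 0 ≤ x ∧ (x : EReal) < L} =
      {x : ℝ | t ≤ x ∧ (x : EReal) < L} ∪ {x : ℝ | 0 ≤ x ∧ x ≤ t ∧ (x : EReal) < L} := by
    ext y
    simp only [mem_ofPred_eq, mem_union]
    constructor
    · rintro ⟨h1, h2⟩
      rcases le_total t y with h | h
      exacts [.inl ⟨h, h2⟩, .inr ⟨h1, h, h2⟩]
    · rintro (⟨h1, h2⟩ | ⟨h1, h2, h3⟩)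
      exacts [⟨ht.trans h1, h2⟩, ⟨h1, h3⟩]
  rw [hsplit]
  refine ContinuousWithinAt.union ?_ ?_
  · rcases lt_or_ge x t with h | h
    · refine ContinuousWithinAt.mono (t := Ici t) ?_ fun y hy => hy.1
      have : Ici t ∈ (𝓝[Ici t] t) := self_mem_nhdsWithin
      exact continuousWithinAt_of_notMem_closure (by rw [closure_Ici]; simpa using h)
    · have : ContinuousWithinAt (fun _ : ℝ => expSigma3 (-Complex.I * z * t))
          {x : ℝ | t ≤ x ∧ (x : EReal) < L} x := continuousWithinAt_const
      exact this.congr (fun y hy => hsol.psi_of_le hn ht hy.1 hy.2 z) (hsol.psi_of_le hn ht h hxL z)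
  · rcases lt_or_ge t x with h | h
    · refine ContinuousWithinAt.mono (t := Iic t) ?_ fun y hy => hy.2.1
      exact continuousWithinAt_of_notMem_closure (by rw [closure_Iic]; simpa using h)
    obtain ⟨X, hxX, hXL⟩ : ∃ X : ℝ, x < X ∧ (X : EReal) < L := by
      obtain ⟨X, h1, h2⟩ := EReal.lt_iff_exists_real_btwn.1 hxL
      exact ⟨X, EReal.coe_lt_coe_iff.1 h1, h2⟩
    obtain ⟨C, hC⟩ := hsol.exists_psi_shift_lipschitz hn t hx hxX.le hXL z
    have h1 : Tendsto (fun y : ℝ => C * (|y - x| +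
        ‖expSigma3 (-Complex.I * z * y) - expSigma3 (-Complex.I * z * x)‖)) (𝓝 x) (𝓝 0) := by
      have hc : ContinuousAt (fun y : ℝ => expSigma3 (-Complex.I * z * y)) x :=
        (expSigma3_hasDerivAt (-Complex.I * z) x).continuousAt
      have : ContinuousAt (fun y : ℝ => C * (|y - x| +
        ‖expSigma3 (-Complex.I * z * y) - expSigma3 (-Complex.I * z * x)‖)) x := by fun_prop
      simpa [ContinuousAt] using this
    have h2 : Tendsto (fun y : ℝ => psi Ef (x + (t - y)) x z)
        (𝓝[{x : ℝ | 0 ≤ x ∧ x ≤ t ∧ (x : EReal) < L}] x) (𝓝 (psi Ef t x z)) := by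
      have := (hsol.psi_shift_continuousOn hx hxL z (t - x) (sub_nonneg.2 h)).tendsto
      rw [add_sub_cancel] at this
      refine this.comp (tendsto_nhdsWithin_iff.2 ⟨?_, ?_⟩)
      · exact (Continuous.tendsto (by fun_prop) x).mono_left nhdsWithin_le_nhds
      · filter_upwards [self_mem_nhdsWithin] with y hy using sub_nonneg.2 hy.2.1
    have h3 : Tendsto (fun y : ℝ => psi Ef t y z - psi Ef (x + (t - y)) x z)
        (𝓝[{x : ℝ | 0 ≤ x ∧ x ≤ t ∧ (x : EReal) < L}] x) (𝓝 0) := by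
      refine squeeze_zero_norm' ?_ (h1.mono_left nhdsWithin_le_nhds)
      filter_upwards [self_mem_nhdsWithin, mem_nhdsWithin_of_mem_nhds (Iio_mem_nhds hxX)] with y hy hyX
      have := hC (t - y) y (sub_nonneg.2 hy.2.1) (by linarith [hy.1]) hy.1 (le_of_lt hyX)
      rwa [add_sub_cancel] at this
    have h4 := h3.add h2
    simpa [ContinuousWithinAt] using h4

/-- The candidate `-i G Ψ - i η Ψ σ₃` for the derivative of `Ψ` along characteristics solves the
`t`-equation differentiated along characteristics; this is the zero curvature condition. -/
theorem candidate_hasDerivAt (hn : IsLineShape n) {τ x : ℝ} (hτ : 0 < τ) (hx : 0 < x)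
    (hxL : (x : EReal) < L) {z : ℂ} (hz : z.im ≠ 0) :
    HasDerivAt (fun τ => -Complex.I • (cauchyMatrix n ρ Nf (x + τ) x z * psi Ef (x + τ) x z)
        - psi Ef (x + τ) x z * ((Complex.I * eta n z) • sigma3))
      (coeffU Ef (x + τ) x z * (-Complex.I • (cauchyMatrix n ρ Nf (x + τ) x z
        * psi Ef (x + τ) x z) - psi Ef (x + τ) x z * ((Complex.I * eta n z) • sigma3))
        - skewOffDiag (polarization n ρ (x + τ) x) * psi Ef (x + τ) x z) τ := by
  have hG := (hsol.cauchyMatrix_hasDerivAt_t hn (t := x + τ) (by linarith) hx hxL (by linarith)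
    hz).comp_const_add x τ
  have hP := hsol.psi_shift_hasDerivAt hτ hx.le hxL z
  refine (((hG.mul hP).const_smul (-Complex.I)).sub (hP.mul_const _)).congr_deriv ?_
  have key := zero_curvature_identity (cauchyMatrix_one_one n ρ Nf (x + τ) x z) (z := z)
    (polarization n ρ (x + τ) x) Ef (x + τ) x
  rw [sub_eq_add_neg _ (skewOffDiag _ * _), ← neg_mul, ← key]
  simp only [smul_add, smul_sub, add_mul, sub_mul, mul_sub, smul_mul_assoc, mul_smul_comm,
    mul_assoc]
  abel

end MaxwellBloch.IsSolution

namespace MaxwellBloch.IsSolution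

variable {L : EReal} {n : ℝ → ℝ} {A₀ ω₀ : ℝ} {Ef : ℝ → ℝ → ℂ} {ρ : ℝ → ℝ → ℝ → ℂ}
  {Nf : ℝ → ℝ → ℝ → ℝ} (hsol : IsSolution L n A₀ ω₀ Ef ρ Nf)

include hsol

/-- The field is differentiable along characteristics, uniformly on bounded time intervals. -/
theorem eventually_field_taylor (hn : IsLineShape n) (T : ℝ) {x : ℝ} (hx : 0 < x)
    (hxL : (x : EReal) < L) {ε : ℝ} (hε : 0 < ε) : ∀ᶠ y in 𝓝 x, ∀ τ : ℝ, 0 < τ → τ ≤ T →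
      ‖Ef (y + τ) y - Ef (x + τ) x - (y - x) • polarization n ρ (x + τ) x‖ ≤ ε * |y - x| := by
  obtain ⟨r, hr, hball⟩ : ∃ r > 0, Metric.closedBall x r ⊆ {y : ℝ | 0 < y ∧ (y : EReal) < L} :=
    Metric.nhds_basis_closedBall.mem_iff.1 ((isOpen_Ioi.inter (isOpen_lt_coe L)).mem_nhds ⟨hx, hxL⟩)
  have hc : ContinuousOn (fun p : ℝ × ℝ => polarization n ρ (p.1 + p.2) p.1)
      (Metric.closedBall x r ×ˢ Icc 0 T) := by
    refine (hsol.polarization_continuousOn hn).comp (f := fun p : ℝ × ℝ => (p.1 + p.2, p.1))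
      (by fun_prop) fun p hp => ?_
    have h1 := hball hp.1
    exact ⟨add_nonneg h1.1.le hp.2.1, h1.1, h1.2⟩
  have huc := ((isCompact_closedBall x r).prod isCompact_Icc).uniformContinuousOn_of_continuous hc
  obtain ⟨δ, hδ, hδ'⟩ := Metric.uniformContinuousOn_iff.1 huc ε hε
  filter_upwards [Metric.ball_mem_nhds x (lt_min hr hδ)] with y hy τ hτ hτT
  have hyr : ∀ w ∈ Metric.ball x (min r δ), w ∈ Metric.closedBall x r := fun w hw =>
    Metric.mem_closedBall.2 ((Metric.mem_ball.1 hw).le.trans (min_le_left _ _))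
  have hd : ∀ w ∈ Metric.ball x (min r δ), HasDerivWithinAt
      (fun w => Ef (w + τ) w - w • polarization n ρ (x + τ) x)
      (polarization n ρ (w + τ) w - polarization n ρ (x + τ) x) (Metric.ball x (min r δ)) w := by
    intro w hw
    have hw' := hball (hyr w hw)
    have h1 : HasDerivAt (fun w => Ef (w + τ) w) (polarization n ρ (w + τ) w) w := by
      have := hsol.field_hasDerivAt_characteristic (a := τ) (b := 0) (s := w)
        (add_pos hτ hw'.1) (by simpa using hw'.1) (by simpa using hw'.2) hτ.ne'
      simpa [add_comm] using this
    refine (h1.sub ((hasDerivAt_id w).smul_const _)).hasDerivWithinAt.congr_deriv ?_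
    simp
  have hb : ∀ w ∈ Metric.ball x (min r δ),
      ‖polarization n ρ (w + τ) w - polarization n ρ (x + τ) x‖ ≤ ε := by
    intro w hw
    have := hδ' (w, τ) ⟨hyr w hw, hτ.le, hτT⟩ (x, τ) ⟨Metric.mem_closedBall_self hr.le, hτ.le, hτT⟩
      (by
        rw [Prod.dist_eq, dist_self, max_eq_left dist_nonneg]
        exact (Metric.mem_ball.1 hw).trans_le (min_le_right _ _))
    rw [dist_eq_norm] at this
    exact this.le
  have := (convex_ball x (min r δ)).norm_image_sub_le_of_norm_hasDerivWithin_le hd hb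
    (Metric.mem_ball_self (lt_min hr hδ)) hy
  rw [Real.norm_eq_abs] at this
  refine le_trans (le_of_eq ?_) this
  rw [sub_smul]; congr 1; abel

/-- The solution is differentiable along characteristics, uniformly on bounded time intervals: the
error term satisfies the linear equation with a small inhomogeneity. -/
theorem eventually_psi_taylor (hn : IsLineShape n) {T : ℝ} (hT : 0 ≤ T) {x : ℝ} (hx : 0 < x)
    (hxL : (x : EReal) < L) {z : ℂ} (hz : z.im ≠ 0) {ε : ℝ} (hε : 0 < ε) :
    ∀ᶠ y in 𝓝 x, ∀ τ ∈ Icc 0 T, ‖psi Ef (y + τ) y z - psi Ef (x + τ) x z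
      - (y - x) • (-Complex.I • (cauchyMatrix n ρ Nf (x + τ) x z * psi Ef (x + τ) x z)
        - psi Ef (x + τ) x z * ((Complex.I * eta n z) • sigma3))‖ ≤ ε * |y - x| := by
  set k : ℝ → Mat2 := fun τ => -Complex.I • (cauchyMatrix n ρ Nf (x + τ) x z * psi Ef (x + τ) x z)
        - psi Ef (x + τ) x z * ((Complex.I * eta n z) • sigma3) with hk
  obtain ⟨X, hxX, hXL⟩ : ∃ X : ℝ, x < X ∧ (X : EReal) < L := by
    obtain ⟨X, h1, h2⟩ := EReal.lt_iff_exists_real_btwn.1 hxL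
    exact ⟨X, EReal.coe_lt_coe_iff.1 h1, h2⟩
  have hL : ∀ y', y' ≤ X → (y' : EReal) < L := fun y' h => (EReal.coe_le_coe_iff.2 h).trans_lt hXL
  have hYc := hsol.psi_shift_continuousOn hx.le hxL z
  have hkc : ContinuousOn k (Ici 0) := by
    have hG : ContinuousOn (fun τ => cauchyMatrix n ρ Nf (x + τ) x z) (Ici 0) :=
      (hsol.cauchyMatrix_continuousOn_t hn hx hxL hz).comp (f := fun τ => x + τ) (by fun_prop)
        fun τ hτ => add_nonneg hx.le hτ
    exact ((hG.mul hYc).const_smul (-Complex.I)).sub (hYc.mul continuousOn_const)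
  obtain ⟨D₀, hD₀⟩ := (isCompact_Icc (a := 0) (b := T)).exists_bound_of_continuousOn
    (hYc.mono fun s hs => hs.1)
  obtain ⟨D₁, hD₁⟩ := (isCompact_Icc (a := 0) (b := T)).exists_bound_of_continuousOn
    (hkc.mono fun s hs => hs.1)
  have hD₀0 : 0 ≤ D₀ := (norm_nonneg _).trans (hD₀ 0 ⟨le_rfl, hT⟩)
  have hD₁0 : 0 ≤ D₁ := (norm_nonneg _).trans (hD₁ 0 ⟨le_rfl, hT⟩)
  obtain ⟨K, hK0, hK⟩ := hsol.exists_coeffU_shift_bound T hXL z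
  set c := (1 + (D₀ + D₁) * T) * Real.exp (K * T) with hc
  have hc0 : 0 < c := by positivity
  set ε₁ := ε / c with hε₁
  have hε₁0 : 0 < ε₁ := by positivity
  have h0 : ∀ᶠ y in 𝓝 x, ‖expSigma3 (-Complex.I * z * (y : ℝ)) - expSigma3 (-Complex.I * z * x)
      - (y - x) • ((-Complex.I * z) • sigma3 * expSigma3 (-Complex.I * z * x))‖ ≤ ε₁ * |y - x| := by
    have := (hasDerivAt_iff_isLittleO.1 (expSigma3_hasDerivAt (-Complex.I * z) x)).def hε₁0
    simpa only [Real.norm_eq_abs] using this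
  have hyε : ∀ᶠ y in 𝓝 x, |y - x| ≤ ε₁ := by
    filter_upwards [Metric.closedBall_mem_nhds x hε₁0] with y hy using hy
  filter_upwards [hsol.eventually_field_taylor hn T hx hxL hε₁0, h0, hyε, Ioo_mem_nhds hx hxX]
    with y hE hi hye hy τ hτ
  have hyX := hy.2.le
  have h := norm_le_mul_exp_of_deriv_bound
    (f := fun τ => psi Ef (y + τ) y z - psi Ef (x + τ) x z - (y - x) • k τ)
    (f' := fun τ => coeffU Ef (y + τ) y z * psi Ef (y + τ) y z
      - coeffU Ef (x + τ) x z * psi Ef (x + τ) x z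
      - (y - x) • (coeffU Ef (x + τ) x z * k τ
        - skewOffDiag (polarization n ρ (x + τ) x) * psi Ef (x + τ) x z))
    (K := K) (ε := ε₁ * |y - x| * (D₀ + D₁)) (a := 0) (b := T) (-1) hK0 (by positivity)
    ((((hsol.psi_shift_continuousOn hy.1.le (hL y hyX) z).sub hYc).sub
      (hkc.const_smul (y - x))).mono fun s hs => hs.1)
    (fun s hs _ => ((hsol.psi_shift_hasDerivAt hs.1 hy.1.le (hL y hyX) z).sub
      (hsol.psi_shift_hasDerivAt hs.1 hx.le hxL z)).sub
        ((hsol.candidate_hasDerivAt hn hs.1 hx hxL hz).const_smul (y - x)))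
    (fun s hs _ => by
      have e : coeffU Ef (y + s) y z * psi Ef (y + s) y z
          - coeffU Ef (x + s) x z * psi Ef (x + s) x z
          - (y - x) • (coeffU Ef (x + s) x z * k s
            - skewOffDiag (polarization n ρ (x + s) x) * psi Ef (x + s) x z)
          = coeffU Ef (y + s) y z * (psi Ef (y + s) y z - psi Ef (x + s) x z - (y - x) • k s)
            + ((coeffU Ef (y + s) y z - coeffU Ef (x + s) x z
                + (y - x) • skewOffDiag (polarization n ρ (x + s) x)) * psi Ef (x + s) x z
              + (y - x) • ((coeffU Ef (y + s) y z - coeffU Ef (x + s) x z) * k s)) := by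
        simp only [mul_sub, sub_mul, add_mul, smul_sub, mul_smul_comm, smul_mul_assoc]
        abel
      have e2 : coeffU Ef (y + s) y z - coeffU Ef (x + s) x z
          + (y - x) • skewOffDiag (polarization n ρ (x + s) x)
          = -skewOffDiag (Ef (y + s) y - Ef (x + s) x - (y - x) • polarization n ρ (x + s) x) := by
        rw [coeffU_sub_coeffU]
        ext i j
        fin_cases i <;> fin_cases j <;> simp [skewOffDiag] <;> ring
      have hE1 : ‖coeffU Ef (y + s) y z - coeffU Ef (x + s) x z
          + (y - x) • skewOffDiag (polarization n ρ (x + s) x)‖ ≤ ε₁ * |y - x| := by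
        rw [e2, norm_neg, norm_skewOffDiag]
        have := hE s hs.1 hs.2.le
        linarith [norm_nonneg (Ef (y + s) y - Ef (x + s) x
          - (y - x) • polarization n ρ (x + s) x)]
      have hE2 : ‖coeffU Ef (y + s) y z - coeffU Ef (x + s) x z‖ ≤ ε₁ := by
        rw [coeffU_sub_coeffU, norm_neg, norm_skewOffDiag]
        have := hsol.norm_field_shift_sub_le hn hs.1 hx.le hxL hy.1.le (hL y hyX)
        linarith [norm_nonneg (Ef (y + s) y - Ef (x + s) x)]
      rw [e]
      refine (norm_add_le _ _).trans (add_le_add ?_ ?_)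
      · refine (norm_mul_le _ _).trans ?_
        gcongr
        exact hK s y hs.1 hs.2.le hy.1.le hyX
      · rw [mul_add]
        refine (norm_add_le _ _).trans (add_le_add ?_ ?_)
        · refine (norm_mul_le _ _).trans ?_
          gcongr
          exact hD₀ s ⟨hs.1.le, hs.2.le⟩
        · rw [norm_smul, Real.norm_eq_abs, mul_comm ε₁, mul_assoc]
          gcongr
          refine (norm_mul_le _ _).trans ?_
          gcongr
          exact hD₁ s ⟨hs.1.le, hs.2.le⟩) τ hτ
  have hk0 : k 0 = (-Complex.I * z) • sigma3 * expSigma3 (-Complex.I * z * x) := by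
    simp only [hk, add_zero]
    rw [hsol.psi_of_le hn hx.le le_rfl hxL, hsol.cauchyMatrix_of_le hn hx.le le_rfl hx hxL]
    ext i j
    fin_cases i <;> fin_cases j <;>
      simp [sigma3, expSigma3, Matrix.mul_apply, Fin.sum_univ_two] <;> ring
  simp only [add_zero, sub_zero, hsol.psi_of_le hn hy.1.le le_rfl (hL y hyX),
    hsol.psi_of_le hn hx.le le_rfl hxL, hk0] at h
  refine h.trans ?_
  have hτ0 := hτ.1
  have hτT := hτ.2
  calc _ ≤ (ε₁ * |y - x| + ε₁ * |y - x| * (D₀ + D₁) * T) * Real.exp (K * T) := by gcongr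
    _ = ε₁ * c * |y - x| := by rw [hc]; ring
    _ = ε * |y - x| := by rw [hε₁, div_mul_cancel₀ _ hc0.ne']

/-- Behind the front the solution is differentiable in `x`: the derivative along the
characteristic minus the derivative in `t`. -/
theorem psi_hasDerivAt_x_of_lt (hn : IsLineShape n) {t x : ℝ} (hx : 0 < x) (hxt : x < t)
    (hxL : (x : EReal) < L) {z : ℂ} (hz : z.im ≠ 0) :
    HasDerivAt (fun y => psi Ef t y z)
      (-Complex.I • (cauchyMatrix n ρ Nf t x z * psi Ef t x z)
        - psi Ef t x z * ((Complex.I * eta n z) • sigma3) - coeffU Ef t x z * psi Ef t x z) x := by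
  set k : ℝ → Mat2 := fun τ => -Complex.I • (cauchyMatrix n ρ Nf (x + τ) x z * psi Ef (x + τ) x z)
        - psi Ef (x + τ) x z * ((Complex.I * eta n z) • sigma3) with hk
  have hkt : k (t - x) = -Complex.I • (cauchyMatrix n ρ Nf t x z * psi Ef t x z)
        - psi Ef t x z * ((Complex.I * eta n z) • sigma3) := by
    simp only [hk, add_sub_cancel]
  rw [← hkt, hasDerivAt_iff_isLittleO]
  have h1 : (fun y => psi Ef (y + (t - y)) y z - psi Ef (x + (t - y)) x z - (y - x) • k (t - y))
      =o[𝓝 x] fun y => y - x := by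
    refine IsLittleO.of_bound fun ε hε => ?_
    filter_upwards [hsol.eventually_psi_taylor hn (hx.trans hxt).le hx hxL hz hε,
      Ioo_mem_nhds hx hxt] with y hy hy'
    exact hy (t - y) ⟨by linarith [hy'.2], by linarith [hy'.1]⟩
  have hkc : ContinuousAt k (t - x) :=
    (hsol.candidate_hasDerivAt hn (sub_pos.2 hxt) hx hxL hz).continuousAt
  have h2 : (fun y => (y - x) • (k (t - y) - k (t - x))) =o[𝓝 x] fun y => y - x := by
    have : Tendsto (fun y => k (t - y) - k (t - x)) (𝓝 x) (𝓝 0) := by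
      have h := (hkc.comp (f := fun y => t - y) (x := x) (by fun_prop)).sub
        (continuousAt_const (y := k (t - x)))
      simpa [ContinuousAt, Function.comp_def, Pi.sub_def] using h
    have h := (isBigO_refl (fun y => y - x) (𝓝 x)).smul_isLittleO ((isLittleO_one_iff ℝ).2 this)
    simpa using h
  have h3 : (fun y => psi Ef (x + (t - y)) x z - psi Ef t x z
      - (y - x) • (-(coeffU Ef t x z * psi Ef t x z))) =o[𝓝 x] fun y => y - x := by
    have hd := (hsol.psi_shift_hasDerivAt (sub_pos.2 hxt) hx.le hxL z).scomp x
      ((hasDerivAt_id x).const_sub t)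
    have := hasDerivAt_iff_isLittleO.1 hd
    simpa [Function.comp_def] using this
  clear_value k
  refine ((h1.add h2).add h3).congr_left fun y => ?_
  simp only [add_sub_cancel, smul_sub, smul_sub, smul_neg]
  abel

end MaxwellBloch.IsSolution

/-! ### Boundary values of Cauchy integrals -/

/-- The case of a constant density, with an explicit primitive. -/
theorem tendsto_integral_Icc_inv_sub {ι : Type*} {l : Filter ι} {z : ι → ℂ} {p δ : ℝ} (hδ : 0 < δ)
    (hz : Tendsto z l (𝓝 (p : ℂ))) (hz0 : ∀ᶠ i in l, 0 < (z i).im) :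
    ∃ A : ℂ, Tendsto (fun i => ∫ s : ℝ in Icc (p - δ) (p + δ), ((s : ℂ) - z i)⁻¹) l (𝓝 A) := by
  have h1 : ∀ᶠ i in l, ∫ s : ℝ in Icc (p - δ) (p + δ), ((s : ℂ) - z i)⁻¹
      = Complex.log (((p + δ : ℝ) : ℂ) - z i) - Complex.log (((p - δ : ℝ) : ℂ) - z i) := by
    filter_upwards [hz0] with i hi
    rw [integral_Icc_eq_integral_Ioc, ← intervalIntegral.integral_of_le (by linarith)]
    have hs : ∀ s : ℝ, (s : ℂ) - z i ∈ Complex.slitPlane := fun s => .inr (by simpa using hi.ne')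
    refine intervalIntegral.integral_eq_sub_of_hasDerivAt (f := fun s : ℝ =>
      Complex.log ((s : ℂ) - z i)) (fun s _ => ?_) (Continuous.intervalIntegrable ?_ _ _)
    · have h2 : HasDerivAt (fun s : ℝ => (s : ℂ) - z i) 1 s :=
        (hasDerivAt_id s).ofReal_comp.sub_const _
      have := h2.clog_real (hs s)
      simpa using this
    · exact Continuous.inv₀ (by fun_prop) fun s => Complex.slitPlane_ne_zero (hs s)
  refine ⟨Complex.log ((δ : ℝ) : ℂ) - (Real.log ‖((-δ : ℝ) : ℂ)‖ - Real.pi * Complex.I),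
    Tendsto.congr' (h1.mono fun _ h => h.symm) (Tendsto.sub ?_ ?_)⟩
  · refine ((continuousAt_clog (x := ((δ : ℝ) : ℂ)) ?_).tendsto).comp ?_
    · exact .inl (by simpa using hδ)
    · have := hz.const_sub (((p + δ : ℝ) : ℂ))
      refine this.trans (le_of_eq ?_)
      push_cast; congr 1; ring
  · have h3 := Complex.tendsto_log_nhdsWithin_im_neg_of_re_neg_of_im_zero (z := ((-δ : ℝ) : ℂ))
      (by simpa using hδ) (by simp)
    refine h3.comp (tendsto_nhdsWithin_iff.2 ⟨?_, ?_⟩)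
    · have := hz.const_sub (((p - δ : ℝ) : ℂ))
      refine this.trans (le_of_eq ?_)
      push_cast; congr 1; ring
    · filter_upwards [hz0] with i hi
      simpa using hi

/-- The Plemelj lemma along an arbitrary filter: a convergent family of densities with a common
integrable majorant, which satisfies a common Hölder condition near `p`, and points that approach
`p` from the upper half-plane in an arbitrary manner. Near `p` the value of the density at the real
part of the point is subtracted; after a translation that moves the singularity to the origin, the
integrands are dominated by a multiple of `|u| ^ (μ - 1)`. -/
theorem exists_tendsto_cauchy_integral {ι : Type*} {l : Filter ι} [l.IsCountablyGenerated]
    {f : ι → ℝ → ℂ} {f₀ : ℝ → ℂ} {B : ℝ → ℝ} {z : ι → ℂ} {p K μ δ : ℝ} (hB : Integrable B)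
    (hμ : 0 < μ) (hδ : 0 < δ) (hz : Tendsto z l (𝓝 (p : ℂ))) (hz0 : ∀ᶠ i in l, 0 < (z i).im)
    (hm : ∀ᶠ i in l, AEStronglyMeasurable (f i)) (hb : ∀ᶠ i in l, ∀ s, ‖f i s‖ ≤ B s)
    (hh : ∀ᶠ i in l, ∀ s ∈ Icc (p - δ) (p + δ), ∀ s' ∈ Icc (p - δ) (p + δ),
      ‖f i s - f i s'‖ ≤ K * |s - s'| ^ μ)
    (hl : ∀ s, Tendsto (fun i => f i s) l (𝓝 (f₀ s))) :
    ∃ A : ℂ, Tendsto (fun i => ∫ s : ℝ, f i s / ((s : ℂ) - z i)) l (𝓝 A) := by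
  set I := Icc (p - δ) (p + δ) with hI
  have hIm : MeasurableSet I := measurableSet_Icc
  have hre : Tendsto (fun i => (z i).re) l (𝓝 p) := by
    simpa [Function.comp_def] using (Complex.continuous_re.tendsto _).comp hz
  have him : Tendsto (fun i => (z i).im) l (𝓝 0) := by
    simpa [Function.comp_def] using (Complex.continuous_im.tendsto _).comp hz
  have hreI : ∀ᶠ i in l, (z i).re ∈ Icc (p - δ / 2) (p + δ / 2) :=
    hre (Icc_mem_nhds (by linarith) (by linarith))
  have hreI' : ∀ᶠ i in l, (z i).re ∈ I := hreI.mono fun i hi =>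
    ⟨by linarith [hi.1], by linarith [hi.2]⟩
  -- values of the densities at moving points
  have hmove : ∀ u : ℝ, |u| < δ → Tendsto (fun i => f i ((z i).re + u)) l (𝓝 (f₀ (p + u))) := by
    intro u hu
    have h1 : Tendsto (fun i => f i ((z i).re + u) - f i (p + u)) l (𝓝 0) := by
      have h2 : Tendsto (fun i => K * |(z i).re - p| ^ μ) l (𝓝 0) := by
        have : Tendsto (fun i => |(z i).re - p|) l (𝓝 0) := by
          simpa using (hre.sub_const p).abs
        simpa [Real.zero_rpow hμ.ne'] using (this.rpow_const (.inr hμ.le)).const_mul K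
      refine squeeze_zero_norm' ?_ h2
      have hu' : ∀ᶠ i in l, (z i).re + u ∈ I := by
        have := hre.add_const u
        rw [abs_lt] at hu
        exact this (Icc_mem_nhds (by linarith) (by linarith))
      filter_upwards [hh, hu'] with i hi hi'
      rw [abs_lt] at hu
      have := hi _ hi' (p + u) ⟨by linarith, by linarith⟩
      rwa [add_sub_add_right_eq_sub] at this
    simpa using h1.add (hl (p + u))
  have hcenter : Tendsto (fun i => f i (z i).re) l (𝓝 (f₀ p)) := by
    simpa using hmove 0 (by simpa using hδ)
  have hint : ∀ᶠ i in l, Integrable fun s : ℝ => f i s / ((s : ℂ) - z i) := by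
    filter_upwards [hm, hb, hz0] with i hmi hbi hzi
    have hk : Measurable fun s : ℝ => ((s : ℂ) - z i)⁻¹ :=
      (Complex.measurable_ofReal.sub_const _).inv
    refine (hB.const_mul (1 / |(z i).im|)).mono' ?_ (ae_of_all _ fun s => ?_)
    · simp only [div_eq_mul_inv]
      exact hmi.mul hk.aestronglyMeasurable
    · rw [norm_div, one_div_mul_eq_div]
      have h0 := abs_pos.2 hzi.ne'
      have := abs_im_le_norm_sub s (z i)
      have := hbi s
      have : 0 ≤ B s := (norm_nonneg _).trans this
      gcongr
  -- the far part
  have hfar : Tendsto (fun i => ∫ s : ℝ in Iᶜ, f i s / ((s : ℂ) - z i)) l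
      (𝓝 (∫ s : ℝ in Iᶜ, f₀ s / ((s : ℂ) - p))) := by
    refine tendsto_integral_filter_of_dominated_convergence (fun s => B s / (δ / 2)) ?_ ?_
      (hB.div_const _).integrableOn ?_
    · filter_upwards [hint] with i hi using hi.1.restrict
    · filter_upwards [hb, hreI] with i hbi hri
      refine (ae_restrict_iff' hIm.compl).2 (ae_of_all _ fun s hs => ?_)
      rw [norm_div]
      have h1 : δ / 2 ≤ ‖(s : ℂ) - z i‖ := by
        refine le_trans ?_ (Complex.abs_re_le_norm _)
        simp only [Complex.sub_re, Complex.ofReal_re]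
        simp only [hI, mem_compl_iff, mem_Icc, not_and_or, not_le] at hs
        rcases hs with hs | hs
        · rw [abs_sub_comm]; exact le_trans (by linarith [hri.1]) (le_abs_self _)
        · exact le_trans (by linarith [hri.2]) (le_abs_self _)
      have := hbi s
      have : 0 ≤ B s := (norm_nonneg _).trans this
      gcongr
    · refine (ae_restrict_iff' hIm.compl).2 (ae_of_all _ fun s hs => ?_)
      refine (hl s).div (hz.const_sub _) ?_
      rw [← Complex.ofReal_sub, Complex.ofReal_ne_zero, sub_ne_zero]
      rintro rfl
      exact hs ⟨by linarith, by linarith⟩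
  -- the near part, with the value at the real part of the point subtracted
  set q : ι → ℝ → ℂ := fun i u => (I.indicator (fun s => f i s - f i (z i).re) ((z i).re + u))
    / ((u : ℂ) - ((z i).im : ℝ) * Complex.I) with hq
  have hnear : ∃ A, Tendsto (fun i => ∫ u : ℝ, q i u) l (𝓝 A) := by
    refine ⟨∫ u : ℝ, (Ioo (-δ) δ).indicator (fun u => (f₀ (p + u) - f₀ p) / (u : ℂ)) u,
      tendsto_integral_filter_of_dominated_convergence
        (fun u => (Icc (-(2 * δ)) (2 * δ)).indicator (fun u => K * |u| ^ (μ - 1)) u) ?_ ?_ ?_ ?_⟩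
    · filter_upwards [hm] with i hmi
      have hk : Measurable fun u : ℝ => ((u : ℂ) - ((z i).im : ℝ) * Complex.I)⁻¹ :=
        (Complex.measurable_ofReal.sub_const _).inv
      simp only [hq, div_eq_mul_inv]
      refine AEStronglyMeasurable.mul ?_ hk.aestronglyMeasurable
      have h1 : AEStronglyMeasurable (I.indicator fun s => f i s - f i (z i).re) :=
        (hmi.sub aestronglyMeasurable_const).indicator hIm
      exact h1.comp_quasiMeasurePreserving
        (measurePreserving_add_left volume _).quasiMeasurePreserving
    · filter_upwards [hh, hreI'] with i hhi hri
      refine ae_of_all _ fun u => ?_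
      by_cases hu : (z i).re + u ∈ I
      · have hu' : u ∈ Icc (-(2 * δ)) (2 * δ) :=
          ⟨by linarith [hu.1, hri.2], by linarith [hu.2, hri.1]⟩
        simp only [hq, indicator_of_mem hu, indicator_of_mem hu', norm_div]
        have h1 := hhi _ hu _ hri
        rw [add_sub_cancel_left] at h1
        rcases eq_or_ne u 0 with rfl | hu0
        · have : f i ((z i).re + 0) - f i (z i).re = 0 := by simp
          rw [this, norm_zero, zero_div]
          rw [abs_zero]
          have : 0 ≤ K := by
            have := (norm_nonneg _).trans (hhi (p + δ) ⟨by linarith, le_rfl⟩ p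
              ⟨by linarith, by linarith⟩)
            have h2 : 0 < |p + δ - p| ^ μ := Real.rpow_pos_of_pos (by simpa using hδ.ne') _
            exact nonneg_of_mul_nonneg_left this h2
          exact mul_nonneg this (Real.zero_rpow_nonneg _)
        · have hu1 : 0 < |u| := abs_pos.2 hu0
          have h2 : |u| ≤ ‖(u : ℂ) - ((z i).im : ℝ) * Complex.I‖ := by
            simpa using Complex.abs_re_le_norm ((u : ℂ) - ((z i).im : ℝ) * Complex.I)
          rw [div_le_iff₀ (hu1.trans_le h2), Real.rpow_sub_one hu1.ne']
          refine h1.trans ?_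
          have h3 : 0 ≤ K * |u| ^ μ := (norm_nonneg _).trans h1
          calc K * |u| ^ μ = K * |u| ^ μ / |u| * |u| := by field_simp
            _ ≤ K * |u| ^ μ / |u| * ‖(u : ℂ) - ((z i).im : ℝ) * Complex.I‖ := by gcongr
            _ = _ := by ring
      · simp only [hq, indicator_of_notMem hu, zero_div, norm_zero]
        refine indicator_nonneg (fun u _ => ?_) u
        have : 0 ≤ K := by
          have := (norm_nonneg _).trans (hhi (p + δ) ⟨by linarith, le_rfl⟩ p
            ⟨by linarith, by linarith⟩)
          have h2 : 0 < |p + δ - p| ^ μ := Real.rpow_pos_of_pos (by simpa using hδ.ne') _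
          exact nonneg_of_mul_nonneg_left this h2
        positivity
    · rw [integrable_indicator_iff measurableSet_Icc]
      refine Integrable.const_mul ?_ K
      rw [← IntegrableOn, ← intervalIntegrable_iff_integrableOn_Icc_of_le (by linarith)]
      have hpos : ∀ b : ℝ, 0 ≤ b → IntervalIntegrable (fun u : ℝ => |u| ^ (μ - 1)) volume 0 b := by
        intro b hb
        refine (intervalIntegral.intervalIntegrable_rpow' (r := μ - 1) (by linarith)).congr ?_
        intro u hu
        rw [uIoc_of_le hb] at hu
        simp [abs_of_pos hu.1]
      have h1 := hpos (2 * δ) (by linarith)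
      have h2 := (IntervalIntegrable.iff_comp_neg (f := fun u : ℝ => |u| ^ (μ - 1))
        (a := 0) (b := 2 * δ)).1 h1
      simp only [abs_neg, neg_zero] at h2
      exact h2.symm.trans h1
    · have hne : ∀ᵐ u : ℝ, u ≠ 0 ∧ u ≠ δ ∧ u ≠ -δ := by
        have : ∀ a : ℝ, ∀ᵐ u : ℝ, u ≠ a := fun a => by
          simp [ae_iff, measure_singleton]
        filter_upwards [this 0, this δ, this (-δ)] with u h1 h2 h3 using ⟨h1, h2, h3⟩
      filter_upwards [hne] with u ⟨hu0, hu1, hu2⟩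
      have hden : Tendsto (fun i => (u : ℂ) - ((z i).im : ℝ) * Complex.I) l (𝓝 (u : ℂ)) := by
        have h1 : Tendsto (fun i => (((z i).im : ℝ) : ℂ)) l (𝓝 0) := by
          simpa [Function.comp_def] using (Complex.continuous_ofReal.tendsto _).comp him
        simpa using (h1.mul_const Complex.I).const_sub (u : ℂ)
      by_cases hu : |u| < δ
      · have hu' := abs_lt.1 hu
        rw [indicator_of_mem (show u ∈ Ioo (-δ) δ from hu')]
        have hmem : ∀ᶠ i in l, (z i).re + u ∈ I :=
          (hre.add_const u) (Icc_mem_nhds (by linarith) (by linarith))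
        have h2 := ((hmove u hu).sub hcenter).div hden (by simpa using hu0)
        refine h2.congr' ?_
        filter_upwards [hmem] with i hi
        simp only [hq, indicator_of_mem hi]
        rfl
      · rw [indicator_of_notMem (show u ∉ Ioo (-δ) δ from fun h => hu (abs_lt.2 h))]
        have hmem : ∀ᶠ i in l, (z i).re + u ∉ I := by
          rcases lt_or_ge u 0 with h | h
          · rw [abs_of_neg h, not_lt] at hu
            have : u < -δ := lt_of_le_of_ne (by linarith) hu2
            filter_upwards [(hre.add_const u) (Iio_mem_nhds (show p + u < p - δ by linarith))]
              with i hi hi'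
            exact absurd hi'.1 (not_le.2 hi)
          · rw [abs_of_nonneg h, not_lt] at hu
            have : δ < u := lt_of_le_of_ne hu (Ne.symm hu1)
            filter_upwards [(hre.add_const u) (Ioi_mem_nhds (show p + δ < p + u by linarith))]
              with i hi hi'
            exact absurd hi'.2 (not_le.2 hi)
        refine tendsto_const_nhds.congr' ?_
        filter_upwards [hmem] with i hi
        simp [hq, indicator_of_notMem hi]
  obtain ⟨A₁, hA₁⟩ := hnear
  obtain ⟨A₂, hA₂⟩ := tendsto_integral_Icc_inv_sub hδ hz hz0
  refine ⟨_, (hfar.add (hA₁.add (hcenter.mul hA₂))).congr' ?_⟩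
  filter_upwards [hint, hz0] with i hi hzi
  have hk : IntegrableOn (fun s : ℝ => ((s : ℂ) - z i)⁻¹) I :=
    (Continuous.inv₀ (by fun_prop) fun s => ofReal_sub_ne_zero hzi.ne' s).integrableOn_Icc
  have e1 : ∫ u : ℝ, q i u = ∫ s : ℝ in I, (f i s - f i (z i).re) / ((s : ℂ) - z i) := by
    rw [← integral_indicator hIm, ← integral_add_left_eq_self
      (fun s : ℝ => I.indicator (fun s : ℝ => (f i s - f i (z i).re) / ((s : ℂ) - z i)) s) (z i).re]
    refine integral_congr_ae (ae_of_all _ fun u => ?_)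
    have e : (((z i).re + u : ℝ) : ℂ) - z i = (u : ℂ) - ((z i).im : ℝ) * Complex.I := by
      apply Complex.ext <;> simp
    by_cases hu : (z i).re + u ∈ I
    · simp only [hq, indicator_of_mem hu, e]
    · simp only [hq, indicator_of_notMem hu, zero_div]
  have e2 : ∫ s : ℝ in I, (f i s - f i (z i).re) / ((s : ℂ) - z i)
      = (∫ s : ℝ in I, f i s / ((s : ℂ) - z i))
        - f i (z i).re * ∫ s : ℝ in I, ((s : ℂ) - z i)⁻¹ := by
    rw [← integral_const_mul, ← integral_sub hi.integrableOn (hk.const_mul _)]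
    congr 1; funext s; rw [sub_div, div_eq_mul_inv (f i (z i).re)]
  rw [e1, e2, sub_add_cancel, add_comm]
  exact integral_add_compl hIm hi

/-- The Plemelj lemma in the half-plane `σ Im z > 0`. -/
theorem exists_tendsto_cauchy_integral_side {ι : Type*} {l : Filter ι} [l.IsCountablyGenerated]
    {f : ι → ℝ → ℂ} {f₀ : ℝ → ℂ} {B : ℝ → ℝ} {z : ι → ℂ} {p K μ δ σ : ℝ} (hσ : σ = 1 ∨ σ = -1)
    (hB : Integrable B) (hμ : 0 < μ) (hδ : 0 < δ) (hz : Tendsto z l (𝓝 (p : ℂ)))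
    (hz0 : ∀ᶠ i in l, 0 < σ * (z i).im)
    (hm : ∀ᶠ i in l, AEStronglyMeasurable (f i)) (hb : ∀ᶠ i in l, ∀ s, ‖f i s‖ ≤ B s)
    (hh : ∀ᶠ i in l, ∀ s ∈ Icc (p - δ) (p + δ), ∀ s' ∈ Icc (p - δ) (p + δ),
      ‖f i s - f i s'‖ ≤ K * |s - s'| ^ μ)
    (hl : ∀ s, Tendsto (fun i => f i s) l (𝓝 (f₀ s))) :
    ∃ A : ℂ, Tendsto (fun i => ∫ s : ℝ, f i s / ((s : ℂ) - z i)) l (𝓝 A) := by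
  rcases hσ with rfl | rfl
  · exact exists_tendsto_cauchy_integral hB hμ hδ hz (by simpa using hz0) hm hb hh hl
  · obtain ⟨A, hA⟩ := exists_tendsto_cauchy_integral (f := fun i s => conj (f i s))
      (f₀ := fun s => conj (f₀ s)) (z := fun i => conj (z i)) (p := p) (K := K) hB hμ hδ
      (by simpa [Function.comp_def] using (Complex.continuous_conj.tendsto _).comp hz)
      (hz0.mono fun i hi => by simpa using hi)
      (hm.mono fun i hi => Complex.continuous_conj.comp_aestronglyMeasurable hi)
      (hb.mono fun i hi s => by rw [RCLike.norm_conj]; exact hi s)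
      (hh.mono fun i hi s hs s' hs' => by
        rw [← map_sub, RCLike.norm_conj]; exact hi s hs s' hs')
      (fun s => (Complex.continuous_conj.tendsto _).comp (hl s))
    refine ⟨conj A, ((Complex.continuous_conj.tendsto _).comp hA).congr fun i => ?_⟩
    simp only [Function.comp]
    rw [← integral_conj]
    simp

/-- A compactly supported line shape which is Hölder continuous on `[-Λ, Λ]` vanishes at the
endpoints, so it is Hölder continuous on the real line. -/
theorem MaxwellBloch.IsLineShape.holder_or_indicator {n : ℝ → ℝ} (hn : IsLineShape n) :
    (∃ C μ : ℝ, 0 < μ ∧ μ ≤ 1 ∧ ∀ s s', |n s - n s'| ≤ C * |s - s'| ^ μ) ∨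
      ∃ Λ : ℝ, 0 < Λ ∧ ∀ s, n s = if |s| < Λ then 1 / (2 * Λ) else 0 := by
  obtain ⟨C, μ, h1, h2, h3, _⟩ | ⟨Λ, hΛ, h0, C, μ, h1, h2, h3⟩ | h := hn.2.2
  · refine .inl ⟨C, μ, h1, h2, fun s s' => ?_⟩
    simpa [Real.dist_eq] using h3.dist_le s s'
  · refine .inl ⟨C, μ, h1, h2, fun s s' => ?_⟩
    -- `n` does not change if its argument is projected to `[-Λ, Λ]`
    have hle : -Λ ≤ Λ := by linarith
    have hp : ∀ s, n s = n (projIcc (-Λ) Λ hle s) := by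
      intro s
      rcases le_total s (-Λ) with h | h
      · rw [projIcc_of_le_left hle h, h0 s (by rw [abs_of_nonpos (by linarith)]; linarith)]
        exact (h0 (-Λ) (by rw [abs_neg]; exact le_abs_self Λ)).symm
      rcases le_total Λ s with h' | h'
      · rw [projIcc_of_right_le hle h', h0 s (h'.trans (le_abs_self _))]
        exact (h0 Λ (le_abs_self Λ)).symm
      · rw [projIcc_of_mem hle ⟨h, h'⟩]
    have h4 := h3.dist_le (projIcc (-Λ) Λ hle s).2 (projIcc (-Λ) Λ hle s').2
    rw [Real.dist_eq, Real.dist_eq, ← hp, ← hp] at h4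
    refine h4.trans ?_
    exact mul_le_mul_of_nonneg_left (Real.rpow_le_rpow (abs_nonneg _)
      (abs_projIcc_sub_projIcc hle (c := s) (d := s')) μ.2) C.2
  · exact .inr h

theorem MaxwellBloch.IsLineShape.exists_local_holder {n : ℝ → ℝ} (hn : IsLineShape n) {p : ℝ}
    (hp : ContinuousAt n p) : ∃ C μ δ : ℝ, 0 < μ ∧ μ ≤ 1 ∧ 0 < δ ∧ δ ≤ 1 / 2 ∧
      ∀ s ∈ Icc (p - δ) (p + δ), ∀ s' ∈ Icc (p - δ) (p + δ), |n s - n s'| ≤ C * |s - s'| ^ μ := by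
  obtain ⟨C, μ, h1, h2, h3⟩ | ⟨Λ, hΛ, h⟩ := hn.holder_or_indicator
  · exact ⟨C, μ, 1 / 2, h1, h2, by norm_num, le_rfl, fun s _ s' _ => h3 s s'⟩
  · -- `n` has two values, hence it is constant near a point of continuity
    have hpos : 0 < 1 / (2 * Λ) := by positivity
    have h1 : ∀ᶠ s in 𝓝 p, n s = n p := by
      filter_upwards [Metric.continuousAt_iff'.1 hp _ hpos] with s hs
      rw [Real.dist_eq, abs_lt] at hs
      rw [h s, h p] at hs ⊢
      split_ifs at hs ⊢ <;> linarith
    obtain ⟨r, hr, hr'⟩ := Metric.nhds_basis_closedBall.eventually_iff.1 h1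
    refine ⟨0, 1, min r (1 / 2), one_pos, le_rfl, lt_min hr (by norm_num), min_le_right _ _,
      fun s hs s' hs' => ?_⟩
    have hin : ∀ s ∈ Icc (p - min r (1 / 2)) (p + min r (1 / 2)), n s = n p := fun s hs => by
      refine hr' ?_
      rw [Real.closedBall_eq_Icc]
      have := min_le_left r (1 / 2)
      exact ⟨by linarith [hs.1], by linarith [hs.2]⟩
    rw [hin s hs, hin s' hs']; simp

theorem MaxwellBloch.IsLineShape.finite_discontinuities {n : ℝ → ℝ} (hn : IsLineShape n) :
    {p | ¬ ContinuousAt n p}.Finite := by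
  obtain ⟨C, μ, h1, h2, h3⟩ | ⟨Λ, hΛ, h⟩ := hn.holder_or_indicator
  · convert finite_empty
    ext p
    simp only [mem_ofPred_eq, mem_empty_iff_false, iff_false, not_not]
    have h4 : Tendsto (fun s => C * |s - p| ^ μ) (𝓝 p) (𝓝 0) := by
      have : Tendsto (fun s => |s - p|) (𝓝 p) (𝓝 0) := by
        simpa using ((tendsto_id (x := 𝓝 p)).sub_const p).abs
      simpa [Real.zero_rpow h1.ne'] using (this.rpow_const (.inr h1.le)).const_mul C
    rw [ContinuousAt, tendsto_iff_norm_sub_tendsto_zero]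
    exact squeeze_zero (fun _ => norm_nonneg _) (fun s => h3 s p) h4
  · refine (Set.toFinite {Λ, -Λ}).subset fun p hp => ?_
    by_contra hne
    refine hp ?_
    simp only [mem_insert_iff, mem_singleton_iff, not_or] at hne
    rcases lt_or_ge |p| Λ with h1 | h1
    · refine (continuousAt_const (y := 1 / (2 * Λ))).congr ?_
      filter_upwards [(continuous_abs.tendsto p) (Iio_mem_nhds h1)] with s hs
      rw [h s, if_pos (show |s| < Λ from hs)]
    · have h2 : Λ < |p| := lt_of_le_of_ne h1 fun h2 => by
        rcases abs_choice p with h3 | h3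
        · exact hne.1 (by rw [h2, h3])
        · exact hne.2 (by rw [h2, h3, neg_neg])
      refine (continuousAt_const (y := (0 : ℝ))).congr ?_
      filter_upwards [(continuous_abs.tendsto p) (Ioi_mem_nhds h2)] with s hs
      rw [h s, if_neg (not_lt.2 (le_of_lt (show Λ < |s| from hs)))]

theorem openHalf_neBot {σ : ℝ} (hσ : σ = 1 ∨ σ = -1) (p : ℝ) : (𝓝[openHalf σ] (p : ℂ)).NeBot := by
  refine mem_closure_iff_nhdsWithin_neBot.1 (Metric.mem_closure_iff.2 fun ε hε => ?_)
  refine ⟨p + ((σ * (ε / 2) : ℝ) : ℂ) * Complex.I, ?_, ?_⟩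
  · rcases hσ with rfl | rfl <;> simp [openHalf] <;> linarith
  · rw [dist_self_add_right, norm_mul, Complex.norm_I, mul_one, Complex.norm_real, Real.norm_eq_abs,
      abs_mul, abs_of_pos (half_pos hε)]
    rcases hσ with rfl | rfl <;> simp <;> linarith

theorem tendsto_vertical_openHalf {σ : ℝ} (hσ : σ = 1 ∨ σ = -1) (p : ℝ) :
    Tendsto (fun ε : ℝ => (p : ℂ) + ((σ * ε : ℝ) : ℂ) * Complex.I) (𝓝[>] 0) (𝓝[openHalf σ] p) := by
  refine tendsto_nhdsWithin_iff.2 ⟨?_, ?_⟩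
  · have : Continuous fun ε : ℝ => (p : ℂ) + ((σ * ε : ℝ) : ℂ) * Complex.I := by fun_prop
    simpa using (this.tendsto 0).mono_left nhdsWithin_le_nhds
  · filter_upwards [self_mem_nhdsWithin] with ε hε
    have : 0 < ε := hε
    rcases hσ with rfl | rfl <;> simpa [openHalf] using this

theorem sideValue_ofReal_eq {α : Type*} [TopologicalSpace α] [Nonempty α] [T2Space α] {σ : ℝ}
    (hσ : σ = 1 ∨ σ = -1) {f : ℂ → α} {p : ℝ} {A : α}
    (h : Tendsto f (𝓝[openHalf σ] (p : ℂ)) (𝓝 A)) : sideValue σ f p = A := by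
  rw [sideValue, if_pos (Complex.ofReal_im p)]
  exact (h.comp (tendsto_vertical_openHalf hσ p)).limUnder_eq

theorem sideValue_of_im_ne_zero {α : Type*} [TopologicalSpace α] [Nonempty α] (σ : ℝ) (f : ℂ → α)
    {z : ℂ} (hz : z.im ≠ 0) : sideValue σ f z = f z := if_neg hz

theorem ofReal_re_of_im_eq_zero {z : ℂ} (hz : z.im = 0) : ((z.re : ℝ) : ℂ) = z :=
  Complex.ext rfl hz.symm

theorem im_ne_zero_of_mem_openHalf {σ : ℝ} {z : ℂ} (hz : z ∈ openHalf σ) : z.im ≠ 0 := fun h => by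
  have : 0 < σ * z.im := hz
  simp [h] at this

theorem mem_openHalf_of_mem_closedHalf {n : ℝ → ℝ} {σ : ℝ} (hσ : σ = 1 ∨ σ = -1) {z : ℂ}
    (hz : z ∈ closedHalf n σ) (h : z.im ≠ 0) : z ∈ openHalf σ := by
  refine lt_of_le_of_ne hz.1 (Ne.symm (mul_ne_zero ?_ h))
  rcases hσ with rfl | rfl <;> norm_num

theorem isOpen_openHalf (σ : ℝ) : IsOpen (openHalf σ) :=
  isOpen_lt continuous_const (continuous_const.mul Complex.continuous_im)

theorem openHalf_subset_closedHalf (n : ℝ → ℝ) (σ : ℝ) : openHalf σ ⊆ closedHalf n σ :=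
  fun _ hz => ⟨le_of_lt hz, fun h => absurd h (im_ne_zero_of_mem_openHalf hz)⟩

/-- If `f` is continuous in the open half-plane and has a limit at each real point of `S`, then its
extension by boundary values is continuous on `S`. -/
theorem continuousOn_sideValue {α : Type*} [TopologicalSpace α] [Nonempty α] [T3Space α] {σ : ℝ}
    (hσ : σ = 1 ∨ σ = -1) {f : ℂ → α} {n : ℝ → ℝ} (hf : ContinuousOn f (openHalf σ))
    (h : ∀ p : ℝ, ContinuousAt n p → ∃ A, Tendsto f (𝓝[openHalf σ] (p : ℂ)) (𝓝 A)) :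
    ContinuousOn (sideValue σ f) (closedHalf n σ) := by
  have hlim : ∀ z ∈ closedHalf n σ, Tendsto f (𝓝[openHalf σ] z) (𝓝 (sideValue σ f z)) := by
    intro z hz
    by_cases hi : z.im = 0
    · obtain ⟨A, hA⟩ := h z.re (hz.2 hi)
      rw [ofReal_re_of_im_eq_zero hi] at hA
      have := sideValue_ofReal_eq hσ (p := z.re) (by rwa [ofReal_re_of_im_eq_zero hi])
      rw [ofReal_re_of_im_eq_zero hi] at this
      rwa [this]
    · rw [sideValue_of_im_ne_zero σ f hi]
      exact hf z (mem_openHalf_of_mem_closedHalf hσ hz hi)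
  have hcl : closedHalf n σ ⊆ closure (openHalf σ) := by
    intro z hz
    by_cases hi : z.im = 0
    · have := openHalf_neBot hσ z.re
      rw [ofReal_re_of_im_eq_zero hi] at this
      exact mem_closure_iff_nhdsWithin_neBot.2 this
    · exact subset_closure (mem_openHalf_of_mem_closedHalf hσ hz hi)
  refine (continuousOn_extendFrom hcl fun z hz => ⟨_, hlim z hz⟩).congr fun z hz => ?_
  exact (extendFrom_eq (hcl hz) (hlim z hz)).symm

theorem eta_differentiableAt {n : ℝ → ℝ} (hn : IsLineShape n) {z : ℂ} (hz : z.im ≠ 0) :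
    DifferentiableAt ℂ (eta n) z := by
  have h0 : 0 < |z.im| := abs_pos.2 hz
  have hU : {w : ℂ | |z.im| / 2 < |w.im|} ∈ 𝓝 z :=
    (isOpen_lt continuous_const (by fun_prop)).mem_nhds (half_lt_self h0)
  have hw : ∀ w ∈ {w : ℂ | |z.im| / 2 < |w.im|}, w.im ≠ 0 := fun w hw h => by
    have : |z.im| / 2 < |w.im| := hw
    rw [h, abs_zero] at this; linarith
  have hkm : ∀ w : ℂ, AEStronglyMeasurable fun s : ℝ => ((s : ℂ) - w)⁻¹ := fun w =>
    ((Complex.measurable_ofReal.sub_const _).inv).aestronglyMeasurable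
  have hnm : AEStronglyMeasurable fun s : ℝ => (n s : ℂ) := hn.integrable.ofReal.1
  have := (hasDerivAt_integral_of_dominated_loc_of_deriv_le (μ := volume) (𝕜 := ℂ)
    (F := fun w (s : ℝ) => (n s : ℂ) / ((s : ℂ) - w))
    (F' := fun w (s : ℝ) => (n s : ℂ) / ((s : ℂ) - w) ^ 2) (x₀ := z)
    (bound := fun s => n s / (|z.im| / 2) ^ 2) hU ?_ ?_ ?_ ?_ ?_ ?_).2
  · exact (differentiableAt_id.add (this.differentiableAt.const_mul _))
  · refine Eventually.of_forall fun w => ?_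
    simp only [div_eq_mul_inv]
    exact hnm.mul (hkm w)
  · have := cauchy_kernel_integrable hn.integrable hn.1 (f := fun _ => 1)
      aestronglyMeasurable_const (C := 1) (by simp) hz
    simpa using this
  · simp only [div_eq_mul_inv, ← inv_pow]
    exact hnm.mul ((hkm z).pow 2)
  · refine ae_of_all _ fun s w hw => ?_
    rw [norm_div, norm_pow, Complex.norm_real, Real.norm_of_nonneg (hn.1 s)]
    have h1 := abs_im_le_norm_sub s w
    have h2 : |z.im| / 2 < |w.im| := hw
    have := hn.1 s
    gcongr
    linarith
  · exact hn.integrable.div_const _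
  · refine ae_of_all _ fun s w hw' => ?_
    have h3 := ofReal_sub_ne_zero (hw w hw') s
    have h4 : HasDerivAt (fun w : ℂ => (s : ℂ) - w) (-1) w := (hasDerivAt_id w).const_sub _
    have := (h4.inv h3).const_mul (n s : ℂ)
    simp only [neg_neg] at this
    refine (this.congr_deriv ?_)
    rw [mul_one_div]

theorem eta_continuousOn {n : ℝ → ℝ} (hn : IsLineShape n) (σ : ℝ) :
    ContinuousOn (eta n) (openHalf σ) := fun _ hz =>
  (eta_differentiableAt hn (im_ne_zero_of_mem_openHalf hz)).continuousAt.continuousWithinAt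

theorem exists_tendsto_eta {n : ℝ → ℝ} (hn : IsLineShape n) {σ : ℝ} (hσ : σ = 1 ∨ σ = -1) {p : ℝ}
    (hp : ContinuousAt n p) : ∃ A, Tendsto (eta n) (𝓝[openHalf σ] (p : ℂ)) (𝓝 A) := by
  obtain ⟨C, μ, δ, hμ, -, hδ, -, h⟩ := hn.exists_local_holder hp
  have hid : Tendsto (fun z : ℂ => z) (𝓝[openHalf σ] (p : ℂ)) (𝓝 (p : ℂ)) :=
    tendsto_id.mono_left nhdsWithin_le_nhds
  obtain ⟨A, hA⟩ := exists_tendsto_cauchy_integral_side (l := 𝓝[openHalf σ] (p : ℂ))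
    (f := fun _ s => (n s : ℂ)) (f₀ := fun s => (n s : ℂ)) (B := n) (z := fun z => z) (p := p)
    (K := C) hσ hn.integrable hμ hδ hid self_mem_nhdsWithin
    (Eventually.of_forall fun _ => hn.integrable.ofReal.1)
    (Eventually.of_forall fun _ s => by simp [abs_of_nonneg (hn.1 s)])
    (Eventually.of_forall fun _ s hs s' hs' => by
      rw [← Complex.ofReal_sub, Complex.norm_real]; exact h s hs s' hs') (fun s => tendsto_const_nhds)
  exact ⟨_, hid.add (hA.const_mul _)⟩

theorem sideValue_eta_continuousOn {n : ℝ → ℝ} (hn : IsLineShape n) {σ : ℝ}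
    (hσ : σ = 1 ∨ σ = -1) : ContinuousOn (sideValue σ (eta n)) (closedHalf n σ) :=
  continuousOn_sideValue hσ (eta_continuousOn hn σ) fun _ hp => exists_tendsto_eta hn hσ hp

theorem tendsto_eta_sideValue {n : ℝ → ℝ} (hn : IsLineShape n) {σ : ℝ} (hσ : σ = 1 ∨ σ = -1) {p : ℝ}
    (hp : ContinuousAt n p) :
    Tendsto (eta n) (𝓝[openHalf σ] (p : ℂ)) (𝓝 (sideValue σ (eta n) p)) := by
  obtain ⟨A, hA⟩ := exists_tendsto_eta hn hσ hp
  rwa [sideValue_ofReal_eq hσ hA]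

/-- A joint limit together with limits in the first variable gives uniform convergence near the
base point. -/
theorem tendstoUniformlyOnFilter_of_tendsto_prod {ι α β : Type*} [PseudoMetricSpace β]
    {l : Filter ι} [l.NeBot] {l' : Filter α} {F : ι → α → β} {g : α → β} {A : β}
    (h : ∀ᶠ y in l', Tendsto (fun i => F i y) l (𝓝 (g y)))
    (hj : Tendsto (fun q : ι × α => F q.1 q.2) (l ×ˢ l') (𝓝 A)) :
    TendstoUniformlyOnFilter F g l l' := by
  rw [Metric.tendstoUniformlyOnFilter_iff]
  intro ε hε
  obtain ⟨U, hU, V, hV, hUV⟩ := eventually_prod_iff.1 (hj (Metric.ball_mem_nhds A (half_pos (half_pos hε))))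
  refine (hU.prod_mk (h.and hV)).mono ?_
  rintro ⟨i, y⟩ ⟨hi, hy, hy'⟩
  have h1 : dist (F i y) A < ε / 2 / 2 := hUV hi hy'
  have h2 : dist (g y) A ≤ ε / 2 / 2 :=
    le_of_tendsto (hy.dist tendsto_const_nhds) (hU.mono fun j hj => le_of_lt (hUV hj hy'))
  calc dist (g y) (F i y) ≤ dist (g y) A + dist (F i y) A := dist_triangle_right _ _ _
    _ < ε := by linarith

theorem eventually_pos_lt_coe {L : EReal} {x : ℝ} (hx : 0 < x) (hxL : (x : EReal) < L) :
    ∀ᶠ y : ℝ in 𝓝 x, 0 < y ∧ (y : EReal) < L :=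
  Filter.inter_mem (Ioi_mem_nhds hx) ((isOpen_lt_coe L).mem_nhds hxL)

namespace MaxwellBloch.IsSolution

variable {L : EReal} {n : ℝ → ℝ} {A₀ ω₀ : ℝ} {Ef : ℝ → ℝ → ℂ} {ρ : ℝ → ℝ → ℝ → ℂ}
  {Nf : ℝ → ℝ → ℝ → ℝ} (hsol : IsSolution L n A₀ ω₀ Ef ρ Nf)

include hsol

/-- The `λ`-derivatives of `ρ` and `𝓝` are continuous, hence bounded on compact sets, for `t > 0`;
at `t = 0` the matrix is constant. -/
theorem exists_densityMatrix_lipschitz (hn : IsLineShape n) {t x : ℝ} (ht : 0 ≤ t) (hx : 0 < x)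
    (hxL : (x : EReal) < L) (p : ℝ) (i j : Fin 2) : ∃ K : ℝ, 0 ≤ K ∧ ∀ᶠ y in 𝓝 x,
      ∀ s ∈ Icc (p - 1) (p + 1), ∀ s' ∈ Icc (p - 1) (p + 1),
        ‖densityMatrix ρ Nf t y s i j - densityMatrix ρ Nf t y s' i j‖ ≤ K * |s - s'| := by
  rcases ht.eq_or_lt with rfl | ht
  · refine ⟨0, le_rfl, (eventually_pos_lt_coe hx hxL).mono fun y hy s _ s' _ => ?_⟩
    rw [hsol.densityMatrix_eq_neg_sigma3 hn le_rfl hy.1.le hy.1 hy.2,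
      hsol.densityMatrix_eq_neg_sigma3 hn le_rfl hy.1.le hy.1 hy.2]
    simp
  obtain ⟨r, hr, hr'⟩ := Metric.nhds_basis_closedBall.eventually_iff.1
    (eventually_pos_lt_coe hx hxL)
  have hK : IsCompact (({t} : Set ℝ) ×ˢ (Metric.closedBall x r ×ˢ Icc (p - 1) (p + 1))) :=
    isCompact_singleton.prod ((isCompact_closedBall x r).prod isCompact_Icc)
  have hsub : ({t} : Set ℝ) ×ˢ (Metric.closedBall x r ×ˢ Icc (p - 1) (p + 1)) ⊆
      {q : ℝ × ℝ × ℝ | 0 < q.1 ∧ 0 < q.2.1 ∧ (q.2.1 : EReal) < L} := by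
    rintro ⟨a, b, c⟩ ⟨rfl, hb, -⟩
    exact ⟨ht, hr' hb⟩
  obtain ⟨K₁, hK₁⟩ := hK.exists_bound_of_continuousOn (hsol.rho_deriv_continuous.mono hsub)
  obtain ⟨K₂, hK₂⟩ := hK.exists_bound_of_continuousOn (hsol.inv_deriv_continuous.mono hsub)
  have h1 : ∀ y ∈ Metric.closedBall x r, ∀ s ∈ Icc (p - 1) (p + 1), ∀ s' ∈ Icc (p - 1) (p + 1),
      ‖ρ t y s - ρ t y s'‖ ≤ K₁ * |s - s'| := fun y hy s hs s' hs' =>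
    (convex_Icc (p - 1) (p + 1)).norm_image_sub_le_of_norm_deriv_le
      (fun u _ => hsol.rho_differentiable t y u ht (hr' hy).1 (hr' hy).2)
      (fun u hu => hK₁ (t, y, u) ⟨rfl, hy, hu⟩) hs' hs
  have h2 : ∀ y ∈ Metric.closedBall x r, ∀ s ∈ Icc (p - 1) (p + 1), ∀ s' ∈ Icc (p - 1) (p + 1),
      |Nf t y s - Nf t y s'| ≤ K₂ * |s - s'| := fun y hy s hs s' hs' =>
    (convex_Icc (p - 1) (p + 1)).norm_image_sub_le_of_norm_deriv_le
      (fun u _ => hsol.inv_differentiable t y u ht (hr' hy).1 (hr' hy).2)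
      (fun u hu => hK₂ (t, y, u) ⟨rfl, hy, hu⟩) hs' hs
  refine ⟨max 0 (max K₁ K₂), le_max_left _ _, ?_⟩
  filter_upwards [Metric.closedBall_mem_nhds x hr] with y hy s hs s' hs'
  have g1 : ‖ρ t y s - ρ t y s'‖ ≤ max 0 (max K₁ K₂) * |s - s'| :=
    (h1 y hy s hs s' hs').trans (by gcongr; exact (le_max_left _ _).trans (le_max_right _ _))
  have g2 : |Nf t y s - Nf t y s'| ≤ max 0 (max K₁ K₂) * |s - s'| :=
    (h2 y hy s hs s' hs').trans (by gcongr; exact (le_max_right _ _).trans (le_max_right _ _))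
  fin_cases i <;> fin_cases j <;> simp [densityMatrix]
  · rwa [← Complex.ofReal_sub, Complex.norm_real]
  · exact g1
  · rwa [← map_sub, RCLike.norm_conj]
  · rwa [neg_add_eq_sub, norm_sub_rev, ← Complex.ofReal_sub, Complex.norm_real]

/-- The boundary values of `G` are attained locally uniformly in `x`. -/
theorem exists_tendsto_cauchyMatrix (hn : IsLineShape n) {t x : ℝ} (ht : 0 ≤ t) (hx : 0 < x)
    (hxL : (x : EReal) < L) {σ : ℝ} (hσ : σ = 1 ∨ σ = -1) {p : ℝ} (hp : ContinuousAt n p) :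
    ∃ A, Tendsto (fun q : ℂ × ℝ => cauchyMatrix n ρ Nf t q.2 q.1)
      (𝓝[openHalf σ] (p : ℂ) ×ˢ 𝓝 x) (𝓝 A) := by
  have hentry : ∀ i j, ∃ a : ℂ, Tendsto (fun q : ℂ × ℝ => cauchyMatrix n ρ Nf t q.2 q.1 i j)
      (𝓝[openHalf σ] (p : ℂ) ×ˢ 𝓝 x) (𝓝 a) := by
    intro i j
    obtain ⟨C, μ, δ, hμ, hμ1, hδ, hδ1, h⟩ := hn.exists_local_holder hp
    obtain ⟨K, hK0, hK⟩ := hsol.exists_densityMatrix_lipschitz hn ht hx hxL p i j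
    have hev : ∀ᶠ q : ℂ × ℝ in 𝓝[openHalf σ] (p : ℂ) ×ˢ 𝓝 x, 0 < q.2 ∧ (q.2 : EReal) < L :=
      tendsto_snd.eventually (eventually_pos_lt_coe hx hxL)
    have hC : 0 ≤ C := by
      have h1 := (abs_nonneg _).trans (h (p + δ) ⟨by linarith, le_rfl⟩ p
        ⟨by linarith, by linarith⟩)
      have h2 : 0 < |p + δ - p| ^ μ := Real.rpow_pos_of_pos (by simpa using hδ.ne') _
      exact nonneg_of_mul_nonneg_left h1 h2
    -- near `p` the line shape is bounded by `n p + C`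
    have hnb : ∀ s ∈ Icc (p - δ) (p + δ), |n s| ≤ n p + C := by
      intro s hs
      have h1 := h s hs p ⟨by linarith, by linarith⟩
      have h2 : |s - p| ≤ 1 := abs_le.2 ⟨by linarith [hs.1], by linarith [hs.2]⟩
      have h3 : |s - p| ^ μ ≤ 1 := Real.rpow_le_one (abs_nonneg _) h2 hμ.le
      have h4 := abs_sub_abs_le_abs_sub (n s) (n p)
      rw [abs_of_nonneg (hn.1 p)] at h4
      nlinarith
    have hN : 0 ≤ n p + C := add_nonneg (hn.1 p) hC
    refine Exists.elim (exists_tendsto_cauchy_integral_side (l := 𝓝[openHalf σ] (p : ℂ) ×ˢ 𝓝 x)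
      (f := fun q s => densityMatrix ρ Nf t q.2 s i j * (n s : ℂ))
      (f₀ := fun s => densityMatrix ρ Nf t x s i j * (n s : ℂ)) (B := n) (z := fun q => q.1) (p := p)
      (K := K * (n p + C) + C) hσ hn.integrable hμ hδ
      (tendsto_fst.mono_right nhdsWithin_le_nhds)
      (tendsto_fst.eventually self_mem_nhdsWithin)
      (hev.mono fun q hq => (hsol.densityMatrix_aestronglyMeasurable ht hq.1 hq.2 i j).mul
        hn.integrable.ofReal.1)
      (hev.mono fun q hq s => by
        rw [norm_mul, Complex.norm_real, Real.norm_of_nonneg (hn.1 s)]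
        exact mul_le_of_le_one_left (hn.1 s)
          (hsol.norm_densityMatrix_entry_le ht hq.1 hq.2 s i j)) ?_ ?_) fun a ha => ⟨_, ha.const_mul _⟩
    · filter_upwards [hev, tendsto_snd.eventually hK] with q hq hKq s hs s' hs'
      have e1 := hKq s ⟨by linarith [hs.1], by linarith [hs.2]⟩ s'
        ⟨by linarith [hs'.1], by linarith [hs'.2]⟩
      have hd1 : |s - s'| ≤ 1 := abs_le.2
        ⟨by linarith [hs.1, hs'.2], by linarith [hs.2, hs'.1]⟩
      have hd : |s - s'| ≤ |s - s'| ^ μ := by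
        rcases (abs_nonneg (s - s')).eq_or_lt with h0 | h0
        · rw [← h0, Real.zero_rpow hμ.ne']
        · calc |s - s'| = |s - s'| ^ (1 : ℝ) := (Real.rpow_one _).symm
            _ ≤ _ := Real.rpow_le_rpow_of_exponent_ge h0 hd1 hμ1
      calc ‖densityMatrix ρ Nf t q.2 s i j * (n s : ℂ) - densityMatrix ρ Nf t q.2 s' i j * (n s' : ℂ)‖
          = ‖(densityMatrix ρ Nf t q.2 s i j - densityMatrix ρ Nf t q.2 s' i j) * (n s : ℂ)
            + densityMatrix ρ Nf t q.2 s' i j * ((n s - n s' : ℝ) : ℂ)‖ := by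
            congr 1; push_cast; ring
        _ ≤ K * |s - s'| * (n p + C) + 1 * (C * |s - s'| ^ μ) := by
            refine (norm_add_le _ _).trans ?_
            rw [norm_mul, norm_mul, Complex.norm_real, Complex.norm_real, Real.norm_eq_abs,
              Real.norm_eq_abs]
            have := hsol.norm_densityMatrix_entry_le ht hq.1 hq.2 s' i j
            have := hnb s hs
            have := h s hs s' hs'
            gcongr
        _ ≤ K * |s - s'| ^ μ * (n p + C) + 1 * (C * |s - s'| ^ μ) := by gcongr
        _ = _ := by ring
    · intro s
      have h1 : ContinuousAt (fun y : ℝ => densityMatrix ρ Nf t y s i j) x := by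
        have := (hsol.densityMatrix_continuousOn i j).comp (f := fun y : ℝ => (t, y, s))
          (s := {y : ℝ | 0 < y ∧ (y : EReal) < L}) (by fun_prop) (fun y hy => ⟨ht, hy⟩)
        exact this.continuousAt (eventually_pos_lt_coe hx hxL)
      exact (h1.tendsto.comp tendsto_snd).mul_const _
  choose a ha using hentry
  exact ⟨Matrix.of a, tendsto_pi_nhds.2 fun i => tendsto_pi_nhds.2 fun j => ha i j⟩

/-- Lipschitz continuity in the spectral parameter, uniformly on bounded sets of `(t, y)`. -/
theorem exists_psi_lipschitz_spectral (T : ℝ) {X : ℝ} (hXL : (X : EReal) < L) (z₀ : ℂ) :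
    ∃ C : ℝ, ∀ t y : ℝ, 0 ≤ t → t ≤ T → 0 ≤ y → y ≤ X → ∀ z : ℂ, ‖z - z₀‖ ≤ 1 →
      ‖psi Ef t y z - psi Ef t y z₀‖ ≤ C * ‖z - z₀‖ := by
  obtain ⟨C, hC0, hC⟩ := hsol.field_bound T hXL
  set K := ‖z₀‖ + 1 + C / 2
  have hK : 0 ≤ K := by positivity
  have hU : ∀ s y : ℝ, 0 < s → s ≤ T → 0 ≤ y → y ≤ X → s ≠ y → ∀ z : ℂ, ‖z - z₀‖ ≤ 1 →
      ‖coeffU Ef s y z‖ ≤ K := fun s y h1 h2 h3 h4 h5 z hz => by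
    refine (norm_coeffU_le _ _ _ _).trans ?_
    have h6 := hC s y h1 h2 h3 h4 h5
    have h7 : ‖z‖ ≤ ‖z₀‖ + 1 := by
      have := norm_add_le z₀ (z - z₀); rw [add_sub_cancel] at this; linarith
    simp only [K]; linarith
  have hyL : ∀ y : ℝ, y ≤ X → (y : EReal) < L := fun y hy =>
    (EReal.coe_le_coe_iff.2 hy).trans_lt hXL
  have hpsi : ∀ t y : ℝ, 0 ≤ t → t ≤ T → 0 ≤ y → y ≤ X → ‖psi Ef t y z₀‖ ≤ Real.exp (K * T) := by
    intro t y h1 h2 h3 h4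
    have := norm_le_mul_exp_of_deriv_bound (a := 0) (b := t) (ε := 0) y hK le_rfl
      ((hsol.psi_continuousOn h3 (hyL y h4) z₀).mono fun s hs => hs.1)
      (fun s hs hne => hsol.psi_hasDerivAt hs.1 h3 (hyL y h4) hne z₀) (fun s hs hne => by
        rw [add_zero]
        refine (norm_mul_le _ _).trans ?_
        gcongr
        exact hU s y hs.1 (hs.2.le.trans h2) h3 h4 hne z₀ (by simp)) t ⟨h1, le_rfl⟩
    rw [hsol.psi_zero h3 (hyL y h4), norm_one, zero_mul, add_zero, one_mul, sub_zero] at this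
    exact this.trans (Real.exp_le_exp.2 (by gcongr))
  refine ⟨Real.exp (K * T) * T * Real.exp (K * T), fun t y h1 h2 h3 h4 z hz => ?_⟩
  have hT : 0 ≤ T := h1.trans h2
  have := norm_le_mul_exp_of_deriv_bound (a := 0) (b := t) (ε := ‖z - z₀‖ * Real.exp (K * T))
    (f := fun s => psi Ef s y z - psi Ef s y z₀) y hK (by positivity)
    (((hsol.psi_continuousOn h3 (hyL y h4) z).sub (hsol.psi_continuousOn h3 (hyL y h4) z₀)).mono
      fun s hs => hs.1)
    (fun s hs hne => (hsol.psi_hasDerivAt hs.1 h3 (hyL y h4) hne z).sub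
      (hsol.psi_hasDerivAt hs.1 h3 (hyL y h4) hne z₀)) (fun s hs hne => ?_) t ⟨h1, le_rfl⟩
  · simp only [hsol.psi_zero h3 (hyL y h4), sub_self, norm_zero, zero_add, sub_zero] at this
    refine this.trans ?_
    calc ‖z - z₀‖ * Real.exp (K * T) * t * Real.exp (K * t)
        ≤ ‖z - z₀‖ * Real.exp (K * T) * T * Real.exp (K * T) := by gcongr
      _ = _ := by ring
  · have e : coeffU Ef s y z * psi Ef s y z - coeffU Ef s y z₀ * psi Ef s y z₀
        = coeffU Ef s y z * (psi Ef s y z - psi Ef s y z₀)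
          + (coeffU Ef s y z - coeffU Ef s y z₀) * psi Ef s y z₀ := by noncomm_ring
    rw [e]
    refine (norm_add_le _ _).trans (add_le_add ((norm_mul_le _ _).trans ?_)
      ((norm_mul_le _ _).trans ?_))
    · gcongr
      exact hU s y hs.1 (hs.2.le.trans h2) h3 h4 hne z hz
    · have e' : coeffU Ef s y z - coeffU Ef s y z₀ = (-(Complex.I * (z - z₀))) • sigma3 := by
        simp only [coeffU, mul_sub, neg_sub, sub_smul, neg_smul]; abel
      have : ‖coeffU Ef s y z - coeffU Ef s y z₀‖ = ‖z - z₀‖ := by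
        rw [e', norm_smul, norm_sigma3]; simp
      rw [this]
      gcongr
      exact hpsi s y hs.1.le (hs.2.le.trans h2) h3 h4

theorem psi_tendsto_prod (hn : IsLineShape n) {t x : ℝ} (ht : 0 ≤ t) (hx : 0 < x)
    (hxL : (x : EReal) < L) (z₀ : ℂ) :
    Tendsto (fun q : ℂ × ℝ => psi Ef t q.2 q.1) (𝓝 z₀ ×ˢ 𝓝 x) (𝓝 (psi Ef t x z₀)) := by
  obtain ⟨X, hxX, hXL⟩ := EReal.lt_iff_exists_real_btwn.1 hxL
  have hxX := EReal.coe_lt_coe_iff.1 hxX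
  obtain ⟨C, hC⟩ := hsol.exists_psi_lipschitz_spectral t hXL z₀
  have h1 : Tendsto (fun q : ℂ × ℝ => psi Ef t q.2 q.1 - psi Ef t q.2 z₀) (𝓝 z₀ ×ˢ 𝓝 x) (𝓝 0) := by
    have h2 : Tendsto (fun q : ℂ × ℝ => C * ‖q.1 - z₀‖) (𝓝 z₀ ×ˢ 𝓝 x) (𝓝 0) := by
      have : Tendsto (fun z : ℂ => C * ‖z - z₀‖) (𝓝 z₀) (𝓝 0) := by
        have : Continuous fun z : ℂ => C * ‖z - z₀‖ := by fun_prop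
        simpa using this.tendsto z₀
      exact this.comp tendsto_fst
    refine squeeze_zero_norm' ?_ h2
    have e1 : ∀ᶠ q : ℂ × ℝ in 𝓝 z₀ ×ˢ 𝓝 x, ‖q.1 - z₀‖ ≤ 1 :=
      tendsto_fst.eventually (mem_of_superset (Metric.closedBall_mem_nhds z₀ one_pos) fun z hz => by
        simpa [dist_eq_norm] using hz)
    have e2 : ∀ᶠ q : ℂ × ℝ in 𝓝 z₀ ×ˢ 𝓝 x, 0 < q.2 ∧ q.2 < X :=
      tendsto_snd.eventually (Ioo_mem_nhds hx hxX)
    filter_upwards [e1, e2] with q h1 h2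
    exact hC t q.2 ht le_rfl h2.1.le h2.2.le q.1 h1
  have h2 : ContinuousAt (fun y => psi Ef t y z₀) x :=
    (hsol.psi_continuousOn_x hn ht z₀).continuousAt
      ((eventually_pos_lt_coe hx hxL).mono fun y hy => ⟨hy.1.le, hy.2⟩)
  simpa using h1.add (h2.tendsto.comp tendsto_snd)

end MaxwellBloch.IsSolution

/-! ### The equation in `x` -/

/-- The solution `Ψ exp (i η x σ₃)` of both equations, with the boundary value of `η` on the
real line. -/
noncomputable def jointSol (n : ℝ → ℝ) (Ef : ℝ → ℝ → ℂ) (σ t x : ℝ) (z : ℂ) : Mat2 :=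
  psi Ef t x z * expSigma3 (Complex.I * sideValue σ (eta n) z * x)

theorem expSigma3_continuous : Continuous expSigma3 := by
  refine continuous_pi fun i => continuous_pi fun j => ?_
  fin_cases i <;> fin_cases j <;> simp [expSigma3] <;> fun_prop

theorem expSigma3_differentiable (i j : Fin 2) : Differentiable ℂ fun c => expSigma3 c i j := by
  fin_cases i <;> fin_cases j <;> simp [expSigma3] <;> fun_prop

theorem expSigma3_mul (c d : ℂ) : expSigma3 c * expSigma3 d = expSigma3 (c + d) := by
  ext i j
  fin_cases i <;> fin_cases j <;>
    simp [expSigma3, Matrix.mul_apply, Fin.sum_univ_two, ← Complex.exp_add, add_comm]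

theorem expSigma3_mul_sigma3 (c : ℂ) : expSigma3 c * sigma3 = sigma3 * expSigma3 c := by
  ext i j
  fin_cases i <;> fin_cases j <;>
    simp [expSigma3, sigma3, Matrix.mul_apply, Fin.sum_univ_two]

namespace MaxwellBloch.IsSolution

variable {L : EReal} {n : ℝ → ℝ} {A₀ ω₀ : ℝ} {Ef : ℝ → ℝ → ℂ} {ρ : ℝ → ℝ → ℝ → ℂ}
  {Nf : ℝ → ℝ → ℝ → ℝ} (hsol : IsSolution L n A₀ ω₀ Ef ρ Nf)

include hsol

theorem fieldMatrix_eq_zero (hn : IsLineShape n) {t x : ℝ} (ht : 0 ≤ t) (htx : t < x)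
    (hxL : (x : EReal) < L) : fieldMatrix Ef t x = 0 := by
  ext i j
  fin_cases i <;> fin_cases j <;> simp [fieldMatrix, hsol.field_eq_zero hn ht htx hxL]

theorem fieldMatrix_tendsto_x (hn : IsLineShape n) {t x : ℝ} (ht : 0 ≤ t) (hx : 0 < x)
    (hxL : (x : EReal) < L) (hne : x ≠ t) :
    Tendsto (fun y => fieldMatrix Ef t y) (𝓝 x) (𝓝 (fieldMatrix Ef t x)) := by
  have hE : ContinuousAt (fun y => Ef t y) x := by
    rcases lt_or_gt_of_ne hne with h | h
    · exact (hsol.field_hasDerivAt_x (hx.trans h) hx hxL h.ne').continuousAt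
    · refine (continuousAt_const (y := (0 : ℂ))).congr ?_
      filter_upwards [Ioi_mem_nhds h, (isOpen_lt_coe L).mem_nhds hxL] with y hy hyL
      exact (hsol.field_eq_zero hn ht hy hyL).symm
  have hE' : ContinuousAt (fun y => conj (Ef t y)) x := Complex.continuous_conj.continuousAt.comp hE
  refine tendsto_pi_nhds.2 fun i => tendsto_pi_nhds.2 fun j => ?_
  show ContinuousAt (fun y => fieldMatrix Ef t y i j) x
  fin_cases i <;> fin_cases j <;> simp [fieldMatrix] <;> fun_prop

/-- Off the real line `Ψ exp (i η x σ₃)` solves the `x`-equation. Behind the front this is the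
derivative of `Ψ`; ahead of it, all matrices involved are diagonal. -/
theorem jointSol_hasDerivAt_of_im_ne_zero (hn : IsLineShape n) {t x : ℝ} (ht : 0 ≤ t) (hx : 0 < x)
    (hxL : (x : EReal) < L) (hne : x ≠ t) {z : ℂ} (hz : z.im ≠ 0) :
    HasDerivAt (fun y : ℝ => psi Ef t y z * expSigma3 (Complex.I * eta n z * y))
      (((Complex.I * z) • sigma3 + fieldMatrix Ef t x - Complex.I • cauchyMatrix n ρ Nf t x z)
        * (psi Ef t x z * expSigma3 (Complex.I * eta n z * x))) x := by
  have he := expSigma3_hasDerivAt (Complex.I * eta n z) x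
  rcases lt_or_gt_of_ne hne with h | h
  · refine ((hsol.psi_hasDerivAt_x_of_lt hn hx h hxL hz).mul he).congr_deriv ?_
    have hU : coeffU Ef t x z = -((Complex.I * z) • sigma3 + fieldMatrix Ef t x) := by
      rw [coeffU, neg_smul, neg_add, sub_eq_add_neg]
    rw [hU]
    simp only [sub_mul, neg_mul, sub_neg_eq_add, Matrix.smul_mul, neg_smul, ← Matrix.mul_assoc,
      Matrix.mul_smul, add_mul]
    abel
  · have hev : ∀ᶠ y : ℝ in 𝓝 x, psi Ef t y z * expSigma3 (Complex.I * eta n z * y)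
        = expSigma3 (-Complex.I * z * t) * expSigma3 (Complex.I * eta n z * y) := by
      filter_upwards [Ioi_mem_nhds h, (isOpen_lt_coe L).mem_nhds hxL] with y hy hyL
      rw [hsol.psi_of_le hn ht (le_of_lt hy) hyL]
    refine ((he.const_mul (expSigma3 (-Complex.I * z * t))).congr_of_eventuallyEq
      hev).congr_deriv ?_
    rw [hsol.fieldMatrix_eq_zero hn ht h hxL, hsol.cauchyMatrix_of_le hn ht h.le hx hxL,
      hsol.psi_of_le hn ht h.le hxL, add_zero]
    have e : (Complex.I * z) • sigma3 - Complex.I • -(eta n z - z) • sigma3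
        = (Complex.I * eta n z) • sigma3 := by
      rw [smul_smul, ← sub_smul]; congr 1; ring
    rw [e]
    simp only [Matrix.smul_mul, Matrix.mul_smul, ← Matrix.mul_assoc, expSigma3_mul_sigma3]

theorem tendsto_cauchyMatrix_sideValue (hn : IsLineShape n) {t x : ℝ} (ht : 0 ≤ t) (hx : 0 < x)
    (hxL : (x : EReal) < L) {σ : ℝ} (hσ : σ = 1 ∨ σ = -1) {p : ℝ} (hp : ContinuousAt n p) :
    Tendsto (cauchyMatrix n ρ Nf t x) (𝓝[openHalf σ] (p : ℂ))
      (𝓝 (sideValue σ (cauchyMatrix n ρ Nf t x) p)) := by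
  obtain ⟨A, hA⟩ := hsol.exists_tendsto_cauchyMatrix hn ht hx hxL hσ hp
  have h0 : Tendsto (fun z : ℂ => (z, x)) (𝓝[openHalf σ] (p : ℂ))
      (𝓝[openHalf σ] (p : ℂ) ×ˢ 𝓝 x) := tendsto_id.prodMk tendsto_const_nhds
  have h1 : Tendsto (cauchyMatrix n ρ Nf t x) (𝓝[openHalf σ] (p : ℂ)) (𝓝 A) := by
    have := hA.comp h0
    simpa only [Function.comp_def] using this
  have h2 : sideValue σ (cauchyMatrix n ρ Nf t x) p = A := sideValue_ofReal_eq hσ h1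
  exact h2 ▸ h1

/-- At real points the equation is obtained from the one in the half-plane: the solutions
converge, and the derivatives converge locally uniformly in `x`. -/
theorem jointSol_hasDerivAt (hn : IsLineShape n) {σ : ℝ} (hσ : σ = 1 ∨ σ = -1) {t x : ℝ}
    (ht : 0 ≤ t) (hx : 0 < x) (hxL : (x : EReal) < L) (hne : x ≠ t) {z : ℂ}
    (hz : z ∈ closedHalf n σ) :
    HasDerivAt (fun y => jointSol n Ef σ t y z)
      (coeffV n Ef ρ Nf σ t x z * jointSol n Ef σ t x z) x := by
  by_cases hi : z.im = 0
  swap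
  · simp only [jointSol, coeffV, sideValue_of_im_ne_zero σ _ hi]
    exact hsol.jointSol_hasDerivAt_of_im_ne_zero hn ht hx hxL hne hi
  obtain ⟨p, rfl⟩ : ∃ p : ℝ, (p : ℂ) = z := ⟨z.re, ofReal_re_of_im_eq_zero hi⟩
  have hp : ContinuousAt n p := by simpa using hz.2 hi
  have := openHalf_neBot hσ p
  have hη := tendsto_eta_sideValue hn hσ hp
  have hid : Tendsto (fun z : ℂ => z) (𝓝[openHalf σ] (p : ℂ)) (𝓝 (p : ℂ)) :=
    tendsto_id.mono_left nhdsWithin_le_nhds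
  have hpsi := fun (y : ℝ) (hy : 0 < y ∧ (y : EReal) < L) =>
    ((hsol.psi_differentiable ht hy.1.le hy.2).continuous.tendsto (p : ℂ)).mono_left
      (nhdsWithin_le_nhds (s := openHalf σ))
  have hexp : ∀ y : ℝ, Tendsto (fun z : ℂ => expSigma3 (Complex.I * eta n z * y))
      (𝓝[openHalf σ] (p : ℂ)) (𝓝 (expSigma3 (Complex.I * sideValue σ (eta n) p * y))) := fun y =>
    (expSigma3_continuous.tendsto _).comp ((hη.const_mul _).mul_const _)
  have hG : ∀ y : ℝ, 0 < y ∧ (y : EReal) < L → Tendsto (fun z => cauchyMatrix n ρ Nf t y z)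
      (𝓝[openHalf σ] (p : ℂ)) (𝓝 (sideValue σ (cauchyMatrix n ρ Nf t y) p)) := fun y hy =>
    hsol.tendsto_cauchyMatrix_sideValue hn ht hy.1 hy.2 hσ hp
  have hev := eventually_pos_lt_coe hx hxL
  refine hasDerivAt_of_tendstoUniformlyOnFilter (l := 𝓝[openHalf σ] (p : ℂ))
    (f := fun z y => psi Ef t y z * expSigma3 (Complex.I * eta n z * y))
    (f' := fun z y => ((Complex.I * z) • sigma3 + fieldMatrix Ef t y
      - Complex.I • cauchyMatrix n ρ Nf t y z)
        * (psi Ef t y z * expSigma3 (Complex.I * eta n z * y)))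
    (g' := fun y => coeffV n Ef ρ Nf σ t y p * jointSol n Ef σ t y p) ?_ ?_ ?_
  · obtain ⟨A, hA⟩ := hsol.exists_tendsto_cauchyMatrix hn ht hx hxL hσ hp
    refine tendstoUniformlyOnFilter_of_tendsto_prod
      (A := ((Complex.I * p) • sigma3 + fieldMatrix Ef t x - Complex.I • A)
        * (psi Ef t x p * expSigma3 (Complex.I * sideValue σ (eta n) p * x))) ?_ ?_
    · filter_upwards [hev] with y hy
      exact ((((hid.const_mul _).smul_const _).add_const _).sub ((hG y hy).const_smul _)).mul
        ((hpsi y hy).mul (hexp y))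
    · have hfst : Tendsto (fun q : ℂ × ℝ => q.1) (𝓝[openHalf σ] (p : ℂ) ×ˢ 𝓝 x) (𝓝 (p : ℂ)) :=
        hid.comp tendsto_fst
      have hH : Tendsto (fun q : ℂ × ℝ => fieldMatrix Ef t q.2) (𝓝[openHalf σ] (p : ℂ) ×ˢ 𝓝 x)
          (𝓝 (fieldMatrix Ef t x)) :=
        (hsol.fieldMatrix_tendsto_x hn ht hx hxL hne).comp tendsto_snd
      have hsnd : Tendsto (fun q : ℂ × ℝ => (q.2 : ℂ)) (𝓝[openHalf σ] (p : ℂ) ×ˢ 𝓝 x)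
          (𝓝 (x : ℂ)) := (Complex.continuous_ofReal.tendsto x).comp tendsto_snd
      have hψ := (hsol.psi_tendsto_prod hn ht hx hxL p).mono_left
        (Filter.prod_mono_left (𝓝 x) (nhdsWithin_le_nhds (s := openHalf σ) (a := (p : ℂ))))
      refine ((((hfst.const_mul _).smul_const _).add hH).sub (hA.const_smul _)).mul
        (hψ.mul ((expSigma3_continuous.tendsto _).comp
          (((hη.comp tendsto_fst).const_mul _).mul hsnd)))
  · have h1 : ∀ᶠ y in 𝓝 x, y ≠ t := isOpen_ne.mem_nhds hne
    have h2 : ∀ᶠ w in 𝓝[openHalf σ] (p : ℂ), w.im ≠ 0 :=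
      eventually_mem_nhdsWithin.mono fun w hw => im_ne_zero_of_mem_openHalf hw
    filter_upwards [h2.prod_mk (hev.and h1)] with q hq
    exact hsol.jointSol_hasDerivAt_of_im_ne_zero hn ht hq.2.1.1 hq.2.1.2 hq.2.2 hq.1
  · filter_upwards [hev] with y hy
    exact (hpsi y hy).mul (hexp y)

end MaxwellBloch.IsSolution

/-! ### The spectral functions -/

section Spectral

variable {E z : ℂ}

theorem mem_segment_conj_iff (hE : 0 < E.im) :
    z ∈ segment ℝ E (conj E) ↔ z.re = E.re ∧ |z.im| ≤ E.im := by
  constructor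
  · rintro ⟨a, b, ha, hb, hab, rfl⟩
    obtain rfl : b = 1 - a := by linarith
    refine ⟨by simp; ring, ?_⟩
    simp only [Complex.add_im, Complex.smul_im, Complex.conj_im, smul_eq_mul]
    exact abs_le.2 ⟨by nlinarith, by nlinarith⟩
  · rintro ⟨h1, h2⟩
    rw [abs_le] at h2
    refine ⟨(E.im + z.im) / (2 * E.im), (E.im - z.im) / (2 * E.im),
      div_nonneg (by linarith) (by linarith), div_nonneg (by linarith) (by linarith),
      by field_simp; ring, ?_⟩
    apply Complex.ext
    · simp only [Complex.add_re, Complex.smul_re, Complex.conj_re, smul_eq_mul, h1]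
      field_simp; ring
    · simp only [Complex.add_im, Complex.smul_im, Complex.conj_im, smul_eq_mul]
      field_simp; ring

theorem ne_of_notMem_segment (hz : z ∉ segment ℝ E (conj E)) : z ≠ E ∧ z ≠ conj E :=
  ⟨fun h => hz (h ▸ left_mem_segment ℝ _ _), fun h => hz (h ▸ right_mem_segment ℝ _ _)⟩

theorem isClosed_segment_conj (E : ℂ) : IsClosed (segment ℝ E (conj E)) := by
  rw [← convexHull_pair]
  exact ((Set.toFinite {E, conj E}).isCompact_convexHull (𝕜 := ℝ)).isClosed

/-- The imaginary part of the quotient has the sign of `Re (z - E)`. -/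
theorem quotient_im (E z : ℂ) : ((z - conj E) / (z - E)).im
    = 2 * E.im * (z.re - E.re) / Complex.normSq (z - E) := by
  rw [Complex.div_im]
  simp only [Complex.sub_re, Complex.sub_im, Complex.conj_re, Complex.conj_im]
  ring

theorem quotient_re (E z : ℂ) : ((z - conj E) / (z - E)).re
    = ((z.re - E.re) ^ 2 + (z.im ^ 2 - E.im ^ 2)) / Complex.normSq (z - E) := by
  rw [Complex.div_re]
  simp only [Complex.sub_re, Complex.sub_im, Complex.conj_re, Complex.conj_im]
  ring

theorem quotient_mem_slitPlane (hE : 0 < E.im) (hz : z ∉ segment ℝ E (conj E)) :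
    (z - conj E) / (z - E) ∈ Complex.slitPlane := by
  have h0 : 0 < Complex.normSq (z - E) :=
    Complex.normSq_pos.2 (sub_ne_zero.2 (ne_of_notMem_segment hz).1)
  rw [Complex.mem_slitPlane_iff, quotient_im, quotient_re]
  by_cases h : z.re = E.re
  · left
    refine div_pos ?_ h0
    have : E.im < |z.im| := by
      by_contra h'
      exact hz ((mem_segment_conj_iff hE).2 ⟨h, not_lt.1 h'⟩)
    have := pow_lt_pow_left₀ this hE.le two_ne_zero
    rw [sq_abs] at this
    rw [h]; linarith
  · right
    have := sub_ne_zero.2 h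
    positivity

theorem kappa_pow_four (E z : ℂ) : kappa E z ^ 4 = (z - conj E) / (z - E) := by
  rw [kappa, ← Complex.cpow_mul_nat]
  norm_num

theorem kappa_ne_zero (h1 : z ≠ E) (h2 : z ≠ conj E) : kappa E z ≠ 0 := fun h => by
  have h3 := kappa_pow_four E z
  rw [h, zero_pow four_ne_zero, eq_comm, div_eq_zero_iff] at h3
  exact h3.elim (sub_ne_zero.2 h2) (sub_ne_zero.2 h1)

theorem kappa_sq_re_nonneg (E z : ℂ) : 0 ≤ (kappa E z ^ 2).re := by
  rw [kappa, ← Complex.cpow_mul_nat]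
  norm_num
  rcases eq_or_ne ((z - conj E) / (z - E)) 0 with h | h
  · rw [h]; simp
  · rw [Complex.cpow_def_of_ne_zero h, Complex.exp_re]
    refine mul_nonneg (Real.exp_pos _).le (Real.cos_nonneg_of_mem_Icc ?_)
    have h1 := Complex.neg_pi_lt_arg ((z - conj E) / (z - E))
    have h2 := Complex.arg_le_pi ((z - conj E) / (z - E))
    have : (Complex.log ((z - conj E) / (z - E)) * (1 / 2)).im
        = ((z - conj E) / (z - E)).arg / 2 := by
      rw [show (1 / 2 : ℂ) = ((1 / 2 : ℝ) : ℂ) by norm_num, Complex.im_mul_ofReal, Complex.log_im]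
      ring
    rw [this]
    constructor <;> linarith

theorem one_le_norm_kappa_sq_add_one (E z : ℂ) : 1 ≤ ‖kappa E z ^ 2 + 1‖ := by
  refine le_trans ?_ ((le_abs_self _).trans (Complex.abs_re_le_norm _))
  have := kappa_sq_re_nonneg E z
  simpa using this

theorem kappa_sq_add_one_ne_zero (E z : ℂ) : kappa E z ^ 2 + 1 ≠ 0 := fun h => by
  have := one_le_norm_kappa_sq_add_one E z
  rw [h, norm_zero] at this
  linarith

theorem kappa_mul_aFun (h1 : z ≠ E) (h2 : z ≠ conj E) :
    2 * kappa E z * aFun E z = kappa E z ^ 2 + 1 := by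
  have := kappa_ne_zero h1 h2
  rw [aFun]; field_simp

theorem kappa_mul_bFun (h1 : z ≠ E) (h2 : z ≠ conj E) :
    2 * kappa E z * bFun E z = kappa E z ^ 2 - 1 := by
  have := kappa_ne_zero h1 h2
  rw [bFun]; field_simp

theorem aFun_ne_zero (h1 : z ≠ E) (h2 : z ≠ conj E) : aFun E z ≠ 0 := fun h => by
  have := kappa_mul_aFun h1 h2
  rw [h, mul_zero] at this
  exact kappa_sq_add_one_ne_zero E z this.symm

theorem rFun_eq (h1 : z ≠ E) (h2 : z ≠ conj E) :
    rFun E z = (kappa E z ^ 2 - 1) / (kappa E z ^ 2 + 1) := by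
  have := kappa_ne_zero h1 h2
  rw [← kappa_mul_aFun h1 h2, ← kappa_mul_bFun h1 h2, rFun, mul_div_mul_left]
  exact mul_ne_zero two_ne_zero this

/-- The principal branch has `Re κ² ≥ 0`, and `r = (κ² - 1) / (κ² + 1)`. At `E` and `Ē` the junk values
are harmless. -/
theorem norm_rFun_le_one (E z : ℂ) : ‖rFun E z‖ ≤ 1 := by
  by_cases h0 : kappa E z = 0
  · simp [rFun, bFun, aFun, h0]
  · have e : rFun E z = (kappa E z ^ 2 - 1) / (kappa E z ^ 2 + 1) := by
      have := kappa_sq_add_one_ne_zero E z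
      rw [rFun, aFun, bFun]; field_simp
    rw [e, norm_div, div_le_one (lt_of_lt_of_le one_pos (one_le_norm_kappa_sq_add_one E z))]
    rw [← sq_le_sq₀ (norm_nonneg _) (norm_nonneg _), ← Complex.normSq_eq_norm_sq,
      ← Complex.normSq_eq_norm_sq, Complex.normSq_apply, Complex.normSq_apply]
    have := kappa_sq_re_nonneg E z
    simp only [Complex.sub_re, Complex.add_re, Complex.one_re, Complex.sub_im, Complex.add_im,
      Complex.one_im]
    nlinarith

theorem kappa_sq_sub_one_mul (h1 : z ≠ E) :
    (kappa E z ^ 2 - 1) * (kappa E z ^ 2 + 1) = 2 * E.im * Complex.I / (z - E) := by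
  have h := kappa_pow_four E z
  have h3 := sub_ne_zero.2 h1
  calc (kappa E z ^ 2 - 1) * (kappa E z ^ 2 + 1) = kappa E z ^ 4 - 1 := by ring
    _ = _ := by
      rw [h, div_sub_one h3]
      congr 1
      apply Complex.ext <;> simp; ring

theorem norm_kappa_sq_sub_one_le (hE : 0 < E.im) (h1 : z ≠ E) :
    ‖kappa E z ^ 2 - 1‖ ≤ 2 * E.im / ‖z - E‖ := by
  have h := congrArg norm (kappa_sq_sub_one_mul h1)
  have h2 := one_le_norm_kappa_sq_add_one E z
  rw [norm_mul, norm_div] at h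
  have h3 : ‖(2 * E.im * Complex.I : ℂ)‖ = 2 * E.im := by
    simp [abs_of_pos hE]
  rw [h3] at h
  rw [← h]
  exact le_mul_of_one_le_right (norm_nonneg _) h2

theorem norm_rFun_le (hE : 0 < E.im) (h1 : z ≠ E) (h2 : z ≠ conj E) :
    ‖rFun E z‖ ≤ 2 * E.im / ‖z - E‖ := by
  rw [rFun_eq h1 h2, norm_div]
  exact (div_le_self (norm_nonneg _) (one_le_norm_kappa_sq_add_one E z)).trans
    (norm_kappa_sq_sub_one_le hE h1)

theorem sub_wFun_mul_aFun (h1 : z ≠ E) (h2 : z ≠ conj E) :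
    Complex.I * (z - E.re - wFun E z) * aFun E z = -E.im * bFun E z := by
  have h0 := kappa_ne_zero h1 h2
  have hk : kappa E z ^ 4 * (z - E) = z - conj E := by
    rw [kappa_pow_four, div_mul_cancel₀ _ (sub_ne_zero.2 h1)]
  have hE : E = E.re + E.im * Complex.I := (Complex.re_add_im E).symm
  have hE' : conj E = E.re - E.im * Complex.I := by
    apply Complex.ext <;> simp
  rw [hE'] at hk
  refine mul_left_cancel₀ (mul_ne_zero two_ne_zero h0) ?_
  have ha := kappa_mul_aFun h1 h2
  have hb := kappa_mul_bFun h1 h2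
  have hE1 : (E.re : ℂ) = E - E.im * Complex.I := by linear_combination -hE
  rw [wFun]
  rw [hE1] at hk ⊢
  linear_combination (Complex.I * (z - (E - E.im * Complex.I) - (z - E) * kappa E z ^ 2)) * ha
    + E.im * hb - Complex.I * hk + E.im * (kappa E z ^ 2 - 1) * Complex.I_sq

theorem add_wFun_mul_bFun (h1 : z ≠ E) (h2 : z ≠ conj E) :
    Complex.I * (z - E.re + wFun E z) * bFun E z = -E.im * aFun E z := by
  have h0 := kappa_ne_zero h1 h2
  have hk : kappa E z ^ 4 * (z - E) = z - conj E := by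
    rw [kappa_pow_four, div_mul_cancel₀ _ (sub_ne_zero.2 h1)]
  have hE : E = E.re + E.im * Complex.I := (Complex.re_add_im E).symm
  have hE' : conj E = E.re - E.im * Complex.I := by
    apply Complex.ext <;> simp
  rw [hE'] at hk
  refine mul_left_cancel₀ (mul_ne_zero two_ne_zero h0) ?_
  have ha := kappa_mul_aFun h1 h2
  have hb := kappa_mul_bFun h1 h2
  have hE1 : (E.re : ℂ) = E - E.im * Complex.I := by linear_combination -hE
  rw [wFun]
  rw [hE1] at hk ⊢
  linear_combination (Complex.I * (z - (E - E.im * Complex.I) + (z - E) * kappa E z ^ 2)) * hb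
    + E.im * ha + Complex.I * hk + E.im * (kappa E z ^ 2 + 1) * Complex.I_sq

theorem kappa_differentiableAt (hE : 0 < E.im) (hz : z ∉ segment ℝ E (conj E)) :
    DifferentiableAt ℂ (kappa E) z := by
  refine DifferentiableAt.cpow_const ?_ (quotient_mem_slitPlane hE hz)
  exact (differentiableAt_id.sub_const _).div (differentiableAt_id.sub_const _)
    (sub_ne_zero.2 (ne_of_notMem_segment hz).1)

theorem aFun_differentiableAt (hE : 0 < E.im) (hz : z ∉ segment ℝ E (conj E)) :
    DifferentiableAt ℂ (aFun E) z := by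
  have h := kappa_differentiableAt hE hz
  have h0 := kappa_ne_zero (ne_of_notMem_segment hz).1 (ne_of_notMem_segment hz).2
  exact (h.add (h.inv h0)).div_const _

theorem bFun_differentiableAt (hE : 0 < E.im) (hz : z ∉ segment ℝ E (conj E)) :
    DifferentiableAt ℂ (bFun E) z := by
  have h := kappa_differentiableAt hE hz
  have h0 := kappa_ne_zero (ne_of_notMem_segment hz).1 (ne_of_notMem_segment hz).2
  exact (h.sub (h.inv h0)).div_const _

theorem rFun_differentiableAt (hE : 0 < E.im) (hz : z ∉ segment ℝ E (conj E)) :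
    DifferentiableAt ℂ (rFun E) z :=
  (bFun_differentiableAt hE hz).div (aFun_differentiableAt hE hz)
    (aFun_ne_zero (ne_of_notMem_segment hz).1 (ne_of_notMem_segment hz).2)

theorem kappa_conj (hE : 0 < E.im) (hz : z ∉ segment ℝ E (conj E)) :
    kappa E (conj z) = conj (kappa E z)⁻¹ := by
  have h1 := quotient_mem_slitPlane hE hz
  have h2 : (conj z - conj E) / (conj z - E) = conj ((z - conj E) / (z - E))⁻¹ := by
    simp
  have h3 : ((z - conj E) / (z - E)).arg ≠ Real.pi := Complex.slitPlane_arg_ne_pi h1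
  rw [kappa, kappa, h2, map_inv₀, Complex.inv_cpow _ _ ?_, Complex.conj_cpow _ _ h3, map_inv₀]
  · rw [map_div₀, map_one, map_ofNat]
  · rw [Complex.arg_conj, if_neg h3]
    have := Complex.neg_pi_lt_arg ((z - conj E) / (z - E))
    exact fun h => by linarith

theorem rFun_conj (hE : 0 < E.im) (hz : z ∉ segment ℝ E (conj E)) :
    rFun E (conj z) = -conj (rFun E z) := by
  have h1 := ne_of_notMem_segment hz
  have h0 := kappa_ne_zero h1.1 h1.2
  rw [rFun, rFun, aFun, bFun, aFun, bFun, kappa_conj hE hz]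
  simp only [map_inv₀, map_div₀, map_add, map_sub, inv_inv, map_ofNat]
  rw [← neg_div, add_comm]
  congr 1
  ring

theorem kappa_sq_eq_exp (h1 : z ≠ E) (h2 : z ≠ conj E) :
    kappa E z ^ 2 = Complex.exp (Complex.log ((z - conj E) / (z - E)) / 2) := by
  have h : (z - conj E) / (z - E) ≠ 0 := div_ne_zero (sub_ne_zero.2 h2) (sub_ne_zero.2 h1)
  rw [kappa, ← Complex.cpow_mul_nat, Complex.cpow_def_of_ne_zero h]
  congr 1
  push_cast
  ring

theorem quotient_tendsto_segment {ζ : ℂ} (hre : ζ.re = E.re) (him : |ζ.im| < E.im) :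
    Tendsto (fun z => (z - conj E) / (z - E)) (𝓝 ζ)
      (𝓝 (-(((E.im + ζ.im) / (E.im - ζ.im) : ℝ) : ℂ))) := by
  have him := abs_lt.1 him
  have hne : ζ - E ≠ 0 := fun h => by
    have := congrArg Complex.im h
    simp at this
    linarith
  have h : Tendsto (fun z => (z - conj E) / (z - E)) (𝓝 ζ) (𝓝 ((ζ - conj E) / (ζ - E))) := by
    have : ContinuousAt (fun z => (z - conj E) / (z - E)) ζ :=
      ContinuousAt.div (by fun_prop) (by fun_prop) hne
    exact this
  have h4 : E.im - ζ.im ≠ 0 := by linarith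
  have e : (ζ - conj E) / (ζ - E) = -(((E.im + ζ.im) / (E.im - ζ.im) : ℝ) : ℂ) := by
    have e1 : ζ - conj E = ((E.im + ζ.im : ℝ) : ℂ) * Complex.I := by
      apply Complex.ext <;> simp [hre, add_comm]
    have e2 : ζ - E = -((E.im - ζ.im : ℝ) : ℂ) * Complex.I := by
      apply Complex.ext <;> simp [hre]
    rw [e1, e2, mul_div_mul_right _ _ Complex.I_ne_zero, div_neg, Complex.ofReal_div]
  rwa [e] at h

/-- The boundary values of the reflection coefficient on the two sides `τ = ±1` of the cut. -/
theorem rFun_tendsto_segment (hE : 0 < E.im) {ζ : ℂ} (hre : ζ.re = E.re) (him : |ζ.im| < E.im)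
    {τ : ℝ} (hτ : τ = 1 ∨ τ = -1) :
    Tendsto (rFun E) (𝓝[{z | 0 < τ * (z.re - E.re)}] ζ)
      (𝓝 ((τ * Complex.I * √((E.im + ζ.im) / (E.im - ζ.im)) - 1)
        / (τ * Complex.I * √((E.im + ζ.im) / (E.im - ζ.im)) + 1))) := by
  have him' := abs_lt.1 him
  set Q : ℝ := (E.im + ζ.im) / (E.im - ζ.im) with hQ
  have hQ0 : 0 < Q := div_pos (by linarith) (by linarith)
  have hq := quotient_tendsto_segment hre him
  rw [← hQ] at hq
  have hne : ∀ᶠ z in 𝓝[{z | 0 < τ * (z.re - E.re)}] ζ, z ≠ E ∧ z ≠ conj E := by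
    filter_upwards [self_mem_nhdsWithin] with z hz
    have hz : 0 < τ * (z.re - E.re) := hz
    constructor <;> rintro rfl <;> simp at hz
  have hlog : Tendsto (fun z => Complex.log ((z - conj E) / (z - E)))
      (𝓝[{z | 0 < τ * (z.re - E.re)}] ζ) (𝓝 (Real.log Q + τ * Real.pi * Complex.I)) := by
    have hr : (-(Q : ℂ)).re < 0 := by simpa using hQ0
    have hi : (-(Q : ℂ)).im = 0 := by simp
    have hn : ‖(-(Q : ℂ))‖ = Q := by rw [norm_neg, Complex.norm_real, Real.norm_of_nonneg hQ0.le]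
    have him2 : ∀ z ∈ {z : ℂ | 0 < τ * (z.re - E.re)}, z ≠ E → 0 < τ * ((z - conj E) / (z - E)).im := by
      intro z hz h
      have hz : 0 < τ * (z.re - E.re) := hz
      rw [quotient_im, mul_div_assoc', mul_left_comm]
      have := Complex.normSq_pos.2 (sub_ne_zero.2 h)
      positivity
    rcases hτ with rfl | rfl
    · have h1 := (Complex.continuousWithinAt_log_of_re_neg_of_im_zero hr hi).tendsto
      have h2 : Complex.log (-(Q : ℂ)) = Real.log Q + (1 : ℝ) * Real.pi * Complex.I := by
        rw [Complex.log, hn, ← Complex.ofReal_neg, Complex.arg_ofReal_of_neg (neg_lt_zero.2 hQ0)]; simp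
      rw [h2] at h1
      refine h1.comp (tendsto_nhdsWithin_iff.2 ⟨hq.mono_left nhdsWithin_le_nhds, ?_⟩)
      filter_upwards [self_mem_nhdsWithin, hne] with z hz hz'
      have := him2 z hz hz'.1
      rw [one_mul] at this
      exact this.le
    · have h1 := Complex.tendsto_log_nhdsWithin_im_neg_of_re_neg_of_im_zero hr hi
      have h2 : (Real.log ‖(-(Q : ℂ))‖ - Real.pi * Complex.I : ℂ)
          = Real.log Q + (-1 : ℝ) * Real.pi * Complex.I := by
        rw [hn]; push_cast; ring
      rw [h2] at h1
      refine h1.comp (tendsto_nhdsWithin_iff.2 ⟨hq.mono_left nhdsWithin_le_nhds, ?_⟩)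
      filter_upwards [self_mem_nhdsWithin, hne] with z hz hz'
      have := him2 z hz hz'.1
      show ((z - conj E) / (z - E)).im < 0
      linarith
  have hκ : Tendsto (fun z => kappa E z ^ 2) (𝓝[{z | 0 < τ * (z.re - E.re)}] ζ)
      (𝓝 (τ * Complex.I * √Q)) := by
    have h1 := (Complex.continuous_exp.tendsto _).comp (hlog.div_const 2)
    have h2 : Complex.exp ((Real.log Q + τ * Real.pi * Complex.I) / 2) = τ * Complex.I * √Q := by
      rw [add_div, Complex.exp_add]
      have e1 : Complex.exp ((Real.log Q : ℂ) / 2) = √Q := by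
        rw [← Complex.ofReal_ofNat, ← Complex.ofReal_div, ← Complex.ofReal_exp,
          Real.sqrt_eq_rpow, Real.rpow_def_of_pos hQ0]
        congr 2; ring
      have e2 : Complex.exp (τ * Real.pi * Complex.I / 2) = τ * Complex.I := by
        rcases hτ with rfl | rfl
        · rw [Complex.ofReal_one, one_mul, one_mul, show (Real.pi * Complex.I / 2 : ℂ)
            = Real.pi / 2 * Complex.I by ring, Complex.exp_pi_div_two_mul_I]
        · rw [show (((-1 : ℝ) : ℂ) * Real.pi * Complex.I / 2 : ℂ)
            = -(Real.pi / 2 * Complex.I) by push_cast; ring, Complex.exp_neg,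
            Complex.exp_pi_div_two_mul_I, Complex.inv_I]
          push_cast; ring
      rw [e1, e2]; ring
    rw [h2] at h1
    exact h1.congr' (hne.mono fun z hz => (kappa_sq_eq_exp hz.1 hz.2).symm)
  have hden : (τ * Complex.I * √Q + 1 : ℂ) ≠ 0 := fun h => by
    have := congrArg Complex.re h
    simp at this
  exact ((hκ.sub_const 1).div (hκ.add_const 1) hden).congr'
    (hne.mono fun z hz => (rFun_eq hz.1 hz.2).symm)

/-- The jump of the reflection coefficient across the cut. -/
theorem hFun_eq_sub (hE : 0 < E.im) {ζ : ℂ} (him : |ζ.im| < E.im) :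
    hFun E ζ = (((-1 : ℝ) : ℂ) * Complex.I * √((E.im + ζ.im) / (E.im - ζ.im)) - 1)
        / (((-1 : ℝ) : ℂ) * Complex.I * √((E.im + ζ.im) / (E.im - ζ.im)) + 1)
      - (((1 : ℝ) : ℂ) * Complex.I * √((E.im + ζ.im) / (E.im - ζ.im)) - 1)
        / (((1 : ℝ) : ℂ) * Complex.I * √((E.im + ζ.im) / (E.im - ζ.im)) + 1) := by
  have him' := abs_lt.1 him
  set m := E.im
  set v := ζ.im
  have hm : 0 < m - v := by linarith
  have hp : 0 < m + v := by linarith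
  set S : ℝ := √((m + v) / (m - v)) with hS
  have hS2 : S ^ 2 * (m - v) = m + v := by
    rw [hS, Real.sq_sqrt (div_pos hp hm).le, div_mul_cancel₀ _ hm.ne']
  have hsq : √(m ^ 2 - v ^ 2) = S * (m - v) := by
    rw [show m ^ 2 - v ^ 2 = (S * (m - v)) ^ 2 by rw [mul_pow]; linear_combination -(m - v) * hS2]
    exact Real.sqrt_sq (mul_nonneg (Real.sqrt_nonneg _) hm.le)
  have hd : ∀ τ : ℝ, (τ * Complex.I * S + 1 : ℂ) ≠ 0 := fun τ h => by
    have := congrArg Complex.re h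
    simp at this
  have hS2' : (S : ℂ) ^ 2 * (m - v) = m + v := by exact_mod_cast hS2
  have hm' : (m : ℂ) ≠ 0 := Complex.ofReal_ne_zero.2 hE.ne'
  rw [hFun, hsq, div_sub_div _ _ (hd _) (hd _), div_eq_div_iff hm' (mul_ne_zero (hd _) (hd _))]
  push_cast
  linear_combination (-2 * Complex.I * S) * hS2'
    + (2 * Complex.I * S ^ 3 * (m - v)) * Complex.I_sq

end Spectral

/-! ### Basic solutions -/

theorem specPoint_re (A₀ ω₀ : ℝ) : (specPoint A₀ ω₀).re = -ω₀ / 2 := rfl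

theorem specPoint_im (A₀ ω₀ : ℝ) : (specPoint A₀ ω₀).im = A₀ / 2 := rfl

/-- The value at `t = 0` of the solution of the `t`-equation at `x = 0`. -/
noncomputable def connection (E z : ℂ) : Mat2 := !![aFun E z, bFun E z; bFun E z, aFun E z]

/-- The imaginary part of a Cauchy integral of a nonnegative density has the sign of `Im z`. -/
theorem mul_im_le_mul_eta_im {n : ℝ → ℝ} (hn : IsLineShape n) {σ : ℝ} {z : ℂ}
    (hz : z ∈ openHalf σ) : σ * z.im ≤ σ * (eta n z).im := by
  have him := im_ne_zero_of_mem_openHalf hz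
  have hz : 0 < σ * z.im := hz
  have hint : Integrable fun s : ℝ => (n s : ℂ) / ((s : ℂ) - z) := by
    simpa using cauchy_kernel_integrable hn.integrable hn.1 (f := fun _ => 1)
      aestronglyMeasurable_const (C := 1) (by simp) him
  have h1 : (eta n z).im = z.im * (1 + 1 / 4 * ∫ s : ℝ, n s / Complex.normSq ((s : ℂ) - z)) := by
    have h2 : (∫ s : ℝ, (n s : ℂ) / ((s : ℂ) - z)).im
        = z.im * ∫ s : ℝ, n s / Complex.normSq ((s : ℂ) - z) := by
      rw [← integral_const_mul]
      refine (integral_im hint).symm.trans (integral_congr_ae (ae_of_all _ fun s => ?_))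
      show ((n s : ℂ) / ((s : ℂ) - z)).im = _
      rw [Complex.div_im]
      simp
      ring
    rw [eta, Complex.add_im, show (1 / 4 : ℂ) = ((1 / 4 : ℝ) : ℂ) by norm_num, Complex.im_ofReal_mul,
      h2]
    ring
  rw [h1, ← mul_assoc]
  refine le_mul_of_one_le_right hz.le (le_add_of_nonneg_right (mul_nonneg (by norm_num)
    (integral_nonneg fun s => div_nonneg (hn.1 s) (Complex.normSq_nonneg _))))

theorem eta_im_mul_nonneg {n : ℝ → ℝ} (hn : IsLineShape n) {σ : ℝ} {z : ℂ} (hz : z ∈ openHalf σ) :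
    0 ≤ σ * (eta n z).im :=
  (show 0 < σ * z.im from hz).le.trans (mul_im_le_mul_eta_im hn hz)

theorem comap_coe_nhdsWithin_neBot {L : EReal} (hL : 0 < L) :
    (comap (fun x : ℝ => (x : EReal)) (𝓝[<] L)).NeBot := by
  rw [comap_neBot_iff]
  intro s hs
  obtain ⟨l, hl, hs⟩ := (mem_nhdsLT_iff_exists_Ioo_subset' hL).1 hs
  obtain ⟨x, h1, h2⟩ := EReal.lt_iff_exists_real_btwn.1 (show l < L from hl)
  exact ⟨x, hs ⟨h1, h2⟩⟩

theorem eventually_comap_coe {L : EReal} (hL : 0 < L) :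
    ∀ᶠ x : ℝ in comap (fun x : ℝ => (x : EReal)) (𝓝[<] L), 0 < x ∧ (x : EReal) < L := by
  refine mem_of_superset (preimage_mem_comap (Ioo_mem_nhdsLT hL)) fun x hx => ⟨?_, hx.2⟩
  exact EReal.coe_lt_coe_iff.1 (by simpa using hx.1)

theorem connection_differentiableAt {E z : ℂ} (hE : 0 < E.im) (hz : z ∉ segment ℝ E (conj E)) :
    DifferentiableAt ℂ (connection E) z := by
  have ha := aFun_differentiableAt hE hz
  have hb := bFun_differentiableAt hE hz
  refine differentiableAt_pi.2 fun i => differentiableAt_pi.2 fun j => ?_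
  fin_cases i <;> fin_cases j <;> simp [connection] <;> assumption

namespace MaxwellBloch.IsSolution

variable {L : EReal} {n : ℝ → ℝ} {A₀ ω₀ : ℝ} {Ef : ℝ → ℝ → ℂ} {ρ : ℝ → ℝ → ℝ → ℂ}
  {Nf : ℝ → ℝ → ℝ → ℝ} (hsol : IsSolution L n A₀ ω₀ Ef ρ Nf)

include hsol

/-- At `x = 0` the field is `A₀ exp (i ω₀ t)`, and the equation reduces to the relations
`i (z - Re E - w) a = -Im E b` and `i (z - Re E + w) b = -Im E a`. -/
theorem backgroundPhi_hasDerivAt {t : ℝ} (ht : 0 < t) {z : ℂ} (h1 : z ≠ specPoint A₀ ω₀)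
    (h2 : z ≠ conj (specPoint A₀ ω₀)) :
    HasDerivAt (fun t => backgroundPhi (specPoint A₀ ω₀) t z)
      (coeffU Ef t 0 z * backgroundPhi (specPoint A₀ ω₀) t z) t := by
  set E := specPoint A₀ ω₀ with hE
  have hd := ((expSigma3_hasDerivAt (-Complex.I * (E.re : ℂ)) t).mul_const
    (!![aFun E z, bFun E z; bFun E z, aFun E z] : Mat2)).mul
    (expSigma3_hasDerivAt (-Complex.I * wFun E z) t)
  refine hd.congr_deriv ?_
  have ha := sub_wFun_mul_aFun h1 h2
  have hb := add_wFun_mul_bFun h1 h2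
  set u := Complex.exp (-Complex.I * (E.re : ℂ) * t) with hu
  set u' := Complex.exp (-(-Complex.I * (E.re : ℂ) * t)) with hu'
  set v := Complex.exp (-Complex.I * wFun E z * t) with hv
  set v' := Complex.exp (-(-Complex.I * wFun E z * t)) with hv'
  have huu : u * u' = 1 := by rw [hu, hu', ← Complex.exp_add, add_neg_cancel, Complex.exp_zero]
  have hm : (A₀ : ℂ) = 2 * E.im := by
    rw [hE, specPoint_im]; push_cast; ring
  have hR : (ω₀ : ℂ) = -2 * E.re := by
    rw [hE, specPoint_re]; push_cast; ring
  have hf : Ef t 0 = 2 * E.im * u ^ 2 := by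
    rw [hsol.field_boundary t ht, hm, hu, ← Complex.exp_nat_mul, hR]
    congr 2; push_cast; ring
  have hf' : conj (Ef t 0) = 2 * E.im * u' ^ 2 := by
    rw [hf, map_mul, map_mul, map_ofNat, map_pow, hu, ← Complex.exp_conj, hu']
    simp
  ext i j
  simp only [backgroundPhi, expSigma3, sigma3, coeffU_eq, hf']
  simp only [hf]
  rw [← hu, ← hu', ← hv, ← hv']
  clear_value u u' v v'
  fin_cases i <;> fin_cases j <;>
    simp [Matrix.mul_apply, Fin.sum_univ_two, Matrix.add_apply]
  · linear_combination (u * v) * ha + (E.im * u * bFun E z * v) * huu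
  · linear_combination (u * v') * hb + (E.im * u * aFun E z * v') * huu
  · linear_combination (-u' * v) * hb - (E.im * u' * aFun E z * v) * huu
  · linear_combination (-u' * v') * ha - (E.im * u' * bFun E z * v') * huu

/-- The solution at `x = 0` is the propagator applied to its initial value. -/
theorem backgroundPhi_eq (hL : 0 < L) {t : ℝ} (ht : 0 ≤ t) {z : ℂ} (h1 : z ≠ specPoint A₀ ω₀)
    (h2 : z ≠ conj (specPoint A₀ ω₀)) : backgroundPhi (specPoint A₀ ω₀) t z
      = psi Ef t 0 z * connection (specPoint A₀ ω₀) z := by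
  have hL' : ((0 : ℝ) : EReal) < L := by simpa using hL
  obtain ⟨C, hC0, hC⟩ := hsol.field_bound t hL'
  refine eq_of_linear_deriv (A := fun t => coeffU Ef t 0 z) (M := ‖z‖ + C / 2)
    (f := fun t => backgroundPhi (specPoint A₀ ω₀) t z)
    (g := fun t => psi Ef t 0 z * connection (specPoint A₀ ω₀) z) 0 ht ?_ ?_ ?_ ?_ ?_ ?_
  · refine Continuous.continuousOn ?_
    refine ((expSigma3_continuous.comp (by fun_prop)).mul continuous_const).mul
      (expSigma3_continuous.comp (by fun_prop))
  · exact ((hsol.psi_continuousOn le_rfl hL' z).mono fun s hs => hs.1).mul continuousOn_const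
  · exact fun s hs _ => hsol.backgroundPhi_hasDerivAt hs.1 h1 h2
  · intro s hs hne
    rw [← mul_assoc]
    exact (hsol.psi_hasDerivAt hs.1 le_rfl hL' hne z).mul_const _
  · intro s hs hne
    refine (norm_coeffU_le _ _ _ _).trans ?_
    have := hC s 0 hs.1 hs.2.le le_rfl le_rfl hne
    linarith
  · simp only [backgroundPhi, hsol.psi_zero le_rfl hL', connection, Complex.ofReal_zero, mul_zero,
      expSigma3_zero, one_mul, mul_one]

theorem jointSol_continuousOn_x (hn : IsLineShape n) {t : ℝ} (ht : 0 ≤ t) (σ : ℝ) (z : ℂ) :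
    ContinuousOn (fun x => jointSol n Ef σ t x z) {x : ℝ | 0 ≤ x ∧ (x : EReal) < L} :=
  (hsol.psi_continuousOn_x hn ht z).mul
    (expSigma3_continuous.comp (by fun_prop : Continuous fun x : ℝ =>
      Complex.I * sideValue σ (eta n) z * x)).continuousOn

theorem jointSol_continuousOn_t {x : ℝ} (hx : 0 ≤ x) (hxL : (x : EReal) < L) (σ : ℝ) (z : ℂ) :
    ContinuousOn (fun t => jointSol n Ef σ t x z) (Ici 0) :=
  (hsol.psi_continuousOn hx hxL z).mul continuousOn_const

theorem jointSol_hasDerivAt_t {t x : ℝ} (ht : 0 < t) (hx : 0 ≤ x) (hxL : (x : EReal) < L)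
    (hne : t ≠ x) (σ : ℝ) (z : ℂ) : HasDerivAt (fun t => jointSol n Ef σ t x z)
      (coeffU Ef t x z * jointSol n Ef σ t x z) t := by
  simp only [jointSol, ← mul_assoc]
  exact (hsol.psi_hasDerivAt ht hx hxL hne z).mul_const _

theorem jointSol_differentiableOn (hn : IsLineShape n) {t x : ℝ} (ht : 0 ≤ t) (hx : 0 ≤ x)
    (hxL : (x : EReal) < L) (σ : ℝ) :
    DifferentiableOn ℂ (fun z => jointSol n Ef σ t x z) (openHalf σ) := by
  have h1 : DifferentiableOn ℂ (fun z => psi Ef t x z * expSigma3 (Complex.I * eta n z * x))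
      (openHalf σ) := by
    refine (hsol.psi_differentiable ht hx hxL).differentiableOn.mul fun z hz => ?_
    have h2 := (((eta_differentiableAt hn (im_ne_zero_of_mem_openHalf hz)).const_mul
      Complex.I).mul_const (x : ℂ))
    refine (differentiableAt_pi.2 fun i => differentiableAt_pi.2 fun j => ?_).differentiableWithinAt
    exact ((expSigma3_differentiable i j).differentiableAt (x := Complex.I * eta n z * x)).comp z h2
  refine h1.congr fun z hz => ?_
  rw [jointSol, sideValue_of_im_ne_zero σ _ (im_ne_zero_of_mem_openHalf hz)]

theorem jointSol_continuousOn (hn : IsLineShape n) {t x : ℝ} (ht : 0 ≤ t) (hx : 0 ≤ x)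
    (hxL : (x : EReal) < L) {σ : ℝ} (hσ : σ = 1 ∨ σ = -1) :
    ContinuousOn (jointSol n Ef σ t x) (closedHalf n σ) := by
  refine (hsol.psi_differentiable ht hx hxL).continuous.continuousOn.mul ?_
  exact expSigma3_continuous.comp_continuousOn
    ((continuousOn_const.mul (sideValue_eta_continuousOn hn hσ)).mul continuousOn_const)

/-- For `t = 0` the solution is `exp (i η x σ₃)`, so the normalization at `x = L` holds trivially. -/
theorem jointSol_isBasicZ (hn : IsLineShape n) {σ : ℝ} (hσ : σ = 1 ∨ σ = -1) :
    IsBasicZ L n Ef ρ Nf σ (jointSol n Ef σ) where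
  factor := by
    refine ⟨psi Ef, fun x z => expSigma3 (Complex.I * sideValue σ (eta n) z * x),
      fun z hz => ⟨fun x hx hxL => ⟨hsol.psi_zero hx.le hxL z, hsol.psi_continuousOn hx.le hxL z,
        fun t ht hne => hasMatDerivAt_iff.2 (hsol.psi_hasDerivAt ht hx.le hxL hne z), ?_, fun t _ => rfl⟩, ?_⟩⟩
    · have h0 : ∀ y : ℝ, 0 < y → (y : EReal) < L → jointSol n Ef σ 0 y z
          = expSigma3 (Complex.I * sideValue σ (eta n) z * y) := fun y hy hyL => by
        rw [jointSol, hsol.psi_zero hy.le hyL, one_mul]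
      have h := hsol.jointSol_hasDerivAt hn hσ le_rfl hx hxL hx.ne' hz
      rw [h0 x hx hxL] at h
      refine hasMatDerivAt_iff.2 (h.congr_of_eventuallyEq ?_)
      filter_upwards [eventually_pos_lt_coe hx hxL] with y hy
      exact (h0 y hy.1 hy.2).symm
    · refine tendsto_const_nhds.congr fun x => ?_
      rw [expSigma3_mul, ← add_mul, neg_mul, add_neg_cancel, zero_mul, expSigma3_zero]
  x_eq t ht z hz := ⟨(hsol.jointSol_continuousOn_x hn ht σ z).mono fun x hx => ⟨hx.1.le, hx.2⟩,
    fun x hx hxL hne =>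
      hasMatDerivAt_iff.2 (hsol.jointSol_hasDerivAt hn hσ ht hx hxL hne hz)⟩
  analytic t x ht hx hxL i j := fun z hz =>
    differentiableWithinAt_pi.1 (differentiableWithinAt_pi.1
      (hsol.jointSol_differentiableOn hn ht hx.le hxL σ z hz) i) j
  continuous t x ht hx hxL := hsol.jointSol_continuousOn hn ht hx.le hxL hσ

/-- The solution is normalized at `x = 0` by right multiplication with `Ψ(t,0,z)⁻¹`, and the
background solution is `Ψ(t,0,z) (a b; b a)`. -/
theorem jointSol_isBasicY (hL : 0 < L) (hA₀ : 0 < A₀) (hn : IsLineShape n) {σ : ℝ}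
    (hσ : σ = 1 ∨ σ = -1) : IsBasicY L n (specPoint A₀ ω₀) Ef ρ Nf σ
      fun t x z => jointSol n Ef σ t x z * connection (specPoint A₀ ω₀) z where
  factor := by
    have hL' : ((0 : ℝ) : EReal) < L := by simpa using hL
    refine ⟨fun t x z => jointSol n Ef σ t x z * (psi Ef t 0 z).adjugate,
      fun t ht z hz => ⟨?_, ?_, fun x hx hxL hne => ?_, fun x hx hxL => ?_⟩⟩
    · simp only [jointSol, Complex.ofReal_zero, mul_zero, expSigma3_zero, mul_one]
      exact hsol.psi_mul_adjugate ht le_rfl hL' z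
    · exact (hsol.jointSol_continuousOn_x hn ht σ z).mul continuousOn_const
    · simp only [← mul_assoc]
      exact hasMatDerivAt_iff.2 ((hsol.jointSol_hasDerivAt hn hσ ht hx hxL hne hz.1).mul_const _)
    · have hE : 0 < (specPoint A₀ ω₀).im := by rw [specPoint_im]; linarith
      have h1 : z ≠ specPoint A₀ ω₀ := fun h => hz.2 ⟨h ▸ left_mem_segment ℝ _ _, fun h' => by
        have := congrArg Complex.im (h.symm.trans h')
        rw [Complex.ofReal_im] at this; linarith⟩
      have h2 : z ≠ conj (specPoint A₀ ω₀) := fun h =>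
        hz.2 ⟨h ▸ right_mem_segment ℝ _ _, fun h' => by
          have := congrArg Complex.im (h.symm.trans h')
          rw [Complex.ofReal_im, Complex.conj_im] at this; linarith⟩
      rw [hsol.backgroundPhi_eq hL ht h1 h2, mul_assoc (jointSol n Ef σ t x z),
        ← mul_assoc _ (psi Ef t 0 z), hsol.adjugate_mul_psi ht le_rfl hL', one_mul]
  t_eq x hx hxL z hz := by
    refine ⟨(hsol.jointSol_continuousOn_t hx.le hxL σ z).mul continuousOn_const,
      fun t ht hne => ?_⟩
    simp only [← mul_assoc]
    exact hasMatDerivAt_iff.2 ((hsol.jointSol_hasDerivAt_t ht hx.le hxL hne σ z).mul_const _)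
  analytic t x ht hx hxL i j := fun z hz => by
    have hE : 0 < (specPoint A₀ ω₀).im := by rw [specPoint_im]; linarith
    have h := (((hsol.jointSol_differentiableOn hn ht hx.le hxL σ).mono sdiff_subset) z hz).mul
      (connection_differentiableAt hE hz.2).differentiableWithinAt
    exact differentiableWithinAt_pi.1 (differentiableWithinAt_pi.1 h i) j
  continuous t x ht hx hxL := by
    have hE : 0 < (specPoint A₀ ω₀).im := by rw [specPoint_im]; linarith
    exact ((hsol.jointSol_continuousOn hn ht hx.le hxL hσ).mono sdiff_subset).mul fun z hz =>
      (connection_differentiableAt hE hz.2).continuousAt.continuousWithinAt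

end MaxwellBloch.IsSolution

/-! ### Uniqueness of the relevant columns of basic solutions -/

/-- The explicit form of the matrix built from the basic solutions. -/
noncomputable def rhSolution (n : ℝ → ℝ) (E : ℂ) (Ef : ℝ → ℝ → ℂ) (t x : ℝ) (z : ℂ) : Mat2 :=
  psi Ef t x z * expSigma3 (Complex.I * z * t) *
    if 0 < z.im then !![1, rFun E z * Complex.exp (-2 * Complex.I * theta n t x z); 0, 1]
    else !![1, 0; rFun E z * Complex.exp (2 * Complex.I * theta n t x z), 1]

namespace MaxwellBloch.IsSolution

variable {L : EReal} {n : ℝ → ℝ} {A₀ ω₀ : ℝ} {Ef : ℝ → ℝ → ℂ} {ρ : ℝ → ℝ → ℝ → ℂ}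
  {Nf : ℝ → ℝ → ℝ → ℝ} (hsol : IsSolution L n A₀ ω₀ Ef ρ Nf)

include hsol

/-- At `t = 0` the medium is at rest, and the `x`-equation is diagonal. -/
theorem coeffV_zero_eq (hn : IsLineShape n) {σ x : ℝ} (hx : 0 < x) (hxL : (x : EReal) < L) {z : ℂ}
    (hz : z.im ≠ 0) : coeffV n Ef ρ Nf σ 0 x z = (Complex.I * eta n z) • sigma3 := by
  rw [coeffV, sideValue_of_im_ne_zero σ _ hz, hsol.cauchyMatrix_of_le hn le_rfl hx.le hx hxL,
    hsol.fieldMatrix_eq_zero hn le_rfl hx hxL, add_zero, smul_smul, ← sub_smul]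
  congr 1; ring

/-- A solution of the `x`-equation at `t = 0` has the form `exp (i η x σ₃) C`, and the
normalization at `x = L` determines a column of `C`: the off-diagonal entry is multiplied by an
exponential which does not decay. -/
theorem column_of_isBasicZ (hL : 0 < L) (hn : IsLineShape n) {σ : ℝ} {Z : ℝ → ℝ → ℂ → Mat2}
    (hZ : IsBasicZ L n Ef ρ Nf σ Z) {t x : ℝ} (ht : 0 ≤ t) (hx : 0 < x) (hxL : (x : EReal) < L)
    {z : ℂ} (hz : z ∈ openHalf σ) {j : Fin 2} (hj : σ = 1 ∧ j = 0 ∨ σ = -1 ∧ j = 1) (i : Fin 2) :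
    Z t x z i j = jointSol n Ef σ t x z i j := by
  obtain ⟨Ψ, w, h⟩ := hZ.factor
  obtain ⟨h1, h2⟩ := h z (openHalf_subset_closedHalf n σ hz)
  have him := im_ne_zero_of_mem_openHalf hz
  rw [sideValue_of_im_ne_zero σ _ him] at h2
  have hη := eta_im_mul_nonneg hn hz
  set c := Complex.I * eta n z with hc
  -- the conjugated solution is constant
  have hder : ∀ y : ℝ, 0 < y → (y : EReal) < L →
      HasDerivAt (fun y : ℝ => expSigma3 (-c * y) * w y z) 0 y := by
    intro y hy hyL
    have hw := hasMatDerivAt_iff.1 (h1 y hy hyL).2.2.2.1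
    rw [hsol.coeffV_zero_eq hn hy hyL him] at hw
    refine ((expSigma3_hasDerivAt (-c) y).mul hw).congr_deriv ?_
    rw [← hc]
    simp only [neg_smul, Matrix.neg_mul, Matrix.smul_mul, Matrix.mul_smul, ← Matrix.mul_assoc,
      expSigma3_mul_sigma3]
    rw [neg_add_cancel]
  have hconst : ∀ y : ℝ, 0 < y → (y : EReal) < L →
      expSigma3 (-c * y) * w y z = expSigma3 (-c * x) * w x z := by
    have key : ∀ a b : ℝ, 0 < a → a ≤ b → (b : EReal) < L →
        expSigma3 (-c * b) * w b z = expSigma3 (-c * a) * w a z := by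
      intro a b ha hab hb
      have hL : ∀ y ∈ Icc a b, 0 < y ∧ (y : EReal) < L := fun y hy =>
        ⟨ha.trans_le hy.1, (EReal.coe_le_coe_iff.2 hy.2).trans_lt hb⟩
      exact eq_of_deriv_eq_zero (f := fun y : ℝ => expSigma3 (-c * y) * w y z) a hab
        (fun y hy => (hder y (hL y hy).1 (hL y hy).2).continuousAt.continuousWithinAt)
        fun y hy _ => hder y (hL y ⟨hy.1.le, hy.2.le⟩).1 (hL y ⟨hy.1.le, hy.2.le⟩).2
    intro y hy hyL
    rcases le_total x y with h | h
    · exact key x y hx h hyL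
    · exact (key y x hy h hxL).symm
  set K := expSigma3 (-c * x) * w x z with hK
  have hw : ∀ y : ℝ, 0 < y → (y : EReal) < L → w y z = expSigma3 (c * y) * K := by
    intro y hy hyL
    rw [← hconst y hy hyL, ← mul_assoc, expSigma3_mul, neg_mul, add_neg_cancel, expSigma3_zero,
      one_mul]
  have hev := eventually_comap_coe hL
  have := comap_coe_nhdsWithin_neBot hL
  have h3 : Tendsto (fun y : ℝ => expSigma3 (c * y) * K * expSigma3 (-c * y))
      (comap (fun x : ℝ => (x : EReal)) (𝓝[<] L)) (𝓝 1) := by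
    refine h2.congr' (hev.mono fun y hy => ?_)
    rw [hw y hy.1 hy.2, hc, neg_mul]
  have hentry : ∀ a b, Tendsto (fun y : ℝ => (expSigma3 (c * y) * K * expSigma3 (-c * y)) a b)
      (comap (fun x : ℝ => (x : EReal)) (𝓝[<] L)) (𝓝 ((1 : Mat2) a b)) := fun a b =>
    tendsto_pi_nhds.1 (tendsto_pi_nhds.1 h3 a) b
  have hee : ∀ y : ℝ, Complex.exp (c * y) * Complex.exp (-c * y) = 1 := fun y => by
    rw [← Complex.exp_add, neg_mul, add_neg_cancel, Complex.exp_zero]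
  have hcre : c.re = -(eta n z).im := by simp [hc]
  have hcol : ∀ a, K a j = (1 : Mat2) a j := by
    have hdiag : K j j = 1 := by
      have h5 := hentry j j
      rw [Matrix.one_apply_eq] at h5
      refine tendsto_nhds_unique (tendsto_const_nhds.congr fun y => ?_) h5
      rcases hj with ⟨-, rfl⟩ | ⟨-, rfl⟩
      · simp only [expSigma3, Matrix.mul_apply, Fin.sum_univ_two, Matrix.of_apply,
          Matrix.cons_val', Matrix.cons_val_zero, Matrix.cons_val_one, Matrix.cons_val_fin_one]
        linear_combination -K 0 0 * hee y
      · simp only [expSigma3, Matrix.mul_apply, Fin.sum_univ_two, Matrix.of_apply,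
          Matrix.cons_val', Matrix.cons_val_zero, Matrix.cons_val_one, Matrix.cons_val_fin_one]
        rw [show -(-c * (y : ℂ)) = c * y by ring, ← neg_mul c (y : ℂ)]
        linear_combination -K 1 1 * hee y
    have hoff : ∀ a, a ≠ j → K a j = 0 := by
      intro a ha
      have h4 := (hentry a j).norm
      rw [Matrix.one_apply_ne ha, norm_zero] at h4
      refine norm_le_zero_iff.1 (ge_of_tendsto h4 (hev.mono fun y hy => ?_))
      rcases hj with ⟨rfl, rfl⟩ | ⟨rfl, rfl⟩
      · obtain rfl : a = 1 := by omega
        simp only [expSigma3, Matrix.mul_apply, Fin.sum_univ_two, Matrix.of_apply,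
          Matrix.cons_val', Matrix.cons_val_zero, Matrix.cons_val_one, Matrix.cons_val_fin_one]
        simp only [zero_mul, mul_zero, zero_add, add_zero]
        rw [mul_right_comm _ (K 1 0), norm_mul, norm_mul,
          Complex.norm_exp, Complex.norm_exp]
        refine le_mul_of_one_le_left (norm_nonneg _) ?_
        have : 0 ≤ (-c * (y : ℂ)).re := by
          rw [Complex.re_mul_ofReal, Complex.neg_re, hcre]
          have := hy.1
          rw [one_mul] at hη
          simp only [neg_neg]; positivity
        rw [← neg_mul]
        exact one_le_mul_of_one_le_of_one_le (Real.one_le_exp this) (Real.one_le_exp this)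
      · obtain rfl : a = 0 := by omega
        simp only [expSigma3, Matrix.mul_apply, Fin.sum_univ_two, Matrix.of_apply,
          Matrix.cons_val', Matrix.cons_val_zero, Matrix.cons_val_one, Matrix.cons_val_fin_one]
        simp only [zero_mul, mul_zero, zero_add, add_zero]
        rw [mul_right_comm _ (K 0 1), norm_mul, norm_mul,
          Complex.norm_exp, Complex.norm_exp]
        refine le_mul_of_one_le_left (norm_nonneg _) ?_
        have : 0 ≤ (c * (y : ℂ)).re := by
          rw [Complex.re_mul_ofReal, hcre]
          have := hy.1
          have : 0 ≤ -(eta n z).im := by linarith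
          positivity
        rw [neg_mul, neg_neg]
        exact one_le_mul_of_one_le_of_one_le (Real.one_le_exp this) (Real.one_le_exp this)
    intro a
    by_cases h : a = j
    · rw [h, hdiag, Matrix.one_apply_eq]
    · rw [hoff a h, Matrix.one_apply_ne h]
  -- the first factor is the propagator
  have hΨ : Ψ t x z = psi Ef t x z := by
    obtain ⟨g1, g2, g3, -, -⟩ := h1 x hx hxL
    obtain ⟨C, hC0, hC⟩ := hsol.field_bound t hxL
    refine eq_of_linear_deriv (A := fun t => coeffU Ef t x z) (M := ‖z‖ + C / 2)
      (f := fun t => Ψ t x z) x ht (g2.mono fun s hs => hs.1)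
      ((hsol.psi_continuousOn hx.le hxL z).mono fun s hs => hs.1)
      (fun s hs hne => hasMatDerivAt_iff.1 (g3 s hs.1 hne))
      (fun s hs hne => hsol.psi_hasDerivAt hs.1 hx.le hxL hne z) (fun s hs hne => ?_) ?_
    · refine (norm_coeffU_le _ _ _ _).trans ?_
      have := hC s x hs.1 hs.2.le hx.le le_rfl hne
      linarith
    · exact g1.trans (hsol.psi_zero hx.le hxL z).symm
  rw [(h1 x hx hxL).2.2.2.2 t ht, hw x hx hxL, hΨ, jointSol, sideValue_of_im_ne_zero σ _ him,
    ← mul_assoc, ← hc, Matrix.mul_apply, Fin.sum_univ_two, hcol, hcol]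
  rcases hj with ⟨-, rfl⟩ | ⟨-, rfl⟩ <;> simp

/-- Off the real line the coefficient of the `x`-equation is bounded, so the solution with value
`1` at `x = 0` is unique. -/
theorem eq_of_isBasicY (hL : 0 < L) (hA₀ : 0 < A₀) (hn : IsLineShape n) {σ : ℝ}
    (hσ : σ = 1 ∨ σ = -1) {Y : ℝ → ℝ → ℂ → Mat2} (hY : IsBasicY L n (specPoint A₀ ω₀) Ef ρ Nf σ Y)
    {t x : ℝ} (ht : 0 ≤ t) (hx : 0 < x) (hxL : (x : EReal) < L) {z : ℂ}
    (hz : z ∈ openHalf σ \ segment ℝ (specPoint A₀ ω₀) (conj (specPoint A₀ ω₀))) :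
    Y t x z = jointSol n Ef σ t x z * connection (specPoint A₀ ω₀) z := by
  have hz' : z ∈ closedHalf n σ \ (segment ℝ (specPoint A₀ ω₀) (conj (specPoint A₀ ω₀))
      \ {((specPoint A₀ ω₀).re : ℂ)}) :=
    ⟨openHalf_subset_closedHalf n σ hz.1, fun h => hz.2 h.1⟩
  have him := im_ne_zero_of_mem_openHalf hz.1
  obtain ⟨W, hW⟩ := hY.factor
  obtain ⟨W₀, hW₀⟩ := (hsol.jointSol_isBasicY hL hA₀ hn hσ).factor
  obtain ⟨a1, a2, a3, a4⟩ := hW t ht z hz'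
  obtain ⟨b1, b2, b3, b4⟩ := hW₀ t ht z hz'
  rw [a4 x hx.le hxL, b4 x hx.le hxL]
  congr 1
  obtain ⟨C, hC0, hC⟩ := hsol.field_bound t hxL
  have hyL : ∀ y : ℝ, y ≤ x → (y : EReal) < L := fun y hy =>
    (EReal.coe_le_coe_iff.2 hy).trans_lt hxL
  refine eq_of_linear_deriv (A := fun y => coeffV n Ef ρ Nf σ t y z)
    (M := ‖z‖ + C / 2 + 4 * (1 / (4 * |z.im|))) (f := fun y => W t y z) (g := fun y => W₀ t y z) t
    hx.le (a2.mono fun y hy => ⟨hy.1, hyL y hy.2⟩) (b2.mono fun y hy => ⟨hy.1, hyL y hy.2⟩)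
    (fun y hy hne => hasMatDerivAt_iff.1 (a3 y hy.1 (hyL y hy.2.le) hne))
    (fun y hy hne => hasMatDerivAt_iff.1 (b3 y hy.1 (hyL y hy.2.le) hne)) (fun y hy hne => ?_)
    (a1.trans b1.symm)
  have hE : ‖Ef t y‖ ≤ C := by
    rcases ht.eq_or_lt with rfl | ht
    · rw [hsol.field_init y hy.1 (hyL y hy.2.le), norm_zero]; exact hC0
    · exact hC t y ht le_rfl hy.1.le hy.2.le hne.symm
  have hG : ‖cauchyMatrix n ρ Nf t y z‖ ≤ 4 * (1 / (4 * |z.im|)) := by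
    refine (norm_le_sum_entries _).trans ?_
    have := fun i j => hsol.norm_cauchyMatrix_entry_le hn ht hy.1 (hyL y hy.2.le) him i j
    linarith [this 0 0, this 0 1, this 1 0, this 1 1]
  rw [coeffV, sideValue_of_im_ne_zero σ _ him]
  refine (norm_sub_le _ _).trans (add_le_add ((norm_add_le _ _).trans (add_le_add ?_ ?_)) ?_)
  · rw [norm_smul, norm_sigma3]; simp
  · rw [norm_fieldMatrix]; linarith
  · rw [norm_smul, Complex.norm_I, one_mul]; exact hG

/-- The matrix built from any basic solutions has the explicit form off the contour. -/
theorem basicM_eq (hL : 0 < L) (hA₀ : 0 < A₀) (hn : IsLineShape n)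
    {Yp Zp Ym Zm : ℝ → ℝ → ℂ → Mat2}
    (h : AreBasicSolutions L n (specPoint A₀ ω₀) Ef ρ Nf Yp Zp Ym Zm) {t x : ℝ} (ht : 0 ≤ t)
    (hx : 0 < x) (hxL : (x : EReal) < L) {z : ℂ} (hz : z ∈ (closedContour (specPoint A₀ ω₀))ᶜ) :
    basicM n (specPoint A₀ ω₀) Yp Zp Ym Zm t x z = rhSolution n (specPoint A₀ ω₀) Ef t x z := by
  obtain ⟨hYp, hZp, hYm, hZm⟩ := h
  set E := specPoint A₀ ω₀ with hE
  have him : z.im ≠ 0 := fun h => hz (.inl h)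
  have hseg : z ∉ segment ℝ E (conj E) := fun h => hz (.inr h)
  have ha := aFun_ne_zero (ne_of_notMem_segment hseg).1 (ne_of_notMem_segment hseg).2
  have hr : bFun E z = rFun E z * aFun E z := by rw [rFun, div_mul_cancel₀ _ ha]
  have e1 : Complex.exp (Complex.I * eta n z * x) * Complex.exp (Complex.I * theta n t x z)
      = Complex.exp (Complex.I * z * t) := by
    rw [← Complex.exp_add, theta]; congr 1; ring
  have e2 : Complex.exp (-(Complex.I * eta n z * x)) * Complex.exp (-Complex.I * theta n t x z)
      = Complex.exp (-(Complex.I * z * t)) := by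
    rw [← Complex.exp_add, theta]; congr 1; ring
  have e3 : Complex.exp (Complex.I * eta n z * x) * Complex.exp (-Complex.I * theta n t x z)
      = Complex.exp (Complex.I * z * t) * Complex.exp (-2 * Complex.I * theta n t x z) := by
    rw [← Complex.exp_add, ← Complex.exp_add, theta]; congr 1; ring
  have e4 : Complex.exp (-(Complex.I * eta n z * x)) * Complex.exp (Complex.I * theta n t x z)
      = Complex.exp (-(Complex.I * z * t)) * Complex.exp (2 * Complex.I * theta n t x z) := by
    rw [← Complex.exp_add, ← Complex.exp_add, theta]; congr 1; ring
  rcases lt_or_gt_of_ne him with h | h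
  · have hz1 : z ∈ openHalf (-1) := by simpa [openHalf] using h
    ext i j
    rw [basicM, rhSolution, if_neg (not_lt.2 h.le), if_neg (not_lt.2 h.le)]
    fin_cases j
    · simp only [Matrix.of_apply, Fin.zero_eta, Matrix.cons_val_zero]
      rw [hsol.eq_of_isBasicY hL hA₀ hn (.inr rfl) hYm ht hx hxL ⟨hz1, hseg⟩, jointSol,
        sideValue_of_im_ne_zero _ _ him, ← hE]
      simp only [connection, expSigma3, Matrix.mul_apply, Fin.sum_univ_two, Matrix.of_apply,
        Matrix.cons_val', Matrix.cons_val_zero, Matrix.cons_val_one, Matrix.cons_val_fin_one, hr]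
      rw [div_mul_eq_mul_div, div_eq_iff ha]
      linear_combination (aFun E z * psi Ef t x z i 0) * e1
        + (aFun E z * rFun E z * psi Ef t x z i 1) * e4
    · simp only [Matrix.of_apply, Fin.mk_one, Matrix.cons_val_one]
      rw [Matrix.cons_val_fin_one, hsol.column_of_isBasicZ hL hn hZm ht hx hxL hz1
        (.inr ⟨rfl, rfl⟩), jointSol, sideValue_of_im_ne_zero _ _ him]
      simp only [expSigma3, Matrix.mul_apply, Fin.sum_univ_two, Matrix.of_apply,
        Matrix.cons_val', Matrix.cons_val_zero, Matrix.cons_val_one, Matrix.cons_val_fin_one]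
      linear_combination (psi Ef t x z i 1) * e2
  · have hz1 : z ∈ openHalf 1 := by simpa [openHalf] using h
    ext i j
    rw [basicM, rhSolution, if_pos h, if_pos h]
    fin_cases j
    · simp only [Matrix.of_apply, Fin.zero_eta, Matrix.cons_val_zero]
      rw [hsol.column_of_isBasicZ hL hn hZp ht hx hxL hz1
        (.inl ⟨rfl, rfl⟩), jointSol, sideValue_of_im_ne_zero _ _ him]
      simp only [expSigma3, Matrix.mul_apply, Fin.sum_univ_two, Matrix.of_apply,
        Matrix.cons_val', Matrix.cons_val_zero, Matrix.cons_val_one, Matrix.cons_val_fin_one]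
      linear_combination (psi Ef t x z i 0) * e1
    · simp only [Matrix.of_apply, Fin.mk_one, Matrix.cons_val_one]
      rw [Matrix.cons_val_fin_one, hsol.eq_of_isBasicY hL hA₀ hn (.inl rfl) hYp ht hx hxL
        ⟨hz1, hseg⟩, jointSol, sideValue_of_im_ne_zero _ _ him, ← hE]
      simp only [connection, expSigma3, Matrix.mul_apply, Fin.sum_univ_two, Matrix.of_apply,
        Matrix.cons_val', Matrix.cons_val_zero, Matrix.cons_val_one, Matrix.cons_val_fin_one, hr]
      rw [div_mul_eq_mul_div, div_eq_iff ha]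
      linear_combination (aFun E z * psi Ef t x z i 1) * e2
        + (aFun E z * rFun E z * psi Ef t x z i 0) * e3

end MaxwellBloch.IsSolution

/-! ### Local properties of the solution of the Riemann--Hilbert problem -/

section Contour

variable {n : ℝ → ℝ} {E : ℂ}

theorem isOpen_compl_closedContour (E : ℂ) : IsOpen (closedContour E)ᶜ :=
  ((isClosed_eq Complex.continuous_im continuous_const).union (isClosed_segment_conj E)).isOpen_compl

theorem mem_compl_closedContour_iff {z : ℂ} :
    z ∈ (closedContour E)ᶜ ↔ z.im ≠ 0 ∧ z ∉ segment ℝ E (conj E) := by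
  simp [closedContour]

/-- The sides of the cut: `τ = 1` on the right, `τ = -1` on the left. -/
def cutSide (E : ℂ) (τ : ℝ) : Set ℂ := {z | 0 < τ * (z.re - E.re)}

/-- The one-sided neighborhoods of a contour point, `τ = 1` for the plus side and `τ = -1` for the
minus side. -/
noncomputable def sideFilter (E : ℂ) (τ : ℝ) (ζ : ℂ) : Filter ℂ :=
  if ζ.im = 0 then 𝓝[openHalf τ] ζ else 𝓝[cutSide E τ] ζ

theorem plusSide_eq (E ζ : ℂ) : plusSide E ζ = sideFilter E 1 ζ := by
  simp [plusSide, sideFilter, openHalf, cutSide]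

theorem minusSide_eq (E ζ : ℂ) : minusSide E ζ = sideFilter E (-1) ζ := by
  simp [minusSide, sideFilter, openHalf, cutSide]

theorem sideFilter_neBot (E : ℂ) {τ : ℝ} (hτ : τ = 1 ∨ τ = -1) {ζ : ℂ} (hζ : ζ ∈ regularContour n E) :
    (sideFilter E τ ζ).NeBot := by
  rw [sideFilter]
  split_ifs with h
  · rw [← ofReal_re_of_im_eq_zero h]
    exact openHalf_neBot hτ ζ.re
  · obtain ⟨h1, -⟩ | ⟨h1, -, -⟩ := hζ
    · exact absurd h1 h
    refine mem_closure_iff_nhdsWithin_neBot.1 (Metric.mem_closure_iff.2 fun ε hε => ?_)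
    refine ⟨ζ + ((τ * (ε / 2) : ℝ) : ℂ), ?_, ?_⟩
    · rcases hτ with rfl | rfl <;> simp [cutSide, h1] <;> linarith
    · rw [dist_self_add_right, Complex.norm_real, Real.norm_eq_abs, abs_mul,
        abs_of_pos (half_pos hε)]
      rcases hτ with rfl | rfl <;> simp <;> linarith

theorem eventually_sideFilter_compl (hE : 0 < E.im) {τ : ℝ} {ζ : ℂ}
    (hζ : ζ ∈ regularContour n E) : ∀ᶠ z in sideFilter E τ ζ, z ∈ (closedContour E)ᶜ := by
  rw [sideFilter]
  obtain ⟨h1, h2, -⟩ | ⟨h1, h2, -⟩ := hζ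
  · rw [if_pos h1]
    have h3 : ∀ᶠ z : ℂ in 𝓝 ζ, z.re ≠ E.re := Complex.continuous_re.continuousAt.eventually_ne h2
    filter_upwards [self_mem_nhdsWithin, nhdsWithin_le_nhds h3] with z hz hz'
    exact mem_compl_closedContour_iff.2 ⟨im_ne_zero_of_mem_openHalf hz,
      fun h => hz' ((mem_segment_conj_iff hE).1 h).1⟩
  · rw [if_neg h2]
    have h3 : ∀ᶠ z : ℂ in 𝓝 ζ, z.im ≠ 0 := Complex.continuous_im.continuousAt.eventually_ne h2
    filter_upwards [self_mem_nhdsWithin, nhdsWithin_le_nhds h3] with z hz hz'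
    refine mem_compl_closedContour_iff.2 ⟨hz', fun h => ?_⟩
    have hz : 0 < τ * (z.re - E.re) := hz
    rw [((mem_segment_conj_iff hE).1 h).1, sub_self, mul_zero] at hz
    exact lt_irrefl _ hz

theorem MaxwellBloch.SolvesRH.congr (hE : 0 < E.im) {t x : ℝ} {M M' : ℂ → Mat2}
    (h : SolvesRH n E t x M) (hM : EqOn M' M (closedContour E)ᶜ) : SolvesRH n E t x M' := by
  have hside : ∀ τ : ℝ, ∀ ζ ∈ regularContour n E, M =ᶠ[sideFilter E τ ζ] M' := fun τ ζ hζ =>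
    (eventually_sideFilter_compl hE hζ).mono fun z hz => (hM hz).symm
  have hp : ∀ ζ ∈ regularContour n E, M =ᶠ[plusSide E ζ] M' := fun ζ hζ => by
    rw [plusSide_eq]; exact hside 1 ζ hζ
  have hm : ∀ ζ ∈ regularContour n E, M =ᶠ[minusSide E ζ] M' := fun ζ hζ => by
    rw [minusSide_eq]; exact hside (-1) ζ hζ
  have hw : ∀ (z₀ : ℂ) (i j : Fin 2), (fun z => M z i j) =ᶠ[𝓝[(closedContour E)ᶜ] z₀]
      fun z => M' z i j := fun z₀ i j =>
    eventually_mem_nhdsWithin.mono fun z hz => by simp only [hM hz]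
  constructor
  · exact fun i j => (h.analytic i j).congr fun z hz => by rw [hM hz]
  · exact fun ζ hζ => (h.boundary_plus ζ hζ).imp fun A hA => hA.congr' (hp ζ hζ)
  · exact fun ζ hζ => (h.boundary_minus ζ hζ).imp fun A hA => hA.congr' (hm ζ hζ)
  · exact fun l hl i j => (h.bounded l hl i j).congr' (hw _ i j) EventuallyEq.rfl
  · exact fun i j => (h.endpoint i j).congr' (hw _ i j) EventuallyEq.rfl
  · exact fun i j => (h.endpoint_conj i j).congr' (hw _ i j) EventuallyEq.rfl
  · intro ζ hζ
    have := h.jump ζ hζ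
    rwa [minusValue, plusValue, limUnder, limUnder, Filter.map_congr (hm ζ hζ),
      Filter.map_congr (hp ζ hζ)] at this
  · refine fun i j => (h.normalization i j).congr' ?_ EventuallyEq.rfl
    filter_upwards [mem_inf_of_right (mem_principal_self _)] with z hz
    rw [hM hz]

end Contour

theorem theta_differentiableAt {n : ℝ → ℝ} (hn : IsLineShape n) (t x : ℝ) {z : ℂ} (hz : z.im ≠ 0) :
    DifferentiableAt ℂ (theta n t x) z :=
  (differentiableAt_id.mul_const _).sub ((eta_differentiableAt hn hz).mul_const _)

theorem tendsto_theta_sideValue {n : ℝ → ℝ} (hn : IsLineShape n) {σ : ℝ} (hσ : σ = 1 ∨ σ = -1)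
    (t x : ℝ) {p : ℝ} (hp : ContinuousAt n p) :
    Tendsto (theta n t x) (𝓝[openHalf σ] (p : ℂ)) (𝓝 (sideValue σ (theta n t x) p)) := by
  have hid : Tendsto (fun z : ℂ => z) (𝓝[openHalf σ] (p : ℂ)) (𝓝 (p : ℂ)) :=
    tendsto_id.mono_left nhdsWithin_le_nhds
  have h : Tendsto (theta n t x) (𝓝[openHalf σ] (p : ℂ)) _ :=
    (hid.mul_const (t : ℂ)).sub ((tendsto_eta_sideValue hn hσ hp).mul_const (x : ℂ))
  rwa [sideValue_ofReal_eq hσ h]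

/-- In the half-plane `σ Im z > 0` the exponential in the triangular factor grows at most
like `exp (2 t |Im z|)`, since `σ Im η ≥ 0`. -/
theorem norm_exp_theta_le {n : ℝ → ℝ} (hn : IsLineShape n) {t x : ℝ} (hx : 0 ≤ x) {σ : ℝ} {z : ℂ}
    (hσ : σ = 1 ∨ σ = -1) (hz : z ∈ openHalf σ) :
    ‖Complex.exp (-2 * σ * Complex.I * theta n t x z)‖ ≤ Real.exp (2 * t * |z.im|) := by
  have h1 := eta_im_mul_nonneg hn hz
  have h2 : 0 < σ * z.im := hz
  have h3 : σ * z.im = |z.im| := by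
    rcases hσ with rfl | rfl
    · rw [abs_of_pos (by linarith)]; ring
    · rw [abs_of_neg (by linarith)]; ring
  rw [Complex.norm_exp]
  refine Real.exp_le_exp.2 ?_
  have h4 : (-2 * σ * Complex.I * theta n t x z).re = 2 * t * |z.im| - 2 * x * (σ * (eta n z).im) := by
    rw [← h3, theta]
    simp
    ring
  rw [h4]
  have := mul_nonneg hx h1
  linarith

/-- The triangular factor of the solution, `σ = 1` in the upper and `σ = -1` in the lower
half-plane; `r` and `θ` are values of the reflection coefficient and the phase. -/
noncomputable def triangularFactor (σ : ℝ) (r θ : ℂ) : Mat2 :=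
  if σ = 1 then !![1, r * Complex.exp (-2 * Complex.I * θ); 0, 1]
  else !![1, 0; r * Complex.exp (2 * Complex.I * θ), 1]

theorem triangularFactor_continuous (σ : ℝ) :
    Continuous fun q : ℂ × ℂ => triangularFactor σ q.1 q.2 := by
  refine continuous_pi fun i => continuous_pi fun j => ?_
  by_cases h : σ = 1 <;> simp only [triangularFactor, h, if_true, if_false] <;>
    fin_cases i <;> fin_cases j <;> simp <;> fun_prop

theorem norm_triangularFactor_le {σ : ℝ} (hσ : σ = 1 ∨ σ = -1) {r θ : ℂ} {C : ℝ} (hr : ‖r‖ ≤ 1)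
    (hC : ‖Complex.exp (-2 * σ * Complex.I * θ)‖ ≤ C) : ‖triangularFactor σ r θ‖ ≤ 1 + C := by
  have hC0 := (norm_nonneg _).trans hC
  rw [mat2_norm_eq]
  rcases hσ with rfl | rfl
  · have : ‖r * Complex.exp (-2 * Complex.I * θ)‖ ≤ C := by
      rw [norm_mul]
      exact (mul_le_of_le_one_left (norm_nonneg _) hr).trans (by simpa using hC)
    simp [triangularFactor] at this ⊢
    linarith
  · have : ‖r * Complex.exp (2 * Complex.I * θ)‖ ≤ C := by
      rw [norm_mul]
      exact (mul_le_of_le_one_left (norm_nonneg _) hr).trans (by simpa using hC)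
    simp [triangularFactor, show (-1 : ℝ) ≠ 1 by norm_num] at this ⊢
    linarith

theorem rhSolution_of_mem_openHalf {n : ℝ → ℝ} {E : ℂ} {Ef : ℝ → ℝ → ℂ} {t x σ : ℝ} {z : ℂ}
    (hσ : σ = 1 ∨ σ = -1) (hz : z ∈ openHalf σ) : rhSolution n E Ef t x z
      = psi Ef t x z * expSigma3 (Complex.I * z * t)
        * triangularFactor σ (rFun E z) (theta n t x z) := by
  have hz : 0 < σ * z.im := hz
  rcases hσ with rfl | rfl
  · rw [rhSolution, triangularFactor, if_pos rfl, if_pos (by linarith)]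
  · rw [rhSolution, triangularFactor, if_neg (show ¬ 0 < z.im by linarith),
      if_neg (show ¬ (-1 : ℝ) = 1 by norm_num)]

theorem exists_mem_openHalf {z : ℂ} (hz : z.im ≠ 0) :
    ∃ σ : ℝ, (σ = 1 ∨ σ = -1) ∧ z ∈ openHalf σ := by
  rcases lt_or_gt_of_ne hz with h | h
  · exact ⟨-1, .inr rfl, by simpa [openHalf] using h⟩
  · exact ⟨1, .inl rfl, by simpa [openHalf] using h⟩

namespace MaxwellBloch.IsSolution

variable {L : EReal} {n : ℝ → ℝ} {A₀ ω₀ : ℝ} {Ef : ℝ → ℝ → ℂ} {ρ : ℝ → ℝ → ℝ → ℂ}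
  {Nf : ℝ → ℝ → ℝ → ℝ} (hsol : IsSolution L n A₀ ω₀ Ef ρ Nf)

include hsol

theorem rhSolution_differentiableAt (hn : IsLineShape n) {E : ℂ} (hE : 0 < E.im) {t x : ℝ}
    (ht : 0 ≤ t) (hx : 0 < x) (hxL : (x : EReal) < L) {z : ℂ} (hz : z ∈ (closedContour E)ᶜ)
    (i j : Fin 2) : DifferentiableAt ℂ (fun z => rhSolution n E Ef t x z i j) z := by
  obtain ⟨him, hseg⟩ := mem_compl_closedContour_iff.1 hz
  obtain ⟨σ, hσ, hzσ⟩ := exists_mem_openHalf him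
  have hev : (fun z => rhSolution n E Ef t x z) =ᶠ[𝓝 z] fun z => psi Ef t x z
      * expSigma3 (Complex.I * z * t) * triangularFactor σ (rFun E z) (theta n t x z) := by
    filter_upwards [(isOpen_openHalf σ).mem_nhds hzσ] with w hw
    exact rhSolution_of_mem_openHalf hσ hw
  have h1 : DifferentiableAt ℂ (fun z : ℂ => expSigma3 (Complex.I * z * t)) z :=
    differentiableAt_pi.2 fun i => differentiableAt_pi.2 fun j =>
      ((expSigma3_differentiable i j).comp (by fun_prop :
        Differentiable ℂ fun z : ℂ => Complex.I * z * t)) z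
  have h2 : DifferentiableAt ℂ (fun z => triangularFactor σ (rFun E z) (theta n t x z)) z := by
    have hr := rFun_differentiableAt hE hseg
    have hθ := theta_differentiableAt hn t x him
    have e1 : DifferentiableAt ℂ
        (fun z => rFun E z * Complex.exp (-2 * Complex.I * theta n t x z)) z :=
      hr.mul (hθ.const_mul _).cexp
    have e2 : DifferentiableAt ℂ
        (fun z => rFun E z * Complex.exp (2 * Complex.I * theta n t x z)) z :=
      hr.mul (hθ.const_mul _).cexp
    refine differentiableAt_pi.2 fun i => differentiableAt_pi.2 fun j => ?_
    by_cases h : σ = 1 <;> simp only [triangularFactor, h, if_true, if_false] <;>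
      fin_cases i <;> fin_cases j <;>
      first | exact differentiableAt_const _ | exact e1 | exact e2
  have h3 := (((hsol.psi_differentiable ht hx.le hxL z).mul h1).mul h2).congr_of_eventuallyEq hev
  exact differentiableAt_pi.1 (differentiableAt_pi.1 h3 i) j

/-- The solution is bounded near every point of the plane. -/
theorem rhSolution_isBigO_one (hn : IsLineShape n) (E : ℂ) {t x : ℝ} (ht : 0 ≤ t) (hx : 0 < x)
    (hxL : (x : EReal) < L) (z₀ : ℂ) (i j : Fin 2) :
    (fun z => rhSolution n E Ef t x z i j) =O[𝓝[(closedContour E)ᶜ] z₀] (fun _ => (1 : ℝ)) := by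
  have hc : Continuous fun z : ℂ => ‖psi Ef t x z‖ * ‖expSigma3 (Complex.I * z * t)‖
      * (1 + Real.exp (2 * t * |z.im|)) := by
    have h1 := (hsol.psi_differentiable ht hx.le hxL).continuous
    have h2 : Continuous fun z : ℂ => expSigma3 (Complex.I * z * t) :=
      expSigma3_continuous.comp (by fun_prop)
    fun_prop
  have hb := (hc.continuousAt (x := z₀)).tendsto.isBigO_one ℝ
  refine IsBigO.trans (IsBigO.of_bound 1 ?_) (hb.mono nhdsWithin_le_nhds)
  filter_upwards [self_mem_nhdsWithin] with z hz
  obtain ⟨him, hseg⟩ := mem_compl_closedContour_iff.1 hz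
  obtain ⟨σ, hσ, hzσ⟩ := exists_mem_openHalf him
  rw [rhSolution_of_mem_openHalf hσ hzσ, one_mul, Real.norm_of_nonneg (by positivity)]
  refine (norm_entry_le _ i j).trans ((norm_mul_le _ _).trans ?_)
  have := norm_triangularFactor_le hσ (norm_rFun_le_one E z)
    (norm_exp_theta_le (t := t) hn hx.le hσ hzσ)
  have := norm_mul_le (psi Ef t x z) (expSigma3 (Complex.I * z * t))
  gcongr

theorem rhSolution_isBigO_rpow (hn : IsLineShape n) (E : ℂ) {t x : ℝ} (ht : 0 ≤ t) (hx : 0 < x)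
    (hxL : (x : EReal) < L) {z₀ : ℂ} (hz₀ : z₀ ∈ closedContour E) (i j : Fin 2) :
    (fun z => rhSolution n E Ef t x z i j) =O[𝓝[(closedContour E)ᶜ] z₀]
      (fun z => ‖z - z₀‖ ^ (-(1 / 4) : ℝ)) := by
  refine (hsol.rhSolution_isBigO_one hn E ht hx hxL z₀ i j).trans (IsBigO.of_bound 1 ?_)
  filter_upwards [self_mem_nhdsWithin,
    nhdsWithin_le_nhds (Metric.ball_mem_nhds z₀ one_pos)] with z hz hz1
  have h0 : 0 < ‖z - z₀‖ := norm_pos_iff.2 (sub_ne_zero.2 fun h => hz (h ▸ hz₀))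
  rw [mem_ball_iff_norm] at hz1
  rw [norm_one, one_mul, Real.norm_of_nonneg (by positivity)]
  exact Real.one_le_rpow_of_pos_of_le_one_of_nonpos h0 hz1.le (by norm_num)

theorem rhSolution_tendsto_real (hn : IsLineShape n) {E : ℂ} (hE : 0 < E.im) {t x : ℝ} (ht : 0 ≤ t)
    (hx : 0 < x) (hxL : (x : EReal) < L) {σ : ℝ} (hσ : σ = 1 ∨ σ = -1) {p : ℝ}
    (hpE : p ≠ E.re) (hp : ContinuousAt n p) :
    Tendsto (rhSolution n E Ef t x) (𝓝[openHalf σ] (p : ℂ)) (𝓝 (psi Ef t x p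
      * expSigma3 (Complex.I * p * t)
      * triangularFactor σ (rFun E p) (sideValue σ (theta n t x) p))) := by
  have hseg : (p : ℂ) ∉ segment ℝ E (conj E) := fun h => hpE ((mem_segment_conj_iff hE).1 h).1
  have hr := (rFun_differentiableAt hE hseg).continuousAt.tendsto.mono_left
    (nhdsWithin_le_nhds (s := openHalf σ))
  have h1 : Continuous fun z : ℂ => psi Ef t x z * expSigma3 (Complex.I * z * t) :=
    (hsol.psi_differentiable ht hx.le hxL).continuous.mul (expSigma3_continuous.comp (by fun_prop))
  have h2 := ((triangularFactor_continuous σ).tendsto (rFun E p, sideValue σ (theta n t x) p)).comp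
    (hr.prodMk_nhds (tendsto_theta_sideValue hn hσ t x hp))
  refine (((h1.tendsto (p : ℂ)).mono_left nhdsWithin_le_nhds).mul h2).congr' ?_
  filter_upwards [self_mem_nhdsWithin] with z hz
  exact (rhSolution_of_mem_openHalf hσ hz).symm

/-- On the two sides of the cut `κ²` has the boundary values `± i √((Im E + Im ζ) / (Im E - Im ζ))`,
and `r = (κ² - 1) / (κ² + 1)`. -/
theorem rhSolution_tendsto_cut (hn : IsLineShape n) {E : ℂ} (hE : 0 < E.im) {t x : ℝ} (ht : 0 ≤ t)
    (hx : 0 < x) (hxL : (x : EReal) < L) {τ : ℝ} (hτ : τ = 1 ∨ τ = -1) {ζ : ℂ}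
    (hre : ζ.re = E.re) (him : |ζ.im| < E.im) {σ : ℝ} (hσ : σ = 1 ∨ σ = -1) (hζ : ζ ∈ openHalf σ) :
    Tendsto (rhSolution n E Ef t x) (𝓝[cutSide E τ] ζ) (𝓝 (psi Ef t x ζ
      * expSigma3 (Complex.I * ζ * t)
      * triangularFactor σ ((τ * Complex.I * √((E.im + ζ.im) / (E.im - ζ.im)) - 1)
        / (τ * Complex.I * √((E.im + ζ.im) / (E.im - ζ.im)) + 1)) (theta n t x ζ))) := by
  have h1 : Continuous fun z : ℂ => psi Ef t x z * expSigma3 (Complex.I * z * t) :=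
    (hsol.psi_differentiable ht hx.le hxL).continuous.mul (expSigma3_continuous.comp (by fun_prop))
  have hθ := (theta_differentiableAt hn t x
    (im_ne_zero_of_mem_openHalf hζ)).continuousAt.tendsto.mono_left
    (nhdsWithin_le_nhds (s := cutSide E τ))
  have h2 := ((triangularFactor_continuous σ).tendsto (_, theta n t x ζ)).comp
    ((rFun_tendsto_segment hE hre him hτ).prodMk_nhds hθ)
  refine (((h1.tendsto ζ).mono_left nhdsWithin_le_nhds).mul h2).congr' ?_
  filter_upwards [nhdsWithin_le_nhds ((isOpen_openHalf σ).mem_nhds hζ)] with z hz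
  exact (rhSolution_of_mem_openHalf hσ hz).symm

/-- The local conditions of the Riemann--Hilbert problem, with the normalization as a hypothesis. -/
theorem rhSolution_solvesRH_of_normalization (hn : IsLineShape n) {E : ℂ} (hE : 0 < E.im) {t x : ℝ}
    (ht : 0 ≤ t) (hx : 0 < x) (hxL : (x : EReal) < L)
    (hnorm : ∀ i j, (fun z => rhSolution n E Ef t x z i j - (1 : Mat2) i j)
      =O[Bornology.cobounded ℂ ⊓ 𝓟 (closedContour E)ᶜ] (fun z => z⁻¹)) :
    SolvesRH n E t x (rhSolution n E Ef t x) := by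
  have hreal : ∀ τ : ℝ, (τ = 1 ∨ τ = -1) → ∀ ζ ∈ regularContour n E, ζ.im = 0 →
      Tendsto (rhSolution n E Ef t x) (sideFilter E τ ζ) (𝓝 (psi Ef t x ζ
        * expSigma3 (Complex.I * ζ * t)
        * triangularFactor τ (rFun E ζ) (sideValue τ (theta n t x) ζ))) := by
    intro τ hτ ζ hζ h
    obtain ⟨-, h2, h3⟩ | ⟨-, h2, -⟩ := hζ
    · have := hsol.rhSolution_tendsto_real hn hE ht hx hxL hτ h2 h3
      rw [ofReal_re_of_im_eq_zero h] at this
      rwa [sideFilter, if_pos h]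
    · exact absurd h h2
  have hcut : ∀ τ : ℝ, (τ = 1 ∨ τ = -1) → ∀ ζ ∈ regularContour n E, ∀ σ : ℝ, (σ = 1 ∨ σ = -1) →
      ζ ∈ openHalf σ → Tendsto (rhSolution n E Ef t x) (sideFilter E τ ζ) (𝓝 (psi Ef t x ζ
      * expSigma3 (Complex.I * ζ * t)
      * triangularFactor σ ((τ * Complex.I * √((E.im + ζ.im) / (E.im - ζ.im)) - 1)
        / (τ * Complex.I * √((E.im + ζ.im) / (E.im - ζ.im)) + 1)) (theta n t x ζ))) := by
    intro τ hτ ζ hζ σ hσ h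
    have him := im_ne_zero_of_mem_openHalf h
    obtain ⟨h1, -, -⟩ | ⟨h1, -, h3⟩ := hζ
    · exact absurd h1 him
    · rw [sideFilter, if_neg him]
      exact hsol.rhSolution_tendsto_cut hn hE ht hx hxL hτ h1 h3 hσ h
  have hex : ∀ τ : ℝ, (τ = 1 ∨ τ = -1) → ∀ ζ ∈ regularContour n E,
      ∃ A : Mat2, Tendsto (rhSolution n E Ef t x) (sideFilter E τ ζ) (𝓝 A) := by
    intro τ hτ ζ hζ
    by_cases h : ζ.im = 0
    · exact ⟨_, hreal τ hτ ζ hζ h⟩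
    · obtain ⟨σ, hσ, h'⟩ := exists_mem_openHalf h
      exact ⟨_, hcut τ hτ ζ hζ σ hσ h'⟩
  constructor
  · exact fun i j z hz =>
      (hsol.rhSolution_differentiableAt hn hE ht hx hxL hz i j).differentiableWithinAt
  · exact fun ζ hζ => by rw [plusSide_eq]; exact hex 1 (.inl rfl) ζ hζ
  · exact fun ζ hζ => by rw [minusSide_eq]; exact hex (-1) (.inr rfl) ζ hζ
  · exact fun l _ => hsol.rhSolution_isBigO_one hn E ht hx hxL l
  · exact hsol.rhSolution_isBigO_rpow hn E ht hx hxL (.inr (left_mem_segment ℝ _ _))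
  · exact hsol.rhSolution_isBigO_rpow hn E ht hx hxL (.inr (right_mem_segment ℝ _ _))
  · intro ζ hζ
    have := sideFilter_neBot E (τ := 1) (.inl rfl) hζ
    have := sideFilter_neBot E (τ := -1) (.inr rfl) hζ
    rw [minusValue, plusValue, plusSide_eq, minusSide_eq]
    by_cases h : ζ.im = 0
    · rw [(hreal 1 (.inl rfl) ζ hζ h).limUnder_eq, (hreal (-1) (.inr rfl) ζ hζ h).limUnder_eq,
        mul_assoc _ (triangularFactor _ _ _)]
      congr 1
      have e : Complex.exp (2 * Complex.I * (sideValue (-1) (theta n t x) ζ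
          - sideValue 1 (theta n t x) ζ)) = Complex.exp (-2 * Complex.I * sideValue 1 (theta n t x) ζ)
          * Complex.exp (2 * Complex.I * sideValue (-1) (theta n t x) ζ) := by
        rw [← Complex.exp_add]; congr 1; ring
      simp only [jumpMatrix, if_pos h, triangularFactor, show (-1 : ℝ) ≠ 1 by norm_num, if_true,
        if_false, e]
      ext i j
      fin_cases i <;> fin_cases j <;> simp [Matrix.mul_apply, Fin.sum_univ_two]
      ring
    · obtain ⟨σ, hσ, h'⟩ := exists_mem_openHalf h
      rw [(hcut 1 (.inl rfl) ζ hζ σ hσ h').limUnder_eq,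
        (hcut (-1) (.inr rfl) ζ hζ σ hσ h').limUnder_eq, mul_assoc _ (triangularFactor _ _ _)]
      congr 1
      obtain ⟨h1, -, -⟩ | ⟨-, -, h3⟩ := hζ
      · exact absurd h1 h
      have hh := hFun_eq_sub hE h3
      have h' : 0 < σ * ζ.im := h'
      rcases hσ with rfl | rfl
      · simp only [jumpMatrix, if_neg h, if_pos (show 0 < ζ.im by linarith), triangularFactor,
          if_true, hh]
        ext i j
        fin_cases i <;> fin_cases j <;> simp [Matrix.mul_apply, Fin.sum_univ_two]
        ring
      · simp only [jumpMatrix, if_neg h, if_neg (show ¬ 0 < ζ.im by linarith), triangularFactor,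
          show (-1 : ℝ) ≠ 1 by norm_num, if_false, hh]
        ext i j
        fin_cases i <;> fin_cases j <;> simp [Matrix.mul_apply, Fin.sum_univ_two]
        ring
  · exact hnorm

end MaxwellBloch.IsSolution

/-! ### Oscillatory systems with a large parameter -/

/-- A scalar equation `u' = 2 i ζ u + g`, where `Im ζ` is bounded from below. -/
theorem norm_le_of_oscillatory {u : ℝ → ℂ} {ζ : ℂ} {a b A G D : ℝ} (hab : a < b) (hA : 0 ≤ A)
    (hζ : -A ≤ ζ.im) (hG : 0 ≤ G) (hu : ContinuousOn u (Ioc a b))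
    (hd : ∀ s ∈ Ioo a b, ∃ g, HasDerivAt u (2 * Complex.I * ζ * u s + g) s ∧ ‖g‖ ≤ G)
    (hD : ∀ᶠ s in 𝓝[>] a, ‖u s‖ ≤ D) :
    ‖u b‖ ≤ (D + G * (b - a)) * Real.exp (2 * A * (b - a)) := by
  obtain ⟨s, hs, hsab⟩ := (hD.and (Ioo_mem_nhdsGT hab)).exists
  have hexp : ∀ τ ∈ Icc s b, ‖Complex.exp (2 * Complex.I * ζ * (b - τ))‖
      ≤ Real.exp (2 * A * (b - a)) := by
    intro τ hτ
    rw [Complex.norm_exp]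
    refine Real.exp_le_exp.2 ?_
    have : (2 * Complex.I * ζ * ((b : ℂ) - τ)).re = -(2 * ζ.im * (b - τ)) := by simp
    rw [this]
    have h1 : 0 ≤ b - τ := sub_nonneg.2 hτ.2
    have h2 : b - τ ≤ b - a := by linarith [hτ.1, hsab.1]
    nlinarith
  choose! g hg hgG using hd
  have key := norm_le_add_sub_of_deriv_bound (a := s) (b := b)
    (f := fun τ => Complex.exp (2 * Complex.I * ζ * (b - τ)) * u τ)
    (f' := fun τ => Complex.exp (2 * Complex.I * ζ * (b - τ)) * g τ)
    (B := fun τ => Real.exp (2 * A * (b - a)) * G * τ)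
    (B' := fun _ => Real.exp (2 * A * (b - a)) * G) s hsab.2.le ?_ ?_ ?_ ?_
  · simp only [sub_self, mul_zero, Complex.exp_zero, one_mul, norm_mul] at key
    refine key.trans ?_
    have h1 := hexp s ⟨le_rfl, hsab.2.le⟩
    have h2 : b - s ≤ b - a := by linarith [hsab.1]
    calc _ ≤ Real.exp (2 * A * (b - a)) * D + Real.exp (2 * A * (b - a)) * G * (b - s) := by
          rw [← mul_sub]; gcongr
      _ ≤ Real.exp (2 * A * (b - a)) * D + Real.exp (2 * A * (b - a)) * G * (b - a) := by gcongr
      _ = _ := by ring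
  · refine ContinuousOn.mul (Continuous.continuousOn (by fun_prop))
      (hu.mono fun τ hτ => ⟨hsab.1.trans_le hτ.1, hτ.2⟩)
  · intro τ hτ _
    have hτ' : τ ∈ Ioo a b := ⟨hsab.1.trans hτ.1, hτ.2⟩
    have h1 : HasDerivAt (fun τ : ℝ => 2 * Complex.I * ζ * ((b : ℂ) - τ))
        (2 * Complex.I * ζ * -1) τ :=
      ((hasDerivAt_id τ).ofReal_comp.const_sub (b : ℂ)).const_mul _
    refine (h1.cexp.mul (hg τ hτ')).congr_deriv ?_
    ring
  · exact fun τ => by simpa using (hasDerivAt_id τ).const_mul (Real.exp (2 * A * (b - a)) * G)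
  · intro τ hτ _
    rw [norm_mul]
    have h1 := hexp τ ⟨hτ.1.le, hτ.2.le⟩
    have h2 := hgG τ ⟨hsab.1.trans hτ.1, hτ.2⟩
    gcongr

/-- The same equation in the upper half-plane: the inhomogeneity is damped. -/
theorem norm_le_of_damped {u : ℝ → ℂ} {ζ : ℂ} {a b G : ℝ} (hab : a ≤ b) (hζ : 0 < ζ.im)
    (hu : ContinuousOn u (Icc a b)) (hG : 0 ≤ G)
    (hd : ∀ s ∈ Ioo a b, ∃ g, HasDerivAt u (2 * Complex.I * ζ * u s + g) s ∧ ‖g‖ ≤ G) :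
    ‖u b‖ ≤ Real.exp (-(2 * ζ.im * (b - a))) * ‖u a‖ + G / (2 * ζ.im) := by
  have hexp : ∀ τ : ℝ, ‖Complex.exp (2 * Complex.I * ζ * (b - τ))‖
      = Real.exp (-(2 * ζ.im * (b - τ))) := by
    intro τ
    rw [Complex.norm_exp]
    simp
  choose! g hg hgG using hd
  have key := norm_le_add_sub_of_deriv_bound (a := a) (b := b)
    (f := fun τ => Complex.exp (2 * Complex.I * ζ * (b - τ)) * u τ)
    (f' := fun τ => Complex.exp (2 * Complex.I * ζ * (b - τ)) * g τ)
    (B := fun τ => G / (2 * ζ.im) * Real.exp (-(2 * ζ.im * (b - τ))))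
    (B' := fun τ => G * Real.exp (-(2 * ζ.im * (b - τ)))) a hab ?_ ?_ ?_ ?_
  · simp only [sub_self, mul_zero, Complex.exp_zero, one_mul, norm_mul, hexp, neg_zero,
      Real.exp_zero, mul_one] at key
    refine key.trans ?_
    have : 0 ≤ G / (2 * ζ.im) * Real.exp (-(2 * ζ.im * (b - a))) := by positivity
    linarith
  · exact ContinuousOn.mul (Continuous.continuousOn (by fun_prop)) hu
  · intro τ hτ _
    have h1 : HasDerivAt (fun τ : ℝ => 2 * Complex.I * ζ * ((b : ℂ) - τ))
        (2 * Complex.I * ζ * -1) τ :=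
      ((hasDerivAt_id τ).ofReal_comp.const_sub (b : ℂ)).const_mul _
    refine (h1.cexp.mul (hg τ hτ)).congr_deriv ?_
    ring
  · intro τ
    have h1 : HasDerivAt (fun τ : ℝ => -(2 * ζ.im * (b - τ))) (-(2 * ζ.im * -1)) τ :=
      (((hasDerivAt_id τ).const_sub b).const_mul _).neg
    refine (h1.exp.const_mul (G / (2 * ζ.im))).congr_deriv ?_
    field_simp
  · intro τ hτ _
    rw [norm_mul, hexp, mul_comm]
    have := hgG τ hτ
    gcongr

/-- The system `u' = 2 i ζ u + (e / 2) v`, `v' = -(ē / 2) u` on `[a, b]`, perturbed by coefficients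
of size `C / |ζ|`, with a continuously differentiable potential `e` bounded by `C` together with
its derivative. The value of `e` at the left endpoint plays no role. -/
structure OscillatorySystem (a b C : ℝ) (ζ : ℂ) (u v e : ℝ → ℂ) : Prop where
  u_continuousOn : ContinuousOn u (Icc a b)
  v_continuousOn : ContinuousOn v (Icc a b)
  hasDerivAt : ∀ s ∈ Ioo a b, ∃ α β γ δ : ℂ,
    HasDerivAt u (2 * Complex.I * ζ * u s + e s / 2 * v s + α * u s + β * v s) s ∧
    HasDerivAt v (-(conj (e s) / 2) * u s + γ * u s + δ * v s) s ∧
    ‖α‖ ≤ C / ‖ζ‖ ∧ ‖β‖ ≤ C / ‖ζ‖ ∧ ‖γ‖ ≤ C / ‖ζ‖ ∧ ‖δ‖ ≤ C / ‖ζ‖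
  e_continuousOn : ContinuousOn e (Ioc a b)
  e_hasDerivAt : ∀ s ∈ Ioo a b, ∃ e', HasDerivAt e e' s ∧ ‖e'‖ ≤ C
  e_bound : ∀ s ∈ Ioc a b, ‖e s‖ ≤ C

namespace OscillatorySystem

variable {a b A C T B : ℝ} {ζ : ℂ} {u v e : ℝ → ℂ}

theorem mono (h : OscillatorySystem a b C ζ u v e) {c : ℝ} (hc : c ∈ Icc a b) :
    OscillatorySystem a c C ζ u v e where
  u_continuousOn := h.u_continuousOn.mono (Icc_subset_Icc_right hc.2)
  v_continuousOn := h.v_continuousOn.mono (Icc_subset_Icc_right hc.2)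
  hasDerivAt s hs := h.hasDerivAt s ⟨hs.1, hs.2.trans_le hc.2⟩
  e_continuousOn := h.e_continuousOn.mono (Ioc_subset_Ioc_right hc.2)
  e_hasDerivAt s hs := h.e_hasDerivAt s ⟨hs.1, hs.2.trans_le hc.2⟩
  e_bound s hs := h.e_bound s ⟨hs.1, hs.2.trans hc.2⟩

theorem mono_const (h : OscillatorySystem a b C ζ u v e) {D : ℝ} (hCD : C ≤ D) :
    OscillatorySystem a b D ζ u v e where
  u_continuousOn := h.u_continuousOn
  v_continuousOn := h.v_continuousOn
  hasDerivAt s hs := by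
    obtain ⟨α, β, γ, δ, h1, h2, h3, h4, h5, h6⟩ := h.hasDerivAt s hs
    have hle : C / ‖ζ‖ ≤ D / ‖ζ‖ := by gcongr
    exact ⟨α, β, γ, δ, h1, h2, h3.trans hle, h4.trans hle, h5.trans hle, h6.trans hle⟩
  e_continuousOn := h.e_continuousOn
  e_hasDerivAt s hs := by
    obtain ⟨e', h1, h2⟩ := h.e_hasDerivAt s hs
    exact ⟨e', h1, h2.trans hCD⟩
  e_bound s hs := (h.e_bound s hs).trans hCD

/-- The energy `|u|² + |v|²`: the terms with `e` cancel, and `ζ` contributes `-4 Im ζ |u|²`. -/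
theorem energy_le (h : OscillatorySystem a b C ζ u v e) (hab : a ≤ b) (hA : 0 ≤ A)
    (hζ : -A ≤ ζ.im) (h1 : 1 ≤ ‖ζ‖) (hC : 0 ≤ C) : ‖u b‖ ^ 2 + ‖v b‖ ^ 2
      ≤ (‖u a‖ ^ 2 + ‖v a‖ ^ 2) * Real.exp ((4 * A + 4 * C) * (b - a)) := by
  set K := 4 * A + 4 * C with hK
  have hCζ : C / ‖ζ‖ ≤ C := div_le_self hC h1
  have hd : ∀ s ∈ Ioo a b, ∃ f', HasDerivAt (fun s => ‖u s‖ ^ 2 + ‖v s‖ ^ 2) f' s ∧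
      f' ≤ K * (‖u s‖ ^ 2 + ‖v s‖ ^ 2) := by
    intro s hs
    obtain ⟨α, β, γ, δ, hu, hv, hα, hβ, hγ, hδ⟩ := h.hasDerivAt s hs
    refine ⟨_, hu.norm_sq.add hv.norm_sq, ?_⟩
    rw [Complex.inner, Complex.inner]
    have e1 : ((2 * Complex.I * ζ * u s + e s / 2 * v s + α * u s + β * v s) * conj (u s)).re
        + ((-(conj (e s) / 2) * u s + γ * u s + δ * v s) * conj (v s)).re
        = -(2 * ζ.im) * ‖u s‖ ^ 2 + ((conj (u s) * (α * u s)).re + (conj (u s) * (β * v s)).re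
          + (conj (v s) * (γ * u s)).re + (conj (v s) * (δ * v s)).re) := by
      rw [← Complex.normSq_eq_norm_sq, Complex.normSq_apply]
      simp only [Complex.add_re, Complex.mul_re, Complex.mul_im, Complex.conj_re, Complex.conj_im,
        Complex.add_im, Complex.neg_re, Complex.neg_im, Complex.div_ofNat_re, Complex.div_ofNat_im,
        Complex.I_re, Complex.I_im, Complex.re_ofNat, Complex.im_ofNat]
      ring
    have e2 : ∀ p q w c : ℂ, ‖c‖ ≤ C / ‖ζ‖ → (conj p * (c * w)).re ≤ C * (‖p‖ * ‖w‖) := by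
      intro p _ w c hc
      refine (Complex.re_le_norm _).trans ?_
      rw [norm_mul, norm_mul, RCLike.norm_conj]
      have := hc.trans hCζ
      calc ‖p‖ * (‖c‖ * ‖w‖) = ‖c‖ * (‖p‖ * ‖w‖) := by ring
        _ ≤ _ := by gcongr
    have f1 := e2 (u s) 0 (u s) α hα
    have f2 := e2 (u s) 0 (v s) β hβ
    have f3 := e2 (v s) 0 (u s) γ hγ
    have f4 := e2 (v s) 0 (v s) δ hδ
    have f5 : -(2 * ζ.im) * ‖u s‖ ^ 2 ≤ 2 * A * ‖u s‖ ^ 2 := by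
      have : -(2 * ζ.im) ≤ 2 * A := by linarith
      gcongr
    have f6 : 2 * (‖u s‖ * ‖v s‖) ≤ ‖u s‖ ^ 2 + ‖v s‖ ^ 2 := by
      nlinarith [sq_nonneg (‖u s‖ - ‖v s‖)]
    have f7 : C * (2 * (‖u s‖ * ‖v s‖)) ≤ C * (‖u s‖ ^ 2 + ‖v s‖ ^ 2) := by gcongr
    have f8 : 0 ≤ A * ‖v s‖ ^ 2 := by positivity
    rw [← mul_add, e1, hK]
    nlinarith
  choose! f' hf' hle using hd
  have hanti : AntitoneOn (fun s => (‖u s‖ ^ 2 + ‖v s‖ ^ 2) * Real.exp (-K * s)) (Icc a b) := by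
    have hg : ∀ s ∈ Ioo a b, HasDerivAt (fun s => (‖u s‖ ^ 2 + ‖v s‖ ^ 2) * Real.exp (-K * s))
        (f' s * Real.exp (-K * s)
          + (‖u s‖ ^ 2 + ‖v s‖ ^ 2) * (Real.exp (-K * s) * (-K * 1))) s := fun s hs =>
      (hf' s hs).mul (((hasDerivAt_id s).const_mul (-K)).exp)
    refine antitoneOn_of_deriv_nonpos (convex_Icc a b) ?_ ?_ ?_
    · exact ((h.u_continuousOn.norm.pow 2).add (h.v_continuousOn.norm.pow 2)).mul
        (Continuous.continuousOn (by fun_prop))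
    · rw [interior_Icc]
      exact fun s hs => (hg s hs).differentiableAt.differentiableWithinAt
    · rw [interior_Icc]
      intro s hs
      rw [(hg s hs).deriv]
      have := hle s hs
      have := Real.exp_pos (-K * s)
      nlinarith
  have := hanti ⟨le_rfl, hab⟩ ⟨hab, le_rfl⟩ hab
  simp only at this
  have e3 : Real.exp (K * (b - a)) = Real.exp (-K * a) * Real.exp (K * b) := by
    rw [← Real.exp_add]; congr 1; ring
  have e4 : Real.exp (-K * b) * Real.exp (K * b) = 1 := by
    rw [← Real.exp_add, neg_mul, neg_add_cancel, Real.exp_zero]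
  calc ‖u b‖ ^ 2 + ‖v b‖ ^ 2
      = (‖u b‖ ^ 2 + ‖v b‖ ^ 2) * Real.exp (-K * b) * Real.exp (K * b) := by
        rw [mul_assoc, e4, mul_one]
    _ ≤ (‖u a‖ ^ 2 + ‖v a‖ ^ 2) * Real.exp (-K * a) * Real.exp (K * b) := by gcongr
    _ = _ := by rw [e3]; ring

theorem bound (h : OscillatorySystem a b C ζ u v e) (hab : a ≤ b) (hT : b - a ≤ T) (hA : 0 ≤ A)
    (hζ : -A ≤ ζ.im) (h1 : 1 ≤ ‖ζ‖) (hC : 0 ≤ C) (hu : ‖u a‖ ≤ C) (hv : ‖v a‖ ≤ C) :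
    ‖u b‖ ≤ 2 * C * Real.exp ((4 * A + 4 * C) * T) ∧
      ‖v b‖ ≤ 2 * C * Real.exp ((4 * A + 4 * C) * T) := by
  have h2 := h.energy_le hab hA hζ h1 hC
  have hT0 : 0 ≤ T := (sub_nonneg.2 hab).trans hT
  have h3 : Real.exp ((4 * A + 4 * C) * (b - a)) ≤ Real.exp ((4 * A + 4 * C) * T) :=
    Real.exp_le_exp.2 (by gcongr)
  have h4 : 1 ≤ Real.exp ((4 * A + 4 * C) * T) := Real.one_le_exp (by positivity)
  set M := Real.exp ((4 * A + 4 * C) * T)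
  have h5 : ‖u b‖ ^ 2 + ‖v b‖ ^ 2 ≤ (2 * C * M) ^ 2 := by
    calc _ ≤ (C ^ 2 + C ^ 2) * M := h2.trans (by gcongr)
      _ ≤ (C ^ 2 + C ^ 2) * (2 * M ^ 2) := by gcongr; nlinarith
      _ = _ := by ring
  have h6 : 0 ≤ 2 * C * M := by positivity
  exact ⟨abs_le_of_sq_le_sq' (by nlinarith [sq_nonneg ‖v b‖]) h6 |>.2,
    abs_le_of_sq_le_sq' (by nlinarith [sq_nonneg ‖u b‖]) h6 |>.2⟩

theorem v_hasDerivAt (h : OscillatorySystem a b C ζ u v e) (hC : 0 ≤ C) {D : ℝ} {s : ℝ}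
    (hs : s ∈ Ioo a b) (hu : ‖u s‖ ≤ D) (hv : ‖v s‖ ≤ B) (h1 : 1 ≤ ‖ζ‖) :
    ∃ v', HasDerivAt v v' s ∧ ‖v'‖ ≤ 2 * C * D + C * B / ‖ζ‖ := by
  obtain ⟨α, β, γ, δ, -, hv', -, -, hγ, hδ⟩ := h.hasDerivAt s hs
  refine ⟨_, hv', ?_⟩
  have he := h.e_bound s ⟨hs.1, hs.2.le⟩
  have hγ' := hγ.trans (div_le_self hC h1)
  have hD := (norm_nonneg _).trans hu
  have g1 : ‖-(conj (e s) / 2) * u s‖ ≤ C / 2 * D := by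
    rw [norm_mul, norm_neg, norm_div, RCLike.norm_conj, RCLike.norm_ofNat]
    gcongr
  have g2 : ‖γ * u s‖ ≤ C * D := by rw [norm_mul]; gcongr
  have g3 : ‖δ * v s‖ ≤ C / ‖ζ‖ * B := by rw [norm_mul]; gcongr
  calc _ ≤ ‖-(conj (e s) / 2) * u s‖ + ‖γ * u s‖ + ‖δ * v s‖ := norm_add₃_le
    _ ≤ C / 2 * D + C * D + C / ‖ζ‖ * B := by gcongr
    _ ≤ 2 * C * D + C * B / ‖ζ‖ := by
      rw [div_mul_eq_mul_div C ‖ζ‖ B]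
      have := mul_nonneg hC hD
      linarith

/-- The first approximation `u ≈ -e v / (4 i ζ)`: the difference satisfies the scalar equation with
an inhomogeneity of order `1 / ζ`. -/
theorem corrected_hasDerivAt (h : OscillatorySystem a b C ζ u v e) (hC : 0 ≤ C) {s : ℝ}
    (hs : s ∈ Ioo a b) (hu : ‖u s‖ ≤ B) (hv : ‖v s‖ ≤ B) (h1 : 1 ≤ ‖ζ‖) :
    ∃ g, HasDerivAt (fun s => u s + e s * v s / (4 * Complex.I * ζ))
      (2 * Complex.I * ζ * (u s + e s * v s / (4 * Complex.I * ζ)) + g) s ∧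
      ‖g‖ ≤ (3 * C * B + 3 * C ^ 2 * B) / ‖ζ‖ := by
  obtain ⟨v', hv', hv'n⟩ := h.v_hasDerivAt hC hs hu hv h1
  obtain ⟨e', he', he'n⟩ := h.e_hasDerivAt s hs
  obtain ⟨α, β, γ, δ, hu', -, hα, hβ, -, -⟩ := h.hasDerivAt s hs
  have h0 : 0 < ‖ζ‖ := one_pos.trans_le h1
  have hζ0 : ζ ≠ 0 := norm_pos_iff.1 h0
  have hB := (norm_nonneg _).trans hu
  refine ⟨α * u s + β * v s + (e' * v s + e s * v') / (4 * Complex.I * ζ),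
    (hu'.add ((he'.mul hv').div_const _)).congr_deriv ?_, ?_⟩
  · have := Complex.I_ne_zero
    field_simp
    ring
  · have he := h.e_bound s ⟨hs.1, hs.2.le⟩
    have hv'2 : ‖v'‖ ≤ 3 * C * B := by
      have : C * B / ‖ζ‖ ≤ C * B := div_le_self (by positivity) h1
      linarith
    have g1 : ‖α * u s‖ ≤ C / ‖ζ‖ * B := by rw [norm_mul]; gcongr
    have g2 : ‖β * v s‖ ≤ C / ‖ζ‖ * B := by rw [norm_mul]; gcongr
    have g3 : ‖(e' * v s + e s * v') / (4 * Complex.I * ζ)‖ ≤ (C * B + C * (3 * C * B)) / ‖ζ‖ := by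
      rw [norm_div]
      have e1 : ‖(4 * Complex.I * ζ : ℂ)‖ = 4 * ‖ζ‖ := by simp
      have e2 : ‖e' * v s + e s * v'‖ ≤ C * B + C * (3 * C * B) := by
        refine (norm_add_le _ _).trans ?_
        rw [norm_mul, norm_mul]
        gcongr
      rw [e1]
      gcongr
      linarith
    calc _ ≤ ‖α * u s‖ + ‖β * v s‖ + ‖(e' * v s + e s * v') / (4 * Complex.I * ζ)‖ := norm_add₃_le
      _ ≤ C / ‖ζ‖ * B + C / ‖ζ‖ * B + (C * B + C * (3 * C * B)) / ‖ζ‖ := by gcongr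
      _ = _ := by ring

theorem corrected_continuousOn (h : OscillatorySystem a b C ζ u v e) :
    ContinuousOn (fun s => u s + e s * v s / (4 * Complex.I * ζ)) (Ioc a b) :=
  (h.u_continuousOn.mono Ioc_subset_Icc_self).add
    ((h.e_continuousOn.mul (h.v_continuousOn.mono Ioc_subset_Icc_self)).div_const _)

end OscillatorySystem

/-- Uniform asymptotics for `Im ζ ≥ -A`. -/
theorem exists_oscillatory_bound {A C T : ℝ} (hA : 0 ≤ A) (hC : 0 ≤ C) (hT : 0 ≤ T) :
    ∃ K : ℝ, 0 ≤ K ∧ ∀ (a b : ℝ) (ζ : ℂ) (u v e : ℝ → ℂ), a ≤ b → b - a ≤ T → -A ≤ ζ.im → 1 ≤ ‖ζ‖ →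
      OscillatorySystem a b C ζ u v e → ‖u a‖ ≤ C / ‖ζ‖ → ‖v a‖ ≤ C →
      ‖u b‖ ≤ K / ‖ζ‖ ∧ ‖v b - v a‖ ≤ K / ‖ζ‖ := by
  set B := 2 * C * Real.exp ((4 * A + 4 * C) * T) with hB
  have hB0 : 0 ≤ B := by positivity
  set G := 3 * C * B + 3 * C ^ 2 * B with hG
  have hG0 : 0 ≤ G := by positivity
  set K₁ := (C + 1 + C * B + G * T) * Real.exp (2 * A * T) + C * B with hK₁
  have hK₁0 : 0 ≤ K₁ := by positivity
  have hu : ∀ (a b : ℝ) (ζ : ℂ) (u v e : ℝ → ℂ), a ≤ b → b - a ≤ T → -A ≤ ζ.im → 1 ≤ ‖ζ‖ →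
      OscillatorySystem a b C ζ u v e → ‖u a‖ ≤ C / ‖ζ‖ → ‖v a‖ ≤ C → ‖u b‖ ≤ K₁ / ‖ζ‖ := by
    intro a b ζ u v e hab hbT hζ h1 h hua hva
    have h0 : 0 < ‖ζ‖ := one_pos.trans_le h1
    have hbd : ∀ s ∈ Icc a b, ‖u s‖ ≤ B ∧ ‖v s‖ ≤ B := fun s hs =>
      (h.mono hs).bound hs.1 (by linarith [hs.2]) hA hζ h1 hC (hua.trans (div_le_self hC h1)) hva
    have hcor : ∀ s ∈ Ioc a b, ‖e s * v s / (4 * Complex.I * ζ)‖ ≤ C * B / ‖ζ‖ := by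
      intro s hs
      rw [norm_div, norm_mul]
      have e1 : ‖(4 * Complex.I * ζ : ℂ)‖ = 4 * ‖ζ‖ := by simp
      have e2 := h.e_bound s hs
      have e3 := (hbd s ⟨hs.1.le, hs.2⟩).2
      rw [e1]
      gcongr
      linarith
    rcases hab.eq_or_lt with rfl | hlt
    · refine hua.trans (div_le_div_of_nonneg_right ?_ h0.le)
      have h2 : 1 ≤ Real.exp (2 * A * T) := Real.one_le_exp (by positivity)
      have h3 : C ≤ (C + 1 + C * B + G * T) := by
        have : 0 ≤ C * B := by positivity
        have : 0 ≤ G * T := by positivity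
        linarith
      have : C * 1 ≤ (C + 1 + C * B + G * T) * Real.exp (2 * A * T) := by gcongr
      have : 0 ≤ C * B := by positivity
      linarith
    have hcont : Tendsto u (𝓝[>] a) (𝓝 (u a)) :=
      ((h.u_continuousOn a ⟨le_rfl, hab⟩).mono_of_mem_nhdsWithin
        (mem_of_superset (Ioc_mem_nhdsGT hlt) Ioc_subset_Icc_self)).tendsto
    have hev : ∀ᶠ s in 𝓝[>] a, ‖u s‖ < (C + 1) / ‖ζ‖ :=
      hcont.norm.eventually_lt_const (hua.trans_lt (by gcongr; linarith))
    have hD : ∀ᶠ s in 𝓝[>] a, ‖u s + e s * v s / (4 * Complex.I * ζ)‖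
        ≤ (C + 1 + C * B) / ‖ζ‖ := by
      filter_upwards [hev, Ioc_mem_nhdsGT hlt] with s hs hs'
      refine (norm_add_le _ _).trans ?_
      rw [add_div]
      exact add_le_add hs.le (hcor s hs')
    have key := norm_le_of_oscillatory hlt hA hζ (div_nonneg hG0 h0.le) h.corrected_continuousOn
      (fun s hs => h.corrected_hasDerivAt hC hs (hbd s ⟨hs.1.le, hs.2.le⟩).1
        (hbd s ⟨hs.1.le, hs.2.le⟩).2 h1) hD
    calc ‖u b‖ = ‖(u b + e b * v b / (4 * Complex.I * ζ)) - e b * v b / (4 * Complex.I * ζ)‖ := by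
          rw [add_sub_cancel_right]
      _ ≤ ((C + 1 + C * B) / ‖ζ‖ + G / ‖ζ‖ * (b - a)) * Real.exp (2 * A * (b - a))
          + C * B / ‖ζ‖ := (norm_sub_le _ _).trans (add_le_add key (hcor b ⟨hlt, le_rfl⟩))
      _ ≤ ((C + 1 + C * B) / ‖ζ‖ + G / ‖ζ‖ * T) * Real.exp (2 * A * T) + C * B / ‖ζ‖ := by gcongr
      _ = _ := by rw [hK₁]; ring
  refine ⟨max K₁ ((2 * C * K₁ + C * B) * T), le_max_of_le_left hK₁0,
    fun a b ζ u v e hab hbT hζ h1 h hua hva => ?_⟩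
  have h0 : 0 < ‖ζ‖ := one_pos.trans_le h1
  refine ⟨(hu a b ζ u v e hab hbT hζ h1 h hua hva).trans (by gcongr; exact le_max_left _ _), ?_⟩
  have hd : ∀ s ∈ Ioo a b, ∃ v', HasDerivAt v v' s ∧ ‖v'‖ ≤ (2 * C * K₁ + C * B) / ‖ζ‖ := by
    intro s hs
    have hs' : s ∈ Icc a b := ⟨hs.1.le, hs.2.le⟩
    obtain ⟨v', h2, h3⟩ := h.v_hasDerivAt hC hs
      (hu a s ζ u v e hs.1.le (by linarith [hs.2]) hζ h1 (h.mono hs') hua hva)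
      ((h.mono hs').bound (T := T) hs.1.le (by linarith [hs.2]) hA hζ h1 hC
        (hua.trans (div_le_self hC h1)) hva).2 h1
    refine ⟨v', h2, h3.trans (le_of_eq ?_)⟩
    rw [← hB]
    ring
  choose! v' hv' hv'n using hd
  have := norm_le_add_sub_of_deriv_bound (f := fun s => v s - v a) (f' := v')
    (B := fun s => (2 * C * K₁ + C * B) / ‖ζ‖ * s) (B' := fun _ => (2 * C * K₁ + C * B) / ‖ζ‖) a hab
    (h.v_continuousOn.sub continuousOn_const) (fun s hs _ => (hv' s hs).sub_const _)
    (fun s => by simpa using (hasDerivAt_id s).const_mul ((2 * C * K₁ + C * B) / ‖ζ‖))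
    (fun s hs _ => hv'n s hs)
  rw [sub_self, norm_zero, zero_add, ← mul_sub] at this
  calc _ ≤ _ := this
    _ ≤ (2 * C * K₁ + C * B) / ‖ζ‖ * T := by gcongr
    _ = (2 * C * K₁ + C * B) * T / ‖ζ‖ := by ring
    _ ≤ _ := by gcongr; exact le_max_right _ _

/-- In a cone in the upper half-plane the leading term of `u` is determined by the endpoint value
of the potential. -/
theorem tendsto_mul_of_oscillatory {ι : Type*} {l : Filter ι} {a b c C : ℝ} (hab : a < b)
    (hc : 0 < c) (hC : 0 ≤ C) {ζ : ι → ℂ} {u v : ι → ℝ → ℂ} {e : ℝ → ℂ}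
    (hζ : Tendsto (fun i => ‖ζ i‖) l atTop) (hcone : ∀ᶠ i in l, c * ‖ζ i‖ ≤ (ζ i).im)
    (h : ∀ᶠ i in l, OscillatorySystem a b C (ζ i) (u i) (v i) e)
    (hu : ∀ᶠ i in l, ‖u i a‖ ≤ C / ‖ζ i‖) (hv : ∀ᶠ i in l, ‖v i a‖ ≤ C)
    (hva : Tendsto (fun i => v i a) l (𝓝 1)) :
    Tendsto (fun i => ζ i * u i b) l (𝓝 (Complex.I * e b / 4)) := by
  obtain ⟨K, hK0, hK⟩ := exists_oscillatory_bound le_rfl hC (sub_nonneg.2 hab.le)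
  set B := 2 * C * Real.exp ((4 * 0 + 4 * C) * (b - a)) with hB
  have hB0 : 0 ≤ B := by positivity
  set G := 3 * C * B + 3 * C ^ 2 * B with hG
  have hG0 : 0 ≤ G := by positivity
  have h1 : ∀ᶠ i in l, 1 ≤ ‖ζ i‖ := hζ.eventually_ge_atTop 1
  have hinv : Tendsto (fun i => ‖ζ i‖⁻¹) l (𝓝 0) := tendsto_inv_atTop_zero.comp hζ
  -- the second component
  have hvb : Tendsto (fun i => v i b) l (𝓝 1) := by
    have h2 : Tendsto (fun i => v i b - v i a) l (𝓝 0) := by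
      refine squeeze_zero_norm' (a := fun i => K * ‖ζ i‖⁻¹) ?_ (by simpa using hinv.const_mul K)
      filter_upwards [hcone, h, hu, hv, h1] with i h2 h3 h4 h5 h6
      exact (hK a b _ _ _ _ hab.le le_rfl (by rw [neg_zero]; exact le_trans (by positivity) h2) h6 h3 h4 h5).2
    simpa using h2.add hva
  -- the corrected first component is of smaller order
  have hcorr : Tendsto (fun i => ζ i * (u i b + e b * v i b / (4 * Complex.I * ζ i))) l (𝓝 0) := by
    have h2 : Tendsto (fun i => (K + C * B) * Real.exp (-(c * (b - a) * ‖ζ i‖))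
        + G / (2 * c) * ‖ζ i‖⁻¹) l (𝓝 0) := by
      have h3 : Tendsto (fun i => Real.exp (-(c * (b - a) * ‖ζ i‖))) l (𝓝 0) :=
        Real.tendsto_exp_neg_atTop_nhds_zero.comp
          (hζ.const_mul_atTop (mul_pos hc (sub_pos.2 hab)))
      simpa using (h3.const_mul (K + C * B)).add (hinv.const_mul (G / (2 * c)))
    refine squeeze_zero_norm' ?_ h2
    filter_upwards [hcone, h, hu, hv, h1] with i h3 h4 h5 h6 h7
    have h0 : 0 < ‖ζ i‖ := one_pos.trans_le h7
    have him : 0 < (ζ i).im := (mul_pos hc h0).trans_le h3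
    have hua := h5.trans (div_le_self hC h7)
    have hbd : ∀ s ∈ Icc a b, ‖u i s‖ ≤ B ∧ ‖v i s‖ ≤ B := fun s hs =>
      (h4.mono hs).bound hs.1 (by linarith [hs.2]) le_rfl (by linarith) h7 hC hua h6
    set m := (a + b) / 2 with hm
    have hma : a < m := by rw [hm]; linarith
    have hmb : m < b := by rw [hm]; linarith
    have hd := norm_le_of_damped hmb.le him
      (h4.corrected_continuousOn.mono fun s hs => ⟨hma.trans_le hs.1, hs.2⟩)
      (div_nonneg hG0 h0.le) (fun s hs => h4.corrected_hasDerivAt hC ⟨hma.trans hs.1, hs.2⟩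
        (hbd s ⟨(hma.trans hs.1).le, hs.2.le⟩).1 (hbd s ⟨(hma.trans hs.1).le, hs.2.le⟩).2 h7)
    have hum : ‖u i m + e m * v i m / (4 * Complex.I * ζ i)‖ ≤ (K + C * B) / ‖ζ i‖ := by
      have g1 := (hK a m _ _ _ _ hma.le (by linarith) (by linarith) h7 (h4.mono ⟨hma.le, hmb.le⟩) h5 h6).1
      have g2 : ‖e m * v i m / (4 * Complex.I * ζ i)‖ ≤ C * B / ‖ζ i‖ := by
        rw [norm_div, norm_mul]
        have e1 : ‖(4 * Complex.I * ζ i : ℂ)‖ = 4 * ‖ζ i‖ := by simp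
        have e2 := h4.e_bound m ⟨hma, hmb.le⟩
        have e3 := (hbd m ⟨hma.le, hmb.le⟩).2
        rw [e1]
        gcongr
        linarith
      rw [add_div]
      exact (norm_add_le _ _).trans (add_le_add g1 g2)
    rw [norm_mul]
    have hexp : Real.exp (-(2 * (ζ i).im * (b - m))) ≤ Real.exp (-(c * (b - a) * ‖ζ i‖)) := by
      refine Real.exp_le_exp.2 (neg_le_neg ?_)
      have e1 : 2 * (ζ i).im * (b - m) = (b - a) * (ζ i).im := by rw [hm]; ring
      rw [e1]
      have := mul_le_mul_of_nonneg_left h3 (sub_nonneg.2 hab.le)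
      linarith
    have hG' : G / ‖ζ i‖ / (2 * (ζ i).im) ≤ G / ‖ζ i‖ / (2 * (c * ‖ζ i‖)) := by gcongr
    calc _ ≤ ‖ζ i‖ * (Real.exp (-(c * (b - a) * ‖ζ i‖)) * ((K + C * B) / ‖ζ i‖)
          + G / ‖ζ i‖ / (2 * (c * ‖ζ i‖))) := by
          gcongr
          exact hd.trans (add_le_add (mul_le_mul hexp hum (norm_nonneg _) (Real.exp_pos _).le) hG')
      _ = _ := by field_simp
  have h8 : Tendsto (fun i => ζ i * (u i b + e b * v i b / (4 * Complex.I * ζ i))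
      + Complex.I * (e b * v i b) / 4) l (𝓝 (0 + Complex.I * (e b * 1) / 4)) :=
    hcorr.add (((hvb.const_mul (e b)).const_mul Complex.I).div_const 4)
  rw [zero_add, mul_one] at h8
  refine h8.congr' ?_
  filter_upwards [h1] with i hi
  have hζ0 : ζ i ≠ 0 := norm_pos_iff.1 (one_pos.trans_le hi)
  have := Complex.I_ne_zero
  field_simp
  linear_combination (e b * v i b) * Complex.I_sq

/-! ### Large spectral parameter: the equation in `t` -/

namespace MaxwellBloch.IsSolution

variable {L : EReal} {n : ℝ → ℝ} {A₀ ω₀ : ℝ} {Ef : ℝ → ℝ → ℂ} {ρ : ℝ → ℝ → ℝ → ℂ}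
  {Nf : ℝ → ℝ → ℝ → ℝ} (hsol : IsSolution L n A₀ ω₀ Ef ρ Nf)

include hsol

theorem psi_entry_hasDerivAt {t x : ℝ} (ht : 0 < t) (hx : 0 ≤ x) (hxL : (x : EReal) < L)
    (hne : t ≠ x) (z : ℂ) (j : Fin 2) :
    HasDerivAt (fun s => psi Ef s x z 0 j)
      (-(Complex.I * z) * psi Ef t x z 0 j - Ef t x / 2 * psi Ef t x z 1 j) t ∧
    HasDerivAt (fun s => psi Ef s x z 1 j)
      (conj (Ef t x) / 2 * psi Ef t x z 0 j + Complex.I * z * psi Ef t x z 1 j) t := by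
  have h := hasMatDerivAt_iff.2 (hsol.psi_hasDerivAt ht hx hxL hne z)
  have h0 := h 0 j
  have h1 := h 1 j
  rw [coeffU_eq] at h0 h1
  simp only [Matrix.mul_apply, Fin.sum_univ_two] at h0 h1
  exact ⟨h0.congr_deriv (by simp; ring), h1.congr_deriv (by simp)⟩

/-- The columns of `Ψ exp (i z t σ₃)` form oscillatory systems with respect to `t ≥ x`. -/
theorem exists_oscillatorySystem_t {t x : ℝ} (hx : 0 < x) (hxL : (x : EReal) < L) :
    ∃ C : ℝ, 1 ≤ C ∧ ∀ z : ℂ,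
      OscillatorySystem x t C z (fun s => psi Ef s x z 1 0 * Complex.exp (Complex.I * z * s))
        (fun s => psi Ef s x z 0 0 * Complex.exp (Complex.I * z * s)) (fun s => conj (Ef s x)) ∧
      OscillatorySystem x t C (-z) (fun s => psi Ef s x z 0 1 * Complex.exp (-Complex.I * z * s))
        (fun s => psi Ef s x z 1 1 * Complex.exp (-Complex.I * z * s)) (fun s => -Ef s x) := by
  obtain ⟨C, hC⟩ := hsol.field_bounded t x hxL
  have hfd : ∀ s ∈ Ioo x t, ∃ e', HasDerivAt (fun s => Ef s x) e' s ∧ ‖e'‖ ≤ max C 1 := by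
    intro s hs
    have hs0 : 0 < s := hx.trans hs.1
    refine ⟨_, hsol.field_hasDerivAt_t hs0 hx hxL hs.1.ne', ?_⟩
    refine (ContinuousLinearMap.le_opNorm _ _).trans ?_
    have h1 : ‖((1 : ℝ), (0 : ℝ))‖ = 1 := by simp
    rw [h1, mul_one]
    exact (hC s x hs0 hs.2.le hx le_rfl hs.1.ne').2.trans (le_max_left _ _)
  have hcont : ContinuousOn (fun s => Ef s x) (Ioc x t) := fun s hs =>
    (hsol.field_continuousAt (hx.trans hs.1) hx.le hxL hs.1.ne').continuousWithinAt
  have hbd : ∀ s ∈ Ioc x t, ‖Ef s x‖ ≤ max C 1 := fun s hs =>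
    (hC s x (hx.trans hs.1) hs.2 hx le_rfl hs.1.ne').1.trans (le_max_left _ _)
  have hexp : ∀ (c : ℂ) (s : ℝ), HasDerivAt (fun s : ℝ => Complex.exp (c * s))
      (Complex.exp (c * s) * c) s := fun c s => by
    simpa using ((hasDerivAt_id s).ofReal_comp.const_mul c).cexp
  have hψ := fun (z : ℂ) (c : ℂ) (i j : Fin 2) =>
    ((hsol.psi_entry_continuousOn hx.le hxL z i j).mono
      (fun s hs => hx.le.trans hs.1 : Icc x t ⊆ Ici 0)).mul
    (Continuous.continuousOn (by fun_prop : Continuous fun s : ℝ => Complex.exp (c * s)))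
  have h0 : ∀ z : ℂ, ‖(0 : ℂ)‖ ≤ max C 1 / ‖z‖ := fun z => by
    rw [norm_zero]; positivity
  refine ⟨max C 1, le_max_right _ _, fun z => ⟨⟨hψ _ _ _ _, hψ _ _ _ _, fun s hs => ?_,
    Complex.continuous_conj.comp_continuousOn hcont, fun s hs => ?_, fun s hs => ?_⟩,
    ⟨hψ _ _ _ _, hψ _ _ _ _, fun s hs => ?_, hcont.neg, fun s hs => ?_, fun s hs => ?_⟩⟩⟩
  · obtain ⟨h1, h2⟩ := hsol.psi_entry_hasDerivAt (hx.trans hs.1) hx.le hxL hs.1.ne' z 0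
    refine ⟨0, 0, 0, 0, (h2.mul (hexp _ s)).congr_deriv ?_, (h1.mul (hexp _ s)).congr_deriv ?_,
      h0 z, h0 z, h0 z, h0 z⟩
    · ring
    · rw [Complex.conj_conj]; ring
  · obtain ⟨e', h1, h2⟩ := hfd s hs
    exact ⟨conj e', h1.star, (RCLike.norm_conj _).trans_le h2⟩
  · exact (RCLike.norm_conj _).trans_le (hbd s hs)
  · obtain ⟨h1, h2⟩ := hsol.psi_entry_hasDerivAt (hx.trans hs.1) hx.le hxL hs.1.ne' z 1
    refine ⟨0, 0, 0, 0, (h1.mul (hexp _ s)).congr_deriv ?_, (h2.mul (hexp _ s)).congr_deriv ?_,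
      h0 _, h0 _, h0 _, h0 _⟩
    · ring
    · rw [map_neg]; ring
  · obtain ⟨e', h1, h2⟩ := hfd s hs
    exact ⟨-e', h1.neg, (norm_neg _).trans_le h2⟩
  · exact (norm_neg _).trans_le (hbd s hs)

/-- The initial values at `t = x` of the columns of `Ψ exp (i z t σ₃)`. -/
theorem psi_diag_mul_exp (hn : IsLineShape n) {x : ℝ} (hx : 0 < x) (hxL : (x : EReal) < L) (z : ℂ) :
    psi Ef x x z 1 0 * Complex.exp (Complex.I * z * x) = 0 ∧
    psi Ef x x z 0 0 * Complex.exp (Complex.I * z * x) = 1 ∧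
    psi Ef x x z 0 1 * Complex.exp (-Complex.I * z * x) = 0 ∧
    psi Ef x x z 1 1 * Complex.exp (-Complex.I * z * x) = 1 := by
  rw [hsol.psi_of_le hn hx.le le_rfl hxL z]
  simp [expSigma3, ← Complex.exp_add]

/-- The columns of `Ψ exp (i z t σ₃)` are close to those of the identity in a half-plane each. -/
theorem exists_psi_bound (hn : IsLineShape n) {t x A : ℝ} (hx : 0 < x) (hxt : x < t)
    (hxL : (x : EReal) < L) (hA : 0 ≤ A) : ∃ K : ℝ, 0 ≤ K ∧ ∀ z : ℂ, 1 ≤ ‖z‖ →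
      (-A ≤ z.im → ‖psi Ef t x z 1 0 * Complex.exp (Complex.I * z * t)‖ ≤ K / ‖z‖ ∧
        ‖psi Ef t x z 0 0 * Complex.exp (Complex.I * z * t) - 1‖ ≤ K / ‖z‖) ∧
      (z.im ≤ A → ‖psi Ef t x z 0 1 * Complex.exp (-Complex.I * z * t)‖ ≤ K / ‖z‖ ∧
        ‖psi Ef t x z 1 1 * Complex.exp (-Complex.I * z * t) - 1‖ ≤ K / ‖z‖) := by
  obtain ⟨C, hC, h⟩ := hsol.exists_oscillatorySystem_t (t := t) hx hxL
  obtain ⟨K, hK0, hK⟩ := exists_oscillatory_bound hA (zero_le_one.trans hC)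
    (sub_nonneg.2 hxt.le)
  refine ⟨K, hK0, fun z hz => ?_⟩
  obtain ⟨i1, i2, i3, i4⟩ := hsol.psi_diag_mul_exp hn hx hxL z
  have hC' : 0 ≤ C / ‖z‖ := div_nonneg (zero_le_one.trans hC) (norm_nonneg z)
  refine ⟨fun hA => ?_, fun hA => ?_⟩
  · have := hK x t z _ _ _ hxt.le le_rfl hA hz (h z).1
      (by rw [i1, norm_zero]; exact hC') (by rw [i2, norm_one]; exact hC)
    rwa [i2] at this
  · have := hK x t (-z) _ _ _ hxt.le le_rfl (by simpa using hA) (by rwa [norm_neg])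
      (h z).2
      (by rw [i3, norm_zero, norm_neg]; exact hC') (by rw [i4, norm_one]; exact hC)
    rwa [i4, norm_neg] at this

/-- In the lower half-plane the field is recovered from `Ψ` alone. -/
theorem tendsto_mul_psi (hn : IsLineShape n) {t x c : ℝ} (hx : 0 < x) (hxt : x < t)
    (hxL : (x : EReal) < L) (hc : 0 < c) :
    Tendsto (fun z : ℂ => z * (psi Ef t x z 0 1 * Complex.exp (-Complex.I * z * t)))
      (Bornology.cobounded ℂ ⊓ 𝓟 {z : ℂ | c * ‖z‖ ≤ -z.im}) (𝓝 (Complex.I * Ef t x / 4)) := by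
  obtain ⟨C, hC, h⟩ := hsol.exists_oscillatorySystem_t (t := t) hx hxL
  have hi := fun z => hsol.psi_diag_mul_exp hn hx hxL z
  have hl : ∀ᶠ z : ℂ in Bornology.cobounded ℂ ⊓ 𝓟 {z : ℂ | c * ‖z‖ ≤ -z.im}, c * ‖z‖ ≤ -z.im :=
    mem_inf_of_right (mem_principal_self _)
  have hC' : ∀ z : ℂ, 0 ≤ C / ‖-z‖ := fun z => div_nonneg (zero_le_one.trans hC) (norm_nonneg _)
  have := tendsto_mul_of_oscillatory (l := Bornology.cobounded ℂ ⊓ 𝓟 {z : ℂ | c * ‖z‖ ≤ -z.im})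
    (ζ := fun z => -z) hxt hc (zero_le_one.trans hC)
    (by simpa using tendsto_norm_cobounded_atTop.mono_left inf_le_left)
    (hl.mono fun z hz => by simpa using hz)
    (Eventually.of_forall fun z => (h z).2)
    (Eventually.of_forall fun z => by rw [(hi z).2.2.1, norm_zero]; exact hC' z)
    (Eventually.of_forall fun z => by rw [(hi z).2.2.2, norm_one]; exact hC)
    (by simp only [(hi _).2.2.2]; exact tendsto_const_nhds)
  convert this.neg using 2
  · ring
  · ring

end MaxwellBloch.IsSolution

/-! ### Large spectral parameter: the equation in `x` -/

theorem norm_rFun_le_of_norm_le {E z : ℂ} (hE : 0 < E.im) (hz : 2 * (‖E‖ + 1) ≤ ‖z‖) :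
    ‖rFun E z‖ ≤ 4 * E.im / ‖z‖ := by
  have hE0 := norm_nonneg E
  have hne : z ≠ E ∧ z ≠ conj E := by
    constructor <;> rintro rfl
    · linarith
    · rw [RCLike.norm_conj] at hz; linarith
  have h1 : ‖z‖ / 2 ≤ ‖z - E‖ := by
    have := norm_sub_norm_le z E
    linarith
  have h0 : 0 < ‖z‖ := by linarith
  calc _ ≤ 2 * E.im / ‖z - E‖ := norm_rFun_le hE hne.1 hne.2
    _ ≤ 2 * E.im / (‖z‖ / 2) := by gcongr
    _ = _ := by field_simp; ring

theorem norm_eta_sub_le {n : ℝ → ℝ} (hn : IsLineShape n) {z : ℂ} (hz : z.im ≠ 0) :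
    ‖eta n z - z‖ ≤ 1 / (4 * |z.im|) := by
  have h := norm_integral_le_of_norm_le (hn.integrable.const_mul (1 / |z.im|))
    (ae_of_all _ fun s => norm_cauchy_kernel_le hn.1 (s := s) hz (f := 1) (by simp))
  rw [integral_const_mul, hn.2.1, mul_one] at h
  simp only [one_mul] at h
  have h4 : ‖(1 / 4 : ℂ)‖ = 1 / 4 := by norm_num
  rw [eta, add_sub_cancel_left, norm_mul, h4]
  calc _ ≤ 1 / 4 * (1 / |z.im|) := by gcongr
    _ = _ := by rw [one_div_mul_one_div]

section Entries

variable {n : ℝ → ℝ} {E : ℂ} {Ef : ℝ → ℝ → ℂ} {t x : ℝ} {z : ℂ}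

theorem rhSolution_apply_zero (hz : 0 < z.im) (i : Fin 2) :
    rhSolution n E Ef t x z i 0 = psi Ef t x z i 0 * Complex.exp (Complex.I * z * t) := by
  rw [rhSolution, if_pos hz]
  simp [Matrix.mul_apply, Fin.sum_univ_two, expSigma3]

theorem rhSolution_apply_one (hz : 0 < z.im) (i : Fin 2) :
    rhSolution n E Ef t x z i 1 = psi Ef t x z i 0 * Complex.exp (Complex.I * z * t)
      * (rFun E z * Complex.exp (-2 * Complex.I * theta n t x z))
      + psi Ef t x z i 1 * Complex.exp (-Complex.I * z * t) := by
  rw [rhSolution, if_pos hz]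
  simp [Matrix.mul_apply, Fin.sum_univ_two, expSigma3]

theorem rhSolution_apply_one_of_neg (hz : z.im < 0) (i : Fin 2) :
    rhSolution n E Ef t x z i 1 = psi Ef t x z i 1 * Complex.exp (-Complex.I * z * t) := by
  rw [rhSolution, if_neg hz.not_gt]
  simp [Matrix.mul_apply, Fin.sum_univ_two, expSigma3]

/-- In the upper half-plane the second column of the solution is a solution of the `x`-equation
up to a scalar factor. -/
theorem rhSolution_apply_one_eq (hz : 0 < z.im) (i : Fin 2) :
    rhSolution n E Ef t x z i 1 = ((psi Ef t x z * expSigma3 (Complex.I * eta n z * x)) i 0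
      * rFun E z + (psi Ef t x z * expSigma3 (Complex.I * eta n z * x)) i 1)
      * Complex.exp (Complex.I * eta n z * x + -Complex.I * z * t) := by
  have e1 : Complex.exp (Complex.I * z * t) * Complex.exp (-2 * Complex.I * theta n t x z)
      = Complex.exp (Complex.I * eta n z * x) * Complex.exp (Complex.I * eta n z * x)
        * Complex.exp (-Complex.I * z * t) := by
    rw [← Complex.exp_add, ← Complex.exp_add, ← Complex.exp_add, theta]; congr 1; ring
  have e2 : Complex.exp (-(Complex.I * eta n z * x)) * Complex.exp (Complex.I * eta n z * x) = 1 := by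
    rw [← Complex.exp_add, neg_add_cancel, Complex.exp_zero]
  rw [rhSolution_apply_one hz, Complex.exp_add]
  simp only [Matrix.mul_apply, Fin.sum_univ_two, expSigma3, Matrix.of_apply, Matrix.cons_val_zero,
    Matrix.cons_val_one, mul_zero, add_zero, zero_add, Matrix.cons_val', Matrix.cons_val_fin_one]
  linear_combination (psi Ef t x z i 0 * rFun E z) * e1
    - (psi Ef t x z i 1 * Complex.exp (-Complex.I * z * t)) * e2

end Entries

namespace MaxwellBloch.IsSolution

variable {L : EReal} {n : ℝ → ℝ} {A₀ ω₀ : ℝ} {Ef : ℝ → ℝ → ℂ} {ρ : ℝ → ℝ → ℝ → ℂ}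
  {Nf : ℝ → ℝ → ℝ → ℝ} (hsol : IsSolution L n A₀ ω₀ Ef ρ Nf)

include hsol

/-- The second column of the solution is an oscillatory system in `x`: the phase is split off, and
`G` and `η - z` are of order `1 / |Im z|`. -/
theorem rhSolution_hasDerivAt_x (hn : IsLineShape n) (E : ℂ) {t x : ℝ} (ht : 0 ≤ t) (hx : 0 < x)
    (hxL : (x : EReal) < L) (hne : x ≠ t) {z : ℂ} (hz : 0 < z.im) :
    HasDerivAt (fun y => rhSolution n E Ef t y z 0 1)
      (2 * Complex.I * z * rhSolution n E Ef t x z 0 1 + Ef t x / 2 * rhSolution n E Ef t x z 1 1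
        + Complex.I * (eta n z - z - cauchyMatrix n ρ Nf t x z 0 0) * rhSolution n E Ef t x z 0 1
        + -Complex.I * cauchyMatrix n ρ Nf t x z 0 1 * rhSolution n E Ef t x z 1 1) x ∧
    HasDerivAt (fun y => rhSolution n E Ef t y z 1 1)
      (-(conj (Ef t x) / 2) * rhSolution n E Ef t x z 0 1
        + -Complex.I * cauchyMatrix n ρ Nf t x z 1 0 * rhSolution n E Ef t x z 0 1
        + Complex.I * (eta n z - z - cauchyMatrix n ρ Nf t x z 1 1) * rhSolution n E Ef t x z 1 1)
      x := by
  have h := hasMatDerivAt_iff.2 (hsol.jointSol_hasDerivAt_of_im_ne_zero hn ht hx hxL hne hz.ne')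
  have hexp : HasDerivAt (fun y : ℝ => Complex.exp (Complex.I * eta n z * y + -Complex.I * z * t))
      (Complex.exp (Complex.I * eta n z * x + -Complex.I * z * t) * (Complex.I * eta n z)) x := by
    have := (((hasDerivAt_id x).ofReal_comp.const_mul (Complex.I * eta n z)).add_const
      (-Complex.I * z * t)).cexp
    simpa using this
  simp only [rhSolution_apply_one_eq hz]
  set J := psi Ef t x z * expSigma3 (Complex.I * eta n z * x) with hJ
  have h00 := h 0 0
  have h01 := h 0 1
  have h10 := h 1 0
  have h11 := h 1 1
  have hmul : ∀ (B : Mat2) (i j : Fin 2), (B * J) i j = B i 0 * J 0 j + B i 1 * J 1 j :=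
    fun B i j => by rw [Matrix.mul_apply, Fin.sum_univ_two]
  rw [hmul] at h00 h01 h10 h11
  refine ⟨(((h00.mul_const (rFun E z)).add h01).mul hexp).congr_deriv ?_,
    (((h10.mul_const (rFun E z)).add h11).mul hexp).congr_deriv ?_⟩
  · simp [fieldMatrix, sigma3, ← hJ]
    ring
  · simp [fieldMatrix, sigma3, ← hJ]
    ring

/-- In a cone in the upper half-plane the second column of the solution forms an oscillatory system
with respect to `x < t`: there the Cauchy integrals are of order `1 / z`. -/
theorem exists_oscillatorySystem_x (hn : IsLineShape n) (E : ℂ) {t x c : ℝ} (hx : 0 < x)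
    (hxt : x < t) (hxL : (x : EReal) < L) (hc : 0 < c) :
    ∃ C : ℝ, 1 ≤ C ∧ ∀ z : ℂ, 0 < z.im → c * ‖z‖ ≤ z.im →
      OscillatorySystem 0 x C z (fun y => rhSolution n E Ef t y z 0 1)
        (fun y => rhSolution n E Ef t y z 1 1) (fun y => Ef t y) := by
  obtain ⟨C, hC⟩ := hsol.field_bounded t x hxL
  have ht : 0 < t := hx.trans hxt
  have hyL : ∀ y ≤ x, (y : EReal) < L := fun y hy => (EReal.coe_le_coe_iff.2 hy).trans_lt hxL
  have hC1 : C ≤ max C (max 1 (1 / (2 * c))) := le_max_left _ _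
  have hC2 : 1 ≤ max C (max 1 (1 / (2 * c))) := (le_max_left _ _).trans (le_max_right _ _)
  have hC3 : 1 / (2 * c) ≤ max C (max 1 (1 / (2 * c))) := (le_max_right _ _).trans (le_max_right _ _)
  refine ⟨max C (max 1 (1 / (2 * c))), hC2, fun z hz hcz => ?_⟩
  set D := max C (max 1 (1 / (2 * c))) with hD
  have hz0 : 0 < ‖z‖ := hz.trans_le ((le_abs_self _).trans (Complex.abs_im_le_norm z))
  have hzD : 1 / (2 * |z.im|) ≤ D / ‖z‖ := by
    rw [abs_of_pos hz]
    calc _ ≤ 1 / (2 * (c * ‖z‖)) := by gcongr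
      _ = 1 / (2 * c) / ‖z‖ := by rw [← mul_assoc, div_div]
      _ ≤ _ := by gcongr
  have hquarter : 1 / (4 * |z.im|) + 1 / (4 * |z.im|) = 1 / (2 * |z.im|) := by
    have := abs_pos.2 hz.ne'
    field_simp; norm_num
  have hquarter0 : 0 ≤ 1 / (4 * |z.im|) := by positivity
  have hcont : ∀ i, ContinuousOn (fun y => rhSolution n E Ef t y z i 1) (Icc 0 x) := by
    intro i
    simp only [rhSolution_apply_one_eq hz]
    have h1 : ContinuousOn (fun y : ℝ => psi Ef t y z * expSigma3 (Complex.I * eta n z * y))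
        (Icc 0 x) := ((hsol.psi_continuousOn_x hn ht.le z).mul
      (expSigma3_continuous.comp (by fun_prop : Continuous fun y : ℝ =>
        Complex.I * eta n z * y)).continuousOn).mono fun y hy => ⟨hy.1, hyL y hy.2⟩
    have h2 := fun j => (continuous_apply_apply i j).comp_continuousOn h1
    exact (((h2 0).mul continuousOn_const).add (h2 1)).mul
      (Continuous.continuousOn (by fun_prop))
  refine ⟨hcont 0, hcont 1, fun y hy => ?_, fun y hy => ?_, fun y hy => ?_, fun y hy => ?_⟩
  · obtain ⟨h1, h2⟩ := hsol.rhSolution_hasDerivAt_x hn E ht.le hy.1 (hyL y hy.2.le)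
      (hy.2.trans hxt).ne hz
    have hG := fun i j => hsol.norm_cauchyMatrix_entry_le hn ht.le hy.1 (hyL y hy.2.le) hz.ne' i j
    have hη := norm_eta_sub_le hn hz.ne'
    refine ⟨_, _, _, _, h1, h2, ?_, ?_, ?_, ?_⟩
    · rw [norm_mul, Complex.norm_I, one_mul]
      exact (norm_sub_le _ _).trans (by linarith [hG 0 0])
    · rw [norm_mul, norm_neg, Complex.norm_I, one_mul]
      linarith [hG 0 1]
    · rw [norm_mul, norm_neg, Complex.norm_I, one_mul]
      linarith [hG 1 0]
    · rw [norm_mul, Complex.norm_I, one_mul]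
      exact (norm_sub_le _ _).trans (by linarith [hG 1 1])
  · exact (hsol.field_hasDerivAt_x ht hy.1 (hyL y hy.2)
      (hy.2.trans_lt hxt).ne').continuousAt.continuousWithinAt
  · refine ⟨_, hsol.field_hasDerivAt_x ht hy.1 (hyL y hy.2.le) (hy.2.trans hxt).ne', ?_⟩
    refine (ContinuousLinearMap.le_opNorm _ _).trans ?_
    have h1 : ‖((0 : ℝ), (1 : ℝ))‖ = 1 := by simp
    rw [h1, mul_one]
    exact (hC t y ht le_rfl hy.1 hy.2.le (hy.2.trans hxt).ne').2.trans hC1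
  · exact (hC t y ht le_rfl hy.1 hy.2 (hy.2.trans_lt hxt).ne').1.trans hC1

/-- The values at `x = 0` are explicit: `w(z) = z - Re E - i (Im E) r(z)`. -/
theorem rhSolution_zero_apply_one (hL : 0 < L) {t : ℝ} (ht : 0 ≤ t) {z : ℂ} (hz : 0 < z.im)
    (h1 : z ≠ specPoint A₀ ω₀) (h2 : z ≠ conj (specPoint A₀ ω₀)) :
    rhSolution n (specPoint A₀ ω₀) Ef t 0 z 0 1 = rFun (specPoint A₀ ω₀) z
      * Complex.exp (-2 * Complex.I * (specPoint A₀ ω₀).re * t)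
      * Complex.exp ((specPoint A₀ ω₀).im * rFun (specPoint A₀ ω₀) z * t) ∧
    rhSolution n (specPoint A₀ ω₀) Ef t 0 z 1 1
      = Complex.exp ((specPoint A₀ ω₀).im * rFun (specPoint A₀ ω₀) z * t) := by
  set E := specPoint A₀ ω₀ with hE
  have ha := aFun_ne_zero h1 h2
  have hb : rFun E z * aFun E z = bFun E z := div_mul_cancel₀ _ ha
  have hw : Complex.I * (z - E.re - wFun E z) = -E.im * rFun E z :=
    mul_right_cancel₀ ha (by rw [sub_wFun_mul_aFun h1 h2, mul_assoc, hb])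
  have hΦ := hsol.backgroundPhi_eq hL ht h1 h2
  rw [← hE] at hΦ
  have hcol : ∀ i, psi Ef t 0 z i 0 * rFun E z + psi Ef t 0 z i 1
      = backgroundPhi E t z i 1 / aFun E z := by
    intro i
    rw [hΦ, eq_div_iff ha]
    simp only [connection, Matrix.mul_apply, Fin.sum_univ_two, Matrix.of_apply,
      Matrix.cons_val_zero, Matrix.cons_val_one, Matrix.cons_val', Matrix.cons_val_fin_one]
    linear_combination psi Ef t 0 z i 0 * hb
  have hexp0 : psi Ef t 0 z * expSigma3 (Complex.I * eta n z * ((0 : ℝ) : ℂ)) = psi Ef t 0 z := by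
    rw [Complex.ofReal_zero, mul_zero, expSigma3_zero, mul_one]
  simp only [rhSolution_apply_one_eq hz, hexp0, hcol]
  have e1 : (E.im * rFun E z * t : ℂ) = Complex.I * E.re * t + Complex.I * wFun E z * t
      + -Complex.I * z * t := by linear_combination (t : ℂ) * hw
  have e2 : Complex.exp (-2 * Complex.I * E.re * t) * Complex.exp (Complex.I * E.re * t)
      = Complex.exp (-Complex.I * E.re * t) := by
    rw [← Complex.exp_add]; congr 1; ring
  have e3 : ∀ c : ℂ, -(-Complex.I * c * t) = Complex.I * c * t := fun c => by ring
  simp only [backgroundPhi, expSigma3, Matrix.mul_apply, Fin.sum_univ_two, Matrix.of_apply,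
    Matrix.cons_val_zero, Matrix.cons_val_one, Matrix.cons_val', Matrix.cons_val_fin_one,
    mul_zero, zero_mul, add_zero, zero_add, e3, ← hb, Complex.ofReal_zero, e1, Complex.exp_add]
  constructor
  · rw [← e2]
    generalize Complex.exp (-2 * Complex.I * E.re * t) = k1
    generalize Complex.exp (Complex.I * E.re * t) = k2
    generalize Complex.exp (Complex.I * wFun E z * t) = k3
    generalize Complex.exp (-Complex.I * z * t) = k4
    field_simp
  · generalize Complex.exp (Complex.I * E.re * t) = k2
    generalize Complex.exp (Complex.I * wFun E z * t) = k3
    generalize Complex.exp (-Complex.I * z * t) = k4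
    field_simp

end MaxwellBloch.IsSolution

/-! ### Asymptotics in the upper half-plane -/

/-- Ahead of the front, where `t ≤ x`, the exponential in the triangular factor is bounded. -/
theorem norm_exp_theta_le_of_im_pos {n : ℝ → ℝ} (hn : IsLineShape n) {t x : ℝ} (hx : 0 ≤ x) {z : ℂ}
    (hz : 0 < z.im) :
    ‖Complex.exp (-2 * Complex.I * theta n t x z)‖ ≤ Real.exp (-(2 * (x - t) * z.im)) := by
  have h1 := mul_im_le_mul_eta_im hn (σ := 1) (z := z) (by simpa [openHalf] using hz)
  rw [Complex.norm_exp]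
  refine Real.exp_le_exp.2 ?_
  have h4 : (-2 * Complex.I * theta n t x z).re = 2 * t * z.im - 2 * x * (eta n z).im := by
    rw [theta]; simp; ring
  rw [h4]
  have := mul_le_mul_of_nonneg_left h1 hx
  linarith

theorem mem_compl_closedContour_of_lt {E z : ℂ} (hE : 0 < E.im) (hz : E.im < |z.im|) :
    z ∈ (closedContour E)ᶜ :=
  mem_compl_closedContour_iff.2 ⟨abs_pos.1 (hE.trans hz),
    fun h => absurd ((mem_segment_conj_iff hE).1 h).2 hz.not_ge⟩

namespace MaxwellBloch.IsSolution

variable {L : EReal} {n : ℝ → ℝ} {A₀ ω₀ : ℝ} {Ef : ℝ → ℝ → ℂ} {ρ : ℝ → ℝ → ℝ → ℂ}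
  {Nf : ℝ → ℝ → ℝ → ℝ} (hsol : IsSolution L n A₀ ω₀ Ef ρ Nf)

include hsol

/-- At `x = 0` the second column of the solution is explicit in terms of `r`, which is `O(1/z)`. -/
theorem exists_rhSolution_zero_bound (hL : 0 < L) (hA₀ : 0 < A₀) {t : ℝ} (ht : 0 ≤ t) :
    ∃ D R : ℝ, 0 ≤ D ∧ 1 ≤ R ∧ ∀ z : ℂ, 0 < z.im → R ≤ ‖z‖ →
      ‖rhSolution n (specPoint A₀ ω₀) Ef t 0 z 0 1‖ ≤ D / ‖z‖ ∧
      ‖rhSolution n (specPoint A₀ ω₀) Ef t 0 z 1 1 - 1‖ ≤ D / ‖z‖ := by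
  set E := specPoint A₀ ω₀ with hE
  have hm : 0 < E.im := half_pos hA₀
  have hE0 := norm_nonneg E
  refine ⟨max (4 * E.im * Real.exp (E.im * t)) (2 * (E.im * (4 * E.im) * t)),
    max (2 * (‖E‖ + 1)) (E.im * (4 * E.im) * t), le_max_of_le_left (by positivity),
    le_max_of_le_left (by linarith), fun z hz hR => ?_⟩
  have hR1 := (le_max_left _ _).trans hR
  have hR2 := (le_max_right _ _).trans hR
  have h0 : 0 < ‖z‖ := by linarith
  have h1 : z ≠ E := by rintro h; rw [h] at hR1; linarith
  have h2 : z ≠ conj E := by rintro h; rw [h, RCLike.norm_conj] at hR1; linarith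
  obtain ⟨e1, e2⟩ := hsol.rhSolution_zero_apply_one hL ht hz h1 h2
  have hr := norm_rFun_le_of_norm_le hm hR1
  have hr1 := norm_rFun_le_one E z
  have hnorm : ‖(E.im * rFun E z * t : ℂ)‖ = E.im * ‖rFun E z‖ * t := by
    rw [norm_mul, norm_mul, Complex.norm_real, Complex.norm_real, Real.norm_of_nonneg hm.le,
      Real.norm_of_nonneg ht]
  rw [e1, e2]
  constructor
  · have h3 : ‖Complex.exp (-2 * Complex.I * E.re * t)‖ = 1 := by
      rw [show (-2 * Complex.I * E.re * t : ℂ) = ((-2 * E.re * t : ℝ) : ℂ) * Complex.I by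
        push_cast; ring, Complex.norm_exp_ofReal_mul_I]
    have h4 : ‖Complex.exp (E.im * rFun E z * t)‖ ≤ Real.exp (E.im * t) := by
      refine (Complex.norm_exp_le_exp_norm _).trans (Real.exp_le_exp.2 ?_)
      rw [hnorm]
      have := mul_le_mul_of_nonneg_left hr1 hm.le
      rw [mul_one] at this
      gcongr
    rw [norm_mul, norm_mul, h3, mul_one]
    calc _ ≤ 4 * E.im / ‖z‖ * Real.exp (E.im * t) := by gcongr
      _ = 4 * E.im * Real.exp (E.im * t) / ‖z‖ := by ring
      _ ≤ _ := by gcongr; exact le_max_left _ _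
  · have h3 : E.im * ‖rFun E z‖ * t ≤ E.im * (4 * E.im) * t / ‖z‖ := by
      calc _ ≤ E.im * (4 * E.im / ‖z‖) * t := by gcongr
        _ = _ := by ring
    have h4 : E.im * (4 * E.im) * t / ‖z‖ ≤ 1 := (div_le_one h0).2 hR2
    refine (Complex.norm_exp_sub_one_le (hnorm.trans_le (h3.trans h4))).trans ?_
    rw [hnorm]
    calc _ ≤ 2 * (E.im * (4 * E.im) * t / ‖z‖) := by gcongr
      _ = 2 * (E.im * (4 * E.im) * t) / ‖z‖ := by ring
      _ ≤ _ := by gcongr; exact le_max_right _ _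

/-- The second column of the solution in a cone in the upper half-plane. -/
theorem exists_cone_bound (hL : 0 < L) (hA₀ : 0 < A₀) (hn : IsLineShape n) {t x c : ℝ}
    (hx : 0 < x) (hxt : x < t) (hxL : (x : EReal) < L) (hc : 0 < c) :
    ∃ K R : ℝ, 0 ≤ K ∧ 1 ≤ R ∧ ∀ z : ℂ, 0 < z.im → c * ‖z‖ ≤ z.im → R ≤ ‖z‖ →
      ‖rhSolution n (specPoint A₀ ω₀) Ef t x z 0 1‖ ≤ K / ‖z‖ ∧
      ‖rhSolution n (specPoint A₀ ω₀) Ef t x z 1 1 - 1‖ ≤ K / ‖z‖ := by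
  obtain ⟨D, R, hD, hR, hi⟩ := hsol.exists_rhSolution_zero_bound (n := n) hL hA₀ (hx.trans hxt).le
  obtain ⟨C, hC, h⟩ := hsol.exists_oscillatorySystem_x hn (specPoint A₀ ω₀) hx hxt hxL hc
  have hCC : 0 ≤ max C (1 + D) := le_max_of_le_right (by positivity)
  obtain ⟨K, hK0, hK⟩ := exists_oscillatory_bound le_rfl hCC (sub_nonneg.2 hx.le)
  refine ⟨K + D, R, by positivity, hR, fun z hz hcz hRz => ?_⟩
  obtain ⟨i1, i2⟩ := hi z hz hRz
  have h1 : 1 ≤ ‖z‖ := hR.trans hRz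
  have hD1 : D / ‖z‖ ≤ max C (1 + D) / ‖z‖ := by
    gcongr; exact le_max_of_le_right (by linarith)
  have hv : ‖rhSolution n (specPoint A₀ ω₀) Ef t 0 z 1 1‖ ≤ max C (1 + D) := by
    have h2 := norm_add_le (rhSolution n (specPoint A₀ ω₀) Ef t 0 z 1 1 - 1) 1
    rw [sub_add_cancel, norm_one] at h2
    have h3 : D / ‖z‖ ≤ D := div_le_self hD h1
    exact le_max_of_le_right (by linarith)
  obtain ⟨k1, k2⟩ := hK 0 x z _ _ _ hx.le le_rfl (by rw [neg_zero]; exact hz.le) h1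
    ((h z hz hcz).mono_const (le_max_left _ _)) (i1.trans hD1) hv
  rw [add_div]
  refine ⟨k1.trans (le_add_of_nonneg_right (by positivity)), ?_⟩
  calc _ = ‖(rhSolution n (specPoint A₀ ω₀) Ef t x z 1 1
        - rhSolution n (specPoint A₀ ω₀) Ef t 0 z 1 1)
        + (rhSolution n (specPoint A₀ ω₀) Ef t 0 z 1 1 - 1)‖ := by rw [sub_add_sub_cancel]
    _ ≤ _ := (norm_add_le _ _).trans (add_le_add k2 i2)

/-- In a cone in the upper half-plane the field is the leading coefficient of the solution. -/
theorem tendsto_mul_rhSolution_upper (hL : 0 < L) (hA₀ : 0 < A₀) (hn : IsLineShape n) {t x c : ℝ}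
    (hx : 0 < x) (hxt : x < t) (hxL : (x : EReal) < L) (hc : 0 < c) :
    Tendsto (fun z : ℂ => z * rhSolution n (specPoint A₀ ω₀) Ef t x z 0 1)
      (Bornology.cobounded ℂ ⊓ 𝓟 {z : ℂ | c * ‖z‖ ≤ z.im}) (𝓝 (Complex.I * Ef t x / 4)) := by
  obtain ⟨D, R, hD, hR, hi⟩ := hsol.exists_rhSolution_zero_bound (n := n) hL hA₀ (hx.trans hxt).le
  obtain ⟨C, hC, h⟩ := hsol.exists_oscillatorySystem_x hn (specPoint A₀ ω₀) hx hxt hxL hc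
  have hCC : 0 ≤ max C (1 + D) := le_max_of_le_right (by positivity)
  set l := Bornology.cobounded ℂ ⊓ 𝓟 {z : ℂ | c * ‖z‖ ≤ z.im}
  have hl : ∀ᶠ z : ℂ in l, c * ‖z‖ ≤ z.im := mem_inf_of_right (mem_principal_self _)
  have hz : Tendsto (fun z : ℂ => ‖z‖) l atTop := tendsto_norm_cobounded_atTop.mono_left inf_le_left
  have hev : ∀ᶠ z : ℂ in l, 0 < z.im ∧ c * ‖z‖ ≤ z.im ∧ R ≤ ‖z‖ := by
    filter_upwards [hl, hz.eventually_ge_atTop R] with z h1 h2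
    exact ⟨(mul_pos hc (by linarith)).trans_le h1, h1, h2⟩
  have hva : ∀ᶠ z in l, ‖rhSolution n (specPoint A₀ ω₀) Ef t 0 z 1 1 - 1‖ ≤ D / ‖z‖ :=
    hev.mono fun z hz => (hi z hz.1 hz.2.2).2
  refine tendsto_mul_of_oscillatory (l := l) (ζ := fun z => z)
    (u := fun z y => rhSolution n (specPoint A₀ ω₀) Ef t y z 0 1)
    (v := fun z y => rhSolution n (specPoint A₀ ω₀) Ef t y z 1 1) (e := fun y => Ef t y)
    hx hc hCC hz hl
    (hev.mono fun z hz => (h z hz.1 hz.2.1).mono_const (le_max_left C (1 + D)))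
    (hev.mono fun z hz => (hi z hz.1 hz.2.2).1.trans ?_) (hev.mono fun z hz => ?_) ?_
  · gcongr; exact le_max_of_le_right (by linarith)
  · have h2 := norm_add_le (rhSolution n (specPoint A₀ ω₀) Ef t 0 z 1 1 - 1) 1
    rw [sub_add_cancel, norm_one] at h2
    have h3 : D / ‖z‖ ≤ D := div_le_self hD (hR.trans hz.2.2)
    exact le_max_of_le_right (by linarith [(hi z hz.1 hz.2.2).2])
  · have h0 : Tendsto (fun z : ℂ => D / ‖z‖) l (𝓝 0) := hz.const_div_atTop D
    have := squeeze_zero_norm' hva h0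
    simpa using this.add_const 1

/-- The solution in a strip in the upper half-plane. -/
theorem exists_strip_bound (hA₀ : 0 < A₀) (hn : IsLineShape n) {t x A : ℝ}
    (hx : 0 < x) (hxt : x < t) (hxL : (x : EReal) < L) (hA : 0 ≤ A) :
    ∃ K : ℝ, 0 ≤ K ∧ ∀ z : ℂ, 0 < z.im → z.im ≤ A → 2 * (‖specPoint A₀ ω₀‖ + 1) ≤ ‖z‖ →
      ∀ i, ‖rhSolution n (specPoint A₀ ω₀) Ef t x z i 1 - (1 : Mat2) i 1‖ ≤ K / ‖z‖ := by
  set E := specPoint A₀ ω₀ with hE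
  have hm : 0 < E.im := half_pos hA₀
  obtain ⟨K, hK0, hK⟩ := hsol.exists_psi_bound hn hx hxt hxL hA
  have ht := hx.trans hxt
  refine ⟨(1 + K) * (4 * E.im * Real.exp (2 * t * A)) + K, by positivity,
    fun z hz hzA hR => ?_⟩
  have h1 : 1 ≤ ‖z‖ := by linarith [norm_nonneg E]
  obtain ⟨k1, k2⟩ := (hK z h1).1 (by linarith)
  obtain ⟨k3, k4⟩ := (hK z h1).2 hzA
  have hKz : K / ‖z‖ ≤ K := div_le_self hK0 h1
  have hre : ‖rFun E z * Complex.exp (-2 * Complex.I * theta n t x z)‖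
      ≤ 4 * E.im * Real.exp (2 * t * A) / ‖z‖ := by
    rw [norm_mul]
    have h2 := norm_exp_theta_le_of_im_pos hn (t := t) hx.le hz
    have h3 : Real.exp (-(2 * (x - t) * z.im)) ≤ Real.exp (2 * t * A) := by
      refine Real.exp_le_exp.2 ?_
      have := mul_le_mul_of_nonneg_left hzA ht.le
      have := mul_pos hx hz
      linarith
    have := norm_rFun_le_of_norm_le hm hR
    calc _ ≤ 4 * E.im / ‖z‖ * Real.exp (2 * t * A) := by gcongr; exact h2.trans h3
      _ = _ := by ring
  have hcol : ∀ i, ‖psi Ef t x z i 0 * Complex.exp (Complex.I * z * t)‖ ≤ 1 + K := by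
    intro i
    fin_cases i
    · have h2 := norm_add_le (psi Ef t x z 0 0 * Complex.exp (Complex.I * z * t) - 1) 1
      rw [sub_add_cancel, norm_one] at h2
      exact h2.trans (by linarith)
    · exact k1.trans (by linarith)
  have hlast : ∀ i, ‖psi Ef t x z i 1 * Complex.exp (-Complex.I * z * t) - (1 : Mat2) i 1‖
      ≤ K / ‖z‖ := by
    exact Fin.forall_fin_two.2 ⟨by simpa using k3, by simpa using k4⟩
  intro i
  rw [rhSolution_apply_one hz, add_sub_assoc]
  refine (norm_add_le _ _).trans ?_
  rw [add_div, mul_div_assoc, norm_mul]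
  have := hcol i
  have := hlast i
  gcongr

/-- The solution is of exponential type in `z`. -/
theorem exists_norm_rhSolution_le_exp (hn : IsLineShape n) (E : ℂ) {t x : ℝ} (ht : 0 ≤ t)
    (hx : 0 ≤ x) (hxL : (x : EReal) < L) : ∃ C : ℝ, 0 ≤ C ∧ ∀ z : ℂ, z.im ≠ 0 →
      ‖rhSolution n E Ef t x z‖ ≤ C * Real.exp (4 * t * ‖z‖) := by
  obtain ⟨C, hC0, hC⟩ := hsol.field_bound t hxL
  have hpsi : ∀ z, ‖psi Ef t x z‖ ≤ Real.exp ((‖z‖ + C / 2) * t) := by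
    intro z
    have := norm_le_mul_exp_of_deriv_bound (f := fun s => psi Ef s x z)
      (f' := fun s => coeffU Ef s x z * psi Ef s x z) (K := ‖z‖ + C / 2) (ε := 0) (a := 0) (b := t) x
      (by positivity) le_rfl ((hsol.psi_continuousOn hx hxL z).mono fun s hs => hs.1)
      (fun s hs hne => hsol.psi_hasDerivAt hs.1 hx hxL hne z) (fun s hs hne => ?_) t ⟨ht, le_rfl⟩
    · simpa [hsol.psi_zero hx hxL] using this
    · rw [add_zero]
      refine (norm_mul_le _ _).trans ?_
      gcongr
      exact (norm_coeffU_le _ _ _ _).trans (by linarith [hC s x hs.1 hs.2.le hx le_rfl hne])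
  have hexp : ∀ z : ℂ, ‖expSigma3 (Complex.I * z * t)‖ ≤ Real.exp (‖z‖ * t) := by
    intro z
    have h1 : ‖Complex.I * z * t‖ = ‖z‖ * t := by
      rw [norm_mul, norm_mul, Complex.norm_I, one_mul, Complex.norm_real, Real.norm_of_nonneg ht]
    rw [mat2_norm_eq]
    simp only [expSigma3, Matrix.of_apply, Matrix.cons_val_zero, Matrix.cons_val_one,
      Matrix.cons_val', Matrix.cons_val_fin_one, norm_zero, add_zero, zero_add]
    refine max_le ?_ ?_
    · exact (Complex.norm_exp_le_exp_norm _).trans_eq (by rw [h1])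
    · exact (Complex.norm_exp_le_exp_norm _).trans_eq (by rw [norm_neg, h1])
  refine ⟨2 * Real.exp (C / 2 * t), by positivity, fun z hz => ?_⟩
  obtain ⟨σ, hσ, hzσ⟩ := exists_mem_openHalf hz
  rw [rhSolution_of_mem_openHalf hσ hzσ]
  have h3 : ‖triangularFactor σ (rFun E z) (theta n t x z)‖ ≤ 2 * Real.exp (2 * t * ‖z‖) := by
    refine (norm_triangularFactor_le hσ (norm_rFun_le_one E z)
      (norm_exp_theta_le (t := t) hn hx hσ hzσ)).trans ?_
    have h4 : Real.exp (2 * t * |z.im|) ≤ Real.exp (2 * t * ‖z‖) := by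
      gcongr; exact Complex.abs_im_le_norm z
    have h5 : 1 ≤ Real.exp (2 * t * ‖z‖) := Real.one_le_exp (by positivity)
    linarith
  calc _ ≤ ‖psi Ef t x z‖ * ‖expSigma3 (Complex.I * z * t)‖
        * ‖triangularFactor σ (rFun E z) (theta n t x z)‖ := norm_mul₃_le
    _ ≤ Real.exp ((‖z‖ + C / 2) * t) * Real.exp (‖z‖ * t) * (2 * Real.exp (2 * t * ‖z‖)) := by
      have := hpsi z
      have := hexp z
      gcongr
    _ = 2 * (Real.exp ((‖z‖ + C / 2) * t) * Real.exp (‖z‖ * t) * Real.exp (2 * t * ‖z‖)) := by ring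
    _ = 2 * (Real.exp (C / 2 * t) * Real.exp (4 * t * ‖z‖)) := by
      rw [← Real.exp_add, ← Real.exp_add, ← Real.exp_add]; congr 2; ring
    _ = _ := by ring

end MaxwellBloch.IsSolution

/-! ### Normalization and reconstruction of the field -/

namespace MaxwellBloch.IsSolution

variable {L : EReal} {n : ℝ → ℝ} {A₀ ω₀ : ℝ} {Ef : ℝ → ℝ → ℂ} {ρ : ℝ → ℝ → ℝ → ℂ}
  {Nf : ℝ → ℝ → ℝ → ℝ} (hsol : IsSolution L n A₀ ω₀ Ef ρ Nf)

include hsol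

/-- The bound in a strip and on a ray extends to the half-plane by the Phragmén--Lindelöf
principle: the solution is of exponential type. -/
theorem exists_upper_bound_column_one (hL : 0 < L) (hA₀ : 0 < A₀) (hn : IsLineShape n) {t x : ℝ}
    (hx : 0 < x) (hxt : x < t) (hxL : (x : EReal) < L) :
    ∃ K R : ℝ, 0 ≤ K ∧ 1 ≤ R ∧ ∀ z : ℂ, 0 < z.im → R ≤ ‖z‖ → ∀ i,
      ‖rhSolution n (specPoint A₀ ω₀) Ef t x z i 1 - (1 : Mat2) i 1‖ ≤ K / ‖z‖ := by
  have ht : 0 < t := hx.trans hxt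
  set E := specPoint A₀ ω₀ with hE
  have hm : 0 < E.im := half_pos hA₀
  have hEn : E.im ≤ ‖E‖ := (le_abs_self _).trans (Complex.abs_im_le_norm E)
  obtain ⟨K₁, R, hK₁0, hR, hcone⟩ := hsol.exists_cone_bound hL hA₀ hn hx hxt hxL one_pos
  obtain ⟨C, hC0, hC⟩ := hsol.exists_norm_rhSolution_le_exp hn E ht.le hx.le hxL
  -- the horizontal line `Im z = A` lies above the cut; the strip below it is already covered
  set A := R + 2 * (‖E‖ + 1) with hA
  have hA1 : 1 ≤ A := by linarith
  have hA0 : 0 ≤ A := zero_le_one.trans hA1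
  obtain ⟨K₂, hK₂0, hstrip⟩ := hsol.exists_strip_bound hA₀ hn hx hxt hxL hA0
  rw [← hE] at hcone hstrip
  refine ⟨max K₁ K₂, A, le_max_of_le_left hK₁0, hA1, fun z hz hAz i => ?_⟩
  rcases le_or_gt z.im A with hzA | hzA
  · exact (hstrip z hz hzA (by linarith) i).trans (by gcongr; exact le_max_right _ _)
  set f : ℂ → ℂ := fun z => z * (rhSolution n E Ef t x z i 1 - (1 : Mat2) i 1) with hf
  have hfdiff : ∀ z : ℂ, A ≤ z.im → DifferentiableAt ℂ f z := fun z hz =>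
    differentiableAt_id.mul ((hsol.rhSolution_differentiableAt hn hm ht.le hx hxL
      (mem_compl_closedContour_of_lt hm (by
        have := le_abs_self z.im
        linarith)) i 1).sub_const _)
  have him : ∀ ζ : ℂ, (Complex.I * (ζ + A)).im = ζ.re + A := fun ζ => by simp
  have hnrm : ∀ ζ : ℂ, ‖Complex.I * (ζ + A)‖ ≤ ‖ζ‖ + A := fun ζ => by
    rw [norm_mul, Complex.norm_I, one_mul]
    refine (norm_add_le _ _).trans_eq ?_
    rw [Complex.norm_real, Real.norm_of_nonneg hA0]
  have hmul : ∀ (z : ℂ) (K : ℝ), 0 < ‖z‖ →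
      ‖rhSolution n E Ef t x z i 1 - (1 : Mat2) i 1‖ ≤ K / ‖z‖ → ‖f z‖ ≤ K := by
    intro z K hz h
    rw [hf, norm_mul]
    rwa [le_div_iff₀ hz, mul_comm] at h
  -- `ζ ↦ i (ζ + A)` maps the right half-plane to `Im z > A` and the positive axis to a vertical ray
  have key := PhragmenLindelof.right_half_plane_of_bounded_on_real
    (f := fun ζ => f (Complex.I * (ζ + A))) (C := max K₁ K₂) (z := -Complex.I * z - A)
    ?_ ⟨1, one_lt_two, 4 * t + 1, ?_⟩ ?_ ?_ ?_
  · have e : Complex.I * (-Complex.I * z - A + A) = z := by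
      linear_combination (-z) * Complex.I_mul_I
    simp only [e] at key
    rw [le_div_iff₀ (by linarith), mul_comm, ← norm_mul]
    exact key
  · refine DifferentiableOn.diffContOnCl ?_
    rw [Complex.closure_setOfPred_lt_re]
    intro ζ hζ
    have hζ : 0 ≤ ζ.re := hζ
    refine DifferentiableAt.differentiableWithinAt ?_
    have h1 : DifferentiableAt ℂ (fun ζ : ℂ => Complex.I * (ζ + A)) ζ := by fun_prop
    exact (hfdiff (Complex.I * (ζ + A)) (by rw [him]; linarith)).comp ζ h1
  · refine IsBigO.of_bound ((C + 1) * Real.exp ((4 * t + 1) * A)) ?_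
    filter_upwards [mem_inf_of_right (mem_principal_self _)] with ζ hζ
    have hζ : 0 < ζ.re := hζ
    rw [Real.rpow_one, Real.norm_of_nonneg (Real.exp_nonneg _), mul_assoc, ← Real.exp_add]
    set w := Complex.I * (ζ + A) with hw
    have h1 := hC w (by rw [him]; linarith)
    have h2 : ‖rhSolution n E Ef t x w i 1 - (1 : Mat2) i 1‖ ≤ C * Real.exp (4 * t * ‖w‖) + 1 := by
      exact (norm_sub_le _ _).trans (add_le_add ((norm_entry_le _ _ _).trans h1)
        ((norm_entry_le (1 : Mat2) i 1).trans norm_one.le))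
    have h3 : 1 ≤ Real.exp (4 * t * ‖w‖) := Real.one_le_exp (by positivity)
    have h4 : ‖w‖ ≤ Real.exp ‖w‖ := by linarith [Real.add_one_le_exp ‖w‖]
    have hw' := hnrm ζ
    calc ‖f w‖ = ‖w‖ * ‖rhSolution n E Ef t x w i 1 - (1 : Mat2) i 1‖ := norm_mul _ _
      _ ≤ Real.exp ‖w‖ * (C * Real.exp (4 * t * ‖w‖) + 1 * Real.exp (4 * t * ‖w‖)) := by
        gcongr
        exact h2.trans (by linarith)
      _ = (C + 1) * Real.exp ((4 * t + 1) * ‖w‖) := by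
        rw [← add_mul, add_mul (4 * t) 1, Real.exp_add, one_mul]; ring
      _ ≤ (C + 1) * Real.exp ((4 * t + 1) * (‖ζ‖ + A)) := by gcongr
      _ = _ := by rw [mul_add (4 * t + 1), add_comm (_ * A)]
  · refine isBoundedUnder_of_eventually_le (a := K₁) ?_
    filter_upwards [eventually_ge_atTop 0] with s hs
    have h1 : ‖Complex.I * ((s : ℂ) + A)‖ = s + A := by
      rw [norm_mul, Complex.norm_I, one_mul, ← Complex.ofReal_add, Complex.norm_real,
        Real.norm_of_nonneg (by linarith)]
    have h2 : (Complex.I * ((s : ℂ) + A)).im = s + A := by simp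
    obtain ⟨k1, k2⟩ := hcone (Complex.I * ((s : ℂ) + A)) (by rw [h2]; linarith)
      (by rw [h1, h2, one_mul]) (by rw [h1]; linarith [norm_nonneg E])
    have k3 : ∀ i : Fin 2, ‖rhSolution n E Ef t x (Complex.I * ((s : ℂ) + A)) i 1
        - (1 : Mat2) i 1‖ ≤ K₁ / ‖Complex.I * ((s : ℂ) + A)‖ :=
      Fin.forall_fin_two.2 ⟨by simpa using k1, by simpa using k2⟩
    exact hmul _ _ (by rw [h1]; linarith) (k3 i)
  · intro s
    have h2 : (Complex.I * ((s : ℂ) * Complex.I + A)).im = A := by simp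
    have h3 : A ≤ ‖Complex.I * ((s : ℂ) * Complex.I + A)‖ := by
      have := Complex.abs_im_le_norm (Complex.I * ((s : ℂ) * Complex.I + A))
      rw [h2] at this
      exact (le_abs_self A).trans this
    refine (hmul _ _ (by linarith) (hstrip _ (by rw [h2]; linarith) h2.le (by linarith) i)).trans
      (le_max_right _ _)
  · simp
    linarith

/-- Ahead of the front the solution is triangular. -/
theorem rhSolution_eq_of_le (hn : IsLineShape n) (E : ℂ) {t x : ℝ} (ht : 0 ≤ t) (htx : t ≤ x)
    (hxL : (x : EReal) < L) {z : ℂ} (hz : 0 < z.im) : rhSolution n E Ef t x z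
      = !![1, rFun E z * Complex.exp (-2 * Complex.I * theta n t x z); 0, 1] := by
  rw [rhSolution, if_pos hz, hsol.psi_of_le hn ht htx hxL z, expSigma3_mul,
    show -Complex.I * z * t + Complex.I * z * t = 0 by ring, expSigma3_zero, one_mul]

/-- The normalization in the upper half-plane. -/
theorem exists_upper_bound (hL : 0 < L) (hA₀ : 0 < A₀) (hn : IsLineShape n) {t x : ℝ}
    (ht : 0 ≤ t) (hx : 0 < x) (hxL : (x : EReal) < L) :
    ∃ K R : ℝ, 0 ≤ K ∧ ∀ z : ℂ, 0 < z.im → R ≤ ‖z‖ → ∀ i j,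
      ‖rhSolution n (specPoint A₀ ω₀) Ef t x z i j - (1 : Mat2) i j‖ ≤ K / ‖z‖ := by
  rcases lt_or_ge x t with hxt | htx
  · obtain ⟨K₁, R, hK₁0, hR, h1⟩ := hsol.exists_upper_bound_column_one hL hA₀ hn hx hxt hxL
    obtain ⟨K₂, hK₂0, h2⟩ := hsol.exists_psi_bound hn hx hxt hxL le_rfl
    refine ⟨max K₁ K₂, R, le_max_of_le_left hK₁0, fun z hz hRz i => Fin.forall_fin_two.2 ⟨?_, ?_⟩⟩
    · obtain ⟨k1, k2⟩ := (h2 z (hR.trans hRz)).1 (by rw [neg_zero]; exact hz.le)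
      rw [rhSolution_apply_zero hz]
      refine le_trans ?_ (div_le_div_of_nonneg_right (le_max_right K₁ K₂) (norm_nonneg z))
      revert i
      exact Fin.forall_fin_two.2 ⟨by simpa using k2, by simpa using k1⟩
    · exact (h1 z hz hRz i).trans (by gcongr; exact le_max_left _ _)
  · set E := specPoint A₀ ω₀ with hE
    have hm : 0 < E.im := half_pos hA₀
    refine ⟨4 * E.im, 2 * (‖E‖ + 1), by positivity, fun z hz hR i j => ?_⟩
    rw [hsol.rhSolution_eq_of_le hn E ht htx hxL hz]
    have hr := norm_rFun_le_of_norm_le hm hR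
    have h2 : ‖Complex.exp (-2 * Complex.I * theta n t x z)‖ ≤ 1 := by
      refine (norm_exp_theta_le_of_im_pos hn hx.le hz).trans (Real.exp_le_one_iff.2 ?_)
      have := mul_nonneg (sub_nonneg.2 htx) hz.le
      linarith
    have h3 : ‖rFun E z * Complex.exp (-2 * Complex.I * theta n t x z)‖ ≤ 4 * E.im / ‖z‖ := by
      rw [norm_mul]
      exact (mul_le_of_le_one_right (norm_nonneg _) h2).trans hr
    have h0 : 0 ≤ 4 * E.im / ‖z‖ := by positivity
    revert i j
    refine Fin.forall_fin_two.2 ⟨Fin.forall_fin_two.2 ⟨?_, ?_⟩, Fin.forall_fin_two.2 ⟨?_, ?_⟩⟩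
    · simpa using h0
    · simpa using h3
    · simpa using h0
    · simpa using h0

theorem det_rhSolution (E : ℂ) {t x : ℝ} (ht : 0 ≤ t) (hx : 0 ≤ x) (hxL : (x : EReal) < L) (z : ℂ) :
    (rhSolution n E Ef t x z).det = 1 := by
  have h1 : (expSigma3 (Complex.I * z * t)).det = 1 := by
    simp [expSigma3, Matrix.det_fin_two, ← Complex.exp_add]
  rw [rhSolution, Matrix.det_mul, Matrix.det_mul, hsol.det_psi ht hx hxL, h1]
  split_ifs <;> simp [Matrix.det_fin_two]

/-- The symmetry of the solution with respect to the real line. -/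
theorem rhSolution_conjTranspose_mul {E : ℂ} (hE : 0 < E.im) {t x : ℝ} (ht : 0 ≤ t)
    (hx : 0 ≤ x) (hxL : (x : EReal) < L) {z : ℂ} (hz : z.im < 0) (hseg : z ∉ segment ℝ E (conj E)) :
    (rhSolution n E Ef t x (conj z)).conjTranspose * rhSolution n E Ef t x z = 1 := by
  have hη : conj (eta n (conj z)) = eta n z := by
    simp only [eta, map_add, map_mul, Complex.conj_conj, map_div₀, map_one, map_ofNat]
    rw [← integral_conj]
    simp
  have hθ : conj (theta n t x (conj z)) = theta n t x z := by
    simp [theta, hη]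
  have he : (expSigma3 (Complex.I * conj z * t)).conjTranspose = expSigma3 (-(Complex.I * z * t)) := by
    ext i j
    fin_cases i <;> fin_cases j <;> simp [expSigma3, ← Complex.exp_conj]
  have hr := rFun_conj hE hseg
  have hT : (!![1, rFun E (conj z) * Complex.exp (-2 * Complex.I * theta n t x (conj z)); 0, 1] :
      Mat2).conjTranspose = !![1, 0; -(rFun E z * Complex.exp (2 * Complex.I * theta n t x z)), 1] := by
    have h1 : conj (rFun E (conj z) * Complex.exp (-2 * Complex.I * theta n t x (conj z)))
        = -(rFun E z * Complex.exp (2 * Complex.I * theta n t x z)) := by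
      rw [map_mul, hr, map_neg, Complex.conj_conj, ← Complex.exp_conj, neg_mul]
      simp [hθ, map_ofNat]
    ext i j
    fin_cases i <;> fin_cases j
    · simp
    · simp
    · exact h1
    · simp
  rw [rhSolution, rhSolution, if_pos (by simpa using hz), if_neg hz.not_gt, Matrix.conjTranspose_mul,
    Matrix.conjTranspose_mul, hT, he]
  set T₁ : Mat2 := !![1, 0; -(rFun E z * Complex.exp (2 * Complex.I * theta n t x z)), 1]
  set T₂ : Mat2 := !![1, 0; rFun E z * Complex.exp (2 * Complex.I * theta n t x z), 1]
  set e := expSigma3 (Complex.I * z * t)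
  have h1 : expSigma3 (-(Complex.I * z * t)) * e = 1 := by
    rw [expSigma3_mul, neg_add_cancel, expSigma3_zero]
  have h2 : T₁ * T₂ = 1 := by
    ext i j
    fin_cases i <;> fin_cases j <;> simp [T₁, T₂, Matrix.mul_apply, Fin.sum_univ_two]
  calc _ = T₁ * (expSigma3 (-(Complex.I * z * t))
        * ((psi Ef t x (conj z)).conjTranspose * psi Ef t x z) * e) * T₂ := by
        simp only [mul_assoc]
    _ = 1 := by rw [hsol.psi_conjTranspose_mul ht hx hxL, mul_one, h1, mul_one, h2]

/-- The symmetry expresses the solution in the lower half-plane by the one in the upper half-plane,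
without inverses. -/
theorem rhSolution_eq_adjugate {E : ℂ} (hE : 0 < E.im) {t x : ℝ} (ht : 0 ≤ t)
    (hx : 0 ≤ x) (hxL : (x : EReal) < L) {z : ℂ} (hz : z.im < 0) (hseg : z ∉ segment ℝ E (conj E)) :
    rhSolution n E Ef t x z = (rhSolution n E Ef t x (conj z)).conjTranspose.adjugate := by
  have h1 := hsol.rhSolution_conjTranspose_mul (n := n) hE ht hx hxL hz hseg
  have h2 := congrArg (fun B => (rhSolution n E Ef t x (conj z)).conjTranspose.adjugate * B) h1
  simp only [← mul_assoc, mul_one] at h2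
  rwa [Matrix.adjugate_mul, Matrix.det_conjTranspose, hsol.det_rhSolution E ht hx hxL, star_one,
    one_smul, one_mul] at h2

theorem exists_norm_rhSolution_sub_one_le (hL : 0 < L) (hA₀ : 0 < A₀) (hn : IsLineShape n) {t x : ℝ}
    (ht : 0 ≤ t) (hx : 0 < x) (hxL : (x : EReal) < L) :
    ∃ K R : ℝ, 0 ≤ K ∧ ∀ z ∈ (closedContour (specPoint A₀ ω₀))ᶜ, R ≤ ‖z‖ → ∀ i j,
      ‖rhSolution n (specPoint A₀ ω₀) Ef t x z i j - (1 : Mat2) i j‖ ≤ K / ‖z‖ := by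
  obtain ⟨K, R, hK0, hK⟩ := hsol.exists_upper_bound hL hA₀ hn ht hx hxL
  refine ⟨K, R, hK0, fun z hz hR => ?_⟩
  obtain ⟨him, hseg⟩ := mem_compl_closedContour_iff.1 hz
  rcases lt_or_gt_of_ne him with h | h
  swap
  · exact hK z h hR
  have hk := hK (conj z) (by simpa using h) (by rwa [RCLike.norm_conj])
  rw [RCLike.norm_conj] at hk
  rw [hsol.rhSolution_eq_adjugate (half_pos hA₀) ht hx.le hxL h hseg]
  have hc : ∀ a b : ℂ, ‖conj a - conj b‖ = ‖a - b‖ := fun a b => by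
    rw [← map_sub, RCLike.norm_conj]
  have h00 := hk 1 1
  have h01 := hk 1 0
  have h10 := hk 0 1
  have h11 := hk 0 0
  rw [← hc] at h00 h11
  refine Fin.forall_fin_two.2 ⟨Fin.forall_fin_two.2 ⟨?_, ?_⟩, Fin.forall_fin_two.2 ⟨?_, ?_⟩⟩
  · simpa [Matrix.adjugate_fin_two] using h00
  · simpa [Matrix.adjugate_fin_two] using h01
  · simpa [Matrix.adjugate_fin_two] using h10
  · simpa [Matrix.adjugate_fin_two] using h11

/-- The explicit matrix solves the Riemann--Hilbert problem: the local conditions hold by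
construction, and the normalization is the estimate in both half-planes. -/
theorem rhSolution_solvesRH (hL : 0 < L) (hA₀ : 0 < A₀) (hn : IsLineShape n) {t x : ℝ}
    (ht : 0 ≤ t) (hx : 0 < x) (hxL : (x : EReal) < L) :
    SolvesRH n (specPoint A₀ ω₀) t x (rhSolution n (specPoint A₀ ω₀) Ef t x) := by
  obtain ⟨K, R, hK0, hK⟩ := hsol.exists_norm_rhSolution_sub_one_le hL hA₀ hn ht hx hxL
  refine hsol.rhSolution_solvesRH_of_normalization hn (half_pos hA₀) ht hx hxL fun i j =>
    IsBigO.of_bound K ?_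
  filter_upwards [mem_inf_of_right (mem_principal_self _), mem_inf_of_left
    (tendsto_norm_cobounded_atTop.eventually_ge_atTop R)] with z hz hR
  rw [norm_inv, ← div_eq_mul_inv]
  exact hK z hz hR i j

/-- The field as a nontangential limit. Ahead of the front `x = t` the field vanishes, and so does
the limit. -/
theorem tendsto_mul_rhSolution (hL : 0 < L) (hA₀ : 0 < A₀) (hn : IsLineShape n) {t x : ℝ}
    (ht : 0 ≤ t) (hx : 0 < x) (hxL : (x : EReal) < L) (hne : t ≠ x) {c : ℝ} (hc : 0 < c) :
    Tendsto (fun z : ℂ => z * rhSolution n (specPoint A₀ ω₀) Ef t x z 0 1)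
      (Bornology.cobounded ℂ ⊓ 𝓟 {z : ℂ | c * ‖z‖ ≤ |z.im|}) (𝓝 (Complex.I * Ef t x / 4)) := by
  set E := specPoint A₀ ω₀ with hE
  have hset : {z : ℂ | c * ‖z‖ ≤ |z.im|} = {z : ℂ | c * ‖z‖ ≤ z.im} ∪ {z : ℂ | c * ‖z‖ ≤ -z.im} := by
    ext z
    exact le_abs (a := c * ‖z‖) (b := z.im)
  rw [hset, ← sup_principal, inf_sup_left, tendsto_sup]
  have hinf : ∀ s : Set ℂ, Tendsto (fun z : ℂ => ‖z‖) (Bornology.cobounded ℂ ⊓ 𝓟 s) atTop :=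
    fun s => tendsto_norm_cobounded_atTop.mono_left inf_le_left
  have hlow : ∀ᶠ z in Bornology.cobounded ℂ ⊓ 𝓟 {z : ℂ | c * ‖z‖ ≤ -z.im},
      z * (psi Ef t x z 0 1 * Complex.exp (-Complex.I * z * t)) = z * rhSolution n E Ef t x z 0 1 := by
    filter_upwards [mem_inf_of_right (mem_principal_self _),
      (hinf _).eventually_ge_atTop 1] with z hz hz1
    have hz : c * ‖z‖ ≤ -z.im := hz
    rw [rhSolution_apply_one_of_neg]
    have := mul_pos hc (zero_lt_one.trans_le hz1)
    linarith
  rcases lt_or_gt_of_ne hne with h | h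
  · rw [hsol.field_eq_zero hn ht h hxL, mul_zero, zero_div]
    constructor
    · have h0 : Tendsto (fun s : ℝ => s ^ (1 : ℝ) * Real.exp (-(2 * (x - t) * c) * s)) atTop (𝓝 0) :=
        tendsto_rpow_mul_exp_neg_mul_atTop_nhds_zero 1 _
          (mul_pos (mul_pos two_pos (sub_pos.2 h)) hc)
      refine squeeze_zero_norm' ?_ (h0.comp (hinf {z : ℂ | c * ‖z‖ ≤ z.im}))
      filter_upwards [mem_inf_of_right (mem_principal_self _),
        (hinf _).eventually_ge_atTop 1] with z hz hz1
      have hz : c * ‖z‖ ≤ z.im := hz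
      have him : 0 < z.im := (mul_pos hc (zero_lt_one.trans_le hz1)).trans_le hz
      have h1 := norm_exp_theta_le_of_im_pos hn (t := t) hx.le him
      have h2 : Real.exp (-(2 * (x - t) * z.im)) ≤ Real.exp (-(2 * (x - t) * c) * ‖z‖) := by
        refine Real.exp_le_exp.2 ?_
        have := mul_le_mul_of_nonneg_left hz (sub_nonneg.2 h.le)
        linarith
      rw [hsol.rhSolution_eq_of_le hn E ht h.le hxL him]
      simp only [Matrix.of_apply, Matrix.cons_val_zero, Matrix.cons_val_one, Matrix.cons_val',
        Matrix.cons_val_fin_one, Function.comp_def, Real.rpow_one]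
      rw [norm_mul, norm_mul]
      have h3 := norm_rFun_le_one E z
      calc _ ≤ ‖z‖ * (1 * Real.exp (-(2 * (x - t) * c) * ‖z‖)) := by gcongr; exact h1.trans h2
        _ = _ := by rw [one_mul]
    · refine (tendsto_const_nhds (x := (0 : ℂ))).congr' (hlow.mono fun z hz => ?_)
      refine Eq.trans ?_ hz
      rw [hsol.psi_of_le hn ht h.le hxL]
      simp [expSigma3]
  · exact ⟨hsol.tendsto_mul_rhSolution_upper hL hA₀ hn hx h hxL hc,
      (hsol.tendsto_mul_psi hn hx h hxL hc).congr' hlow⟩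

end MaxwellBloch.IsSolution

/-! ### Continuation across a contour -/

/-- A continuous function which is holomorphic off a horizontal line is holomorphic. -/
theorem differentiableOn_of_differentiableOn_off_im {f : ℂ → ℂ} {U : Set ℂ} {c : ℝ} (hU : IsOpen U)
    (hf : ContinuousOn f U) (hd : ∀ z ∈ U, z.im ≠ c → DifferentiableAt ℂ f z) :
    DifferentiableOn ℂ f U := by
  refine (Complex.isConservativeOn_and_continuousOn_iff_isDifferentiableOn hU).1 ⟨?_, hf⟩
  intro z w hzw
  rw [← add_eq_zero_iff_eq_neg, Complex.wedgeIntegral_add_wedgeIntegral_eq]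
  have hbox : ∀ p q : ℂ, (uIcc p.re q.re) ×ℂ (uIcc p.im q.im) ⊆ U →
      c ∉ Ioo (min p.im q.im) (max p.im q.im) →
      (∫ x : ℝ in p.re..q.re, f (x + p.im * Complex.I))
        - (∫ x : ℝ in p.re..q.re, f (x + q.im * Complex.I))
        + Complex.I • (∫ y : ℝ in p.im..q.im, f (q.re + y * Complex.I))
        - Complex.I • (∫ y : ℝ in p.im..q.im, f (p.re + y * Complex.I)) = 0 := by
    intro p q hpq hc
    refine Complex.integral_boundary_rect_eq_zero_of_continuousOn_of_differentiableOn f p q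
      (hf.mono hpq) fun ζ hζ => (hd ζ (hpq ⟨?_, ?_⟩) fun h => hc (h ▸ hζ.2)).differentiableWithinAt
    · exact Ioo_subset_Icc_self hζ.1
    · exact Ioo_subset_Icc_self hζ.2
  by_cases hc : c ∈ uIcc z.im w.im
  swap
  · exact hbox z w hzw fun h => hc (Ioo_subset_Icc_self h)
  -- the rectangle is cut along the line
  have hsub1 : uIcc z.im c ⊆ uIcc z.im w.im := uIcc_subset_uIcc_left hc
  have hsub2 : uIcc c w.im ⊆ uIcc z.im w.im := uIcc_subset_uIcc_right hc
  have h1 := hbox z ⟨w.re, c⟩ (fun ζ hζ => hzw ⟨hζ.1, hsub1 hζ.2⟩) (by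
    intro h
    rcases le_total z.im c with h' | h' <;> simp [h'] at h)
  have h2 := hbox ⟨z.re, c⟩ w (fun ζ hζ => hzw ⟨hζ.1, hsub2 hζ.2⟩) (by
    intro h
    rcases le_total c w.im with h' | h' <;> simp [h'] at h)
  have hint : ∀ r ∈ uIcc z.re w.re, ∀ a b : ℝ, uIcc a b ⊆ uIcc z.im w.im →
      IntervalIntegrable (fun y : ℝ => f (r + y * Complex.I)) volume a b := by
    intro r hr a b hab
    refine ContinuousOn.intervalIntegrable (hf.comp (by fun_prop) fun y hy => hzw ⟨?_, ?_⟩)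
    · simpa using hr
    · simpa using hab hy
  simp only at h1 h2
  have e1 := intervalIntegral.integral_add_adjacent_intervals
    (hint w.re right_mem_uIcc _ _ hsub1) (hint w.re right_mem_uIcc _ _ hsub2)
  have e2 := intervalIntegral.integral_add_adjacent_intervals
    (hint z.re left_mem_uIcc _ _ hsub1) (hint z.re left_mem_uIcc _ _ hsub2)
  rw [← e1, ← e2, smul_add, smul_add]
  linear_combination h1 + h2

/-- A continuous function which is holomorphic off a vertical line is holomorphic. -/
theorem differentiableOn_of_differentiableOn_off_re {f : ℂ → ℂ} {U : Set ℂ} {c : ℝ} (hU : IsOpen U)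
    (hf : ContinuousOn f U) (hd : ∀ z ∈ U, z.re ≠ c → DifferentiableAt ℂ f z) :
    DifferentiableOn ℂ f U := by
  have hI : Differentiable ℂ fun z : ℂ => Complex.I * z := by fun_prop
  have h := differentiableOn_of_differentiableOn_off_im (f := fun z => f (Complex.I * z))
    (U := (fun z : ℂ => Complex.I * z) ⁻¹' U) (c := -c) (hU.preimage hI.continuous)
    (hf.comp hI.continuous.continuousOn fun z hz => hz)
    fun z hz hne => (hd _ hz fun h => hne (by simp at h; linarith)).comp z (hI z)
  refine (h.comp (f := fun z : ℂ => -Complex.I * z) (by fun_prop) fun z hz => ?_).congr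
    fun z hz => ?_
  · show Complex.I * (-Complex.I * z) ∈ U
    rwa [← mul_assoc, mul_neg, Complex.I_mul_I, neg_neg, one_mul]
  · show f z = f (Complex.I * (-Complex.I * z))
    rw [← mul_assoc, mul_neg, Complex.I_mul_I, neg_neg, one_mul]

/-- Finitely many singularities of order `o(1 / z)` are removable. -/
theorem exists_differentiable_eqOn_compl_finset (P : Finset ℂ) : ∀ f : ℂ → ℂ,
    DifferentiableOn ℂ f (P : Set ℂ)ᶜ → (∀ p ∈ P, f =o[𝓝[≠] p] fun z => (z - p)⁻¹) →
    ∃ g : ℂ → ℂ, Differentiable ℂ g ∧ EqOn g f (P : Set ℂ)ᶜ := by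
  induction P using Finset.induction_on with
  | empty =>
    intro f hf _
    exact ⟨f, by simpa [differentiableOn_univ] using hf, fun _ _ => rfl⟩
  | insert p P hp ih =>
    intro f hf ho
    set f' := Function.update f p (limUnder (𝓝[≠] p) f) with hf'
    have hPo : IsOpen (P : Set ℂ)ᶜ := P.finite_toSet.isClosed.isOpen_compl
    have hconst : (fun _ : ℂ => f p) =o[𝓝[≠] p] fun z => (z - p)⁻¹ := by
      rw [isLittleO_const_left]
      refine .inr ?_
      have : Tendsto (fun z => z - p) (𝓝[≠] p) (𝓝[≠] 0) :=
        tendsto_nhdsWithin_iff.2 ⟨by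
          have : Tendsto (fun z => z - p) (𝓝[≠] p) (𝓝 (p - p)) :=
            ((continuous_id.sub continuous_const).tendsto p).mono_left nhdsWithin_le_nhds
          simpa using this, eventually_mem_nhdsWithin.mono fun z hz => sub_ne_zero.2 hz⟩
      exact tendsto_norm_cobounded_atTop.comp (tendsto_inv₀_nhdsNE_zero.comp this)
    have h1 : DifferentiableOn ℂ f' (P : Set ℂ)ᶜ :=
      Complex.differentiableOn_update_limUnder_of_isLittleO (hPo.mem_nhds hp)
        (hf.mono fun z hz => by simpa [not_or, and_comm] using hz)
        ((ho p (Finset.mem_insert_self p P)).sub hconst)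
    have hcongr : ∀ z, z ≠ p → f' z = f z := fun z hz => Function.update_of_ne hz _ _
    obtain ⟨g, hg, hgf⟩ := ih f' h1 fun q hq => by
      refine (ho q (Finset.mem_insert_of_mem hq)).congr' ?_ EventuallyEq.rfl
      have hqp : q ≠ p := fun h => hp (h ▸ hq)
      filter_upwards [nhdsWithin_le_nhds (isOpen_ne.mem_nhds hqp)] with z hz
      exact (hcongr z hz).symm
    refine ⟨g, hg, fun z hz => ?_⟩
    simp only [Finset.coe_insert, mem_compl_iff, mem_insert_iff, not_or] at hz
    rw [hgf hz.2, hcongr z hz.1]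

theorem norm_sub_le_of_tendsto_nhdsWithin {f g : ℂ → ℂ} {ψ : ℂ → ℝ} {Ω U : Set ℂ} {z : ℂ} {k : ℂ}
    (hΩ : z ∈ closure Ω) (hU : IsOpen U) (hz : z ∈ U) (hf : Tendsto f (𝓝[Ω] z) (𝓝 (g z)))
    (hψ : ContinuousAt ψ z) (h : ∀ w ∈ Ω, w ∈ U → ‖f w - k‖ ≤ ψ w) : ‖g z - k‖ ≤ ψ z := by
  have := mem_closure_iff_nhdsWithin_neBot.1 hΩ
  refine le_of_tendsto_of_tendsto (hf.sub_const k).norm (hψ.tendsto.mono_left nhdsWithin_le_nhds) ?_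
  filter_upwards [self_mem_nhdsWithin, nhdsWithin_le_nhds (hU.mem_nhds hz)] with w h1 h2
  exact h w h1 h2

/-- Liouville's theorem for functions holomorphic off the contour: if there is no jump at the
regular points of the contour, the singularities at the finitely many other points are of order
less than one, and there is a limit at infinity, then the function is constant. -/
theorem eq_const_of_tendsto_contour {n : ℝ → ℝ} (hn : {l | ¬ContinuousAt n l}.Finite) {E : ℂ}
    (hE : 0 < E.im) {f : ℂ → ℂ} {k : ℂ} (hd : DifferentiableOn ℂ f (closedContour E)ᶜ)
    (hreg : ∀ ζ ∈ regularContour n E, ∃ y, Tendsto f (𝓝[(closedContour E)ᶜ] ζ) (𝓝 y))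
    (hsing : ∀ p ∈ closedContour E, p ∉ regularContour n E →
      f =O[𝓝[(closedContour E)ᶜ] p] fun z => ‖z - p‖ ^ (-(1 / 2) : ℝ))
    (hinf : Tendsto f (Bornology.cobounded ℂ ⊓ 𝓟 (closedContour E)ᶜ) (𝓝 k)) :
    EqOn f (fun _ => k) (closedContour E)ᶜ := by
  set Ω := (closedContour E)ᶜ with hΩ
  have hΩo : IsOpen Ω := isOpen_compl_closedContour E
  -- the singular points
  have hPfin : (closedContour E \ regularContour n E).Finite := by
    refine ((hn.image (fun l : ℝ => (l : ℂ))).union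
      (Set.toFinite {(E.re : ℂ), E, conj E})).subset ?_
    rintro z ⟨hz, hz'⟩
    by_cases h0 : z.im = 0
    · by_cases h1 : z.re = E.re
      · refine .inr (.inl ?_)
        rw [← h1, ofReal_re_of_im_eq_zero h0]
      · refine .inl ⟨z.re, fun h2 => hz' (.inl ⟨h0, h1, h2⟩), ofReal_re_of_im_eq_zero h0⟩
    · obtain ⟨h1, h2⟩ := (mem_segment_conj_iff hE).1 (hz.resolve_left h0)
      have h3 : |z.im| = E.im := by
        by_contra h3
        exact hz' (.inr ⟨h1, h0, lt_of_le_of_ne h2 h3⟩)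
      refine .inr ?_
      rcases (abs_eq hE.le).1 h3 with h3 | h3
      · exact .inr (.inl (Complex.ext h1 h3))
      · exact .inr (.inr (Complex.ext (by simpa using h1) (by simpa using h3)))
  set P := hPfin.toFinset with hP
  have hmemP : ∀ z, z ∈ P ↔ z ∈ closedContour E ∧ z ∉ regularContour n E := fun z => by
    rw [hP, Set.Finite.mem_toFinset]; rfl
  have hPo : IsOpen (P : Set ℂ)ᶜ := P.finite_toSet.isClosed.isOpen_compl
  -- the complement of the contour is dense
  have hdense : ∀ z, z ∈ closure Ω := by
    intro z
    refine Metric.mem_closure_iff.2 fun ε hε => ?_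
    have havoid : ∀ a c : ℝ, ∃ b, |b - a| < ε / 2 ∧ b ≠ c := by
      intro a c
      by_cases h : a = c
      · refine ⟨a + ε / 4, ?_, by linarith⟩
        rw [add_sub_cancel_left, abs_of_pos (by linarith)]
        linarith
      · exact ⟨a, by simpa using hε, h⟩
    obtain ⟨a, ha, ha'⟩ := havoid z.re E.re
    obtain ⟨b, hb, hb'⟩ := havoid z.im 0
    refine ⟨⟨a, b⟩, mem_compl_closedContour_iff.2 ⟨hb', fun h =>
      ha' ((mem_segment_conj_iff hE).1 h).1⟩, ?_⟩
    rw [dist_comm, dist_eq_norm]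
    have := Complex.norm_le_abs_re_add_abs_im ((⟨a, b⟩ : ℂ) - z)
    simp only [Complex.sub_re, Complex.sub_im] at this
    linarith
  have hlim : ∀ z ∈ (P : Set ℂ)ᶜ, ∃ y, Tendsto f (𝓝[Ω] z) (𝓝 y) := by
    intro z hz
    by_cases h : z ∈ Ω
    · exact ⟨f z, (hd z h).continuousWithinAt⟩
    · refine hreg z ?_
      by_contra h'
      exact hz ((hmemP z).2 ⟨not_notMem.1 h, h'⟩)
  set g := extendFrom Ω f with hg
  have hgΩ : ∀ z ∈ Ω, g z = f z := fun z hz => extendFrom_extends hd.continuousOn z hz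
  have hgt : ∀ z ∈ (P : Set ℂ)ᶜ, Tendsto f (𝓝[Ω] z) (𝓝 (g z)) := fun z hz =>
    tendsto_extendFrom (hlim z hz)
  have hgc : ContinuousOn g (P : Set ℂ)ᶜ := continuousOn_extendFrom (fun z _ => hdense z) hlim
  have hgd : ∀ z ∈ Ω, DifferentiableAt ℂ g z := fun z hz =>
    ((hd z hz).differentiableAt (hΩo.mem_nhds hz)).congr_of_eventuallyEq
      (eventually_of_mem (hΩo.mem_nhds hz) hgΩ)
  have hdiff : DifferentiableOn ℂ g (P : Set ℂ)ᶜ := by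
    intro z hz
    by_cases hzΩ : z ∈ Ω
    · exact (hgd z hzΩ).differentiableWithinAt
    have hzr : z ∈ regularContour n E := by
      by_contra h'
      exact hz ((hmemP z).2 ⟨not_notMem.1 hzΩ, h'⟩)
    refine DifferentiableAt.differentiableWithinAt ?_
    obtain ⟨h1, h2, -⟩ | ⟨h1, h2, h3⟩ := hzr
    · -- near a real point the contour is the real line
      set U := (P : Set ℂ)ᶜ ∩ {w | w.re ≠ E.re}
      have hUo : IsOpen U := hPo.inter (isOpen_ne_fun Complex.continuous_re continuous_const)
      refine (differentiableOn_of_differentiableOn_off_im (c := 0) hUo (hgc.mono inter_subset_left)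
        fun w hw hw0 => hgd w (mem_compl_closedContour_iff.2 ⟨hw0, fun h =>
          hw.2 ((mem_segment_conj_iff hE).1 h).1⟩)).differentiableAt (hUo.mem_nhds ⟨hz, h2⟩)
    · set U := (P : Set ℂ)ᶜ ∩ {w | w.im ≠ 0}
      have hUo : IsOpen U := hPo.inter (isOpen_ne_fun Complex.continuous_im continuous_const)
      refine (differentiableOn_of_differentiableOn_off_re (c := E.re) hUo
        (hgc.mono inter_subset_left)
        fun w hw hw0 => hgd w (mem_compl_closedContour_iff.2 ⟨hw.2, fun h =>
          hw0 ((mem_segment_conj_iff hE).1 h).1⟩)).differentiableAt (hUo.mem_nhds ⟨hz, h2⟩)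
  -- the remaining singularities are removable
  obtain ⟨G, hG, hGg⟩ := exists_differentiable_eqOn_compl_finset P g hdiff fun p hp => by
    obtain ⟨hp1, hp2⟩ := (hmemP p).1 hp
    obtain ⟨C, hC⟩ := (hsing p hp1 hp2).bound
    obtain ⟨U, hU, hpU, hUC⟩ : ∃ U, IsOpen U ∧ p ∈ U ∧ ∀ w ∈ Ω, w ∈ U →
        ‖f w‖ ≤ C * ‖‖w - p‖ ^ (-(1 / 2) : ℝ)‖ := by
      obtain ⟨U, hU, hpU, h⟩ := mem_nhdsWithin.1 hC
      exact ⟨U, hU, hpU, fun w hw hwU => h ⟨hwU, hw⟩⟩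
    have hbig : g =O[𝓝[≠] p] fun z => ‖z - p‖ ^ (-(1 / 2) : ℝ) := by
      refine IsBigO.of_bound C ?_
      have hP' : ∀ᶠ z in 𝓝[≠] p, z ∈ (P : Set ℂ)ᶜ := by
        have h1 : ((P : Set ℂ) \ {p})ᶜ ∈ 𝓝 p :=
          (P.finite_toSet.subset sdiff_subset).isClosed.isOpen_compl.mem_nhds fun h => h.2 rfl
        filter_upwards [nhdsWithin_le_nhds h1, self_mem_nhdsWithin] with z hz hz' h
        exact hz ⟨h, hz'⟩
      filter_upwards [hP', nhdsWithin_le_nhds (hU.mem_nhds hpU), self_mem_nhdsWithin] with z h1 h2 h3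
      have hc : ContinuousAt (fun z => C * ‖‖z - p‖ ^ (-(1 / 2) : ℝ)‖) z := by
        have h4 : ContinuousAt (fun z => ‖z - p‖) z := by fun_prop
        exact ((h4.rpow_const (.inl (norm_ne_zero_iff.2 (sub_ne_zero.2 h3)))).norm).const_mul C
      have := norm_sub_le_of_tendsto_nhdsWithin (k := 0) (hdense z) hU h2 (hgt z h1) hc
        (fun w hw hwU => by simpa using hUC w hw hwU)
      simpa using this
    refine hbig.trans_isLittleO (IsLittleO.of_norm_right (isLittleO_iff_exists_eq_mul.2
      ⟨fun z => ‖z - p‖ ^ (1 / 2 : ℝ), ?_, ?_⟩))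
    · have h1 : Continuous fun z : ℂ => ‖z - p‖ ^ (1 / 2 : ℝ) :=
        (by fun_prop : Continuous fun z : ℂ => ‖z - p‖).rpow_const fun _ => .inr (by norm_num)
      have h2 := h1.tendsto p
      rw [sub_self, norm_zero, Real.zero_rpow (by norm_num)] at h2
      exact h2.mono_left nhdsWithin_le_nhds
    · filter_upwards [self_mem_nhdsWithin] with z hz
      have h1 : 0 < ‖z - p‖ := norm_pos_iff.2 (sub_ne_zero.2 hz)
      rw [Pi.mul_apply, norm_inv, ← Real.rpow_neg_one, ← Real.rpow_add h1]
      norm_num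
  have hGΩ : ∀ z ∈ Ω, G z = f z := fun z hz => by
    rw [hGg fun h => hz ((hmemP z).1 h).1, hgΩ z hz]
  have hGinf : Tendsto G (cocompact ℂ) (𝓝 k) := by
    rw [← Metric.cobounded_eq_cocompact, Metric.tendsto_nhds]
    intro ε hε
    have h1 : ∀ᶠ z in Bornology.cobounded ℂ ⊓ 𝓟 Ω, ‖f z - k‖ ≤ ε / 2 := by
      filter_upwards [Metric.tendsto_nhds.1 hinf (ε / 2) (half_pos hε)] with z hz
      rw [dist_eq_norm] at hz
      exact hz.le
    rw [eventually_inf_principal] at h1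
    obtain ⟨R, hR⟩ : ∃ R : ℝ, ∀ z : ℂ, R < ‖z‖ → z ∈ Ω → ‖f z - k‖ ≤ ε / 2 := by
      obtain ⟨R, -, hR⟩ := (Metric.hasBasis_cobounded_compl_closedBall (0 : ℂ)).mem_iff.1 h1
      exact ⟨R, fun z hz => hR (by simpa using hz)⟩
    filter_upwards [tendsto_norm_cobounded_atTop.eventually_gt_atTop R] with z hz
    rw [dist_eq_norm]
    have := norm_sub_le_of_tendsto_nhdsWithin (k := k) (f := f) (g := G) (ψ := fun _ => ε / 2)
      (U := {z | R < ‖z‖}) (hdense z) (isOpen_lt continuous_const continuous_norm) hz ?_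
      continuousAt_const fun w hw hwU => hR w hwU hw
    · linarith
    · refine ((hG z).continuousAt.tendsto.mono_left nhdsWithin_le_nhds).congr' ?_
      exact eventually_mem_nhdsWithin.mono hGΩ
  intro z hz
  rw [← hGΩ z hz, hG.eq_const_of_tendsto_cocompact hGinf]
  rfl

/-! ### Uniqueness for the Riemann--Hilbert problem -/

theorem det_jumpMatrix (n : ℝ → ℝ) (E : ℂ) (t x : ℝ) (ζ : ℂ) : (jumpMatrix n E t x ζ).det = 1 := by
  have e : ∀ a b : ℂ, Complex.exp (2 * Complex.I * (a - b))
      = Complex.exp (-2 * Complex.I * b) * Complex.exp (2 * Complex.I * a) := fun a b => by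
    rw [← Complex.exp_add]; congr 1; ring
  rw [jumpMatrix]
  split_ifs
  · rw [Matrix.det_fin_two, e]
    simp only [Matrix.of_apply, Matrix.cons_val_zero, Matrix.cons_val_one, Matrix.cons_val',
      Matrix.cons_val_fin_one]
    ring
  · simp [Matrix.det_fin_two]
  · simp [Matrix.det_fin_two]

/-- At a regular point the complement of the contour is covered by the two sides. -/
theorem nhdsWithin_compl_le_sup {n : ℝ → ℝ} {E : ℂ} (hE : 0 < E.im) {ζ : ℂ}
    (hζ : ζ ∈ regularContour n E) :
    𝓝[(closedContour E)ᶜ] ζ ≤ plusSide E ζ ⊔ minusSide E ζ := by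
  rw [plusSide, minusSide]
  obtain ⟨h1, -, -⟩ | ⟨h1, h2, h3⟩ := hζ
  · rw [if_pos h1, if_pos h1, ← nhdsWithin_union]
    exact nhdsWithin_mono _ fun z hz => (mem_compl_closedContour_iff.1 hz).1.lt_or_gt.symm
  · rw [if_neg h2, if_neg h2, ← nhdsWithin_union]
    refine nhdsWithin_le_iff.2 ?_
    have h4 : ∀ᶠ z : ℂ in 𝓝 ζ, |z.im| < E.im :=
      (by fun_prop : Continuous fun z : ℂ => |z.im|).continuousAt.eventually_lt_const h3
    filter_upwards [self_mem_nhdsWithin, nhdsWithin_le_nhds h4] with z hz hz'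
    refine (lt_or_gt_of_ne fun h => ?_ : E.re < z.re ∨ z.re < E.re)
    exact (mem_compl_closedContour_iff.1 hz).2 ((mem_segment_conj_iff hE).2 ⟨h.symm, hz'.le⟩)

theorem adjugate_entry_isBigO {M : ℂ → Mat2} {l : Filter ℂ} {φ : ℂ → ℝ}
    (h : ∀ i j, (fun z => M z i j) =O[l] φ) (i j : Fin 2) :
    (fun z => (M z).adjugate i j) =O[l] φ := by
  simp only [Matrix.adjugate_fin_two]
  revert i j
  refine Fin.forall_fin_two.2 ⟨Fin.forall_fin_two.2 ⟨?_, ?_⟩, Fin.forall_fin_two.2 ⟨?_, ?_⟩⟩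
  · simpa using h 1 1
  · simpa using (h 0 1).neg_left
  · simpa using (h 1 0).neg_left
  · simpa using h 0 0

theorem adjugate_continuous : Continuous fun M : Mat2 => M.adjugate := by
  refine continuous_pi fun i => continuous_pi fun j => ?_
  simp only [Matrix.adjugate_fin_two]
  fin_cases i <;> fin_cases j <;> simp <;> fun_prop

/-- If `M` is a solution with determinant one, then `M' M⁻¹` has no jumps for every
solution `M'`. -/
theorem MaxwellBloch.SolvesRH.eqOn_of_det_eq_one {n : ℝ → ℝ} (hn : {l | ¬ContinuousAt n l}.Finite)
    {E : ℂ} (hE : 0 < E.im) {t x : ℝ} {M M' : ℂ → Mat2} (hM : SolvesRH n E t x M)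
    (hdet : ∀ z ∈ (closedContour E)ᶜ, (M z).det = 1) (hM' : SolvesRH n E t x M') :
    EqOn M' M (closedContour E)ᶜ := by
  set X : ℂ → Mat2 := fun z => M' z * (M z).adjugate with hX
  have hXij : ∀ i j z, X z i j = M' z i 0 * (M z).adjugate 0 j + M' z i 1 * (M z).adjugate 1 j :=
    fun i j z => (Matrix.mul_apply).trans (Fin.sum_univ_two _)
  have hone : ∀ {N : ℂ → Mat2}, SolvesRH n E t x N →
      Tendsto N (Bornology.cobounded ℂ ⊓ 𝓟 (closedContour E)ᶜ) (𝓝 1) := by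
    intro N hN
    refine tendsto_pi_nhds.2 fun i => tendsto_pi_nhds.2 fun j => ?_
    have h1 : Tendsto (fun z : ℂ => z⁻¹) (Bornology.cobounded ℂ ⊓ 𝓟 (closedContour E)ᶜ) (𝓝 0) :=
      tendsto_inv₀_cobounded.mono_left inf_le_left
    simpa using ((hN.normalization i j).trans_tendsto h1).add_const ((1 : Mat2) i j)
  have hprod : ∀ (l : Filter ℂ) (φ ψ : ℂ → ℝ), (∀ i j, (fun z => M' z i j) =O[l] φ) →
      (∀ i j, (fun z => M z i j) =O[l] φ) → (fun z => φ z * φ z) =O[l] ψ →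
      ∀ i j, (fun z => X z i j) =O[l] ψ := by
    intro l φ ψ h1 h2 h3 i j
    simp only [hXij]
    have h4 := adjugate_entry_isBigO h2
    exact (((h1 i 0).mul (h4 0 j)).add ((h1 i 1).mul (h4 1 j))).trans h3
  have key : ∀ i j, EqOn (fun z => X z i j) (fun _ => (1 : Mat2) i j) (closedContour E)ᶜ := by
    intro i j
    refine eq_const_of_tendsto_contour hn hE ?_ (fun ζ hζ => ?_) (fun p hp hp' => ?_) ?_
    · simp only [hXij]
      have hadj : ∀ i j, DifferentiableOn ℂ (fun z => (M z).adjugate i j) (closedContour E)ᶜ := by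
        simp only [Matrix.adjugate_fin_two]
        refine Fin.forall_fin_two.2 ⟨Fin.forall_fin_two.2 ⟨?_, ?_⟩, Fin.forall_fin_two.2 ⟨?_, ?_⟩⟩
        · simpa using hM.analytic 1 1
        · simpa using (hM.analytic 0 1).neg
        · simpa using (hM.analytic 1 0).neg
        · simpa using hM.analytic 0 0
      exact ((hM'.analytic i 0).mul (hadj 0 j)).add ((hM'.analytic i 1).mul (hadj 1 j))
    · have hp := tendsto_nhds_limUnder (hM.boundary_plus ζ hζ)
      have hm := tendsto_nhds_limUnder (hM.boundary_minus ζ hζ)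
      have hp' := tendsto_nhds_limUnder (hM'.boundary_plus ζ hζ)
      have hm' := tendsto_nhds_limUnder (hM'.boundary_minus ζ hζ)
      have hj : minusValue E M' ζ * (minusValue E M ζ).adjugate
          = plusValue E M' ζ * (plusValue E M ζ).adjugate := by
        rw [hM.jump ζ hζ, hM'.jump ζ hζ, Matrix.adjugate_mul_distrib, ← mul_assoc,
          mul_assoc (plusValue E M' ζ), Matrix.mul_adjugate, det_jumpMatrix, one_smul, mul_one]
      have h1 : Tendsto X (plusSide E ζ)
          (𝓝 (plusValue E M' ζ * (plusValue E M ζ).adjugate)) :=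
        hp'.mul ((adjugate_continuous.tendsto _).comp hp)
      have h2 : Tendsto X (minusSide E ζ)
          (𝓝 (plusValue E M' ζ * (plusValue E M ζ).adjugate)) := by
        rw [← hj]
        exact hm'.mul ((adjugate_continuous.tendsto _).comp hm)
      have h3 := (h1.sup h2).mono_left (nhdsWithin_compl_le_sup hE hζ)
      exact ⟨_, tendsto_pi_nhds.1 (tendsto_pi_nhds.1 h3 i) j⟩
    · have hquarter : ∀ p : ℂ, p ∈ closedContour E →
          (fun z => ‖z - p‖ ^ (-(1 / 4) : ℝ) * ‖z - p‖ ^ (-(1 / 4) : ℝ))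
            =O[𝓝[(closedContour E)ᶜ] p] fun z => ‖z - p‖ ^ (-(1 / 2) : ℝ) := by
        intro p hp
        refine IsBigO.of_bound 1 ?_
        filter_upwards [self_mem_nhdsWithin] with z hz
        have h0 : 0 < ‖z - p‖ := norm_pos_iff.2 (sub_ne_zero.2 fun h => hz (h ▸ hp))
        rw [← Real.rpow_add h0, one_mul]
        norm_num
      by_cases h0 : p.im = 0
      · have hcond : p.re = E.re ∨ ¬ContinuousAt n p.re := by
          by_contra h
          rw [not_or, not_not] at h
          exact hp' (.inl ⟨h0, h.1, h.2⟩)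
        have h1 := hM'.bounded p.re hcond
        have h2 := hM.bounded p.re hcond
        rw [ofReal_re_of_im_eq_zero h0] at h1 h2
        refine hprod _ _ _ h1 h2 (IsBigO.of_bound 1 ?_) i j
        filter_upwards [self_mem_nhdsWithin,
          nhdsWithin_le_nhds (Metric.ball_mem_nhds p one_pos)] with z hz hz1
        have h3 : 0 < ‖z - p‖ := norm_pos_iff.2 (sub_ne_zero.2 fun h => hz (h ▸ hp))
        rw [mem_ball_iff_norm] at hz1
        rw [mul_one, norm_one, one_mul, Real.norm_of_nonneg (by positivity)]
        exact Real.one_le_rpow_of_pos_of_le_one_of_nonpos h3 hz1.le (by norm_num)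
      · obtain ⟨h1, h2⟩ := (mem_segment_conj_iff hE).1 (hp.resolve_left h0)
        have h3 : |p.im| = E.im := by
          by_contra h3
          exact hp' (.inr ⟨h1, h0, lt_of_le_of_ne h2 h3⟩)
        rcases (abs_eq hE.le).1 h3 with h3 | h3
        · obtain rfl : p = E := Complex.ext h1 h3
          exact hprod _ _ _ hM'.endpoint hM.endpoint (hquarter p hp) i j
        · obtain rfl : p = conj E := Complex.ext (by simpa using h1) (by simpa using h3)
          exact hprod _ _ _ hM'.endpoint_conj hM.endpoint_conj (hquarter _ hp) i j
    · have h1 := (hone hM').mul ((adjugate_continuous.tendsto _).comp (hone hM))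
      rw [Matrix.adjugate_one, mul_one] at h1
      exact tendsto_pi_nhds.1 (tendsto_pi_nhds.1 h1 i) j
  intro z hz
  have h1 : M' z * (M z).adjugate = 1 := by
    ext i j
    exact key i j hz
  have h2 : M' z * ((M z).adjugate * M z) = M z := by rw [← mul_assoc, h1, one_mul]
  rwa [Matrix.adjugate_mul, hdet z hz, one_smul, mul_one] at h2

/-! ### Reconstruction of the density matrix -/

theorem sideValue_theta_eq {n : ℝ → ℝ} (hn : IsLineShape n) (t x : ℝ) {l : ℝ}
    (hl : ContinuousAt n l) :
    sideValue 1 (theta n t x) l = l * t + sideValue 1 (theta n 0 x) (l : ℂ) := by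
  have := openHalf_neBot (σ := 1) (.inl rfl) l
  refine tendsto_nhds_unique (tendsto_theta_sideValue hn (.inl rfl) t x hl) ?_
  have h1 : Tendsto (fun z : ℂ => z * t) (𝓝[openHalf 1] (l : ℂ)) (𝓝 (l * t)) :=
    ((continuous_mul_const (t : ℂ)).tendsto (l : ℂ)).mono_left nhdsWithin_le_nhds
  refine (h1.add (tendsto_theta_sideValue hn (.inl rfl) 0 x hl)).congr fun z => ?_
  simp only [theta]
  push_cast
  ring

namespace MaxwellBloch.IsSolution

variable {L : EReal} {n : ℝ → ℝ} {A₀ ω₀ : ℝ} {Ef : ℝ → ℝ → ℂ} {ρ : ℝ → ℝ → ℝ → ℂ}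
  {Nf : ℝ → ℝ → ℝ → ℝ} (hsol : IsSolution L n A₀ ω₀ Ef ρ Nf)

include hsol

/-- The equations for `ρ` and `𝓝` are of Lax type. -/
theorem densityMatrix_hasDerivAt {t x : ℝ} (ht : 0 < t) (hx : 0 < x) (hxL : (x : EReal) < L)
    (hne : t ≠ x) (l : ℝ) : HasDerivAt (fun t => densityMatrix ρ Nf t x l)
      (coeffU Ef t x l * densityMatrix ρ Nf t x l - densityMatrix ρ Nf t x l * coeffU Ef t x l) t := by
  have h1 := hsol.rho_eq t x l ht hx hxL hne
  have h2 := hsol.inv_eq t x l ht hx hxL hne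
  rw [← hasMatDerivAt_iff, coeffU_eq]
  refine Fin.forall_fin_two.2 ⟨Fin.forall_fin_two.2 ⟨?_, ?_⟩, Fin.forall_fin_two.2 ⟨?_, ?_⟩⟩
  · refine h2.congr_deriv ?_
    simp [densityMatrix]
    ring
  · refine h1.congr_deriv ?_
    simp [densityMatrix]
    ring
  · refine h1.star.congr_deriv ?_
    simp [densityMatrix]
    ring
  · refine h2.neg.congr_deriv ?_
    simp [densityMatrix]
    ring

/-- At a real spectral parameter `F = -Ψ σ₃ Ψ⁻¹`: both `F Ψ` and `-Ψ σ₃` solve the `t`-equation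
with the initial value `-σ₃`. -/
theorem densityMatrix_mul_psi {t x : ℝ} (ht : 0 ≤ t) (hx : 0 < x) (hxL : (x : EReal) < L) (l : ℝ) :
    densityMatrix ρ Nf t x l * psi Ef t x l = -(psi Ef t x l * sigma3) := by
  obtain ⟨C, hC0, hC⟩ := hsol.field_bound t hxL
  have hψ := (hsol.psi_continuousOn hx.le hxL (l : ℂ)).mono
    (fun s hs => hs.1 : Icc 0 t ⊆ Ici 0)
  have hF : ContinuousOn (fun t => densityMatrix ρ Nf t x l) (Icc 0 t) := by
    refine continuousOn_pi.2 fun i => continuousOn_pi.2 fun j => ?_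
    exact (hsol.densityMatrix_continuousOn i j).comp (f := fun s : ℝ => (s, x, l)) (by fun_prop)
      fun s hs => ⟨hs.1, hx, hxL⟩
  refine eq_of_linear_deriv (f := fun t => densityMatrix ρ Nf t x l * psi Ef t x l)
    (g := fun t => -(psi Ef t x l * sigma3)) (A := fun t => coeffU Ef t x l)
    (M := ‖(l : ℂ)‖ + C / 2) x ht (hF.mul hψ) (hψ.mul continuousOn_const).neg
    (fun s hs hne => ?_) (fun s hs hne => ?_) (fun s hs hne => ?_) ?_
  · refine ((hsol.densityMatrix_hasDerivAt hs.1 hx hxL hne l).mul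
      (hsol.psi_hasDerivAt hs.1 hx.le hxL hne l)).congr_deriv ?_
    simp only [sub_mul, mul_assoc]
    abel
  · refine ((hsol.psi_hasDerivAt hs.1 hx.le hxL hne l).mul_const sigma3).neg.congr_deriv ?_
    simp only [mul_neg, mul_assoc]
  · exact (norm_coeffU_le _ _ _ _).trans (by linarith [hC s x hs.1 hs.2.le hx.le le_rfl hne])
  · simp only [hsol.psi_zero hx.le hxL, mul_one, one_mul]
    ext i j
    fin_cases i <;> fin_cases j <;>
      simp [densityMatrix, sigma3, hsol.rho_init x l hx hxL, hsol.inv_init x l hx hxL]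

theorem plusValue_rhSolution (hn : IsLineShape n) {E : ℂ} (hE : 0 < E.im) {t x : ℝ} (ht : 0 ≤ t)
    (hx : 0 < x) (hxL : (x : EReal) < L) {l : ℝ} (hlE : l ≠ E.re) (hl : ContinuousAt n l) :
    plusValue E (rhSolution n E Ef t x) l = psi Ef t x l * expSigma3 (Complex.I * l * t)
      * triangularFactor 1 (rFun E l) (sideValue 1 (theta n t x) l) := by
  have hlim := hsol.rhSolution_tendsto_real hn hE ht hx hxL (σ := 1) (.inl rfl) hlE hl
  have h1 : plusSide E (l : ℂ) = 𝓝[openHalf 1] (l : ℂ) := by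
    rw [plusSide_eq, sideFilter, if_pos (Complex.ofReal_im l)]
  have := openHalf_neBot (σ := 1) (.inl rfl) l
  rw [plusValue, h1]
  exact hlim.limUnder_eq

/-- `exp (i l t σ₃)` conjugates the triangular factor at time `t` into the one at time `0`. -/
theorem plusValue_rhSolution_mul (hn : IsLineShape n) {E : ℂ} (hE : 0 < E.im) {t x : ℝ}
    (ht : 0 ≤ t) (hx : 0 < x) (hxL : (x : EReal) < L) {l : ℝ} (hlE : l ≠ E.re)
    (hl : ContinuousAt n l) :
    plusValue E (rhSolution n E Ef t x) l * expSigma3 (-Complex.I * l * t)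
      = psi Ef t x l * plusValue E (rhSolution n E Ef 0 x) l := by
  rw [hsol.plusValue_rhSolution hn hE ht hx hxL hlE hl,
    hsol.plusValue_rhSolution hn hE le_rfl hx hxL hlE hl, hsol.psi_zero hx.le hxL,
    Complex.ofReal_zero, mul_zero, expSigma3_zero, one_mul, one_mul, sideValue_theta_eq hn t x hl,
    mul_assoc, mul_assoc]
  congr 1
  have e1 : Complex.exp (-2 * Complex.I * (l * t + sideValue 1 (theta n 0 x) l))
      = Complex.exp (-(Complex.I * l * t)) * Complex.exp (-(Complex.I * l * t))
        * Complex.exp (-2 * Complex.I * sideValue 1 (theta n 0 x) l) := by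
    rw [← Complex.exp_add, ← Complex.exp_add]; congr 1; ring
  have e2 : Complex.exp (Complex.I * l * t) * Complex.exp (-(Complex.I * l * t)) = 1 := by
    rw [← Complex.exp_add, add_neg_cancel, Complex.exp_zero]
  have e3 : -Complex.I * (l : ℂ) * t = -(Complex.I * l * t) := by ring
  simp only [e3, triangularFactor, if_true, expSigma3, e1, neg_neg]
  generalize Complex.exp (Complex.I * l * t) = k at e2 ⊢
  generalize Complex.exp (-(Complex.I * l * t)) = k' at e2 ⊢
  ext i j
  fin_cases i <;> fin_cases j <;> simp [e2, mul_comm k' k]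
  linear_combination (rFun E l * Complex.exp (-(2 * Complex.I * sideValue 1 (theta n 0 x) l))
    * (k * k' + 1)) * e2

/-- `M = Ψ T` with `T` the product of `exp (i λ t σ₃)` and the triangular factor; inserting this in
`F = -Ψ σ₃ Ψ⁻¹`, the factors at time `t` are traded for those at time `0`. -/
theorem densityMatrix_eq (hn : IsLineShape n) {E : ℂ} (hE : 0 < E.im) {t x : ℝ}
    (ht : 0 ≤ t) (hx : 0 < x) (hxL : (x : EReal) < L) {l : ℝ} (hlE : l ≠ E.re)
    (hl : ContinuousAt n l) : densityMatrix ρ Nf t x l =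
      -(plusValue E (rhSolution n E Ef t x) l * expSigma3 (-Complex.I * l * t) *
        (plusValue E (rhSolution n E Ef 0 x) l)⁻¹ * sigma3 *
        plusValue E (rhSolution n E Ef 0 x) l * expSigma3 (Complex.I * l * t) *
        (plusValue E (rhSolution n E Ef t x) l)⁻¹) := by
  have hmul := hsol.plusValue_rhSolution_mul hn hE ht hx hxL hlE hl
  set P := plusValue E (rhSolution n E Ef t x) l with hP
  set P₀ := plusValue E (rhSolution n E Ef 0 x) l with hP₀
  have hdet : P₀.det = 1 := by
    rw [hP₀, hsol.plusValue_rhSolution hn hE le_rfl hx hxL hlE hl, hsol.psi_zero hx.le hxL,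
      Complex.ofReal_zero, mul_zero, expSigma3_zero, one_mul, one_mul]
    simp [triangularFactor, Matrix.det_fin_two]
  have hexp : expSigma3 (-Complex.I * l * t) * expSigma3 (Complex.I * l * t) = 1 := by
    rw [expSigma3_mul, show -Complex.I * l * t + Complex.I * l * t = 0 by ring, expSigma3_zero]
  have hexp' : expSigma3 (Complex.I * l * t) * expSigma3 (-Complex.I * l * t) = 1 := by
    rw [expSigma3_mul, show Complex.I * l * t + -Complex.I * l * t = 0 by ring, expSigma3_zero]
  have hP₀inv : P₀ * P₀.adjugate = 1 := by rw [Matrix.mul_adjugate, hdet, one_smul]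
  have hP₀inv' : P₀.adjugate * P₀ = 1 := by rw [Matrix.adjugate_mul, hdet, one_smul]
  have hψ := hsol.psi_mul_adjugate ht hx.le hxL (l : ℂ)
  set ψ := psi Ef t x l with hψdef
  have hPeq : P = ψ * P₀ * expSigma3 (Complex.I * l * t) := by
    rw [← hmul, mul_assoc, hexp, mul_one]
  have hPinv : P⁻¹ = expSigma3 (-Complex.I * l * t) * P₀.adjugate * ψ.adjugate := by
    refine Matrix.inv_eq_right_inv ?_
    calc _ = ψ * (P₀ * (expSigma3 (Complex.I * l * t) * expSigma3 (-Complex.I * l * t))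
          * P₀.adjugate) * ψ.adjugate := by rw [hPeq]; simp only [mul_assoc]
      _ = 1 := by rw [hexp', mul_one, hP₀inv, mul_one, hψ]
  have hF := hsol.densityMatrix_mul_psi ht hx hxL l
  rw [← hψdef] at hF
  have hFψ : densityMatrix ρ Nf t x l = -(ψ * sigma3 * ψ.adjugate) := by
    calc _ = densityMatrix ρ Nf t x l * (ψ * ψ.adjugate) := by rw [hψ, mul_one]
      _ = _ := by rw [← mul_assoc, hF, neg_mul]
  rw [hmul, hPinv, Matrix.inv_eq_right_inv hP₀inv, hFψ]
  congr 1
  calc ψ * sigma3 * ψ.adjugate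
      = ψ * (P₀ * P₀.adjugate) * sigma3 * (P₀ * (expSigma3 (Complex.I * l * t)
        * expSigma3 (-Complex.I * l * t)) * P₀.adjugate) * ψ.adjugate := by
        rw [hexp', mul_one, hP₀inv, mul_one, mul_one]
    _ = _ := by simp only [mul_assoc]

end MaxwellBloch.IsSolution

theorem mainTheorem3 (L : EReal) (hL : 0 < L) (n : ℝ → ℝ) (hn : IsLineShape n)
    (A₀ ω₀ : ℝ) (hA₀ : 0 < A₀) (hω₀ : 0 < ω₀)
    (Ef : ℝ → ℝ → ℂ) (ρ : ℝ → ℝ → ℝ → ℂ) (Nf : ℝ → ℝ → ℝ → ℝ)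
    (hsol : IsSolution L n A₀ ω₀ Ef ρ Nf) :
    (∃ Yp Zp Ym Zm : ℝ → ℝ → ℂ → Mat2,
      AreBasicSolutions L n (specPoint A₀ ω₀) Ef ρ Nf Yp Zp Ym Zm) ∧
    ∀ Yp Zp Ym Zm : ℝ → ℝ → ℂ → Mat2,
      AreBasicSolutions L n (specPoint A₀ ω₀) Ef ρ Nf Yp Zp Ym Zm →
      ∀ M : ℝ → ℝ → ℂ → Mat2, M = basicM n (specPoint A₀ ω₀) Yp Zp Ym Zm →
      ∀ t x : ℝ, 0 ≤ t → 0 < x → (x : EReal) < L →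
        -- `M` is the unique solution of the Riemann--Hilbert problem
        SolvesRH n (specPoint A₀ ω₀) t x (M t x) ∧
        (∀ M' : ℂ → Mat2, SolvesRH n (specPoint A₀ ω₀) t x M' →
          EqOn M' (M t x) (closedContour (specPoint A₀ ω₀))ᶜ) ∧
        -- reconstruction of the field, by a limit nontangential to the real line
        (t ≠ x → ∀ c : ℝ, 0 < c →
          Tendsto (fun z : ℂ => -4 * Complex.I * (z • M t x z) 0 1)
            (Bornology.cobounded ℂ ⊓ 𝓟 {z : ℂ | c * |z.re| ≤ |z.im|}) (𝓝 (Ef t x))) ∧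
        -- reconstruction of the density matrix
        Continuous (densityMatrix ρ Nf t x) ∧
        ∀ l : ℝ, l ≠ (specPoint A₀ ω₀).re → ContinuousAt n l →
          densityMatrix ρ Nf t x l =
            -(plusValue (specPoint A₀ ω₀) (M t x) l * expSigma3 (-Complex.I * l * t) *
              (plusValue (specPoint A₀ ω₀) (M 0 x) l)⁻¹ * sigma3 *
              plusValue (specPoint A₀ ω₀) (M 0 x) l * expSigma3 (Complex.I * l * t) *
              (plusValue (specPoint A₀ ω₀) (M t x) l)⁻¹) := by
  have hm : 0 < (specPoint A₀ ω₀).im := half_pos hA₀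
  refine ⟨⟨_, _, _, _, hsol.jointSol_isBasicY hL hA₀ hn (.inl rfl),
    hsol.jointSol_isBasicZ hn (.inl rfl), hsol.jointSol_isBasicY hL hA₀ hn (.inr rfl),
    hsol.jointSol_isBasicZ hn (.inr rfl)⟩, ?_⟩
  rintro Yp Zp Ym Zm hbasic M rfl t x ht hx hxL
  set E := specPoint A₀ ω₀ with hE
  have hM : ∀ s : ℝ, 0 ≤ s →
      EqOn (basicM n E Yp Zp Ym Zm s x) (rhSolution n E Ef s x) (closedContour E)ᶜ :=
    fun s hs z hz => hsol.basicM_eq hL hA₀ hn hbasic hs hx hxL hz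
  have hRH := hsol.rhSolution_solvesRH hL hA₀ hn ht hx hxL
  rw [← hE] at hRH
  refine ⟨hRH.congr hm (hM t ht), fun M' hM' z hz => ?_, fun hne c hc => ?_,
    hsol.densityMatrix_continuous ht hx hxL, fun l hlE hl => ?_⟩
  · rw [hM t ht hz]
    exact hRH.eqOn_of_det_eq_one hn.finite_discontinuities hm
      (fun z _ => hsol.det_rhSolution E ht hx.le hxL z) hM' hz
  -- since `‖z‖ ≤ |Re z| + |Im z|`, the cone lies in `{z | c / (1 + c) * ‖z‖ ≤ |Im z|}`
  · have hc' : 0 < c / (1 + c) := by positivity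
    have hsub : ∀ z : ℂ, c * |z.re| ≤ |z.im| → c / (1 + c) * ‖z‖ ≤ |z.im| := by
      intro z hz
      have h1 := mul_le_mul_of_nonneg_left (Complex.norm_le_abs_re_add_abs_im z) hc.le
      rw [div_mul_eq_mul_div, div_le_iff₀ (by positivity)]
      linarith
    have hlim := ((hsol.tendsto_mul_rhSolution hL hA₀ hn ht hx hxL hne hc').mono_left
      (inf_le_inf_left _ (principal_mono.2 hsub))).const_mul (-4 * Complex.I)
    have hval : -4 * Complex.I * (Complex.I * Ef t x / 4) = Ef t x := by
      linear_combination (-Ef t x) * Complex.I_mul_I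
    rw [hval] at hlim
    refine hlim.congr' ?_
    filter_upwards [mem_inf_of_right (mem_principal_self _), mem_inf_of_left
      (tendsto_norm_cobounded_atTop.eventually_gt_atTop (E.im / (c / (1 + c))))] with z hz hz'
    rw [div_lt_iff₀ hc', mul_comm] at hz'
    rw [← hM t ht (mem_compl_closedContour_of_lt hm (hz'.trans_le (hsub z hz)))]
    rfl
  · have hplus : ∀ s : ℝ, 0 ≤ s → plusValue E (basicM n E Yp Zp Ym Zm s x) l
        = plusValue E (rhSolution n E Ef s x) l := by
      intro s hs
      have hreg : (l : ℂ) ∈ regularContour n E := .inl ⟨by simp, by simpa using hlE, by simpa using hl⟩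
      rw [plusValue, plusValue, limUnder, limUnder, plusSide_eq]
      exact congrArg lim (Filter.map_congr
        ((eventually_sideFilter_compl hm hreg).mono fun z hz => hM s hs hz))
    rw [hplus t ht, hplus 0 le_rfl]
    exact hsol.densityMatrix_eq hn hm ht hx hxL hlE hl
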